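/- Let $M$ be a supermanifold of dimension $n|m$ with local coordinates $x^a$ (even and odd; $\tilde a$ denotes the parity of $x^a$). Forms on $M$ are functions $\omega(x,dx)$ on $\Pi TM$ ($dx^a$ has parity $\tilde a+1$), and multivector fields are functions $P(x,x^*)$ on $\Pi T^*M$, formal along the fibres ($x^*_a$ has parity $\tilde a+1$). All partial derivatives are left derivatives. Let $$[P,R]=(-1)^{\tilde a(\tilde P+1)}\frac{\partial P}{\partial x^*_a}\frac{\partial R}{\partial x^a}+(-1)^{\tilde P+\tilde a(\tilde P+1)}\frac{\partial P}{\partial x^a}\frac{\partial R}{\partial x^*_a}$$ be the canonical Schouten bracket, let $P$ be an even multivector field with $[P,P]=0$ (a homotopy Poisson structure), and let $\{f_1,\dots,f_k\}_P=[\dots[P,f_1],\dots,f_k]|_M$ be the corresponding homotopy Poisson brackets of functions. The higher Koszul brackets $[\omega_1,\dots,\omega_k]_P$, $k\ge 0$, are the odd, multilinear, (super)symmetric operations on forms that satisfy, for homogeneous arguments, the Leibniz rule $$[\omega_1,\dots,\omega_{k-1},\omega\omega']_P=[\omega_1,\dots,\omega_{k-1},\omega]_P\,\omega'+(-1)^{\tilde\omega(1+\tilde\omega_1+\dots+\tilde\omega_{k-1})}\omega\,[\omega_1,\dots,\omega_{k-1},\omega']_P$$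 and, for (local) functions $f_i$, the conditions $$[f_1,df_2,\dots,df_k]_P=(-1)^{\varepsilon}\{f_1,\dots,f_k\}_P\ (k\ge1),\qquad [df_1,\dots,df_k]_P=(-1)^{\varepsilon+1}d\{f_1,\dots,f_k\}_P\ (k\ge0),$$ where $\varepsilon=(k-1)\tilde f_1+(k-2)\tilde f_2+\dots+\tilde f_{k-1}+\tfrac{k(k+1)}2-1$; brackets of functions and differentials of functions that contain at least two functions vanish. Let $\hat P=P\bigl(x,\tfrac{\hbar}{i}\tfrac{\partial}{\partial dx}\bigr)$ (coefficients to the left of derivatives) and $\Delta=[d,\hat P]$, acting on forms as formal power series in $\hbar$. Then: (1) The higher Koszul brackets exist and are unique, and for all forms $\omega_1,\dots,\omega_k$, $k\ge0$, $$[\omega_1,\dots,\omega_k]_P=\lim_{\hbar\to0}\Bigl(\frac{i}{\hbar}\Bigr)^{k}\bigl[\dots[\Delta,\omega_1],\dots,\omega_k\bigr](1),$$ where the commutators are supercommutators with the multiplication operators; in particular the series $[\dots[\Delta,\omega_1],\dots,\omega_k](1)$ is divisible by $\hbar^k$. (2) Equivalently, in each coordinate domain, with coordinates $z^A=(x^a,dx^a)$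 on $\Pi TM$ and conjugate momenta $p_A$, the $\hbar$-principal symbol $$H=\lim_{\hbar\to0}e^{-\frac i\hbar z^Ap_A}\,\Delta\bigl(e^{\frac i\hbar z^Ap_A}\bigr)$$ exists (as a formal function of the momenta) and is the master Hamiltonian of the higher Koszul brackets: $H$ is odd, $(H,H)=0$, and $[\omega_1,\dots,\omega_k]_P=(\dots(H,\omega_1),\dots,\omega_k)|_{p=0}$ for all $k$ and all forms on the domain, where $(-,-)$ is the canonical Poisson bracket on $T^*(\Pi TM)$, $(H,G)=(-1)^{\tilde H\tilde A+\tilde A}\frac{\partial H}{\partial p_A}\frac{\partial G}{\partial z^A}-(-1)^{\tilde H\tilde A}\frac{\partial H}{\partial z^A}\frac{\partial G}{\partial p_A}$. -/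

import Mathlib

open TopologicalSpace

universe u

noncomputable section

namespace HigherKoszul

/-! ### Smooth functions on open subsets of coordinate spaces -/

section Smooth

open scoped ContDiff

variable {ι : Type}

/-- Extension by zero of a function on an open set to the whole coordinate space. -/
def extendZero {V : Opens (ι → ℝ)} (f : V → ℂ) : (ι → ℝ) → ℂ :=
  Function.extend Subtype.val f 0

theorem extendZero_apply {V : Opens (ι → ℝ)} (f : V → ℂ) (x : V) :
    extendZero f (x : ι → ℝ) = f x :=
  Subtype.val_injective.extend_apply f 0 x

variable [Fintype ι]

/-- The algebra of smooth complex-valued functions on an open set `V` of `ℝ^ι`. -/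
def CInf (V : Opens (ι → ℝ)) : Subalgebra ℂ (V → ℂ) where
  carrier := {f | ContDiffOn ℝ ∞ (extendZero f) (V : Set (ι → ℝ))}
  mul_mem' := fun {f g} hf hg =>
    (ContDiffOn.mul hf hg).congr fun x hx => by
      simp [extendZero_apply _ (⟨x, hx⟩ : V)]
  add_mem' := fun {f g} hf hg =>
    (ContDiffOn.add hf hg).congr fun x hx => by
      simp [extendZero_apply f ⟨x, hx⟩,
        extendZero_apply g ⟨x, hx⟩, extendZero_apply (f + g) ⟨x, hx⟩]
  algebraMap_mem' := fun c =>
    (contDiffOn_const (c := c)).congr fun x hx => by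
      rw [extendZero_apply _ (⟨x, hx⟩ : V)]; rfl

/-- If `F` is smooth on `V`, its restriction to `V` belongs to `CInf V`. -/
theorem mem_CInf_of_contDiffOn {V : Opens (ι → ℝ)} {F : (ι → ℝ) → ℂ}
    (hF : ContDiffOn ℝ ∞ F (V : Set (ι → ℝ))) :
    (fun x : V => F x) ∈ CInf V :=
  hF.congr fun x hx => extendZero_apply (fun x : V => F x) ⟨x, hx⟩

/-- The partial derivative `∂f/∂x^a`. -/
def CInf.partialDeriv {V : Opens (ι → ℝ)} [DecidableEq ι] (a : ι) (f : CInf V) : CInf V :=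
  ⟨fun x => fderiv ℝ (extendZero f.1) x (Pi.single a 1),
    mem_CInf_of_contDiffOn
      (F := fun x => fderiv ℝ (extendZero f.1) x (Pi.single a 1))
      (ContDiffOn.clm_apply (f.2.fderiv_of_isOpen V.2 (by simp)) contDiffOn_const)⟩

/-- The coordinate function `x^a`. -/
def CInf.coord (V : Opens (ι → ℝ)) (a : ι) : CInf V :=
  ⟨fun x => ((x : ι → ℝ) a : ℂ),
    mem_CInf_of_contDiffOn (F := fun x => ((x a : ℝ) : ℂ))
      (Complex.ofRealCLM.contDiff.comp (contDiff_apply ℝ ℝ a)).contDiffOn⟩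

/-- Restriction to a smaller open set. -/
def CInf.res {V V' : Opens (ι → ℝ)} (h : V' ≤ V) (f : CInf V) : CInf V' :=
  ⟨fun x => f.1 ⟨x, h x.2⟩, by
    have := mem_CInf_of_contDiffOn (V := V') (f.2.mono h)
    convert this using 2 with x
    exact (extendZero_apply f.1 ⟨x, h x.2⟩).symm⟩

/-- Pointwise complex conjugation. -/
def CInf.conj {V : Opens (ι → ℝ)} (f : CInf V) : CInf V :=
  ⟨fun x => star (f.1 x), by
    have := mem_CInf_of_contDiffOn (V := V)
      (Complex.conjCLE.contDiff.comp_contDiffOn f.2)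
    convert this using 2 with x
    exact congrArg star (extendZero_apply f.1 x).symm⟩

end Smooth

/-! ### Superfunctions: Grassmann variables over a commutative coefficient algebra -/

/-- The Grassmann algebra over `A` in odd variables `θ_o`, `o : ο`. An element `f` stands for
`∑ S, f S • θ^S`, where `θ^S` is the product of the `θ_o`, `o ∈ S`, in increasing order. -/
def Grass (ο : Type) (A : Type u) : Type u := Finset ο → A

/-- The sign `(-1)^p`. -/
def sgn (p : ZMod 2) : ℤ := if p = 0 then 1 else -1

namespace Grass

variable {ο ο' : Type} {A : Type u} {B : Type u}

instance [AddCommGroup A] : AddCommGroup (Grass ο A) :=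
  inferInstanceAs (AddCommGroup (Finset ο → A))

instance [AddCommGroup A] [Module ℂ A] : Module ℂ (Grass ο A) :=
  inferInstanceAs (Module ℂ (Finset ο → A))

/-- `θ^T θ^R = (-1)^(number of pairs t ∈ T, r ∈ R with r < t) θ^(T ∪ R)` for disjoint `T`, `R`. -/
instance [LinearOrder ο] [CommRing A] : Mul (Grass ο A) where
  mul f g := fun S => ∑ T ∈ S.powerset,
    (-1) ^ ((T ×ˢ (S \ T)).filter fun q => q.2 < q.1).card * (f T * g (S \ T))

/-- A coefficient, as an element of the Grassmann algebra. -/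
def const [DecidableEq ο] [CommRing A] (c : A) : Grass ο A := fun S => if S = ∅ then c else 0

instance [DecidableEq ο] [CommRing A] : One (Grass ο A) where
  one := const 1

/-- The odd variable `θ_o`. -/
def gen [DecidableEq ο] [CommRing A] (o : ο) : Grass ο A := fun S => if S = {o} then 1 else 0

/-- The left derivative `∂/∂θ_o`. -/
def oddDeriv [LinearOrder ο] [CommRing A] (o : ο) (f : Grass ο A) : Grass ο A := fun S =>
  if o ∈ S then 0 else (-1) ^ (S.filter fun s => s < o).card * f (insert o S)

/-- Apply a map to all coefficients. -/
def mapCoeff (φ : A → B) (f : Grass ο A) : Grass ο B := fun S => φ (f S)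

/-- Substitute the odd variables along `e` and the coefficients along `φ`. -/
def embed [Fintype ο] [CommRing B] (e : ο → ο') (φ : A → B) (f : Grass ο A) :
    Grass ο' B := by
  classical
  exact fun S => if (S : Set ο') ⊆ Set.range e then φ (f (Finset.univ.filter fun o => e o ∈ S))
    else 0

/-- `f` is homogeneous of parity `p`. -/
def HasParity [CommRing A] (p : ZMod 2) (f : Grass ο A) : Prop :=
  ∀ S : Finset ο, (S.card : ZMod 2) ≠ p → f S = 0

/-- The component of parity `p`. -/
def part [CommRing A] (p : ZMod 2) (f : Grass ο A) : Grass ο A :=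
  fun S => if (S.card : ZMod 2) = p then f S else 0

/-- The parity involution, `f ↦ (-1)^p f` on elements of parity `p`. -/
def inv [CommRing A] (f : Grass ο A) : Grass ο A := fun S => sgn (S.card : ZMod 2) • f S

end Grass

/-- An even unital homomorphism of (complex) superalgebras of superfunctions. -/
structure IsSuperHom {ο ο' : Type} {A : Type u} {B : Type u} [LinearOrder ο] [LinearOrder ο']
    [CommRing A] [CommRing B] [Module ℂ A] [Module ℂ B]
    (φ : Grass ο A → Grass ο' B) : Prop where
  map_add : ∀ f g, φ (f + g) = φ f + φ g
  map_smul : ∀ (c : ℂ) f, φ (c • f) = c • φ f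
  map_one : φ 1 = 1
  map_mul : ∀ f g, φ (f * g) = φ f * φ g
  map_parity : ∀ p f, Grass.HasParity p f → Grass.HasParity p (φ f)

/-- For sets `S`, `T` of odd variables of two groups, their union; the variables of the first group
precede those of the second. -/
def lexUnion {ο ο' : Type} (S : Finset ο) (T : Finset ο') : Finset (ο ⊕ₗ ο') :=
  (S.disjSum T).map toLex.toEmbedding

/-- The odd variables of the first group contained in `U`. -/
def lexLeft {ο ο' : Type} (U : Finset (ο ⊕ₗ ο')) : Finset ο :=
  (U.map ofLex.toEmbedding).toLeft

/-- The odd variables of the second group contained in `U`. -/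
def lexRight {ο ο' : Type} (U : Finset (ο ⊕ₗ ο')) : Finset ο' :=
  (U.map ofLex.toEmbedding).toRight

/-- Apply a map to all coefficients of a formal power series. -/
def mapSeries {σ : Type} {R S : Type} [CommRing R] [CommRing S] (φ : R → S)
    (F : MvPowerSeries σ R) : MvPowerSeries σ S :=
  fun α => φ (MvPowerSeries.coeff α F)

/-! ### Functions, multivector fields and differential forms on a superdomain

The superdomain `V^{n|m}` has even coordinates `x^a`, `a : Fin n`, running over the open set
`V ⊆ ℝ^n`, and odd coordinates `ξ^μ`, `μ : Fin m`. -/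

section Domain

variable {n m : ℕ}

/-- Functions on the superdomain. -/
abbrev SFun (V : Opens (Fin n → ℝ)) (m : ℕ) : Type := Grass (Fin m) (CInf V)

/-- Multivector fields: functions `P(x, ξ, x*, ξ*)` on `ΠT*M`, formal along the fibres. The
antimomenta `x*_a` are odd (they come after the `ξ^μ` in products), the antimomenta `ξ*_μ` are even
and are the variables of the power series. -/
abbrev Mult (V : Opens (Fin n → ℝ)) (m : ℕ) : Type :=
  Grass (Fin m ⊕ₗ Fin n) (MvPowerSeries (Fin m) (CInf V))

/-- The body of `ΠTM`: the even coordinates are `x^a ∈ V` and `dξ^μ ∈ ℝ`. -/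
def tangentDomain (V : Opens (Fin n → ℝ)) (m : ℕ) : Opens (Fin n ⊕ Fin m → ℝ) :=
  ⟨{z | (fun a => z (Sum.inl a)) ∈ V},
    V.2.preimage (continuous_pi fun a => continuous_apply (Sum.inl a))⟩

theorem tangentDomain_mono {V V' : Opens (Fin n → ℝ)} (h : V' ≤ V) :
    tangentDomain V' m ≤ tangentDomain V m := fun _ hz => h hz

/-- (Pseudo)differential forms: arbitrary smooth functions `ω(x, ξ, dx, dξ)` on `ΠTM`. The odd
variables are the `ξ^μ` followed by the `dx^a`. -/
abbrev Form (V : Opens (Fin n → ℝ)) (m : ℕ) : Type :=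
  Grass (Fin m ⊕ₗ Fin n) (CInf (tangentDomain V m))

/-- Pull-back of smooth functions along `(x, dξ) ↦ x`. -/
def pullback {V : Opens (Fin n → ℝ)} (f : CInf V) : CInf (tangentDomain V m) :=
  ⟨fun z => f.1 ⟨fun a => z.1 (Sum.inl a), z.2⟩, by
    have := mem_CInf_of_contDiffOn (V := tangentDomain V m)
      (F := fun z => extendZero f.1 (fun a => z (Sum.inl a)))
      (f.2.comp (contDiff_pi.2 fun a => contDiff_apply ℝ ℝ (Sum.inl a)).contDiffOn
        fun z hz => hz)
    convert this using 2 with z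
    exact (extendZero_apply f.1 ⟨fun a => z.1 (Sum.inl a), z.2⟩).symm⟩

/-- A function, as a form of degree zero. -/
def SFun.toForm {V : Opens (Fin n → ℝ)} (f : SFun V m) : Form V m :=
  Grass.embed (fun μ => toLex (Sum.inl μ)) pullback f

/-- A function, as a multivector field of degree zero. -/
def SFun.toMult {V : Opens (Fin n → ℝ)} (f : SFun V m) : Mult V m :=
  Grass.embed (fun μ => toLex (Sum.inl μ)) (fun c => MvPowerSeries.C c) f

/-- The coefficient of `(ξ*)^α (x*)^S` (the `x*` in increasing order) in a multivector field. -/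
def Mult.coeff {V : Opens (Fin n → ℝ)} (P : Mult V m) (α : Fin m →₀ ℕ) (S : Finset (Fin n)) :
    SFun V m :=
  fun R => MvPowerSeries.coeff α (P (lexUnion R S))

/-- Restriction of a multivector field to the zero section `M ⊂ ΠT*M`. -/
def Mult.restrict {V : Opens (Fin n → ℝ)} (P : Mult V m) : SFun V m := P.coeff 0 ∅

/-- The canonical Schouten bracket
`[P,R] = (-1)^{ã(P̃+1)} ∂P/∂x*_a ∂R/∂x^a + (-1)^{P̃+ã(P̃+1)} ∂P/∂x^a ∂R/∂x*_a`
(summation over all even and odd coordinates, left derivatives), extended to inhomogeneous `P`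
by additivity. -/
def schouten {V : Opens (Fin n → ℝ)} (P R : Mult V m) : Mult V m :=
  ∑ a : Fin n,
    (P.oddDeriv (toLex (Sum.inr a)) * R.mapCoeff (mapSeries (CInf.partialDeriv a))
      + P.inv.mapCoeff (mapSeries (CInf.partialDeriv a)) * R.oddDeriv (toLex (Sum.inr a)))
  + ∑ μ : Fin m,
    (-(P.inv.mapCoeff (MvPowerSeries.pderiv _ μ) * R.oddDeriv (toLex (Sum.inl μ)))
      - P.oddDeriv (toLex (Sum.inl μ)) * R.mapCoeff (MvPowerSeries.pderiv _ μ))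

/-- The homotopy Poisson brackets of functions, `{f₁,…,f_k}_P = [...[P,f₁],…,f_k]|_M`. -/
def homotopyPoisson {V : Opens (Fin n → ℝ)} (P : Mult V m) (l : List (SFun V m)) : SFun V m :=
  (l.foldl (fun Q f => schouten Q f.toMult) P).restrict

/-- `∂/∂x^a` on forms. -/
def Form.dX {V : Opens (Fin n → ℝ)} (a : Fin n) (ω : Form V m) : Form V m :=
  Grass.mapCoeff (CInf.partialDeriv (Sum.inl a)) ω

/-- `∂/∂ξ^μ` on forms. -/
def Form.dXi {V : Opens (Fin n → ℝ)} (μ : Fin m) (ω : Form V m) : Form V m :=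
  Grass.oddDeriv (toLex (Sum.inl μ)) ω

/-- The odd variable `dx^a`. -/
def Form.dx (V : Opens (Fin n → ℝ)) (m : ℕ) (a : Fin n) : Form V m :=
  Grass.gen (toLex (Sum.inr a))

/-- The even variable `dξ^μ`. -/
def Form.dxi (V : Opens (Fin n → ℝ)) (m : ℕ) (μ : Fin m) : Form V m :=
  Grass.const (CInf.coord _ (Sum.inr μ))

/-- The de Rham differential `d = dx^a ∂/∂x^a + dξ^μ ∂/∂ξ^μ`. -/
def deRham {V : Opens (Fin n → ℝ)} (ω : Form V m) : Form V m :=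
  ∑ a : Fin n, Form.dx V m a * ω.dX a + ∑ μ : Fin m, Form.dxi V m μ * ω.dXi μ

/-- The constant-coefficient operator `(∂/∂dξ)^α (∂/∂dx)^S` on forms; the odd derivatives are
composed in increasing order, the smallest index standing leftmost. -/
def Form.fibreDeriv {V : Opens (Fin n → ℝ)} (α : Fin m →₀ ℕ) (S : Finset (Fin n)) (ω : Form V m) :
    Form V m :=
  (List.finRange m).foldr
    (fun μ η => (Grass.mapCoeff (CInf.partialDeriv (Sum.inr μ)))^[α μ] η)
    ((S.sort (· ≤ ·)).foldr (fun a η => Grass.oddDeriv (toLex (Sum.inr a)) η) ω)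

/-! ### Operators depending on `ħ`

Forms depending on `ħ` are formal power series in `ħ`; the `j`-th entry is the coefficient of
`ħ^j`. -/

/-- Formal power series in `ħ` with coefficients in forms. -/
abbrev HForm (V : Opens (Fin n → ℝ)) (m : ℕ) : Type := ℕ → Form V m

/-- A form, as a power series independent of `ħ`. -/
def Form.toH {V : Opens (Fin n → ℝ)} (ω : Form V m) : HForm V m := Pi.single 0 ω

/-- The coefficient of `ħ^j` in `P̂ ω`, where `P̂ = P(x, (ħ/i) ∂/∂dx)`: the coefficient functions of
`P` stand to the left of the derivatives, and `ħ/i = -iħ`. -/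
def quantizeCoeff {V : Opens (Fin n → ℝ)} (P : Mult V m) (j : ℕ) (ω : Form V m) : Form V m :=
  (-Complex.I) ^ j • ∑ q ∈ Finset.HasAntidiagonal.antidiagonal j,
    ∑ S ∈ Finset.powersetCard q.1 (Finset.univ : Finset (Fin n)),
      ∑ α ∈ Finset.finsuppAntidiag (Finset.univ : Finset (Fin m)) q.2,
        (P.coeff α S).toForm * ω.fibreDeriv α S

/-- The operator `P̂ = P(x, (ħ/i) ∂/∂dx)`. -/
def quantize {V : Opens (Fin n → ℝ)} (P : Mult V m) (F : HForm V m) : HForm V m := fun j =>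
  ∑ q ∈ Finset.HasAntidiagonal.antidiagonal j, quantizeCoeff P q.1 (F q.2)

/-- The operator `Δ = [d, P̂] = d P̂ - P̂ d` (for even `P`). -/
def Delta {V : Opens (Fin n → ℝ)} (P : Mult V m) (F : HForm V m) : HForm V m :=
  (fun j => deRham (quantize P F j)) - quantize P (fun j => deRham (F j))

/-- The supercommutator `[A, ω] = A ω - (-1)^{Ã ω̃} ω A` of an operator with the operator of
multiplication by `ω`, for `A` and `ω` not necessarily homogeneous: for odd `ω` the sign `(-1)^Ã` is
produced by conjugating `A` with the parity involution. -/
def superComm {V : Opens (Fin n → ℝ)} (A : HForm V m → HForm V m) (ω : Form V m) :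
    HForm V m → HForm V m := fun F =>
  A (fun j => ω * F j) - (fun j => ω.part 0 * A F j)
    - (fun j => ω.part 1 * (A (fun i => (F i).inv) j).inv)

/-- `[...[A, ω₁],…,ω_k](1)`. -/
def iteratedComm {V : Opens (Fin n → ℝ)} (A : HForm V m → HForm V m) (l : List (Form V m)) :
    HForm V m :=
  l.foldl superComm A (Form.toH 1)

/-- `lim_{ħ → 0} (i/ħ)^k F = ω`: the series `(i/ħ)^k F` has no negative powers of `ħ`, and its
constant term is `ω`. -/
def HasClassicalLimit {V : Opens (Fin n → ℝ)} (k : ℕ) (F : HForm V m) (ω : Form V m) : Prop :=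
  (∀ j < k, F j = 0) ∧ ω = Complex.I ^ k • F k

/-! ### Higher Koszul brackets -/

/-- `∑_k (N - k) p_k` for a list `p₁,…,p_N` of parities. -/
def weightedParity : List (ZMod 2) → ZMod 2
  | [] => 0
  | p :: ps => (ps.length : ZMod 2) * p + weightedParity ps

/-- `ε = ∑_k (N - k) p_k + N(N+1)/2 - 1` (modulo 2) for a list `p₁,…,p_N` of parities. -/
def koszulSign (ps : List (ZMod 2)) : ZMod 2 :=
  weightedParity ps + ((ps.length * (ps.length + 1) / 2 + 1 : ℕ) : ZMod 2)

/-- The elements of the first list have the parities given by the second list. -/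
def HasParities {ο A : Type} [CommRing A] (l : List (Grass ο A)) (ps : List (ZMod 2)) : Prop :=
  List.Forall₂ (fun f p => Grass.HasParity p f) l ps

/-- `B` is the sequence of higher Koszul brackets of forms specified by `P`; the `k`-bracket is the
value of `B` on lists of length `k`. They are odd, multilinear, symmetric, satisfy the Leibniz rule
in each argument, and are given on functions and differentials of functions by
`[f₁, df₂,…,df_N] = (-1)^ε {f₁,…,f_N}_P` (so `[f] = {f}_P`),
`[df₁,…,df_N] = (-1)^{ε+1} d{f₁,…,f_N}_P`, all brackets of `f`'s and `df`'s with at least two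
functions being zero. -/
structure IsKoszulBrackets {V : Opens (Fin n → ℝ)} (P : Mult V m)
    (B : List (Form V m) → Form V m) : Prop where
  map_add : ∀ l₁ ω ω' l₂, B (l₁ ++ (ω + ω') :: l₂) = B (l₁ ++ ω :: l₂) + B (l₁ ++ ω' :: l₂)
  map_smul : ∀ l₁ (c : ℂ) ω l₂, B (l₁ ++ (c • ω) :: l₂) = c • B (l₁ ++ ω :: l₂)
  odd : ∀ l ps, HasParities l ps → Grass.HasParity (ps.sum + 1) (B l)
  symm : ∀ l₁ ω ω' l₂ p p', Grass.HasParity p ω → Grass.HasParity p' ω' →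
    B (l₁ ++ ω :: ω' :: l₂) = sgn (p * p') • B (l₁ ++ ω' :: ω :: l₂)
  leibniz : ∀ l ps ω p ω', HasParities l ps → Grass.HasParity p ω →
    B (l ++ [ω * ω']) = B (l ++ [ω]) * ω' + sgn (p * (1 + ps.sum)) • (ω * B (l ++ [ω']))
  fun_diff : ∀ (f : SFun V m) (fs : List (SFun V m)) (ps : List (ZMod 2)),
    HasParities (f :: fs) ps →
    B (f.toForm :: fs.map (fun g => deRham g.toForm))
      = sgn (koszulSign ps) • (homotopyPoisson P (f :: fs)).toForm
  diff_diff : ∀ (fs : List (SFun V m)) (ps : List (ZMod 2)), HasParities fs ps →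
    B (fs.map (fun g => deRham g.toForm))
      = sgn (koszulSign ps + 1) • deRham (homotopyPoisson P fs).toForm
  fun_fun : ∀ (f g : SFun V m) (l : List (Form V m)),
    (∀ ω ∈ l, ∃ h : SFun V m, ω = h.toForm ∨ ω = deRham h.toForm) →
    B (f.toForm :: g.toForm :: l) = 0

end Domain

/-! ### Hamiltonians on the cotangent bundle of a superdomain and principal symbols

Here the superdomain has even coordinates indexed by `ε`, with values in the open set `W ⊆ ℝ^ε`, and
odd coordinates indexed by `ο`. It will be applied to `ΠTM`. -/

section Cotangent

variable {ε ο : Type} [Fintype ε] [DecidableEq ε] [Fintype ο] [LinearOrder ο]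

/-- Functions on the cotangent bundle, formal in the momenta. The momenta of the even coordinates
are the variables of the power series; the momenta of the odd coordinates are odd variables, which
come after the odd coordinates in products. -/
abbrev Ham (W : Opens (ε → ℝ)) (ο : Type) : Type :=
  Grass (ο ⊕ₗ ο) (MvPowerSeries ε (CInf W))

variable {W : Opens (ε → ℝ)}

/-- A function on the base, as a function on the cotangent bundle. -/
def baseToHam (f : Grass ο (CInf W)) : Ham W ο :=
  Grass.embed (fun o => toLex (Sum.inl o)) (fun c => MvPowerSeries.C c) f

/-- The coefficient (written on the left) of the monomial in the momenta given by `α` and `T`. -/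
def Ham.coeff (H : Ham W ο) (α : ε →₀ ℕ) (T : Finset ο) : Grass ο (CInf W) :=
  fun S => MvPowerSeries.coeff α (H (lexUnion S T))

/-- Restriction to the zero section. -/
def Ham.restrict (H : Ham W ο) : Grass ο (CInf W) := H.coeff 0 ∅

/-- The canonical Poisson bracket
`(H,G) = (-1)^{H̃ã+ã} ∂H/∂p_a ∂G/∂z^a - (-1)^{H̃ã} ∂H/∂z^a ∂G/∂p_a`
(summation over all even and odd coordinates `z^a`, left derivatives), extended to inhomogeneous `H`
by additivity. -/
def poisson (H G : Ham W ο) : Ham W ο :=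
  ∑ a : ε,
    (H.mapCoeff (MvPowerSeries.pderiv _ a) * G.mapCoeff (mapSeries (CInf.partialDeriv a))
      - H.mapCoeff (mapSeries (CInf.partialDeriv a)) * G.mapCoeff (MvPowerSeries.pderiv _ a))
  + ∑ o : ο,
    (-(H.inv.oddDeriv (toLex (Sum.inr o)) * G.oddDeriv (toLex (Sum.inl o)))
      - H.inv.oddDeriv (toLex (Sum.inl o)) * G.oddDeriv (toLex (Sum.inr o)))

/-- `(...(H,ω₁),…,ω_k)` restricted to the zero section. -/
def derivedBracket (H : Ham W ο) (l : List (Grass ο (CInf W))) : Grass ο (CInf W) :=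
  (l.foldl (fun G ω => poisson G (baseToHam ω)) H).restrict

/-- `H` is the master Hamiltonian of the sequence of brackets `B`: it is odd, satisfies the master
equation `(H,H) = 0`, and generates the brackets. -/
structure IsMasterHamiltonian (H : Ham W ο)
    (B : List (Grass ο (CInf W)) → Grass ο (CInf W)) : Prop where
  odd : Grass.HasParity 1 H
  master : poisson H H = 0
  generates : ∀ l, B l = derivedBracket H l

/-- The function `z^a p_a` (summation over all even and odd coordinates). -/
def phase (W : Opens (ε → ℝ)) (ο : Type) [Fintype ο] [LinearOrder ο] : Ham W ο :=
  ∑ a : ε, Grass.const (MvPowerSeries.C (CInf.coord W a) * MvPowerSeries.X a)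
    + ∑ o : ο, Grass.gen (toLex (Sum.inl o)) * Grass.gen (toLex (Sum.inr o))

/-- The degree in the momenta of the monomials with exponents `α` of the even momenta and odd
variables `U`. -/
def momentumDegree (α : ε →₀ ℕ) (U : Finset (ο ⊕ₗ ο)) : ℕ := α.degree + (lexRight U).card

/-- The power series `exp(c z^a p_a)`: its component of degree `k` in the momenta is
`c^k (z^a p_a)^k / k!`. -/
def expPhase (W : Opens (ε → ℝ)) (ο : Type) [Fintype ο] [LinearOrder ο] (c : ℂ) : Ham W ο :=
  fun U => fun α =>
    (c ^ momentumDegree α U / (Nat.factorial (momentumDegree α U) : ℂ)) •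
      MvPowerSeries.coeff α (((fun G => phase W ο * G)^[momentumDegree α U] 1) U)

/-- Let an operator on functions on the base (with values in power series in `ħ`) act on functions
on the cotangent bundle, the momenta being considered as parameters. They are written on the right,
so no signs arise. The `j`-th entry is the coefficient of `ħ^j`. -/
def actWithParameters (A : Grass ο (CInf W) → ℕ → Grass ο (CInf W)) (F : Ham W ο) : ℕ → Ham W ο :=
  fun j U => fun α => A (F.coeff α (lexRight U)) j (lexLeft U)

/-- `lim_{ħ → 0} e^{-(i/ħ) z^a p_a} A (e^{(i/ħ) z^a p_a}) = H`. The component of degree `k` in the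
momenta of the expression under the limit is `(i/ħ)^k` times that of `e^{-z^a p_a} A(e^{z^a p_a})`;
the limit exists if no negative powers of `ħ` remain, and is then the constant term in `ħ`. -/
def IsPrincipalSymbol (A : Grass ο (CInf W) → ℕ → Grass ο (CInf W)) (H : Ham W ο) : Prop :=
  ∀ (U : Finset (ο ⊕ₗ ο)) (α : ε →₀ ℕ),
    let G : ℕ → CInf W := fun j => MvPowerSeries.coeff α
      ((expPhase W ο (-1) * actWithParameters A (expPhase W ο 1) j) U)
    (∀ j < momentumDegree α U, G j = 0) ∧
      MvPowerSeries.coeff α (H U) = Complex.I ^ momentumDegree α U • G (momentumDegree α U)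

end Cotangent

/-! ### Supermanifolds -/

section Restriction

variable {n m : ℕ} {V V' : Opens (Fin n → ℝ)}

/-- Restriction of functions. -/
def SFun.res (h : V' ≤ V) (f : SFun V m) : SFun V' m := Grass.mapCoeff (CInf.res h) f

/-- Restriction of multivector fields. -/
def Mult.res (h : V' ≤ V) (P : Mult V m) : Mult V' m :=
  Grass.mapCoeff (mapSeries (CInf.res h)) P

/-- Restriction of forms. -/
def Form.res (h : V' ≤ V) (ω : Form V m) : Form V' m :=
  Grass.mapCoeff (CInf.res (tangentDomain_mono h)) ω

end Restriction

/-- The image in coordinate space of (the part in the domain of the chart of) an open set. -/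
def chartImage {X : Type u} [TopologicalSpace X] {n : ℕ} (e : OpenPartialHomeomorph X (Fin n → ℝ))
    (W : Opens X) : Opens (Fin n → ℝ) :=
  ⟨e.target ∩ e.symm ⁻¹' W, e.isOpen_inter_preimage_symm W.2⟩

theorem chartImage_mono {X : Type u} [TopologicalSpace X] {n : ℕ}
    (e : OpenPartialHomeomorph X (Fin n → ℝ)) {W W' : Opens X} (h : W' ≤ W) :
    chartImage e W' ≤ chartImage e W := fun _ hx => ⟨hx.1, h hx.2⟩

theorem mem_chartImage {X : Type u} [TopologicalSpace X] {n : ℕ}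
    (e : OpenPartialHomeomorph X (Fin n → ℝ)) {W : Opens X} (hW : (W : Set X) ⊆ e.source)
    {p : X} (hp : p ∈ W) : e p ∈ chartImage e W :=
  ⟨e.map_source (hW hp), by simpa [e.left_inv (hW hp)] using hp⟩

/-- A supermanifold of dimension `n|m`: a Hausdorff second countable space with an atlas, and a
structure sheaf obtained by gluing the sheaves of functions of superdomains `ℝ^{n|m}` along
isomorphisms of sheaves of superalgebras. Functions are complex-valued, so the gluing isomorphisms
respect complex conjugation. -/
structure Supermanifold (n m : ℕ) where
  /-- the underlying space -/
  body : Type u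
  [top : TopologicalSpace body]
  [t2 : T2Space body]
  [sc : SecondCountableTopology body]
  /-- the index set of the atlas -/
  Idx : Type u
  /-- the underlying maps of the charts -/
  chart : Idx → OpenPartialHomeomorph body (Fin n → ℝ)
  cover : ∀ p, ∃ i, p ∈ (chart i).source
  /-- the change of coordinates: it expresses functions of the coordinates of the chart `j` as
  functions of the coordinates of the chart `i` -/
  trans : ∀ (i j : Idx) (W : Opens body), (W : Set body) ⊆ (chart i).source →
    (W : Set body) ⊆ (chart j).source →
    SFun (chartImage (chart j) W) m → SFun (chartImage (chart i) W) m
  trans_hom : ∀ i j W hi hj, IsSuperHom (trans i j W hi hj)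
  trans_real : ∀ i j W hi hj f,
    trans i j W hi hj (f.mapCoeff CInf.conj) = (trans i j W hi hj f).mapCoeff CInf.conj
  trans_body : ∀ i j W hi hj (f : SFun (chartImage (chart j) W) m) p (hp : p ∈ W),
    (trans i j W hi hj f ∅).1 ⟨chart i p, mem_chartImage (chart i) hi hp⟩
      = (f ∅).1 ⟨chart j p, mem_chartImage (chart j) hj hp⟩
  trans_res : ∀ i j (W W' : Opens body) (h : W' ≤ W) hi hj hi' hj'
    (f : SFun (chartImage (chart j) W) m),
    trans i j W' hi' hj' (f.res (chartImage_mono (chart j) h))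
      = (trans i j W hi hj f).res (chartImage_mono (chart i) h)
  trans_self : ∀ i W hi hi' f, trans i i W hi hi' f = f
  trans_trans : ∀ i j k W hi hj hk f,
    trans i j W hi hj (trans j k W hj hk f) = trans i k W hi hk f

attribute [instance] Supermanifold.top Supermanifold.t2 Supermanifold.sc

namespace Supermanifold

variable {n m : ℕ}

/-- The part of coordinate space corresponding to `W` in the chart `i`. -/
def img (M : Supermanifold.{u} n m) (i : M.Idx) (W : Opens M.body) : Opens (Fin n → ℝ) :=
  chartImage (M.chart i) W

/-- The coordinate domain of the chart `i`. -/
def dom (M : Supermanifold.{u} n m) (i : M.Idx) : Opens (Fin n → ℝ) := M.img i ⊤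

theorem img_le_dom (M : Supermanifold.{u} n m) (i : M.Idx) (W : Opens M.body) :
    M.img i W ≤ M.dom i := chartImage_mono (M.chart i) le_top

/-- `Ψ` is the transformation of forms induced by the change of coordinates `φ` on functions: the
isomorphism of superalgebras that extends `φ` and commutes with `d`. -/
structure IsFormTransformation {V V' : Opens (Fin n → ℝ)} (φ : SFun V m → SFun V' m)
    (Ψ : Form V m → Form V' m) : Prop where
  hom : IsSuperHom Ψ
  bijective : Function.Bijective Ψ
  extends_fun : ∀ f : SFun V m, Ψ f.toForm = (φ f).toForm
  comm_d : ∀ ω, Ψ (deRham ω) = deRham (Ψ ω)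

/-- `Θ` is the transformation of multivector fields induced by the change of coordinates `φ` on
functions: the isomorphism of superalgebras that extends `φ`, preserves the Schouten bracket and is
compatible with the restriction to the zero section. -/
structure IsMultTransformation {V V' : Opens (Fin n → ℝ)} (φ : SFun V m → SFun V' m)
    (Θ : Mult V m → Mult V' m) : Prop where
  hom : IsSuperHom Θ
  bijective : Function.Bijective Θ
  extends_fun : ∀ f : SFun V m, Θ f.toMult = (φ f).toMult
  comm_schouten : ∀ P R, Θ (schouten P R) = schouten (Θ P) (Θ R)
  comm_restrict : ∀ P, (Θ P).restrict = φ P.restrict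

/-- A differential form on `M` (a function on `ΠTM`): a form in each chart, these being related by
the transformation of forms induced by the changes of coordinates. -/
@[ext]
structure DiffForm (M : Supermanifold.{u} n m) where
  /-- the coordinate expression in the chart `i` -/
  rep : ∀ i, Form (M.dom i) m
  compat : ∀ i j W hi hj (Ψ : Form (M.img j W) m → Form (M.img i W) m),
    IsFormTransformation (M.trans i j W hi hj) Ψ →
      Ψ ((rep j).res (M.img_le_dom j W)) = (rep i).res (M.img_le_dom i W)

/-- A homotopy Poisson structure on `M`: an even multivector field `P` (a function on `ΠT*M`, formal
along the fibres) with `[P,P] = 0`. -/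
structure HomotopyPoisson (M : Supermanifold.{u} n m) where
  /-- the coordinate expression in the chart `i` -/
  rep : ∀ i, Mult (M.dom i) m
  compat : ∀ i j W hi hj, ∃ Θ : Mult (M.img j W) m → Mult (M.img i W) m,
    IsMultTransformation (M.trans i j W hi hj) Θ ∧
      Θ ((rep j).res (M.img_le_dom j W)) = (rep i).res (M.img_le_dom i W)
  even : ∀ i, Grass.HasParity 0 (rep i)
  master : ∀ i, schouten (rep i) (rep i) = 0

/-- `B` is the sequence of higher Koszul brackets on the forms on `M` that corresponds to `P`: in
each chart it is given by the higher Koszul brackets specified by the coordinate expression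
of `P`. -/
def IsHigherKoszul (M : Supermanifold.{u} n m) (P : M.HomotopyPoisson)
    (B : List M.DiffForm → M.DiffForm) : Prop :=
  ∀ i, ∃ b : List (Form (M.dom i) m) → Form (M.dom i) m,
    IsKoszulBrackets (P.rep i) b ∧ ∀ l, (B l).rep i = b (l.map fun ω => ω.rep i)

end Supermanifold

end HigherKoszul

end

noncomputable section

set_option linter.unusedSectionVars false

namespace HigherKoszul

/-! The argument is local first. On a superdomain a system of brackets is a multiderivation of the
algebra of forms, that is, of functions on ΠTM. The difference of two systems belonging to the same
P is again a multiderivation and vanishes on functions and on differentials of functions. The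
coordinates x, ξ, dx, dξ of ΠTM are of these two kinds, and by Hadamard's lemma a derivation of
smooth functions that kills the coordinates is zero (`derivation_eq_zero`). Hence the brackets are
unique (`IsKoszulBrackets.unique`).

Existence is proved in an abstract model, `DerivedBracketSystem`. A multivector field Q yields an
element `symbol Q` and an element `ham Q`, which plays the role of the commutator of d with `symbol
Q`. The symbol commutes with functions, and its bracket with df is, up to sign, the symbol of the
Schouten bracket [Q,f]. By the Jacobi identity and d² = 0, the bracket of `ham Q` with f is then the
symbol of [Q,f], and its bracket with df is `ham` of [Q,f] up to sign. Iterating and evaluating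
gives exactly the prescribed values, the signs adding up to ε
(`DerivedBracketSystem.isKoszulBrackets`).

There are two models. In `operatorSystem` the elements are sequences of operators, the coefficients
of powers of ħ: the symbol is Q̂, `ham Q` is [d, Q̂], the bracket is i/ħ times the supercommutator
with a multiplication operator, and the evaluation is the value at 1 of the leading coefficient. The
coefficient of ħ^j in Q̂ is a differential operator of order at most j, and commuting with the
derivation d does not raise the order. Therefore k commutators annihilate all coefficients with j <
k, which is the divisibility by ħ^k, while the coefficient of ħ^k has order at most 1 before the
last commutator, which is why the Leibniz rule holds in the limit. In `hamiltonianSystem` the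
elements are functions on T*(ΠTM): the symbol of Q reads the antimomentum x*_a as the momentum of
dx^a, the bracket is the canonical Poisson bracket, and for even P the element `ham P` is H = D(P),
where D is the Hamiltonian vector field of d. By uniqueness both models give the same brackets. The
master equation follows from (H,H) = -D([P,P]) (`poisson_masterHam`).

For the principal symbol, the coefficient of ħ^j in P̂ multiplies e^{zp} by (-i)^j times the
component of P of degree j in the momenta. Commuting with d adds the differential of the
coefficients of P and the commutators of P̂ with dx^a and dξ^μ; together these make up D. So Δ acts
on e^{zp} through the homogeneous components of H (`liftOp_deltaOp`), and e^{-izp/ħ} Δ e^{izp/ħ} is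
H itself, without corrections in ħ.

Globally, the local brackets commute with restriction because they are built from differential
operators (`res_koszul`), and with changes of coordinates because transported brackets satisfy the
same characterisation, so that uniqueness applies again (`map_koszul`). Hence they glue. -/

theorem sgn_add (p q : ZMod 2) : sgn (p + q) = sgn p * sgn q := by
  revert p q; decide

theorem sgn_mul_self (p : ZMod 2) : sgn p * sgn p = 1 := by
  revert p; decide

@[simp] theorem sgn_zero : sgn 0 = 1 := rfl

@[simp] theorem sgn_one : sgn 1 = -1 := rfl

theorem sgn_natCast (k : ℕ) : sgn (k : ZMod 2) = (-1) ^ k := by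
  induction k with
  | zero => rfl
  | succ k ih => rw [Nat.cast_succ, sgn_add, ih, pow_succ]; rfl

theorem zmod_two_cases (p : ZMod 2) : p = 0 ∨ p = 1 := by
  revert p; decide

theorem ring_neg_mul {R : Type*} [Ring R] (a b : R) : -a * b = -(a * b) := neg_mul a b

theorem ring_mul_neg {R : Type*} [Ring R] (a b : R) : a * -b = -(a * b) := mul_neg a b

/-! ### The Grassmann algebra as an associative, supercommutative ring. -/

namespace Grass

variable {ο : Type} [LinearOrder ο] [DecidableEq ο] {A : Type u}

/-- The number of pairs `s ∈ S`, `t ∈ T` with `t < s`. -/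
def inversions (S T : Finset ο) : ℕ := ((S ×ˢ T).filter fun q => q.2 < q.1).card

theorem inversions_eq_sum_left (S T : Finset ο) :
    inversions S T = ∑ s ∈ S, (T.filter fun t => t < s).card := by
  simp only [inversions, Finset.card_filter, Finset.sum_product]

theorem inversions_eq_sum_right (S T : Finset ο) :
    inversions S T = ∑ t ∈ T, (S.filter fun s => t < s).card := by
  simp only [inversions, Finset.card_filter, Finset.sum_product_right]

theorem inversions_union_left {S T : Finset ο} (h : Disjoint S T) (R : Finset ο) :
    inversions (S ∪ T) R = inversions S R + inversions T R := by
  simp only [inversions_eq_sum_left, Finset.sum_union h]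

theorem inversions_union_right {S T : Finset ο} (h : Disjoint S T) (R : Finset ο) :
    inversions R (S ∪ T) = inversions R S + inversions R T := by
  simp only [inversions_eq_sum_right, Finset.sum_union h]

@[simp] theorem inversions_empty_left (S : Finset ο) : inversions ∅ S = 0 := by
  simp [inversions]

@[simp] theorem inversions_empty_right (S : Finset ο) : inversions S ∅ = 0 := by
  simp [inversions]

theorem inversions_singleton_left (o : ο) (T : Finset ο) :
    inversions {o} T = (T.filter fun t => t < o).card := by
  simp [inversions_eq_sum_left]

/-- For disjoint sets every pair (s, t) is out of order in exactly one of the two arrangements. This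
is the sign rule for exchanging two monomials. -/
theorem inversions_add_inversions {S T : Finset ο} (h : Disjoint S T) :
    inversions S T + inversions T S = S.card * T.card := by
  rw [inversions_eq_sum_left S T, inversions_eq_sum_right T S, ← Finset.sum_add_distrib,
    ← smul_eq_mul, ← Finset.sum_const]
  refine Finset.sum_congr rfl fun s hs => ?_
  rw [← Finset.card_filter_add_card_filter_not (s := T) (fun t => t < s)]
  congr 2
  refine Finset.filter_congr fun t ht => ?_
  have : t ≠ s := fun e => Finset.disjoint_left.1 h hs (e ▸ ht)
  rw [not_lt, lt_iff_le_and_ne]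
  exact ⟨fun h => h.1, fun h => ⟨h, this.symm⟩⟩

@[ext] theorem ext {f g : Grass ο A} (h : ∀ S, f S = g S) : f = g := funext h

section
variable [AddCommGroup A]
@[simp] theorem add_apply (f g : Grass ο A) (S : Finset ο) : (f + g) S = f S + g S := rfl
@[simp] theorem sub_apply (f g : Grass ο A) (S : Finset ο) : (f - g) S = f S - g S := rfl
@[simp] theorem neg_apply (f : Grass ο A) (S : Finset ο) : (-f) S = -f S := rfl
@[simp] theorem zero_apply (S : Finset ο) : (0 : Grass ο A) S = 0 := rfl
@[simp] theorem smul_apply [Module ℂ A] (c : ℂ) (f : Grass ο A) (S : Finset ο) :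
    (c • f) S = c • f S := rfl

/-- Evaluation at a set of odd variables, as an additive map. -/
def coeffHom (S : Finset ο) : Grass ο A →+ A where
  toFun f := f S
  map_zero' := rfl
  map_add' _ _ := rfl

@[simp] theorem sum_apply {ι : Type*} (s : Finset ι) (f : ι → Grass ο A) (S : Finset ο) :
    (∑ i ∈ s, f i) S = ∑ i ∈ s, f i S :=
  map_sum (coeffHom S) f s

@[simp] theorem zsmul_apply (k : ℤ) (f : Grass ο A) (S : Finset ο) :
    (k • f) S = k • f S :=
  map_zsmul (coeffHom S) k f

/-- The element `a θ^S`. -/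
def mono (S : Finset ο) (a : A) : Grass ο A := fun R => if R = S then a else 0

theorem mono_apply (S : Finset ο) (a : A) (R : Finset ο) :
    mono S a R = if R = S then a else 0 := rfl

theorem mono_add (S : Finset ο) (a b : A) : mono S (a + b) = mono S a + mono S b := by
  ext R; simp only [mono_apply, add_apply]; split_ifs <;> simp

@[simp] theorem mono_zero (S : Finset ο) : mono S (0 : A) = 0 := by
  ext R; simp [mono_apply]

theorem mono_neg (S : Finset ο) (a : A) : mono S (-a) = -mono S a := by
  ext R; simp only [mono_apply, neg_apply]; split_ifs <;> simp

theorem eq_sum_mono [Fintype ο] (f : Grass ο A) : f = ∑ S, mono S (f S) := by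
  ext R
  rw [sum_apply, Finset.sum_eq_single R] <;> simp +contextual [mono_apply, eq_comm]

/-- Identities that are additive in every argument need only be checked on monomials; associativity
and the sign rules are all proved in this way. -/
theorem induction [Fintype ο] {p : Grass ο A → Prop} (add : ∀ f g, p f → p g → p (f + g))
    (mono : ∀ S a, p (mono S a)) (f : Grass ο A) : p f := by
  rw [eq_sum_mono f]
  refine Finset.sum_induction _ p add ?_ fun S _ => mono S _
  simpa using mono ∅ 0
end

variable [CommRing A]

theorem mul_apply (f g : Grass ο A) (S : Finset ο) :
    (f * g) S = ∑ T ∈ S.powerset, (-1) ^ inversions T (S \ T) * (f T * g (S \ T)) := by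
  have : ‹DecidableEq ο› = LinearOrder.toDecidableEq := Subsingleton.elim _ _
  subst this
  rfl

theorem mono_mul_apply (S : Finset ο) (a : A) (f : Grass ο A) (U : Finset ο) :
    (mono S a * f) U = if S ⊆ U then (-1) ^ inversions S (U \ S) * (a * f (U \ S)) else 0 := by
  rw [mul_apply]
  split_ifs with h
  · rw [Finset.sum_eq_single S]
    · simp [mono_apply]
    · intro T _ hT; simp [mono_apply, hT]
    · intro h'; exact absurd (Finset.mem_powerset.2 h) h'
  · refine Finset.sum_eq_zero fun T hT => ?_
    have : T ≠ S := fun e => h (e ▸ Finset.mem_powerset.1 hT)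
    simp [mono_apply, this]

theorem mono_mul_mono_of_disjoint {S T : Finset ο} (h : Disjoint S T) (a b : A) :
    mono S a * mono T b = mono (S ∪ T) ((-1) ^ inversions S T * (a * b)) := by
  ext U
  rw [mono_mul_apply, mono_apply (S ∪ T)]
  split_ifs with h1 h2 h2
  · subst h2
    rw [Finset.union_sdiff_cancel_left h]; simp [mono_apply]
  · have : U \ S ≠ T := fun e => h2 (by rw [← e, Finset.union_sdiff_of_subset h1])
    simp [mono_apply, this]
  · exact absurd (h2 ▸ Finset.subset_union_left) h1
  · rfl

theorem mono_mul_mono_of_not_disjoint {S T : Finset ο} (h : ¬Disjoint S T) (a b : A) :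
    mono S a * mono T b = 0 := by
  ext U
  rw [mono_mul_apply]
  split_ifs with h1
  · have : U \ S ≠ T := fun e => h (e ▸ Finset.disjoint_sdiff)
    simp [mono_apply, this]
  · rfl

theorem const_eq_mono (a : A) : (const a : Grass ο A) = mono ∅ a := rfl

theorem one_eq_mono : (1 : Grass ο A) = mono ∅ 1 := rfl

theorem gen_eq_mono (o : ο) : (gen o : Grass ο A) = mono {o} 1 := rfl

theorem mul_add' (f g h : Grass ο A) : f * (g + h) = f * g + f * h := by
  ext S; simp only [mul_apply, add_apply, mul_add, Finset.sum_add_distrib]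

theorem add_mul' (f g h : Grass ο A) : (f + g) * h = f * h + g * h := by
  ext S; simp only [mul_apply, add_apply, mul_add, add_mul, Finset.sum_add_distrib]

theorem zero_mul' (f : Grass ο A) : 0 * f = 0 := by
  ext S; simp [mul_apply]

theorem mul_zero' (f : Grass ο A) : f * 0 = 0 := by
  ext S; simp [mul_apply]

/-- If the three sets are pairwise disjoint, both sides carry the exponent inv(S,T) + inv(S,R) +
inv(T,R); if two of them meet, both sides vanish. -/
theorem mono_mul_assoc (S T R : Finset ο) (a b c : A) :
    mono S a * mono T b * mono R c = mono S a * (mono T b * mono R c) := by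
  by_cases h1 : Disjoint S T <;> by_cases h2 : Disjoint T R <;> by_cases h3 : Disjoint S R
  · rw [mono_mul_mono_of_disjoint h1, mono_mul_mono_of_disjoint h2,
      mono_mul_mono_of_disjoint (Finset.disjoint_union_left.2 ⟨h3, h2⟩),
      mono_mul_mono_of_disjoint (Finset.disjoint_union_right.2 ⟨h1, h3⟩),
      inversions_union_left h1, inversions_union_right h2, Finset.union_assoc]
    congr 1; ring
  · rw [mono_mul_mono_of_disjoint h1, mono_mul_mono_of_disjoint h2,
      mono_mul_mono_of_not_disjoint, mono_mul_mono_of_not_disjoint]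
    · rw [Finset.disjoint_union_right]; tauto
    · rw [Finset.disjoint_union_left]; tauto
  · rw [mono_mul_mono_of_disjoint h1, mono_mul_mono_of_not_disjoint h2,
      mono_mul_mono_of_not_disjoint, mul_zero']
    rw [Finset.disjoint_union_left]; tauto
  · rw [mono_mul_mono_of_disjoint h1, mono_mul_mono_of_not_disjoint h2,
      mono_mul_mono_of_not_disjoint, mul_zero']
    rw [Finset.disjoint_union_left]; tauto
  · rw [mono_mul_mono_of_not_disjoint h1, mono_mul_mono_of_disjoint h2, zero_mul',
      mono_mul_mono_of_not_disjoint]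
    rw [Finset.disjoint_union_right]; tauto
  · rw [mono_mul_mono_of_not_disjoint h1, mono_mul_mono_of_disjoint h2, zero_mul',
      mono_mul_mono_of_not_disjoint]
    rw [Finset.disjoint_union_right]; tauto
  · rw [mono_mul_mono_of_not_disjoint h1, mono_mul_mono_of_not_disjoint h2, zero_mul', mul_zero']
  · rw [mono_mul_mono_of_not_disjoint h1, mono_mul_mono_of_not_disjoint h2, zero_mul', mul_zero']

variable [Fintype ο]

/-- The addition, product and unit are those already defined, so that the ring structure agrees with
the operations in the definitions of forms and multivector fields. -/
instance instRing : Ring (Grass ο A) :=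
  { (inferInstance : AddCommGroup (Grass ο A)),
    (inferInstance : Mul (Grass ο A)),
    (inferInstance : One (Grass ο A)) with
    left_distrib := mul_add'
    right_distrib := add_mul'
    zero_mul := zero_mul'
    mul_zero := mul_zero'
    mul_assoc := fun f g h => by
      induction f using Grass.induction with
      | add f f' hf hf' => simp only [add_mul', hf, hf']
      | mono S a =>
        induction g using Grass.induction with
        | add g g' hg hg' => simp only [add_mul', mul_add', hg, hg']
        | mono T b =>
          induction h using Grass.induction with
          | add h h' hh hh' => simp only [mul_add', hh, hh']
          | mono R c => exact mono_mul_assoc S T R a b c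
    one_mul := fun f => by
      induction f using Grass.induction with
      | add f g hf hg => rw [mul_add', hf, hg]
      | mono S a =>
        rw [one_eq_mono, mono_mul_mono_of_disjoint (Finset.disjoint_empty_left S)]; simp
    mul_one := fun f => by
      induction f using Grass.induction with
      | add f g hf hg => rw [add_mul', hf, hg]
      | mono S a =>
        rw [one_eq_mono, mono_mul_mono_of_disjoint (Finset.disjoint_empty_right S)]; simp }

section Complex

variable {B : Type u} [CommRing B] [Algebra ℂ B]

instance instSMulCommClass : SMulCommClass ℂ (Grass ο B) (Grass ο B) where
  smul_comm c f g := by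
    ext S
    simp only [smul_eq_mul, mul_apply, smul_apply, Finset.smul_sum, Algebra.mul_smul_comm]

instance instIsScalarTower : IsScalarTower ℂ (Grass ο B) (Grass ο B) where
  smul_assoc c f g := by
    ext S
    simp only [smul_eq_mul, mul_apply, smul_apply, Finset.smul_sum, Algebra.mul_smul_comm,
      Algebra.smul_mul_assoc]

end Complex

@[simp] theorem const_mul_apply (c : A) (f : Grass ο A) (U : Finset ο) :
    ((const c : Grass ο A) * f) U = c * f U := by
  rw [const_eq_mono, mono_mul_apply]; simp

/-! The parity involution. -/

theorem inv_apply (f : Grass ο A) (S : Finset ο) : f.inv S = sgn (S.card : ZMod 2) • f S := rfl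

theorem inv_mono (S : Finset ο) (a : A) : (mono S a).inv = mono S ((-1) ^ S.card * a) := by
  ext R
  rw [inv_apply, mono_apply, mono_apply, sgn_natCast]
  split_ifs with h
  · subst h; simp
  · simp

theorem inv_add (f g : Grass ο A) : (f + g).inv = f.inv + g.inv := by
  funext S; exact smul_add _ _ _

@[simp] theorem inv_inv (f : Grass ο A) : f.inv.inv = f := by
  funext S; rw [inv_apply, inv_apply, smul_smul, sgn_mul_self, one_smul]

theorem inv_mul (f g : Grass ο A) : (f * g).inv = f.inv * g.inv := by
  induction f using Grass.induction with
  | add f f' hf hf' => simp only [add_mul, inv_add, hf, hf']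
  | mono S a =>
    induction g using Grass.induction with
    | add g g' hg hg' => simp only [mul_add, inv_add, hg, hg']
    | mono T b =>
      rw [inv_mono, inv_mono]
      by_cases h : Disjoint S T
      · rw [mono_mul_mono_of_disjoint h, mono_mul_mono_of_disjoint h, inv_mono,
          Finset.card_union_of_disjoint h]
        congr 1; ring
      · rw [mono_mul_mono_of_not_disjoint h, mono_mul_mono_of_not_disjoint h]
        ext S; simp [inv_apply]

/-- The parity involution as a ring automorphism. -/
def invHom : Grass ο A →+* Grass ο A where
  toFun := inv
  map_one' := by rw [one_eq_mono, inv_mono]; simp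
  map_mul' := inv_mul
  map_zero' := by ext S; simp [inv_apply]
  map_add' := inv_add

@[simp] theorem inv_one : (1 : Grass ο A).inv = 1 := by rw [one_eq_mono, inv_mono]; simp

@[simp] theorem inv_zero : (0 : Grass ο A).inv = 0 := by
  funext S; exact smul_zero _

theorem inv_neg (f : Grass ο A) : (-f).inv = -f.inv := by
  funext S; exact smul_neg _ _

theorem inv_sub (f g : Grass ο A) : (f - g).inv = f.inv - g.inv := by
  funext S; exact smul_sub _ _ _

theorem inv_zsmul (k : ℤ) (f : Grass ο A) : (k • f).inv = k • f.inv := by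
  funext S; rw [inv_apply, zsmul_apply, zsmul_apply, inv_apply, smul_comm]

theorem inv_sum {ι : Type*} (s : Finset ι) (f : ι → Grass ο A) :
    (∑ i ∈ s, f i).inv = ∑ i ∈ s, (f i).inv :=
  map_sum invHom f s

theorem inv_smul {B : Type u} [CommRing B] [Module ℂ B] (c : ℂ) (f : Grass ο B) :
    (c • f).inv = c • f.inv := by
  funext S; exact smul_comm _ _ _

@[simp] theorem inv_const (c : A) : (const c : Grass ο A).inv = const c := by
  rw [const_eq_mono, inv_mono]; simp

@[simp] theorem inv_gen (o : ο) : (gen o : Grass ο A).inv = -gen o := by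
  rw [gen_eq_mono, inv_mono, ← mono_neg]; simp

/-! Homogeneous elements. -/

theorem HasParity.inv_eq {p : ZMod 2} {f : Grass ο A} (h : HasParity p f) :
    f.inv = sgn p • f := by
  ext S
  rw [inv_apply, zsmul_apply]
  by_cases hS : (S.card : ZMod 2) = p
  · rw [hS]
  · rw [h S hS, smul_zero, smul_zero]

/-- A component of the wrong parity is multiplied by a sign and by its opposite, so twice it
vanishes; the complex module structure permits division by 2. Parity thus becomes an equation for
the involution, which is easier to propagate than a condition on components. -/
theorem hasParity_of_inv_eq [Module ℂ A] {p : ZMod 2} {f : Grass ο A}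
    (h : f.inv = sgn p • f) : HasParity p f := by
  intro S hS
  have h1 : f.inv S = (sgn p • f) S := congrFun h S
  rw [inv_apply, zsmul_apply] at h1
  have h2 : sgn (S.card : ZMod 2) = -sgn p := by
    rcases zmod_two_cases (S.card : ZMod 2) with h | h <;> rcases zmod_two_cases p with rfl | rfl <;>
      simp_all
  rw [h2, neg_smul, neg_eq_iff_add_eq_zero, ← add_smul, ← two_mul] at h1
  have h3 : (2 : ℂ) • (sgn p • f S) = 0 := by
    rw [two_smul, ← two_smul ℤ, smul_smul, h1]
  have h4 := (smul_eq_zero_iff_right (two_ne_zero (α := ℂ))).1 h3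
  have h5 := congrArg (sgn p • ·) h4
  simpa only [smul_smul, sgn_mul_self, one_smul, smul_zero] using h5

theorem hasParity_iff [Module ℂ A] {p : ZMod 2} {f : Grass ο A} :
    HasParity p f ↔ f.inv = sgn p • f :=
  ⟨HasParity.inv_eq, hasParity_of_inv_eq⟩

/-- The involution `f ↦ (-1)^(p q) f` on elements of parity `q`. -/
def twist (p : ZMod 2) (f : Grass ο A) : Grass ο A := if p = 0 then f else f.inv

@[simp] theorem twist_zero (f : Grass ο A) : f.twist 0 = f := rfl
@[simp] theorem twist_one (f : Grass ο A) : f.twist 1 = f.inv := rfl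

theorem HasParity.twist_eq {p : ZMod 2} {f : Grass ο A} (h : HasParity p f) (q : ZMod 2) :
    f.twist q = sgn (p * q) • f := by
  rcases zmod_two_cases q with rfl | rfl
  · simp
  · simp [h.inv_eq]

theorem twist_add_parity (p q : ZMod 2) (f : Grass ο A) :
    f.twist (p + q) = (f.twist q).twist p := by
  rcases zmod_two_cases p with rfl | rfl <;> rcases zmod_two_cases q with rfl | rfl <;>
    simp [show (1 : ZMod 2) + 1 = 0 from rfl]

/-- Exchanging θ^S and θ^T costs |S||T| transpositions, by `inversions_add_inversions`, and this is
the sign recorded by the twist. -/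
theorem mono_comm (S T : Finset ο) (a b : A) :
    mono S a * mono T b = (mono T b).twist S.card * mono S a := by
  have key : (mono T b).twist S.card = mono T ((-1) ^ (S.card * T.card) * b) := by
    have hp : HasParity (T.card : ZMod 2) (mono T b) := by
      intro R hR; rw [mono_apply, if_neg]; rintro rfl; exact hR rfl
    rw [hp.twist_eq, ← Nat.cast_mul, sgn_natCast, mul_comm S.card]
    ext R; simp only [zsmul_apply, mono_apply]; split_ifs <;> simp
  rw [key]
  by_cases h : Disjoint S T
  · rw [mono_mul_mono_of_disjoint h, mono_mul_mono_of_disjoint h.symm, Finset.union_comm,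
      ← inversions_add_inversions h, pow_add]
    congr 1
    have : (-1 : A) ^ inversions T S * (-1) ^ inversions T S = 1 := by
      rw [← pow_add, ← two_mul, pow_mul]; simp
    linear_combination (-(-1) ^ inversions S T * (a * b)) * this
  · rw [mono_mul_mono_of_not_disjoint h,
      mono_mul_mono_of_not_disjoint fun h' => h h'.symm]

theorem twist_add (p : ZMod 2) (f g : Grass ο A) : (f + g).twist p = f.twist p + g.twist p := by
  rcases zmod_two_cases p with rfl | rfl
  · rfl
  · exact inv_add f g

/-- Elements of parity `p` commute with all elements up to the sign rule. -/
theorem HasParity.mul_comm {p : ZMod 2} {f : Grass ο A} (h : HasParity p f) (g : Grass ο A) :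
    f * g = g.twist p * f := by
  induction g using Grass.induction with
  | add g g' hg hg' => simp only [mul_add, add_mul, twist_add, hg, hg']
  | mono T b =>
    rw [eq_sum_mono f, Finset.sum_mul, Finset.mul_sum]
    refine Finset.sum_congr rfl fun S _ => ?_
    by_cases hS : (S.card : ZMod 2) = p
    · rw [mono_comm, hS]
    · rw [h S hS]; simp

theorem HasParity.add {p : ZMod 2} {f g : Grass ο A} (hf : HasParity p f) (hg : HasParity p g) :
    HasParity p (f + g) := fun S hS => by
  change f S + g S = 0
  rw [hf S hS, hg S hS, add_zero]

theorem HasParity.neg {p : ZMod 2} {f : Grass ο A} (hf : HasParity p f) :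
    HasParity p (-f) := fun S hS => by
  change -f S = 0
  rw [hf S hS, neg_zero]

theorem HasParity.zsmul {p : ZMod 2} {f : Grass ο A} (hf : HasParity p f) (k : ℤ) :
    HasParity p (k • f) := fun S hS => by
  change k • f S = 0
  rw [hf S hS, smul_zero]

theorem hasParity_zero (p : ZMod 2) : HasParity p (0 : Grass ο A) := fun _ _ => rfl

theorem hasParity_sum {ι : Type*} {p : ZMod 2} (s : Finset ι) (f : ι → Grass ο A)
    (h : ∀ i ∈ s, HasParity p (f i)) : HasParity p (∑ i ∈ s, f i) := fun S hS => by
  rw [sum_apply]; exact Finset.sum_eq_zero fun i hi => h i hi S hS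

theorem HasParity.mul {p q : ZMod 2} {f g : Grass ο A} (hf : HasParity p f)
    (hg : HasParity q g) : HasParity (p + q) (f * g) := fun S hS => by
  classical
  rw [mul_apply]
  refine Finset.sum_eq_zero fun T hT => ?_
  by_cases h1 : (T.card : ZMod 2) = p
  · rw [hg (S \ T), mul_zero, mul_zero]
    rintro rfl
    apply hS
    rw [← h1, ← Nat.cast_add, add_comm, Finset.card_sdiff_add_card_eq_card
      (Finset.mem_powerset.1 hT)]
  · rw [hf T h1, zero_mul, mul_zero]

theorem hasParity_mono (S : Finset ο) (a : A) : HasParity (S.card : ZMod 2) (mono S a) := by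
  intro R hR; rw [mono_apply, if_neg]; rintro rfl; exact hR rfl

theorem hasParity_const (a : A) : HasParity 0 (const a : Grass ο A) := hasParity_mono ∅ a

theorem hasParity_one : HasParity 0 (1 : Grass ο A) := hasParity_mono ∅ 1

theorem hasParity_gen (o : ο) : HasParity 1 (gen o : Grass ο A) := hasParity_mono {o} 1

theorem hasParity_part (p : ZMod 2) (f : Grass ο A) : HasParity p (f.part p) := by
  intro S hS; simp [part, hS]

theorem part_add_part (f : Grass ο A) : f.part 0 + f.part 1 = f := by
  ext S
  rcases zmod_two_cases (S.card : ZMod 2) with h | h <;> simp [part, h]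

theorem HasParity.part_eq {p : ZMod 2} {f : Grass ο A} (h : HasParity p f) (q : ZMod 2) :
    f.part q = if q = p then f else 0 := by
  funext S
  by_cases hq : q = p
  · subst hq
    simp only [part, if_true]
    split_ifs with h1
    · rfl
    · exact (h S h1).symm
  · rw [if_neg hq]
    simp only [part]
    split_ifs with h1
    · exact h S (fun e => hq (h1 ▸ e))
    · rfl

end Grass
end HigherKoszul

/-! ### Derivations of Grassmann algebras and substitutions of variables. -/

namespace HigherKoszul

/-- Additive maps satisfying the Leibniz rule. -/
structure IsDer {A : Type u} [CommRing A] (D : A → A) : Prop where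
  map_add : ∀ a b, D (a + b) = D a + D b
  map_mul : ∀ a b, D (a * b) = D a * b + a * D b

namespace IsDer

variable {A : Type u} [CommRing A] {D : A → A}

theorem map_zero (h : IsDer D) : D 0 = 0 := by simpa using h.map_add 0 0

theorem map_neg (h : IsDer D) (a : A) : D (-a) = -D a := by
  have := h.map_add (-a) a
  rw [neg_add_cancel, h.map_zero] at this
  exact eq_neg_of_add_eq_zero_left this.symm

theorem map_one (h : IsDer D) : D 1 = 0 := by simpa using h.map_mul 1 1

theorem map_sum (h : IsDer D) {ι : Type*} (s : Finset ι) (f : ι → A) :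
    D (∑ i ∈ s, f i) = ∑ i ∈ s, D (f i) :=
  _root_.map_sum (AddMonoidHom.mk' D h.map_add) f s

theorem map_neg_one_pow_mul (h : IsDer D) (k : ℕ) (a : A) :
    D ((-1) ^ k * a) = (-1) ^ k * D a := by
  rcases neg_one_pow_eq_or A k with e | e <;> simp [e, h.map_neg]

end IsDer

namespace Grass

variable {ο ο' : Type} [LinearOrder ο] [DecidableEq ο] [LinearOrder ο'] [DecidableEq ο']
  [Fintype ο] [Fintype ο']
  {A : Type u} {B : Type u}

section
variable [CommRing A]

theorem const_mul_mono (a b : A) (S : Finset ο) :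
    (const a * mono S b : Grass ο A) = mono S (a * b) := by
  ext U; simp only [const_mul_apply, mono_apply]; split_ifs <;> simp

theorem gen_mul_mono {o : ο} {S : Finset ο} (h : o ∉ S) (a : A) :
    gen o * mono S a = mono (insert o S) ((-1) ^ (S.filter fun s => s < o).card * a) := by
  rw [gen_eq_mono, mono_mul_mono_of_disjoint (Finset.disjoint_singleton_left.2 h),
    inversions_singleton_left, one_mul, ← Finset.insert_eq]

theorem oddDeriv_apply (o : ο) (f : Grass ο A) (S : Finset ο) : f.oddDeriv o S =
    if o ∈ S then 0 else (-1) ^ (S.filter fun s => s < o).card * f (insert o S) := by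
  have : ‹DecidableEq ο› = LinearOrder.toDecidableEq := Subsingleton.elim _ _
  subst this
  rfl

theorem oddDeriv_add (o : ο) (f g : Grass ο A) :
    (f + g).oddDeriv o = f.oddDeriv o + g.oddDeriv o := by
  ext S; simp only [oddDeriv_apply, add_apply]; split_ifs <;> simp [mul_add]

theorem oddDeriv_smul {B : Type u} [CommRing B] [Algebra ℂ B] (o : ο) (c : ℂ)
    (f : Grass ο B) : (c • f).oddDeriv o = c • f.oddDeriv o := by
  ext S; simp only [oddDeriv_apply, smul_apply]; split_ifs <;> simp

theorem oddDeriv_mono_of_mem {o : ο} {S : Finset ο} (h : o ∈ S) (a : A) :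
    (mono S a).oddDeriv o = mono (S.erase o) ((-1) ^ (S.filter fun s => s < o).card * a) := by
  ext R
  rw [oddDeriv_apply, mono_apply, mono_apply]
  by_cases h1 : o ∈ R
  · have : R ≠ S.erase o := by rintro rfl; simp at h1
    simp [h1, this]
  · by_cases h2 : insert o R = S
    · subst h2
      rw [Finset.erase_insert h1, Finset.filter_insert]; simp [h1]
    · have : R ≠ S.erase o := by rintro rfl; exact h2 (Finset.insert_erase h)
      simp [h1, h2, this]

theorem oddDeriv_mono_of_notMem {o : ο} {S : Finset ο} (h : o ∉ S) (a : A) :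
    (mono S a).oddDeriv o = 0 := by
  ext R
  rw [oddDeriv_apply, mono_apply]
  have : insert o R ≠ S := by rintro rfl; simp at h
  simp [this]

theorem oddDeriv_const (o : ο) (a : A) : (const a : Grass ο A).oddDeriv o = 0 :=
  oddDeriv_mono_of_notMem (by simp) a

theorem oddDeriv_gen (o o' : ο) :
    (gen o' : Grass ο A).oddDeriv o = if o = o' then 1 else 0 := by
  split_ifs with h
  · subst h
    rw [gen_eq_mono, oddDeriv_mono_of_mem (by simp), one_eq_mono, Finset.filter_singleton]
    simp
  · exact oddDeriv_mono_of_notMem (by simpa using h) _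

/-- The canonical anticommutation relation of θ_{o'} and ∂/∂θ_o. The Leibniz rule and the
anticommutativity of odd derivatives follow from it by induction on generators, so the counting of
positions for these facts is confined to this proof. -/
theorem oddDeriv_gen_mul (o o' : ο) (f : Grass ο A) :
    (gen o' * f).oddDeriv o = (if o = o' then f else 0) - gen o' * f.oddDeriv o := by
  induction f using Grass.induction with
  | add f g hf hg =>
    rw [mul_add, oddDeriv_add, hf, hg, oddDeriv_add, mul_add]
    split_ifs
    · abel
    · abel
  | mono S a =>
    by_cases h1 : o' ∈ S
    · rw [gen_eq_mono, mono_mul_mono_of_not_disjoint (by simpa using h1)]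
      by_cases h : o = o'
      · subst h
        rw [oddDeriv_mono_of_mem h1, ← gen_eq_mono, gen_mul_mono (Finset.notMem_erase _ _),
          Finset.insert_erase h1, Finset.filter_erase]
        have : o ∉ S.filter fun s => s < o := by simp
        rw [Finset.erase_eq_of_notMem this, ← mul_assoc, ← pow_add, ← two_mul, pow_mul]
        ext R; simp [oddDeriv_apply]
      · rw [if_neg h]
        by_cases h2 : o ∈ S
        · rw [oddDeriv_mono_of_mem h2, mono_mul_mono_of_not_disjoint]
          · ext R; simp [oddDeriv_apply]
          · simp [Ne.symm h, h1]
        · rw [oddDeriv_mono_of_notMem h2]; ext R; simp [oddDeriv_apply]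
    · rw [gen_mul_mono h1]
      by_cases h : o = o'
      · subst h
        rw [oddDeriv_mono_of_mem (Finset.mem_insert_self _ _), oddDeriv_mono_of_notMem h1,
          Finset.erase_insert h1, Finset.filter_insert, if_neg (lt_irrefl _), if_pos rfl, mul_zero,
          sub_zero, ← mul_assoc, ← pow_add, ← two_mul, pow_mul]
        simp
      · rw [if_neg h, zero_sub]
        by_cases h2 : o ∈ S
        · rw [oddDeriv_mono_of_mem h2, oddDeriv_mono_of_mem (Finset.mem_insert_of_mem h2),
            gen_mul_mono (fun h' => h1 (Finset.mem_of_mem_erase h')),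
            Finset.erase_insert_of_ne (Ne.symm h), ← mono_neg]
          congr 1
          rw [Finset.filter_insert, Finset.filter_erase]
          -- If o comes first, removing it lowers the position of o' by one; if o' comes first,
          -- inserting it raises the position of o by one. Either way exactly one extra sign
          -- appears.
          rcases lt_or_gt_of_ne h with h3 | h3
          · rw [if_neg h3.not_gt, Finset.card_erase_of_mem (by simp [h2, h3])]
            have : 0 < (S.filter fun s => s < o').card :=
              Finset.card_pos.2 ⟨o, by simp [h2, h3]⟩
            obtain ⟨k, hk⟩ := Nat.exists_eq_succ_of_ne_zero this.ne'
            rw [hk]; simp only [Nat.succ_eq_add_one, Nat.add_sub_cancel]; ring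
          · rw [if_pos h3, Finset.card_insert_of_notMem (by simp [h1]),
              Finset.erase_eq_of_notMem (by simp [h3.not_gt])]
            ring
        · rw [oddDeriv_mono_of_notMem h2, oddDeriv_mono_of_notMem, mul_zero, neg_zero]
          simp [h, h2]

/-- The Grassmann algebra is generated by the coefficients and the odd variables. -/
theorem generator_induction {p : Grass ο A → Prop} (add : ∀ f g, p f → p g → p (f + g))
    (const : ∀ a, p (const a)) (gen_mul : ∀ o f, p f → p (gen o * f)) (f : Grass ο A) : p f := by
  induction f using Grass.induction with
  | add f g hf hg => exact add f g hf hg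
  | mono S a =>
    induction S using Finset.induction_on generalizing a with
    | empty => exact const a
    | insert o S h ih =>
      -- The coefficient carries in advance the sign that will be produced by moving θ_o to its
      -- place.
      have := gen_mul o _ (ih ((-1) ^ (S.filter fun s => s < o).card * a))
      rw [gen_mul_mono h, ← mul_assoc, ← pow_add, ← two_mul, pow_mul] at this
      simpa using this

/-- Additive maps of parity `p` satisfying the Leibniz rule with the sign rule. -/
structure IsSuperDer (p : ZMod 2) (D : Grass ο A → Grass ο A) : Prop where
  map_add : ∀ f g, D (f + g) = D f + D g
  map_mul : ∀ f g, D (f * g) = D f * g + f.twist p * D g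
  map_inv : ∀ f, D f.inv = sgn p • (D f).inv

theorem oddDeriv_const_mul (o : ο) (a : A) (f : Grass ο A) :
    (const a * f).oddDeriv o = const a * f.oddDeriv o := by
  ext S; simp only [oddDeriv_apply, const_mul_apply]; split_ifs <;> ring

theorem oddDeriv_inv (o : ο) (f : Grass ο A) : f.inv.oddDeriv o = -(f.oddDeriv o).inv := by
  ext S
  rw [oddDeriv_apply, neg_apply, inv_apply, inv_apply, oddDeriv_apply]
  split_ifs with h
  · simp
  · rw [Finset.card_insert_of_notMem h, Nat.cast_succ, sgn_add]
    simp; ring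

theorem oddDeriv_mul (o : ο) (f g : Grass ο A) :
    (f * g).oddDeriv o = f.oddDeriv o * g + f.inv * g.oddDeriv o := by
  induction f using generator_induction with
  | add f f' hf hf' =>
    simp only [add_mul, oddDeriv_add, hf, hf', inv_add]; abel
  | const a => rw [oddDeriv_const_mul, oddDeriv_const, inv_const]; simp
  | gen_mul o' f hf =>
    rw [mul_assoc, oddDeriv_gen_mul, oddDeriv_gen_mul, hf, inv_mul, inv_gen]
    split_ifs <;> noncomm_ring

theorem isSuperDer_oddDeriv (o : ο) : IsSuperDer 1 (oddDeriv o : Grass ο A → Grass ο A) where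
  map_add := oddDeriv_add o
  map_mul f g := oddDeriv_mul o f g
  map_inv f := by rw [oddDeriv_inv]; simp

theorem oddDeriv_oddDeriv (o o' : ο) (f : Grass ο A) :
    (f.oddDeriv o').oddDeriv o = -(f.oddDeriv o).oddDeriv o' := by
  have h0 : ∀ o, (0 : Grass ο A).oddDeriv o = 0 := fun o => by ext S; simp [oddDeriv_apply]
  have hn : ∀ o (f : Grass ο A), (-f).oddDeriv o = -f.oddDeriv o := fun o f => by
    ext S; simp only [oddDeriv_apply, neg_apply]; split_ifs <;> simp
  induction f using generator_induction with
  | add f g hf hg => simp only [oddDeriv_add, hf, hg]; abel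
  | const a => simp [oddDeriv_const, h0]
  | gen_mul a f hf =>
    rw [oddDeriv_gen_mul, oddDeriv_gen_mul, sub_eq_add_neg, sub_eq_add_neg, oddDeriv_add,
      oddDeriv_add, hn, hn, oddDeriv_gen_mul, oddDeriv_gen_mul, hf]
    split_ifs <;> simp [h0] <;> noncomm_ring

namespace IsSuperDer

variable {p : ZMod 2} {D : Grass ο A → Grass ο A}

theorem map_zero (h : IsSuperDer p D) : D 0 = 0 := by simpa using h.map_add 0 0

theorem map_neg (h : IsSuperDer p D) (f : Grass ο A) : D (-f) = -D f := by
  have := h.map_add (-f) f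
  rw [neg_add_cancel, h.map_zero] at this
  exact eq_neg_of_add_eq_zero_left this.symm

theorem map_sub (h : IsSuperDer p D) (f g : Grass ο A) : D (f - g) = D f - D g := by
  rw [sub_eq_add_neg, h.map_add, h.map_neg, sub_eq_add_neg]

theorem map_sum (h : IsSuperDer p D) {ι : Type*} (s : Finset ι) (f : ι → Grass ο A) :
    D (∑ i ∈ s, f i) = ∑ i ∈ s, D (f i) :=
  _root_.map_sum (AddMonoidHom.mk' D h.map_add) f s

theorem map_zsmul (h : IsSuperDer p D) (k : ℤ) (f : Grass ο A) : D (k • f) = k • D f :=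
  _root_.map_zsmul (AddMonoidHom.mk' D h.map_add) k f

theorem map_one (h : IsSuperDer p D) : D 1 = 0 := by
  have := h.map_mul 1 1
  rcases zmod_two_cases p with rfl | rfl <;> simpa using this

theorem hasParity [Module ℂ A] (h : IsSuperDer p D) {q : ZMod 2} {f : Grass ο A}
    (hf : HasParity q f) : HasParity (p + q) (D f) := by
  refine hasParity_of_inv_eq ?_
  have h1 : (D f).inv = sgn p • D f.inv := by rw [h.map_inv, smul_smul, sgn_mul_self, one_smul]
  rw [h1, hf.inv_eq, h.map_zsmul, smul_smul, sgn_add]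

end IsSuperDer

/-! Maps acting on coefficients. -/

theorem isSuperDer_mapCoeff {D : A → A} (hD : IsDer D) :
    IsSuperDer 0 (mapCoeff D : Grass ο A → Grass ο A) where
  map_add f g := by ext S; exact hD.map_add _ _
  map_mul f g := by
    ext S
    simp only [mapCoeff, add_apply, mul_apply, hD.map_sum, ← Finset.sum_add_distrib, twist_zero,
      hD.map_neg_one_pow_mul, hD.map_mul, mul_add]
  map_inv f := by
    ext S
    change D (sgn _ • f S) = ((1 : ℤ) • (sgn _ • D (f S)))
    rw [one_smul]
    exact _root_.map_zsmul (AddMonoidHom.mk' D hD.map_add) _ _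

theorem mapCoeff_oddDeriv {D : A → A} (hD : IsDer D) (o : ο) (f : Grass ο A) :
    mapCoeff D (f.oddDeriv o) = (mapCoeff D f).oddDeriv o := by
  ext S
  simp only [mapCoeff, oddDeriv_apply]
  split_ifs
  · exact hD.map_zero
  · exact hD.map_neg_one_pow_mul _ _

theorem mapCoeff_const {D : A → A} (hD : D 0 = 0) (a : A) :
    mapCoeff D (const a : Grass ο A) = const (D a) := by
  ext S; simp only [mapCoeff, const]; split_ifs <;> simp [hD]

theorem mapCoeff_gen {D : A → A} (hD : IsDer D) (o : ο) :
    mapCoeff D (gen o : Grass ο A) = 0 := by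
  ext S; simp only [mapCoeff, gen]; split_ifs <;> simp [hD.map_zero, hD.map_one]

theorem mapCoeff_gen_hom [CommRing B] (φ : A →+* B) (o : ο) :
    mapCoeff φ (gen o : Grass ο A) = gen o := by
  ext S; simp only [mapCoeff, gen]; split_ifs <;> simp

theorem mapCoeff_comm {D D' : A → A} (h : ∀ a, D (D' a) = D' (D a)) (f : Grass ο A) :
    mapCoeff D (mapCoeff D' f) = mapCoeff D' (mapCoeff D f) := by
  ext S; exact h _

theorem mapCoeff_hom_oddDeriv [CommRing B] (φ : A →+* B) (o : ο) (f : Grass ο A) :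
    mapCoeff φ (f.oddDeriv o) = (mapCoeff φ f).oddDeriv o := by
  ext S
  simp only [mapCoeff, oddDeriv_apply]
  split_ifs <;> simp

end

/-! Substitutions of variables. -/

section
variable [CommRing A] [CommRing B]

theorem embed_apply_map (e : ο ↪ ο') (φ : A → B) (f : Grass ο A) (S : Finset ο) :
    embed e φ f (S.map e) = φ (f S) := by
  classical
  rw [embed, if_pos (by simp)]
  congr 2
  ext o; simp

theorem embed_apply_of_not_subset (e : ο → ο') (φ : A → B) (f : Grass ο A) {S : Finset ο'}
    (h : ¬(S : Set ο') ⊆ Set.range e) : embed e φ f S = 0 := by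
  rw [embed, if_neg h]

theorem exists_map_eq (e : ο ↪ ο') {S : Finset ο'} (h : (S : Set ο') ⊆ Set.range e) :
    ∃ T : Finset ο, T.map e = S := by
  classical
  refine ⟨Finset.univ.filter fun o => e o ∈ S, ?_⟩
  ext o'
  simp only [Finset.mem_map, Finset.mem_filter, Finset.mem_univ, true_and]
  exact ⟨fun ⟨o, h1, h2⟩ => h2 ▸ h1, fun h' => by
    obtain ⟨o, rfl⟩ := h h'; exact ⟨o, h', rfl⟩⟩

/-- Two elements agreeing on the subsets of the range of `e` and vanishing elsewhere are equal. -/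
theorem ext_range (e : ο ↪ ο') {f g : Grass ο' B} (h1 : ∀ S : Finset ο, f (S.map e) = g (S.map e))
    (h2 : ∀ S : Finset ο', ¬(S : Set ο') ⊆ Set.range e → f S = g S) : f = g := by
  ext S
  by_cases h : (S : Set ο') ⊆ Set.range e
  · obtain ⟨T, rfl⟩ := exists_map_eq e h
    exact h1 T
  · exact h2 S h

theorem embed_mono (e : ο ↪ ο') (φ : A →+* B) (S : Finset ο) (a : A) :
    embed e φ (mono S a) = mono (S.map e) (φ a) := by
  refine ext_range e (fun T => ?_) fun T hT => ?_
  · rw [embed_apply_map, mono_apply, mono_apply]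
    by_cases h : T = S <;> simp [h]
  · rw [embed_apply_of_not_subset e _ _ hT, mono_apply, if_neg]
    rintro rfl; exact hT (by simp)

theorem embed_add (e : ο ↪ ο') (φ : A →+* B) (f g : Grass ο A) :
    embed e φ (f + g) = embed e φ f + embed e φ g := by
  refine ext_range e (fun T => ?_) fun T hT => ?_
  · simp [embed_apply_map]
  · simp [embed_apply_of_not_subset e _ _ hT]

/-- Signs depend only on the relative order of the variables. Hence an increasing substitution is
multiplicative, and this is why the embeddings of variables used below are order embeddings. -/
theorem inversions_map (e : ο ↪o ο') (S T : Finset ο) :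
    inversions (S.map e.toEmbedding) (T.map e.toEmbedding) = inversions S T := by
  simp only [inversions_eq_sum_left, Finset.sum_map]
  refine Finset.sum_congr rfl fun s _ => ?_
  rw [Finset.filter_map, Finset.card_map]
  congr 2
  ext t; simp

/-- The substitution of odd variables along an increasing map, as a ring homomorphism. -/
def embedHom (e : ο ↪o ο') (φ : A →+* B) : Grass ο A →+* Grass ο' B where
  toFun := embed e φ
  map_zero' := by
    have := embed_add e.toEmbedding φ 0 0
    rw [add_zero] at this
    simpa using this
  map_add' := embed_add e.toEmbedding φ
  map_one' := by
    have := embed_mono e.toEmbedding φ ∅ 1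
    simpa [one_eq_mono] using this
  map_mul' f g := by
    have hadd : ∀ f g : Grass ο A, embed e φ (f + g) = embed e φ f + embed e φ g :=
      embed_add e.toEmbedding φ
    have hmono : ∀ (S : Finset ο) (a : A),
        embed e φ (mono S a) = mono (S.map e.toEmbedding) (φ a) := embed_mono e.toEmbedding φ
    have h0 : embed e φ (0 : Grass ο A) = 0 := by
      have := hadd 0 0
      rw [add_zero] at this
      simpa using this
    induction f using Grass.induction with
    | add f f' hf hf' => simp only [add_mul, hadd, hf, hf']
    | mono S a =>
      induction g using Grass.induction with
      | add g g' hg hg' => simp only [mul_add, hadd, hg, hg']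
      | mono T b =>
        rw [hmono, hmono]
        by_cases h : Disjoint S T
        · rw [mono_mul_mono_of_disjoint h, mono_mul_mono_of_disjoint (by simpa using h), hmono,
            inversions_map, Finset.map_union]
          simp
        · rw [mono_mul_mono_of_not_disjoint h, mono_mul_mono_of_not_disjoint (by simpa using h),
            h0]

theorem embed_const (e : ο ↪ ο') (φ : A →+* B) (a : A) :
    embed e φ (const a : Grass ο A) = const (φ a) := by
  rw [const_eq_mono, embed_mono]; rfl

theorem embed_gen (e : ο ↪ ο') (φ : A →+* B) (o : ο) :
    embed e φ (gen o : Grass ο A) = gen (e o) := by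
  rw [gen_eq_mono, embed_mono]; simp [gen_eq_mono]

theorem embed_inv (e : ο ↪ ο') (φ : A →+* B) (f : Grass ο A) :
    embed e φ f.inv = (embed e φ f).inv := by
  refine ext_range e (fun T => ?_) fun T hT => ?_
  · rw [inv_apply, embed_apply_map, embed_apply_map, Finset.card_map, inv_apply]
    exact map_zsmul φ _ _
  · rw [inv_apply, embed_apply_of_not_subset e _ _ hT, embed_apply_of_not_subset e _ _ hT,
      smul_zero]

theorem embed_smul {A B : Type u} [CommRing A] [CommRing B] [Module ℂ A] [Module ℂ B]
    (e : ο ↪ ο') (φ : A →+* B) (h : ∀ (c : ℂ) a, φ (c • a) = c • φ a) (c : ℂ) (f : Grass ο A) :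
    embed e φ (c • f) = c • embed e φ f := by
  refine ext_range e (fun T => ?_) fun T hT => ?_
  · simp [embed_apply_map, h]
  · simp [embed_apply_of_not_subset e _ _ hT]

/-- An increasing embedding preserves the number of variables standing before o, hence the sign of
the left derivative. -/
theorem embed_oddDeriv (e : ο ↪o ο') (φ : A →+* B) (o : ο) (f : Grass ο A) :
    embed e φ (f.oddDeriv o) = (embed e φ f).oddDeriv (e o) := by
  refine ext_range e.toEmbedding (fun T => ?_) fun T hT => ?_
  · refine (embed_apply_map e.toEmbedding φ _ T).trans ?_
    rw [oddDeriv_apply, oddDeriv_apply]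
    have h1 : e o ∈ T.map e.toEmbedding ↔ o ∈ T := by simp
    have h2 : insert (e o) (T.map e.toEmbedding) = (insert o T).map e.toEmbedding := by
      rw [Finset.map_insert]; rfl
    have h3 : ((T.map e.toEmbedding).filter fun s => s < e o).card
        = (T.filter fun s => s < o).card := by
      rw [Finset.filter_map, Finset.card_map]; congr 2; ext t; simp
    have h4 := embed_apply_map e.toEmbedding φ f (insert o T)
    simp only [h1, h2, h3]
    split_ifs
    · simp
    · rw [map_mul, map_pow, map_neg, map_one]
      exact congrArg _ h4.symm
  · refine (embed_apply_of_not_subset e _ _ hT).trans ?_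
    rw [oddDeriv_apply]
    split_ifs with h
    · rfl
    · rw [embed_apply_of_not_subset, mul_zero]
      intro h'; apply hT
      exact fun x hx => h' (by simpa using Or.inr hx)

theorem oddDeriv_embed_of_notMem (e : ο → ο') (φ : A → B) {o' : ο'} (h : o' ∉ Set.range e)
    (f : Grass ο A) : (embed e φ f).oddDeriv o' = 0 := by
  ext S
  rw [oddDeriv_apply]
  split_ifs with h1
  · rfl
  · rw [embed_apply_of_not_subset, mul_zero]; · rfl
    intro h'; exact h (h' (by simp))

theorem mapCoeff_embed {C D : Type u} [CommRing C] [CommRing D] (e : ο ↪ ο') (φ : A → B) (ψ : C → D)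
    (d : B → D) (d' : A → C) (h0 : d 0 = 0) (h : ∀ a, d (φ a) = ψ (d' a)) (f : Grass ο A) :
    mapCoeff d (embed e φ f) = embed e ψ (mapCoeff d' f) := by
  refine ext_range e (fun T => ?_) fun T hT => ?_
  · simp only [mapCoeff, embed_apply_map, h]
  · simp only [mapCoeff, embed_apply_of_not_subset e _ _ hT, h0]

theorem mapCoeff_embed_eq_zero (e : ο ↪ ο') (φ : A → B) (d : B → B) (h0 : d 0 = 0)
    (h : ∀ a, d (φ a) = 0) (f : Grass ο A) : mapCoeff d (embed e φ f) = 0 := by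
  refine ext_range e (fun T => ?_) fun T hT => ?_
  · simp only [mapCoeff, embed_apply_map, h]; rfl
  · simp only [mapCoeff, embed_apply_of_not_subset e _ _ hT, h0]; rfl

end

end Grass
end HigherKoszul

/-! ### Smooth functions on open sets: Hadamard's lemma, partial derivatives, pull-backs. -/

namespace HigherKoszul

section Analysis

open scoped ContDiff

/-- Repeated differentiation under the integral sign. The target space varies in the induction,
because the derivative of the integrand takes values in a space of linear maps. -/
theorem contDiff_parametric_integral {E : Type} [NormedAddCommGroup E] [NormedSpace ℝ E]
    [FiniteDimensional ℝ E] (k : ℕ) : ∀ {F : Type} [NormedAddCommGroup F] [NormedSpace ℝ F]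
    [CompleteSpace F] {h : E × ℝ → F}, ContDiff ℝ ∞ h →
    ContDiff ℝ k fun x => ∫ t in (0 : ℝ)..1, h (x, t) := by
  induction k with
  | zero =>
    intro F _ _ _ h hh
    refine contDiff_zero.2 ?_
    exact intervalIntegral.continuous_parametric_intervalIntegral_of_continuous'
      (f := fun x t => h (x, t)) hh.continuous 0 1
  | succ k ih =>
    intro F _ _ _ h hh
    have hd : ContDiff ℝ ∞ fun q : E × ℝ =>
        (fderiv ℝ h q).comp (ContinuousLinearMap.inl ℝ E ℝ) :=
      (hh.fderiv_right (m := ∞) (by simp)).clm_comp contDiff_const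
    refine (contDiff_succ_iff_hasFDerivAt (n := k)).2 ⟨_, ih hd, fun x₀ => ?_⟩
    -- In finite dimension the closed unit ball is compact, so the derivative is bounded there
    -- uniformly for t in [0,1]; the constant bound dominates the derivatives near x₀.
    obtain ⟨C, hC⟩ := ((isCompact_closedBall x₀ (1 : ℝ)).prod
      (isCompact_Icc (a := (0 : ℝ)) (b := 1))).exists_bound_of_continuousOn
      hd.continuous.continuousOn
    refine intervalIntegral.hasFDerivAt_integral_of_dominated_of_fderiv_le
      (F := fun x t => h (x, t)) (bound := fun _ => C)
      (F' := fun x t => (fderiv ℝ h (x, t)).comp (ContinuousLinearMap.inl ℝ E ℝ))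
      (Metric.closedBall_mem_nhds x₀ one_pos) ?_ ?_ ?_ ?_ ?_ ?_
    · exact Filter.Eventually.of_forall fun x =>
        (hh.continuous.comp (by fun_prop : Continuous fun t : ℝ => (x, t))).aestronglyMeasurable
    · exact (hh.continuous.comp
        (by fun_prop : Continuous fun t : ℝ => (x₀, t))).intervalIntegrable _ _
    · exact (hd.continuous.comp
        (by fun_prop : Continuous fun t : ℝ => (x₀, t))).aestronglyMeasurable
    · refine Filter.Eventually.of_forall fun t ht x hx => hC (x, t) ⟨hx, ?_⟩
      rw [Set.uIoc_of_le zero_le_one] at ht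
      exact ⟨ht.1.le, ht.2⟩
    · exact intervalIntegrable_const
    · refine Filter.Eventually.of_forall fun t _ x _ => ?_
      have h1 : HasFDerivAt h (fderiv ℝ h (x, t)) (x, t) :=
        (hh.differentiable (by simp) _).hasFDerivAt
      exact h1.comp x (hasFDerivAt_prodMk_left x t)

/-- Hadamard's lemma. -/
theorem exists_contDiff_eq_sum {ι : Type} [Fintype ι] [DecidableEq ι] {F : (ι → ℝ) → ℂ}
    (hF : ContDiff ℝ ∞ F) (z₀ : ι → ℝ) :
    ∃ G : ι → (ι → ℝ) → ℂ, (∀ i, ContDiff ℝ ∞ (G i)) ∧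
      ∀ z, F z - F z₀ = ∑ i, ((z i - z₀ i : ℝ) : ℂ) * G i z := by
  have hd : ∀ i, ContDiff ℝ ∞ fun q : (ι → ℝ) × ℝ =>
      fderiv ℝ F (z₀ + q.2 • (q.1 - z₀)) (Pi.single i 1) := fun i =>
    ((hF.fderiv_right (m := ∞) (by simp)).comp (by fun_prop)).clm_apply contDiff_const
  refine ⟨fun i z => ∫ t in (0 : ℝ)..1, fderiv ℝ F (z₀ + t • (z - z₀)) (Pi.single i 1),
    fun i => contDiff_infty.2 fun k => contDiff_parametric_integral k (hd i), fun z => ?_⟩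
  have h1 : ∀ t : ℝ, HasDerivAt (fun t : ℝ => F (z₀ + t • (z - z₀)))
      (∑ i, ((z i - z₀ i : ℝ) : ℂ) * fderiv ℝ F (z₀ + t • (z - z₀)) (Pi.single i 1)) t := by
    intro t
    have h2 : HasDerivAt (fun t : ℝ => z₀ + t • (z - z₀)) (z - z₀) t := by
      simpa using ((hasDerivAt_id t).smul_const (z - z₀)).const_add z₀
    have h3 := (hF.differentiable (by simp) (z₀ + t • (z - z₀))).hasFDerivAt.comp_hasDerivAt t h2
    refine h3.congr_deriv ?_
    have h4 : z - z₀ = ∑ i, (z i - z₀ i) • (Pi.single i 1 : ι → ℝ) := by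
      ext j; simp [Finset.sum_apply, Pi.single_apply]
    have h5 := congrArg (fderiv ℝ F (z₀ + t • (z - z₀))) h4
    rw [map_sum] at h5
    refine h5.trans (Finset.sum_congr rfl fun i _ => ?_)
    rw [map_smul, Complex.real_smul]
  have hc : ∀ i, Continuous fun t : ℝ =>
      fderiv ℝ F (z₀ + t • (z - z₀)) (Pi.single i 1) := fun i =>
    (hd i).continuous.comp (by fun_prop : Continuous fun t : ℝ => (z, t))
  have h5 := intervalIntegral.integral_eq_sub_of_hasDerivAt (fun t _ => h1 t)
    (Continuous.intervalIntegrable (a := 0) (b := 1)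
      (continuous_finsetSum _ fun i _ => continuous_const.mul (hc i)))
  simp only [one_smul, zero_smul, add_zero, add_sub_cancel] at h5
  rw [← h5, intervalIntegral.integral_finsetSum]
  · simp only [intervalIntegral.integral_const_mul]
  · exact fun i _ => (continuous_const.mul (hc i)).intervalIntegrable _ _

end Analysis

namespace CInf

open scoped ContDiff

variable {ι : Type} [Fintype ι] [DecidableEq ι] {V V' : Opens (ι → ℝ)}

theorem ext {f g : CInf V} (h : ∀ x, f.1 x = g.1 x) : f = g := Subtype.ext (funext h)

theorem differentiableAt (f : CInf V) (x : V) : DifferentiableAt ℝ (extendZero f.1) x :=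
  (f.2.contDiffAt (V.2.mem_nhds x.2)).differentiableAt (by simp)

theorem partialDeriv_apply (a : ι) (f : CInf V) (x : V) :
    (partialDeriv a f).1 x = fderiv ℝ (extendZero f.1) x (Pi.single a 1) := rfl

theorem extendZero_eventuallyEq {F : (ι → ℝ) → ℂ} {f : V → ℂ} (h : ∀ x : V, f x = F x) (x : V) :
    extendZero f =ᶠ[nhds (x : ι → ℝ)] F := by
  filter_upwards [V.2.mem_nhds x.2] with y hy
  rw [← h ⟨y, hy⟩]
  exact extendZero_apply f ⟨y, hy⟩

/-- Since V is open, a derivative at a point of V depends only on the germ, so any function agreeing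
with f on V may replace the extension by zero. -/
theorem partialDeriv_eq {F : (ι → ℝ) → ℂ} {f : CInf V} (h : ∀ x : V, f.1 x = F x) (a : ι) (x : V) :
    (partialDeriv a f).1 x = fderiv ℝ F x (Pi.single a 1) := by
  rw [partialDeriv_apply, (extendZero_eventuallyEq h x).fderiv_eq]

theorem isDer_partialDeriv (a : ι) : IsDer (partialDeriv a : CInf V → CInf V) where
  map_add f g := ext fun x => by
    rw [partialDeriv_eq (F := extendZero f.1 + extendZero g.1), fderiv_add]
    · rfl
    · exact CInf.differentiableAt f x
    · exact CInf.differentiableAt g x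
    · intro y
      rw [Pi.add_apply, extendZero_apply, extendZero_apply]; rfl
  map_mul f g := ext fun x => by
    rw [partialDeriv_eq (F := extendZero f.1 * extendZero g.1), fderiv_mul]
    · change extendZero f.1 x * _ + extendZero g.1 x * _ = _
      rw [extendZero_apply, extendZero_apply, add_comm, mul_comm (g.1 x)]; rfl
    · exact CInf.differentiableAt f x
    · exact CInf.differentiableAt g x
    · intro y
      rw [Pi.mul_apply, extendZero_apply, extendZero_apply]; rfl

theorem partialDeriv_smul (a : ι) (c : ℂ) (f : CInf V) :
    partialDeriv a (c • f) = c • partialDeriv a f := ext fun x => by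
  rw [partialDeriv_eq (F := c • extendZero f.1), fderiv_const_smul]
  · rfl
  · exact CInf.differentiableAt f x
  · intro y
    rw [Pi.smul_apply, extendZero_apply]; rfl

theorem partialDeriv_comm (a b : ι) (f : CInf V) :
    partialDeriv a (partialDeriv b f) = partialDeriv b (partialDeriv a f) := ext fun x => by
  have hf : ContDiffAt ℝ ∞ (extendZero f.1) x := f.2.contDiffAt (V.2.mem_nhds x.2)
  have h : ∀ a b : ι, (partialDeriv a (partialDeriv b f)).1 x
      = fderiv ℝ (fderiv ℝ (extendZero f.1)) x (Pi.single a 1) (Pi.single b 1) := fun a b => by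
    rw [partialDeriv_eq (F := fun y => fderiv ℝ (extendZero f.1) y (Pi.single b 1))
      fun y => rfl]
    have h1 : DifferentiableAt ℝ (fderiv ℝ (extendZero f.1)) x :=
      (hf.fderiv_right (m := ∞) (by simp)).differentiableAt (by simp)
    have := (h1.hasFDerivAt.clm_apply (hasFDerivAt_const (Pi.single b 1) (x : ι → ℝ))).fderiv
    rw [this]; simp
  rw [h, h]
  have := hf.isSymmSndFDerivAt (by
    rw [minSmoothness_of_isRCLikeNormedField]
    exact WithTop.coe_le_coe.2 (le_top : (2 : ℕ∞) ≤ ⊤))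
  exact this.eq _ _

theorem partialDeriv_coord (a b : ι) :
    partialDeriv a (coord V b) = if a = b then 1 else 0 := ext fun x => by
  rw [partialDeriv_eq (F := fun y => ((y b : ℝ) : ℂ)) fun y => rfl]
  have h : HasFDerivAt (fun y : ι → ℝ => ((y b : ℝ) : ℂ))
      (Complex.ofRealCLM.comp (ContinuousLinearMap.proj b)) (x : ι → ℝ) :=
    (Complex.ofRealCLM.comp (ContinuousLinearMap.proj (R := ℝ) (φ := fun _ : ι => ℝ) b)).hasFDerivAt
  rw [h.fderiv]
  by_cases hab : a = b
  · subst hab; simp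
  · simp [hab, Ne.symm hab]

/-- Restriction, as a ring homomorphism. -/
def resHom (h : V' ≤ V) : CInf V →+* CInf V' where
  toFun := res h
  map_zero' := rfl
  map_one' := rfl
  map_add' _ _ := rfl
  map_mul' _ _ := rfl

theorem partialDeriv_res (h : V' ≤ V) (a : ι) (f : CInf V) :
    partialDeriv a (res h f) = res h (partialDeriv a f) := ext fun x => by
  rw [partialDeriv_eq (F := extendZero f.1) fun y => (extendZero_apply f.1 ⟨y, h y.2⟩).symm]
  rfl

/-- Hadamard's lemma near a point of an open set, with a cut-off function. -/
theorem exists_mul_sub_eq_sum (f : CInf V) (z₀ : V) : ∃ (χ : CInf V) (g : ι → CInf V),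
    χ.1 z₀ = 1 ∧ χ * (f - algebraMap ℂ _ (f.1 z₀))
      = ∑ i, (coord V i - algebraMap ℂ _ ((z₀.1 i : ℝ) : ℂ)) * g i := by
  -- V need not be star-shaped about z₀ and the extension of f by zero need not be smooth. A bump
  -- function supported in V makes the product smooth on the whole space, where the global form of
  -- the lemma applies; only its value 1 at z₀ will matter.
  obtain ⟨χ, h1, -, h3, -, h5⟩ := exists_contDiff_tsupport_subset (n := ⊤) (V.2.mem_nhds z₀.2)
  have hF : ContDiff ℝ ∞ fun z => (χ z : ℂ) * (extendZero f.1 z - f.1 z₀) := by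
    refine contDiff_iff_contDiffAt.2 fun z => ?_
    by_cases hz : z ∈ tsupport χ
    · exact (Complex.ofRealCLM.contDiff.comp h3).contDiffAt.mul
        ((f.2.contDiffAt (V.2.mem_nhds (h1 hz))).sub contDiffAt_const)
    · have h6 : (fun z => (χ z : ℂ) * (extendZero f.1 z - f.1 z₀)) =ᶠ[nhds z] fun _ => 0 := by
        filter_upwards [(isClosed_tsupport χ).isOpen_compl.mem_nhds hz] with y hy
        rw [image_eq_zero_of_notMem_tsupport hy]; simp
      exact contDiffAt_const.congr_of_eventuallyEq h6
  obtain ⟨G, hG, hFG⟩ := exists_contDiff_eq_sum hF z₀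
  refine ⟨⟨fun x => χ x, mem_CInf_of_contDiffOn (F := fun x => (χ x : ℂ))
      (Complex.ofRealCLM.contDiff.comp h3).contDiffOn⟩,
    fun i => ⟨fun x => G i x, mem_CInf_of_contDiffOn (hG i).contDiffOn⟩, by simp [h5],
    ext fun x => ?_⟩
  have h7 := hFG x
  rw [extendZero_apply f.1 z₀, sub_self, mul_zero, sub_zero, extendZero_apply f.1 x] at h7
  have h8 : ∀ (s : Finset ι) (u : ι → CInf V), (∑ i ∈ s, u i).1 x = ∑ i ∈ s, (u i).1 x :=
    fun s u => by
      rw [← Finset.sum_apply]; exact congrFun (map_sum (CInf V).val u s) x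
  rw [h8]
  refine h7.trans (Finset.sum_congr rfl fun i _ => ?_)
  rw [Complex.ofReal_sub]
  rfl

end CInf

section Pullback

variable {n m : ℕ} {V V' : Opens (Fin n → ℝ)}

/-- The pull-back along `(x, dξ) ↦ x`, as a ring homomorphism. -/
def pullbackHom (V : Opens (Fin n → ℝ)) (m : ℕ) : CInf V →+* CInf (tangentDomain V m) where
  toFun := pullback
  map_zero' := rfl
  map_one' := rfl
  map_add' _ _ := rfl
  map_mul' _ _ := rfl

theorem partialDeriv_pullback (f : CInf V) (i : Fin n ⊕ Fin m) (z : tangentDomain V m) :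
    (CInf.partialDeriv i (pullback f)).1 z
      = fderiv ℝ (extendZero f.1) (fun a => z.1 (Sum.inl a))
          (fun a => (Pi.single i 1 : Fin n ⊕ Fin m → ℝ) (Sum.inl a)) := by
  let π : (Fin n ⊕ Fin m → ℝ) →L[ℝ] (Fin n → ℝ) :=
    ContinuousLinearMap.pi fun a => ContinuousLinearMap.proj (Sum.inl a)
  rw [CInf.partialDeriv_eq (F := fun z => extendZero f.1 (π z))]
  · have h := (CInf.differentiableAt f ⟨fun a => z.1 (Sum.inl a), z.2⟩).hasFDerivAt.comp z.1
      π.hasFDerivAt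
    exact congrArg (fun L => L (Pi.single i 1)) h.fderiv
  · exact fun y => (extendZero_apply f.1 ⟨fun a => y.1 (Sum.inl a), y.2⟩).symm

theorem partialDeriv_inl_pullback (a : Fin n) (f : CInf V) :
    CInf.partialDeriv (Sum.inl a) (pullback (m := m) f) = pullback (CInf.partialDeriv a f) :=
  CInf.ext fun z => by
    rw [partialDeriv_pullback]
    change _ = fderiv ℝ (extendZero f.1) _ _
    congr 1
    ext b
    simp [Pi.single_apply]

theorem partialDeriv_inr_pullback (μ : Fin m) (f : CInf V) :
    CInf.partialDeriv (Sum.inr μ) (pullback f) = 0 :=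
  CInf.ext fun z => by
    rw [partialDeriv_pullback]
    have : (fun a : Fin n => (Pi.single (Sum.inr μ) 1 : Fin n ⊕ Fin m → ℝ) (Sum.inl a)) = 0 := by
      ext b; simp
    rw [this, map_zero]; rfl

theorem res_pullback (h : V' ≤ V) (f : CInf V) :
    CInf.res (tangentDomain_mono (m := m) h) (pullback f) = pullback (CInf.res h f) := rfl

end Pullback

end HigherKoszul

/-! ### Functions inside forms, and the de Rham differential as an odd derivation. -/

namespace HigherKoszul

theorem eq_zero_of_add_self {M : Type*} [AddCommGroup M] [Module ℂ M] {x : M} (h : x + x = 0) :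
    x = 0 := by
  rw [← two_smul ℂ x] at h
  exact (smul_eq_zero_iff_right (two_ne_zero (α := ℂ))).1 h

/-- The inclusion of the first group of odd variables. -/
def lexInl (α β : Type) [LinearOrder α] [LinearOrder β] : α ↪o α ⊕ₗ β where
  toFun a := toLex (Sum.inl a)
  inj' _ _ h := Sum.inl_injective (toLex.injective h)
  map_rel_iff' := Sum.Lex.inl_le_inl_iff

/-- The inclusion of the second group of odd variables. -/
def lexInr (α β : Type) [LinearOrder α] [LinearOrder β] : β ↪o α ⊕ₗ β where
  toFun a := toLex (Sum.inr a)
  inj' _ _ h := Sum.inr_injective (toLex.injective h)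
  map_rel_iff' := Sum.Lex.inr_le_inr_iff

theorem lex_cases {α β : Type} (x : α ⊕ₗ β) :
    (∃ a, x = toLex (Sum.inl a)) ∨ ∃ b, x = toLex (Sum.inr b) := by
  rcases h : ofLex x with a | b
  · exact Or.inl ⟨a, by rw [← h]; rfl⟩
  · exact Or.inr ⟨b, by rw [← h]; rfl⟩

theorem sum_lex {α β M : Type*} [Fintype α] [Fintype β] [AddCommMonoid M] (f : α ⊕ₗ β → M) :
    ∑ x, f x = ∑ a, f (toLex (Sum.inl a)) + ∑ b, f (toLex (Sum.inr b)) := by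
  rw [← Fintype.sum_sum_type (fun x => f (toLex x))]
  exact (Equiv.sum_comp toLex f).symm

namespace Grass

variable {ο : Type} [LinearOrder ο] [DecidableEq ο] [Fintype ο] {A : Type u} [CommRing A]

namespace IsSuperDer

variable {p q : ZMod 2} {D D' : Grass ο A → Grass ο A}

theorem left_mul (h : IsSuperDer p D) {g : Grass ο A} (hg : HasParity q g) :
    IsSuperDer (q + p) fun f => g * D f where
  map_add f f' := by rw [h.map_add, mul_add]
  map_mul f f' := by
    rw [h.map_mul, mul_add, ← mul_assoc, ← mul_assoc, hg.mul_comm (f.twist p), ← twist_add_parity,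
      mul_assoc (f.twist _)]
  map_inv f := by
    rw [h.map_inv, Grass.inv_mul, hg.inv_eq, sgn_add]
    rw [smul_mul_assoc, smul_smul, mul_smul_comm, mul_right_comm, sgn_mul_self, one_mul]

theorem add (h : IsSuperDer p D) (h' : IsSuperDer p D') :
    IsSuperDer p fun f => D f + D' f where
  map_add f f' := by rw [h.map_add, h'.map_add]; abel
  map_mul f f' := by rw [h.map_mul, h'.map_mul, add_mul, mul_add]; abel
  map_inv f := by rw [h.map_inv, h'.map_inv, Grass.inv_add, smul_add]

theorem zero (p : ZMod 2) : IsSuperDer p fun _ : Grass ο A => (0 : Grass ο A) where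
  map_add f f' := by rw [add_zero]
  map_mul f f' := by rw [zero_mul, mul_zero, add_zero]
  map_inv f := by simp

theorem sum {ι : Type*} (s : Finset ι) {D : ι → Grass ο A → Grass ο A}
    (h : ∀ i, IsSuperDer p (D i)) : IsSuperDer p fun f => ∑ i ∈ s, D i f := by
  classical
  induction s using Finset.induction_on with
  | empty => simpa using zero p
  | insert i s hi ih => simpa only [Finset.sum_insert hi] using (h i).add ih

end IsSuperDer

theorem mul_const_apply (f : Grass ο A) (c : A) (S : Finset ο) :
    (f * (const c : Grass ο A)) S = f S * c := by
  rw [← twist_zero (f), ← (hasParity_const c).mul_comm f, const_mul_apply, twist_zero, mul_comm]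

theorem const_add (a b : A) : (const (a + b) : Grass ο A) = const a + const b := mono_add _ _ _

theorem const_sub (a b : A) : (const (a - b) : Grass ο A) = const a - const b := by
  rw [sub_eq_add_neg, const_add, sub_eq_add_neg]; exact congrArg _ (mono_neg _ _)

theorem const_mul_const (a b : A) : (const a * const b : Grass ο A) = const (a * b) :=
  const_mul_mono _ _ _

theorem const_one : (const 1 : Grass ο A) = 1 := rfl

theorem const_zero : (const 0 : Grass ο A) = 0 := mono_zero _

theorem const_sum {ι : Type*} (s : Finset ι) (f : ι → A) :
    (const (∑ i ∈ s, f i) : Grass ο A) = ∑ i ∈ s, const (f i) :=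
  map_sum (AddMonoidHom.mk' (const : A → Grass ο A) const_add) f s

theorem const_algebraMap {A : Type u} [CommRing A] [Algebra ℂ A] (c : ℂ) :
    (const (algebraMap ℂ A c) : Grass ο A) = c • 1 := by
  ext S
  rw [smul_apply, ← const_one, const, const]
  split_ifs
  · rw [Algebra.algebraMap_eq_smul_one]
  · simp

theorem gen_mul_gen (o o' : ο) : (gen o * gen o' : Grass ο A) = -(gen o' * gen o) := by
  have := (hasParity_gen (A := A) o).mul_comm (gen o')
  rw [this, twist_one, inv_gen, neg_mul]

end Grass

section Forms

variable {n m : ℕ} {V V' : Opens (Fin n → ℝ)}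

open Grass

/-- The inclusion of functions into forms, as a ring homomorphism. -/
def toFormHom (V : Opens (Fin n → ℝ)) (m : ℕ) : SFun V m →+* Form V m :=
  embedHom (lexInl (Fin m) (Fin n)) (pullbackHom V m)

theorem toFormHom_apply (f : SFun V m) : toFormHom V m f = f.toForm := rfl

theorem toForm_mul (f g : SFun V m) : (f * g).toForm = f.toForm * g.toForm :=
  map_mul (toFormHom V m) f g

theorem toForm_add (f g : SFun V m) : SFun.toForm (f + g) = f.toForm + g.toForm :=
  map_add (toFormHom V m) f g

theorem toForm_zero : SFun.toForm (0 : SFun V m) = 0 := map_zero (toFormHom V m)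

theorem toForm_zsmul (k : ℤ) (f : SFun V m) : SFun.toForm (k • f) = k • f.toForm :=
  map_zsmul (toFormHom V m) k f

theorem toForm_inv (f : SFun V m) : SFun.toForm f.inv = f.toForm.inv :=
  embed_inv (lexInl (Fin m) (Fin n)).toEmbedding (pullbackHom V m) f

theorem toForm_const (f : CInf V) : SFun.toForm (m := m) (const f) = const (pullback f) :=
  embed_const (lexInl (Fin m) (Fin n)).toEmbedding (pullbackHom V m) f

theorem toForm_gen (μ : Fin m) : SFun.toForm (V := V) (gen μ) = gen (toLex (Sum.inl μ)) :=
  embed_gen (lexInl (Fin m) (Fin n)).toEmbedding (pullbackHom V m) μ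

theorem HasParity_toForm {p : ZMod 2} {f : SFun V m} (hf : HasParity p f) :
    HasParity p f.toForm :=
  hasParity_of_inv_eq (by rw [← toForm_inv, hf.inv_eq, toForm_zsmul])

theorem isSuperDer_dX (a : Fin n) : IsSuperDer 0 (Form.dX a : Form V m → Form V m) :=
  isSuperDer_mapCoeff (CInf.isDer_partialDeriv _)

theorem isSuperDer_dXi (μ : Fin m) : IsSuperDer 1 (Form.dXi μ : Form V m → Form V m) :=
  isSuperDer_oddDeriv _

theorem isSuperDer_deRham : IsSuperDer 1 (deRham : Form V m → Form V m) :=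
  (IsSuperDer.sum _ fun a => by
      simpa using! (isSuperDer_dX (V := V) (m := m) a).left_mul (hasParity_gen (toLex (Sum.inr a)))).add
    (IsSuperDer.sum _ fun μ => by
      simpa using! (isSuperDer_dXi (V := V) (m := m) μ).left_mul
        (hasParity_const (CInf.coord _ (Sum.inr μ))))

theorem dX_toForm (a : Fin n) (f : SFun V m) :
    f.toForm.dX a = SFun.toForm (f.mapCoeff (CInf.partialDeriv a)) :=
  mapCoeff_embed (lexInl (Fin m) (Fin n)).toEmbedding _ _ _ _ (CInf.isDer_partialDeriv _).map_zero
    (partialDeriv_inl_pullback a) f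

theorem dXi_toForm (μ : Fin m) (f : SFun V m) : f.toForm.dXi μ = SFun.toForm (f.oddDeriv μ) :=
  (embed_oddDeriv (lexInl (Fin m) (Fin n)) (pullbackHom V m) μ f).symm

theorem mapCoeff_inr_toForm (μ : Fin m) (f : SFun V m) :
    f.toForm.mapCoeff (CInf.partialDeriv (Sum.inr μ)) = 0 :=
  mapCoeff_embed_eq_zero (lexInl (Fin m) (Fin n)).toEmbedding _ _
    (CInf.isDer_partialDeriv _).map_zero (partialDeriv_inr_pullback μ) f

theorem oddDeriv_inr_toForm (a : Fin n) (f : SFun V m) :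
    f.toForm.oddDeriv (toLex (Sum.inr a)) = 0 :=
  oddDeriv_embed_of_notMem _ _ (by rintro ⟨μ, h⟩; simp at h) f

theorem deRham_toForm (f : SFun V m) :
    deRham f.toForm = ∑ a, Form.dx V m a * SFun.toForm (f.mapCoeff (CInf.partialDeriv a))
      + ∑ μ, Form.dxi V m μ * SFun.toForm (f.oddDeriv μ) := by
  simp only [deRham, dX_toForm, dXi_toForm]

theorem dX_const (a : Fin n) (c : CInf (tangentDomain V m)) :
    Form.dX a (const c : Form V m) = const (CInf.partialDeriv (Sum.inl a) c) :=
  mapCoeff_const (CInf.isDer_partialDeriv _).map_zero c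

theorem dXi_const (μ : Fin m) (c : CInf (tangentDomain V m)) :
    Form.dXi μ (const c : Form V m) = 0 := oddDeriv_const _ _

theorem dX_gen (a : Fin n) (o : Fin m ⊕ₗ Fin n) : Form.dX a (gen o : Form V m) = 0 :=
  mapCoeff_gen (CInf.isDer_partialDeriv _) o

theorem dXi_gen (μ : Fin m) (o : Fin m ⊕ₗ Fin n) :
    Form.dXi μ (gen o : Form V m) = if toLex (Sum.inl μ) = o then 1 else 0 := oddDeriv_gen _ _

theorem dX_dxi (a : Fin n) (μ : Fin m) : (Form.dxi V m μ).dX a = 0 := by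
  rw [Form.dxi, dX_const, CInf.partialDeriv_coord]; simp [const_zero]

theorem dXi_dxi (ν μ : Fin m) : (Form.dxi V m μ).dXi ν = 0 := dXi_const _ _

theorem dX_dx (a b : Fin n) : (Form.dx V m b).dX a = 0 := dX_gen _ _

theorem dXi_dx (μ : Fin m) (b : Fin n) : (Form.dx V m b).dXi μ = 0 := by
  rw [Form.dx, dXi_gen]; simp

theorem deRham_dx (b : Fin n) : deRham (Form.dx V m b) = 0 := by
  simp [deRham, dX_dx, dXi_dx]

theorem deRham_dxi (μ : Fin m) : deRham (Form.dxi V m μ) = 0 := by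
  simp [deRham, dX_dxi, dXi_dxi]

theorem deRham_const (c : CInf (tangentDomain V m)) : deRham (const c : Form V m)
    = ∑ a, Form.dx V m a * const (CInf.partialDeriv (Sum.inl a) c) := by
  simp [deRham, dX_const, dXi_const]

theorem deRham_gen_inl (μ : Fin m) :
    deRham (gen (toLex (Sum.inl μ)) : Form V m) = Form.dxi V m μ := by
  simp [deRham, dX_gen, dXi_gen]

/-- On coefficient functions the symmetric second derivatives are contracted with anticommuting
dx^a, and d annihilates dx^a and dξ^μ. In d² of a product the cross terms cancel, so the claim
passes from generators to all forms. -/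
theorem deRham_deRham (ω : Form V m) : deRham (deRham ω) = 0 := by
  have hd := isSuperDer_deRham (V := V) (m := m)
  induction ω using generator_induction with
  | add f g hf hg => rw [hd.map_add, hd.map_add, hf, hg, add_zero]
  | const c =>
    rw [deRham_const, hd.map_sum]
    simp only [hd.map_mul, deRham_dx, zero_mul, zero_add, deRham_const, Finset.mul_sum, twist_one]
    -- The double sum is added to itself with the two indices exchanged; the terms then cancel
    -- pairwise.
    refine eq_zero_of_add_self ?_
    nth_rw 2 [Finset.sum_comm]
    rw [← Finset.sum_add_distrib]
    refine Finset.sum_eq_zero fun a _ => ?_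
    rw [← Finset.sum_add_distrib]
    refine Finset.sum_eq_zero fun b _ => ?_
    rw [← mul_assoc, ← mul_assoc, CInf.partialDeriv_comm (Sum.inl a), ← add_mul]
    simp only [Form.dx, inv_gen, ring_neg_mul]
    rw [gen_mul_gen (toLex (Sum.inr a)), _root_.neg_neg, add_neg_cancel, zero_mul]
  | gen_mul o f hf =>
    have h0 : deRham (deRham (gen o : Form V m)) = 0 := by
      rcases lex_cases o with ⟨μ, rfl⟩ | ⟨a, rfl⟩
      · rw [deRham_gen_inl, deRham_dxi]
      · rw [← Form.dx, deRham_dx, hd.map_zero]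
    rw [hd.map_mul, hd.map_add, hd.map_mul, hd.map_mul, h0, hf, twist_one, twist_one, hd.map_inv, sgn_one, neg_smul,
      one_smul, ring_neg_mul]
    simp

theorem hasParity_deRham {p : ZMod 2} {ω : Form V m} (h : HasParity p ω) :
    HasParity (p + 1) (deRham ω) := by
  rw [add_comm]; exact isSuperDer_deRham.hasParity h

theorem deRham_smul (c : ℂ) (ω : Form V m) : deRham (c • ω) = c • deRham ω := by
  have h1 : ∀ a, Form.dX a (c • ω) = c • ω.dX a := fun a => by
    refine Grass.ext (ο := Fin m ⊕ₗ Fin n) fun S => ?_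
    exact CInf.partialDeriv_smul _ c _
  have h2 : ∀ μ, Form.dXi μ (c • ω) = c • ω.dXi μ := fun μ => oddDeriv_smul _ c ω
  simp only [deRham, h1, h2, mul_smul_comm, Finset.smul_sum, smul_add]

theorem toForm_coord (a : Fin n) : SFun.toForm (m := m) (const (CInf.coord V a))
    = const (CInf.coord _ (Sum.inl a)) := toForm_const _

theorem deRham_toForm_coord (a : Fin n) :
    deRham (SFun.toForm (m := m) (const (CInf.coord V a))) = Form.dx V m a := by
  rw [toForm_coord, deRham_const, Finset.sum_eq_single a]
  · rw [CInf.partialDeriv_coord, if_pos rfl, const_one, mul_one]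
  · intro b _ hb
    rw [CInf.partialDeriv_coord, if_neg (by simpa using hb), const_zero, mul_zero]
  · simp

theorem deRham_toForm_gen (μ : Fin m) :
    deRham (SFun.toForm (V := V) (gen μ)) = Form.dxi V m μ := by
  rw [toForm_gen, deRham_gen_inl]

end Forms

end HigherKoszul

/-! ### Multiderivations are determined by their values on coordinates; uniqueness of the brackets.
-/

namespace HigherKoszul

open Grass

section Coordinates

variable {ε ο : Type} [Fintype ε] [DecidableEq ε] [Fintype ο] [LinearOrder ο] [DecidableEq ο]
  {W : Opens (ε → ℝ)}

/-- The coordinate functions, even or odd. -/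
def IsCoordinate (ω : Grass ο (CInf W)) : Prop :=
  (∃ i, ω = const (CInf.coord W i)) ∨ ∃ o, ω = gen o

theorem IsCoordinate.exists_hasParity {ω : Grass ο (CInf W)} (h : IsCoordinate ω) :
    ∃ p, HasParity p ω := by
  rcases h with ⟨i, rfl⟩ | ⟨o, rfl⟩
  · exact ⟨0, hasParity_const _⟩
  · exact ⟨1, hasParity_gen _⟩

/-- A derivation, up to signs, of the algebra of functions that kills the coordinates is zero. -/
theorem derivation_eq_zero {D : Grass ο (CInf W) → Grass ο (CInf W)}
    (map_add : ∀ f g, D (f + g) = D f + D g) (map_smul : ∀ (c : ℂ) f, D (c • f) = c • D f)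
    (s : ZMod 2) (leibniz : ∀ p f g, HasParity p f → D (f * g) = D f * g + sgn (p * s) • (f * D g))
    (coord : ∀ z, IsCoordinate z → D z = 0) (f : Grass ο (CInf W)) : D f = 0 := by
  have h1 : D 1 = 0 := by
    have := leibniz 0 1 1 hasParity_one
    simpa using this
  have h0 : D 0 = 0 := by simpa using map_smul 0 0
  have hsum : ∀ (u : ε → Grass ο (CInf W)), D (∑ i, u i) = ∑ i, D (u i) := fun u =>
    map_sum (AddMonoidHom.mk' D map_add) u _
  have halg : ∀ (c : CInf W) (z : ℂ), D (const (c - algebraMap ℂ _ z)) = D (const c) := by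
    intro c z
    have h2 : (const (c - algebraMap ℂ _ z) : Grass ο (CInf W)) = const c + (-z) • 1 := by
      rw [const_sub, const_algebraMap, neg_smul, sub_eq_add_neg]
    rw [h2, map_add, map_smul, h1, smul_zero, add_zero]
  have hconst : ∀ a b : CInf W, D (const a * const b) = D (const a) * const b
      + const a * D (const b) := fun a b => by
    rw [leibniz 0 _ _ (hasParity_const a), zero_mul, sgn_zero, one_smul]
  induction f using generator_induction with
  | add f g hf hg => rw [map_add, hf, hg, add_zero]
  | const c =>
    -- The derivation is applied to χ (c - c(z₀)) = ∑ (z^i - z₀^i) g_i and the result is evaluated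
    -- at z₀. On the right the coordinates are killed, and the remaining factors z^i - z₀^i vanish
    -- at z₀. On the left the term with the derivative of χ vanishes because c - c(z₀) does, and
    -- χ(z₀) = 1 leaves the value of the derivation on c.
    refine Grass.ext fun S => CInf.ext fun z₀ => ?_
    obtain ⟨χ, g, hχ, hg⟩ := CInf.exists_mul_sub_eq_sum c z₀
    have h2 := congrArg (fun c => D (const c)) hg
    simp only [← const_mul_const, const_sum, hsum, hconst, halg] at h2
    have h3 : ∀ i, D (const (CInf.coord W i)) = 0 := fun i => coord _ (Or.inl ⟨i, rfl⟩)
    simp only [h3, zero_mul, zero_add] at h2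
    have h4 := congrArg (fun f : CInf W => f.1 z₀) (congrFun h2 S)
    simp only [Grass.add_apply, mul_const_apply, const_mul_apply, Grass.sum_apply] at h4
    have h5 : ∀ u : ε → CInf W, (∑ i, u i).1 z₀ = ∑ i, (u i).1 z₀ := fun u => by
      rw [← Finset.sum_apply]; exact congrFun (map_sum (CInf W).val u _) z₀
    rw [h5] at h4
    have h6 : ∀ i, ((CInf.coord W i - algebraMap ℂ _ ((z₀.1 i : ℝ) : ℂ))
        * D (const (g i)) S).1 z₀ = 0 := fun i => by
      change (((z₀.1 i : ℝ) : ℂ) - ((z₀.1 i : ℝ) : ℂ)) * _ = 0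
      rw [sub_self, zero_mul]
    simp only [h6, Finset.sum_const_zero] at h4
    change (D (const χ) S).1 z₀ * (c.1 z₀ - c.1 z₀) + χ.1 z₀ * (D (const c) S).1 z₀ = 0 at h4
    rw [hχ, sub_self, mul_zero, zero_add, one_mul] at h4
    exact h4
  | gen_mul o f hf =>
    rw [leibniz 1 _ _ (hasParity_gen o), coord _ (Or.inr ⟨o, rfl⟩), hf, zero_mul, mul_zero,
      smul_zero, add_zero]

theorem sgn_smul_eq_zero_iff {M : Type*} [AddCommGroup M] (p : ZMod 2) (x : M) :
    sgn p • x = 0 ↔ x = 0 := by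
  refine ⟨fun h => ?_, fun h => by rw [h, smul_zero]⟩
  have := congrArg (sgn p • ·) h
  simpa only [smul_smul, sgn_mul_self, one_smul, smul_zero] using this

variable {A : Type} [CommRing A] [Algebra ℂ A]

/-- Sequences of multilinear symmetric operations satisfying the Leibniz rule in each argument. -/
structure IsMultiderivation (E : List (Grass ο A) → Grass ο A) : Prop where
  map_add : ∀ l₁ ω ω' l₂, E (l₁ ++ (ω + ω') :: l₂) = E (l₁ ++ ω :: l₂) + E (l₁ ++ ω' :: l₂)
  map_smul : ∀ l₁ (c : ℂ) ω l₂, E (l₁ ++ (c • ω) :: l₂) = c • E (l₁ ++ ω :: l₂)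
  symm : ∀ l₁ ω ω' l₂ p p', HasParity p ω → HasParity p' ω' →
    E (l₁ ++ ω :: ω' :: l₂) = sgn (p * p') • E (l₁ ++ ω' :: ω :: l₂)
  leibniz : ∀ l ps ω p ω', HasParities l ps → HasParity p ω →
    E (l ++ [ω * ω']) = E (l ++ [ω]) * ω' + sgn (p * (1 + ps.sum)) • (ω * E (l ++ [ω']))

theorem hasParities_iff_exists {l : List (Grass ο A)} :
    (∃ ps, HasParities l ps) ↔ ∀ ω ∈ l, ∃ p, HasParity p ω := by
  induction l with
  | nil => exact ⟨fun _ => by simp, fun _ => ⟨[], List.Forall₂.nil⟩⟩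
  | cons ω l ih =>
    rw [List.forall_mem_cons, ← ih]
    constructor
    · rintro ⟨_, h⟩
      cases h with
      | cons h1 h2 => exact ⟨⟨_, h1⟩, ⟨_, h2⟩⟩
    · rintro ⟨⟨p, h1⟩, ⟨ps, h2⟩⟩
      exact ⟨p :: ps, List.Forall₂.cons h1 h2⟩

namespace IsMultiderivation

variable {E E' : List (Grass ο A) → Grass ο A}

theorem sub (h : IsMultiderivation E) (h' : IsMultiderivation E') :
    IsMultiderivation fun l => E l - E' l where
  map_add l₁ ω ω' l₂ := by rw [h.map_add, h'.map_add]; abel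
  map_smul l₁ c ω l₂ := by rw [h.map_smul, h'.map_smul, smul_sub]
  symm l₁ ω ω' l₂ p p' hp hp' := by
    rw [h.symm l₁ ω ω' l₂ p p' hp hp', h'.symm l₁ ω ω' l₂ p p' hp hp', smul_sub]
  leibniz l ps ω p ω' hl hp := by
    rw [h.leibniz l ps ω p ω' hl hp, h'.leibniz l ps ω p ω' hl hp, sub_mul, mul_sub, smul_sub]
    abel

/-- Whether the operation vanishes does not depend on the position of a homogeneous argument. -/
theorem move_eq_zero_iff (h : IsMultiderivation E) {ω : Grass ο A} (hω : ∃ p, HasParity p ω)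
    (l₁ l₂ l₃ : List (Grass ο A)) (hl : ∀ η ∈ l₂, ∃ p, HasParity p η) :
    E (l₁ ++ ω :: (l₂ ++ l₃)) = 0 ↔ E (l₁ ++ l₂ ++ ω :: l₃) = 0 := by
  induction l₂ generalizing l₁ with
  | nil => simp
  | cons η l₂ ih =>
    obtain ⟨p, hp⟩ := hω
    obtain ⟨q, hq⟩ := hl η (by simp)
    have h1 := ih (l₁ ++ [η]) fun ζ hζ => hl ζ (by simp [hζ])
    rw [List.cons_append, h.symm l₁ ω η _ p q hp hq, sgn_smul_eq_zero_iff]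
    simpa using h1

/-- Operations vanishing on homogeneous arguments vanish. -/
theorem eq_zero_of_homogeneous (h : IsMultiderivation E)
    (h0 : ∀ l : List (Grass ο A), (∀ ω ∈ l, ∃ p, HasParity p ω) → E l = 0)
    (l : List (Grass ο A)) : E l = 0 := by
  suffices H : ∀ l₂ l₁ : List (Grass ο A), (∀ ω ∈ l₁, ∃ p, HasParity p ω) → E (l₁ ++ l₂) = 0 from
    H l [] (by simp)
  intro l₂
  induction l₂ with
  | nil => intro l₁ h1; rw [List.append_nil]; exact h0 l₁ h1
  | cons ω l₂ ih =>
    intro l₁ h1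
    have key : ∀ p, E (l₁ ++ ω.part p :: l₂) = 0 := fun p => by
      have := ih (l₁ ++ [ω.part p]) fun η hη => by
        rcases List.mem_append.1 hη with h2 | h2
        · exact h1 η h2
        · rw [List.mem_singleton.1 h2]; exact ⟨p, hasParity_part p ω⟩
      simpa using this
    rw [← part_add_part ω, h.map_add, key, key, add_zero]

/-- Arguments are replaced by coordinates one at a time. The argument in question is moved to the
last place, where the Leibniz rule is available, and the operation is a derivation there; by
`derivation_eq_zero` it suffices to insert coordinates, which are then moved back to join those
already treated. -/
theorem eq_zero_of_coordinates {E : List (Grass ο (CInf W)) → Grass ο (CInf W)}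
    (h : IsMultiderivation E) (h0 : ∀ l, (∀ ω ∈ l, IsCoordinate ω) → E l = 0)
    (l : List (Grass ο (CInf W))) : E l = 0 := by
  refine h.eq_zero_of_homogeneous (fun l hl => ?_) l
  suffices H : ∀ l₂ l₁ : List (Grass ο (CInf W)), (∀ ω ∈ l₂, ∃ p, HasParity p ω) →
      (∀ ω ∈ l₁, IsCoordinate ω) → E (l₁ ++ l₂) = 0 from
    H l [] hl (by simp)
  intro l₂
  induction l₂ with
  | nil => intro l₁ _ h1; rw [List.append_nil]; exact h0 l₁ h1
  | cons ω l₂ ih =>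
    intro l₁ h2 h1
    have h3 : ∀ ω ∈ l₂, ∃ p, HasParity p ω := fun η hη => h2 η (by simp [hη])
    have h4 : ∀ ω ∈ l₁ ++ l₂, ∃ p, HasParity p ω := fun η hη => by
      rcases List.mem_append.1 hη with h' | h'
      · exact (h1 η h').exists_hasParity
      · exact h3 η h'
    obtain ⟨ps, hps⟩ := hasParities_iff_exists.2 h4
    have h5 := h.move_eq_zero_iff (h2 ω (by simp)) l₁ l₂ [] h3
    rw [List.append_nil] at h5
    refine h5.2 ?_
    refine derivation_eq_zero (D := fun ω => E (l₁ ++ l₂ ++ [ω])) (fun f g => h.map_add _ _ _ _)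
      (fun c f => h.map_smul _ _ _ _) (1 + ps.sum) (fun p f g hp => h.leibniz _ ps _ p _ hps hp)
      (fun z hz => ?_) ω
    have h6 := h.move_eq_zero_iff hz.exists_hasParity l₁ l₂ [] h3
    refine h6.1 ?_
    have h7 := ih (l₁ ++ [z]) h3 fun η hη => by
      rcases List.mem_append.1 hη with h' | h'
      · exact h1 η h'
      · rw [List.mem_singleton.1 h']; exact hz
    simpa using h7

/-- Operations vanish if they vanish on lists of elements of two kinds that contain at most one
element of the first kind, the latter placed first, and on lists starting with two such elements. -/
theorem eq_zero_of_two_kinds (h : IsMultiderivation E) {F D : Grass ο A → Prop}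
    (hF : ∀ ω, F ω → ∃ p, HasParity p ω) (hD : ∀ ω, D ω → ∃ p, HasParity p ω)
    (h0 : ∀ l, (∀ ω ∈ l, D ω) → E l = 0) (h1 : ∀ ω l, F ω → (∀ ω ∈ l, D ω) → E (ω :: l) = 0)
    (h2 : ∀ ω ω' l, F ω → F ω' → (∀ ω ∈ l, F ω ∨ D ω) → E (ω :: ω' :: l) = 0)
    (l : List (Grass ο A)) (hl : ∀ ω ∈ l, F ω ∨ D ω) : E l = 0 := by
  have hFD : ∀ ω, F ω ∨ D ω → ∃ p, HasParity p ω := fun ω hω => hω.elim (hF ω) (hD ω)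
  have split : ∀ l : List (Grass ο A), (∀ ω ∈ l, F ω ∨ D ω) → (∀ ω ∈ l, D ω) ∨
      ∃ l₁ ω l₂, l = l₁ ++ ω :: l₂ ∧ F ω := fun l hl => by
    by_cases hd : ∀ ω ∈ l, D ω
    · exact Or.inl hd
    · push Not at hd
      obtain ⟨ω, hω, hd⟩ := hd
      obtain ⟨l₁, l₂, rfl⟩ := List.append_of_mem hω
      exact Or.inr ⟨l₁, ω, l₂, rfl, (hl ω hω).resolve_right hd⟩
  rcases split l hl with hd | ⟨l₁, ω, l₂, rfl, hω⟩
  · exact h0 l hd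
  · have hl' : ∀ η ∈ l₁ ++ l₂, F η ∨ D η := fun η hη => hl η (by
      rcases List.mem_append.1 hη with h' | h' <;> simp [h'])
    have h3 := h.move_eq_zero_iff (hF ω hω) [] l₁ l₂ fun η hη => hFD η (hl' η (by simp [hη]))
    refine h3.1 ?_
    rw [List.nil_append]
    rcases split (l₁ ++ l₂) hl' with hd | ⟨l₃, ω', l₄, h4, hω'⟩
    · exact h1 ω _ hω hd
    · rw [h4] at hl' ⊢
      have h5 := h.move_eq_zero_iff (hF ω' hω') [ω] l₃ l₄ fun η hη => hFD η (hl' η (by simp [hη]))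
      exact h5.1 (h2 ω ω' _ hω hω' fun η hη => hl' η (by
        rcases List.mem_append.1 hη with h' | h' <;> simp [h']))

end IsMultiderivation

end Coordinates

section Uniqueness

variable {n m : ℕ} {V : Opens (Fin n → ℝ)} {P : Mult V m} {B B' : List (Form V m) → Form V m}

theorem IsKoszulBrackets.isMultiderivation (h : IsKoszulBrackets P B) : IsMultiderivation B where
  map_add := h.map_add
  map_smul := h.map_smul
  symm := h.symm
  leibniz := h.leibniz

/-- The higher Koszul brackets are determined by the multivector field. -/
theorem IsKoszulBrackets.unique (h : IsKoszulBrackets P B) (h' : IsKoszulBrackets P B') :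
    B = B' := by
  funext l
  have hE := h.isMultiderivation.sub h'.isMultiderivation
  refine sub_eq_zero.1 (hE.eq_zero_of_coordinates (fun l hl => ?_) l)
  -- The coordinates x and ξ are functions, while dx and dξ are differentials of functions. The two
  -- kinds are taken homogeneous, as the conditions with signs require.
  refine hE.eq_zero_of_two_kinds
    (F := fun ω => ∃ (f : SFun V m) (p : ZMod 2), HasParity p f ∧ ω = f.toForm)
    (D := fun ω => ∃ (f : SFun V m) (p : ZMod 2), HasParity p f ∧ ω = deRham f.toForm)
    ?_ ?_ ?_ ?_ ?_ l ?_
  · rintro _ ⟨f, p, hp, rfl⟩; exact ⟨p, HasParity_toForm hp⟩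
  · rintro _ ⟨f, p, hp, rfl⟩; exact ⟨p + 1, hasParity_deRham (HasParity_toForm hp)⟩
  all_goals
    have hd : ∀ l : List (Form V m), (∀ ω ∈ l, ∃ (f : SFun V m) (p : ZMod 2), HasParity p f ∧
        ω = deRham f.toForm) → ∃ (fs : List (SFun V m)) (ps : List (ZMod 2)), HasParities fs ps ∧
        l = fs.map (fun g => deRham g.toForm) := by
      intro l hl
      induction l with
      | nil => exact ⟨[], [], List.Forall₂.nil, rfl⟩
      | cons ω l ih =>
        obtain ⟨f, p, hp, rfl⟩ := hl ω (by simp)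
        obtain ⟨fs, ps, hps, rfl⟩ := ih fun η hη => hl η (by simp [hη])
        exact ⟨f :: fs, p :: ps, List.Forall₂.cons hp hps, rfl⟩
  · intro l hl
    obtain ⟨fs, ps, hps, rfl⟩ := hd l hl
    rw [h.diff_diff fs ps hps, h'.diff_diff fs ps hps, sub_self]
  · rintro _ l ⟨f, p, hp, rfl⟩ hl
    obtain ⟨fs, ps, hps, rfl⟩ := hd l hl
    rw [h.fun_diff f fs (p :: ps) (List.Forall₂.cons hp hps),
      h'.fun_diff f fs (p :: ps) (List.Forall₂.cons hp hps), sub_self]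
  · rintro _ _ l ⟨f, -, -, rfl⟩ ⟨g, -, -, rfl⟩ hl
    have hl' : ∀ ω ∈ l, ∃ h : SFun V m, ω = h.toForm ∨ ω = deRham h.toForm := fun ω hω => by
      rcases hl ω hω with ⟨f, -, -, rfl⟩ | ⟨f, -, -, rfl⟩
      · exact ⟨f, Or.inl rfl⟩
      · exact ⟨f, Or.inr rfl⟩
    rw [h.fun_fun f g l hl', h'.fun_fun f g l hl', sub_self]
  · intro ω hω
    rcases hl ω hω with ⟨i | i, rfl⟩ | ⟨o, rfl⟩
    · exact Or.inl ⟨const (CInf.coord V i), 0, hasParity_const _, (toForm_coord i).symm⟩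
    · exact Or.inr ⟨gen i, 1, hasParity_gen _, (deRham_toForm_gen i).symm⟩
    · rcases lex_cases o with ⟨μ, rfl⟩ | ⟨a, rfl⟩
      · exact Or.inl ⟨gen μ, 1, hasParity_gen _, (toForm_gen μ).symm⟩
      · exact Or.inr ⟨const (CInf.coord V a), 0, hasParity_const _, (deRham_toForm_coord a).symm⟩

end Uniqueness

end HigherKoszul

/-! ### Multivector fields, Schouten brackets with functions, and abstract derived brackets. -/

namespace HigherKoszul

open Grass

theorem isDer_mapSeries {σ R : Type} [CommRing R] {D : R → R} (hD : IsDer D) :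
    IsDer (mapSeries D : MvPowerSeries σ R → MvPowerSeries σ R) where
  map_add F G := by
    ext α
    change D (MvPowerSeries.coeff α (F + G)) = D (MvPowerSeries.coeff α F) +
      D (MvPowerSeries.coeff α G)
    rw [_root_.map_add, hD.map_add]
  map_mul F G := by
    classical
    ext α
    have hc : ∀ (H : MvPowerSeries σ R) β, MvPowerSeries.coeff β (mapSeries D H)
        = D (MvPowerSeries.coeff β H) := fun H β => rfl
    rw [_root_.map_add, hc]
    simp only [MvPowerSeries.coeff_mul, hc, hD.map_sum, hD.map_mul, Finset.sum_add_distrib]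

theorem isDer_pderiv {σ R : Type} [CommRing R] (i : σ) :
    IsDer (MvPowerSeries.pderiv R i : MvPowerSeries σ R → MvPowerSeries σ R) where
  map_add F G := _root_.map_add _ F G
  map_mul F G := by
    rw [Derivation.leibniz, smul_eq_mul, smul_eq_mul, add_comm, mul_comm G]

theorem coeff_mapSeries {σ R S : Type} [CommRing R] [CommRing S] (φ : R → S)
    (F : MvPowerSeries σ R) (α : σ →₀ ℕ) :
    MvPowerSeries.coeff α (mapSeries φ F) = φ (MvPowerSeries.coeff α F) := rfl

theorem mapSeries_C {σ R S : Type} [CommRing R] [CommRing S] {φ : R → S} (h : φ 0 = 0) (c : R) :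
    mapSeries φ (MvPowerSeries.C c : MvPowerSeries σ R) = MvPowerSeries.C (φ c) := by
  classical
  ext α
  rw [coeff_mapSeries, MvPowerSeries.coeff_C, MvPowerSeries.coeff_C]
  split_ifs <;> simp [h]

section Lex

variable {α β : Type}

theorem lexInl_apply [LinearOrder α] [LinearOrder β] (a : α) :
    lexInl α β a = toLex (Sum.inl a) := rfl

theorem lexInr_apply [LinearOrder α] [LinearOrder β] (b : β) :
    lexInr α β b = toLex (Sum.inr b) := rfl

theorem lexUnion_eq [LinearOrder α] [LinearOrder β] [DecidableEq (α ⊕ₗ β)] (S : Finset α)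
    (T : Finset β) : lexUnion S T =
      S.map (lexInl α β).toEmbedding ∪ T.map (lexInr α β).toEmbedding := by
  ext x
  rcases lex_cases x with ⟨a, rfl⟩ | ⟨b, rfl⟩ <;>
    simp [lexUnion, lexInl_apply, lexInr_apply, Finset.mem_map]

theorem card_lexUnion (S : Finset α) (T : Finset β) :
    (lexUnion S T).card = S.card + T.card := by
  rw [lexUnion, Finset.card_map, Finset.card_disjSum]

@[simp] theorem lexLeft_lexUnion (S : Finset α) (T : Finset β) :
    lexLeft (lexUnion S T) = S := by
  ext a; simp [lexLeft, lexUnion]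

@[simp] theorem lexRight_lexUnion (S : Finset α) (T : Finset β) :
    lexRight (lexUnion S T) = T := by
  ext a; simp [lexRight, lexUnion]

theorem lexUnion_left_right (U : Finset (α ⊕ₗ β)) : lexUnion (lexLeft U) (lexRight U) = U := by
  ext x
  rcases lex_cases x with ⟨a, rfl⟩ | ⟨b, rfl⟩ <;>
    simp [lexUnion, lexLeft, lexRight]

end Lex

section Multivectors

variable {n m : ℕ} {V : Opens (Fin n → ℝ)}

/-- The inclusion of functions into multivector fields, as a ring homomorphism. -/
def toMultHom (V : Opens (Fin n → ℝ)) (m : ℕ) : SFun V m →+* Mult V m :=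
  embedHom (lexInl (Fin m) (Fin n)) (MvPowerSeries.C (σ := Fin m) (R := CInf V))

theorem toMultHom_apply (f : SFun V m) : toMultHom V m f = f.toMult := rfl

theorem toMult_inv (f : SFun V m) : SFun.toMult f.inv = f.toMult.inv :=
  embed_inv (lexInl (Fin m) (Fin n)).toEmbedding (MvPowerSeries.C (σ := Fin m) (R := CInf V)) f

theorem hasParity_toMult {p : ZMod 2} {f : SFun V m} (hf : HasParity p f) :
    HasParity p f.toMult :=
  hasParity_of_inv_eq (by
    rw [← toMult_inv, hf.inv_eq, ← toMultHom_apply, map_zsmul, toMultHom_apply])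

theorem isSuperDer_multX (a : Fin n) : IsSuperDer 0
    (Grass.mapCoeff (mapSeries (CInf.partialDeriv a)) : Mult V m → Mult V m) :=
  isSuperDer_mapCoeff (isDer_mapSeries (CInf.isDer_partialDeriv a))

theorem isSuperDer_multPderiv (μ : Fin m) : IsSuperDer 0
    (Grass.mapCoeff (MvPowerSeries.pderiv _ μ) : Mult V m → Mult V m) :=
  isSuperDer_mapCoeff (isDer_pderiv μ)

theorem multX_toMult (a : Fin n) (f : SFun V m) :
    f.toMult.mapCoeff (mapSeries (CInf.partialDeriv a))
      = SFun.toMult (f.mapCoeff (CInf.partialDeriv a)) :=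
  mapCoeff_embed (lexInl (Fin m) (Fin n)).toEmbedding _ _ _ _
    (isDer_mapSeries (CInf.isDer_partialDeriv _)).map_zero
    (mapSeries_C (CInf.isDer_partialDeriv a).map_zero) f

theorem oddDeriv_inl_toMult (μ : Fin m) (f : SFun V m) :
    f.toMult.oddDeriv (toLex (Sum.inl μ)) = SFun.toMult (f.oddDeriv μ) :=
  (embed_oddDeriv (lexInl (Fin m) (Fin n)) (MvPowerSeries.C (σ := Fin m) (R := CInf V)) μ f).symm

theorem oddDeriv_inr_toMult (a : Fin n) (f : SFun V m) :
    f.toMult.oddDeriv (toLex (Sum.inr a)) = 0 :=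
  oddDeriv_embed_of_notMem _ _ (by rintro ⟨μ, h⟩; simp at h) f

theorem multPderiv_toMult (μ : Fin m) (f : SFun V m) :
    f.toMult.mapCoeff (MvPowerSeries.pderiv _ μ) = 0 :=
  mapCoeff_embed_eq_zero (lexInl (Fin m) (Fin n)).toEmbedding _ _
    (isDer_pderiv _).map_zero (fun _ => MvPowerSeries.pderiv_C) f

/-- A function contains no antimomenta, so only the terms that differentiate Q along the fibres
survive. This is the formula that both models of the brackets reproduce. -/
theorem schouten_toMult (Q : Mult V m) (f : SFun V m) : schouten Q f.toMult
    = ∑ a, Q.oddDeriv (toLex (Sum.inr a)) * SFun.toMult (f.mapCoeff (CInf.partialDeriv a))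
      - ∑ μ, Q.inv.mapCoeff (MvPowerSeries.pderiv _ μ) * SFun.toMult (f.oddDeriv μ) := by
  simp only [schouten, multX_toMult, oddDeriv_inl_toMult, oddDeriv_inr_toMult, multPderiv_toMult,
    mul_zero, neg_zero, add_zero, sub_eq_add_neg, Finset.sum_neg_distrib]

theorem hasParity_schouten {q p : ZMod 2} {Q : Mult V m} {f : SFun V m} (hQ : HasParity q Q)
    (hf : HasParity p f) : HasParity (q + p + 1) (schouten Q f.toMult) := by
  rw [schouten_toMult, sub_eq_add_neg]
  refine (hasParity_sum _ _ fun a _ => ?_).add (hasParity_sum _ _ fun μ _ => ?_).neg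
  · have h1 := (isSuperDer_oddDeriv (A := MvPowerSeries (Fin m) (CInf V))
      (toLex (Sum.inr a) : Fin m ⊕ₗ Fin n)).hasParity hQ
    have h2 := hasParity_toMult ((isSuperDer_mapCoeff (CInf.isDer_partialDeriv a)).hasParity hf)
    convert h1.mul h2 using 1; ring
  · have h1 : HasParity q Q.inv := by rw [hQ.inv_eq]; exact hQ.zsmul _
    have h2 := (isSuperDer_multPderiv (V := V) μ).hasParity h1
    have h3 := hasParity_toMult ((isSuperDer_oddDeriv μ).hasParity hf)
    convert h2.mul h3 using 1; ring

theorem schouten_add_left (Q Q' : Mult V m) (f : SFun V m) :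
    schouten (Q + Q') f.toMult = schouten Q f.toMult + schouten Q' f.toMult := by
  simp only [schouten_toMult, oddDeriv_add, inv_add, (isSuperDer_multPderiv _).map_add, add_mul,
    Finset.sum_add_distrib]
  abel

theorem schouten_zsmul_left (k : ℤ) (Q : Mult V m) (f : SFun V m) :
    schouten (k • Q) f.toMult = k • schouten Q f.toMult :=
  map_zsmul (AddMonoidHom.mk' (fun Q : Mult V m => schouten Q f.toMult)
    fun Q Q' => schouten_add_left Q Q' f) k Q

theorem hasParity_restrict {q : ZMod 2} {Q : Mult V m} (hQ : HasParity q Q) :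
    HasParity q Q.restrict := by
  intro S hS
  change MvPowerSeries.coeff 0 (Q (lexUnion S ∅)) = 0
  rw [hQ (lexUnion S ∅) (by rwa [card_lexUnion, Finset.card_empty, add_zero]), map_zero]

theorem hasParity_foldl_schouten {fs : List (SFun V m)} {ps : List (ZMod 2)}
    (h : HasParities fs ps) {q : ZMod 2} {Q : Mult V m} (hQ : HasParity q Q) :
    HasParity (q + ps.sum + ps.length)
      (fs.foldl (fun Q f => schouten Q f.toMult) Q) := by
  induction h generalizing q Q with
  | nil => simpa using hQ
  | cons h1 h2 ih =>
    have := ih (hasParity_schouten hQ h1)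
    rw [List.foldl_cons]
    convert this using 1
    simp only [List.sum_cons, List.length_cons, Nat.cast_succ]
    ring

end Multivectors

section Signs

/-- The triangular number `N(N+1)/2` modulo 2. -/
def triangle (N : ℕ) : ZMod 2 := ((N * (N + 1) / 2 : ℕ) : ZMod 2)

theorem triangle_succ (N : ℕ) : triangle (N + 1) = triangle N + (N + 1) := by
  have : (N + 1) * (N + 1 + 1) / 2 = N * (N + 1) / 2 + (N + 1) := by
    rw [show (N + 1) * (N + 1 + 1) = N * (N + 1) + (N + 1) * 2 by ring,
      Nat.add_mul_div_right _ _ (by norm_num)]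
  rw [triangle, this]; push_cast; rfl

theorem koszulSign_eq (ps : List (ZMod 2)) :
    koszulSign ps = weightedParity ps + triangle ps.length + 1 := by
  rw [koszulSign, triangle]; push_cast; ring

end Signs

/-- Operations on a module `X` whose iterated brackets with forms, evaluated, are the higher Koszul
brackets. -/
structure DerivedBracketSystem {n m : ℕ} (V : Opens (Fin n → ℝ)) (X : Type) [AddCommGroup X]
    [Module ℂ X] where
  /-- the bracket with a form -/
  bracket : X →ₗ[ℂ] Form V m →ₗ[ℂ] X
  /-- the evaluation -/
  ev : X →ₗ[ℂ] Form V m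
  /-- the parity involution -/
  inv : X → X
  /-- the elements for which the Leibniz rule holds after evaluation -/
  good : X → Prop
  /-- the symbol of a multivector field -/
  symbol : Mult V m →+ X
  /-- the Hamiltonian of a multivector field -/
  ham : Mult V m →+ X
  good_bracket : ∀ x ω, good x → good (bracket x ω)
  bracket_symm : ∀ x ω ω' p q, HasParity p ω → HasParity q ω' →
    bracket (bracket x ω) ω' = sgn (p * q) • bracket (bracket x ω') ω
  -- The Leibniz rule is required only after evaluation: for operators of higher order it fails
  -- before the limit is taken, and `good` will encode the bound on the order that makes it true.
  bracket_mul : ∀ x ω ω' p q r, good x → inv x = sgn r • x → HasParity p ω → HasParity q ω' →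
    ev (bracket x (ω * ω')) = ev (bracket x ω) * ω' + sgn (p * r) • (ω * ev (bracket x ω'))
  inv_bracket : ∀ x ω r p, inv x = sgn r • x → HasParity p ω →
    inv (bracket x ω) = sgn (r + p) • bracket x ω
  ev_inv : ∀ x, ev (inv x) = (ev x).inv
  -- The next four relations contain all that is specific to P. The passage to the Schouten bracket
  -- with f accompanies each bracket, a function turns a Hamiltonian into a symbol, and a second
  -- function kills the result.
  bracket_symbol_fun : ∀ Q (f : SFun V m), bracket (symbol Q) f.toForm = 0
  bracket_symbol_diff : ∀ Q (f : SFun V m),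
    bracket (symbol Q) (deRham f.toForm) = -symbol (schouten Q.inv f.toMult)
  bracket_ham_fun : ∀ Q (f : SFun V m),
    bracket (ham Q) f.toForm = symbol (schouten Q.inv f.toMult)
  bracket_ham_diff : ∀ Q (f : SFun V m) p, HasParity p f →
    bracket (ham Q) (deRham f.toForm) = sgn p • ham (schouten Q.inv f.toMult)
  ev_symbol : ∀ Q, ev (symbol Q) = Q.restrict.toForm
  ev_ham : ∀ Q, ev (ham Q) = deRham (SFun.toForm Q.restrict.inv)
  good_ham : ∀ Q, good (ham Q)
  inv_ham : ∀ Q, HasParity 0 Q → inv (ham Q) = -ham Q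

namespace DerivedBracketSystem

variable {n m : ℕ} {V : Opens (Fin n → ℝ)} {X : Type} [AddCommGroup X] [Module ℂ X]
  (𝒮 : DerivedBracketSystem (m := m) V X)

/-- The iterated brackets of `x`. -/
def iter (x : X) (l : List (Form V m)) : X := l.foldl (fun x ω => 𝒮.bracket x ω) x

theorem iter_append (x : X) (l l' : List (Form V m)) :
    𝒮.iter x (l ++ l') = 𝒮.iter (𝒮.iter x l) l' := List.foldl_append

theorem iter_cons (x : X) (ω : Form V m) (l : List (Form V m)) :
    𝒮.iter x (ω :: l) = 𝒮.iter (𝒮.bracket x ω) l := rfl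

theorem iter_add (x y : X) (l : List (Form V m)) : 𝒮.iter (x + y) l = 𝒮.iter x l + 𝒮.iter y l := by
  induction l generalizing x y with
  | nil => rfl
  | cons ω l ih => rw [iter_cons, iter_cons, iter_cons, map_add, LinearMap.add_apply, ih]

theorem iter_smul (c : ℂ) (x : X) (l : List (Form V m)) : 𝒮.iter (c • x) l = c • 𝒮.iter x l := by
  induction l generalizing x with
  | nil => rfl
  | cons ω l ih => rw [iter_cons, iter_cons, map_smul, LinearMap.smul_apply, ih]

theorem iter_zsmul (k : ℤ) (x : X) (l : List (Form V m)) : 𝒮.iter (k • x) l = k • 𝒮.iter x l :=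
  map_zsmul (AddMonoidHom.mk' (fun x => 𝒮.iter x l) fun x y => 𝒮.iter_add x y l) k x

theorem iter_zero (l : List (Form V m)) : 𝒮.iter 0 l = 0 := by
  simpa using 𝒮.iter_smul 0 0 l

theorem good_iter {x : X} (h : 𝒮.good x) (l : List (Form V m)) : 𝒮.good (𝒮.iter x l) := by
  induction l generalizing x with
  | nil => exact h
  | cons ω l ih => exact ih (𝒮.good_bracket x ω h)

theorem inv_iter {x : X} {r : ZMod 2} (h : 𝒮.inv x = sgn r • x) {l : List (Form V m)}
    {ps : List (ZMod 2)} (hl : HasParities l ps) :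
    𝒮.inv (𝒮.iter x l) = sgn (r + ps.sum) • 𝒮.iter x l := by
  induction hl generalizing x r with
  | nil => simpa [iter] using h
  | cons h1 h2 ih =>
    have := ih (𝒮.inv_bracket x _ r _ h h1)
    rw [iter_cons, this, List.sum_cons, add_assoc]

/-- Each differential contributes -(-1)^q, where q is the parity of the current multivector field,
and the bracket with a function of parity p replaces q by q + p + 1. Summed over the list these
exponents give the stated sign, the triangular number coming from the repeated shifts by one. -/
theorem iter_symbol {fs : List (SFun V m)} {ps : List (ZMod 2)} (h : HasParities fs ps)
    {q : ZMod 2} {Q : Mult V m} (hQ : HasParity q Q) :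
    𝒮.iter (𝒮.symbol Q) (fs.map fun g => deRham g.toForm)
      = sgn (ps.length * q + weightedParity ps + triangle ps.length)
        • 𝒮.symbol (fs.foldl (fun Q f => schouten Q f.toMult) Q) := by
  induction h generalizing q Q with
  | nil => simp [iter, weightedParity, triangle]
  | @cons f p fs ps h1 h2 ih =>
    rw [List.map_cons, iter_cons, bracket_symbol_diff, hQ.inv_eq, schouten_zsmul_left, map_zsmul,
      ← neg_smul, iter_zsmul, ih (hasParity_schouten hQ h1), smul_smul, List.foldl_cons]
    congr 1
    rw [show -sgn q = sgn (q + 1) by rw [sgn_add]; simp, ← sgn_add]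
    congr 1
    rw [List.length_cons, triangle_succ, weightedParity]
    push_cast
    ring

/-- The count is that of `iter_symbol`, except that a differential of a function of parity p
contributes (-1)^(p+q) instead of -(-1)^q; this accounts for the additional sum of parities and
length. -/
theorem iter_ham {fs : List (SFun V m)} {ps : List (ZMod 2)} (h : HasParities fs ps)
    {q : ZMod 2} {Q : Mult V m} (hQ : HasParity q Q) :
    𝒮.iter (𝒮.ham Q) (fs.map fun g => deRham g.toForm)
      = sgn (ps.length * q + weightedParity ps + triangle ps.length + ps.sum + ps.length)
        • 𝒮.ham (fs.foldl (fun Q f => schouten Q f.toMult) Q) := by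
  induction h generalizing q Q with
  | nil => simp [iter, weightedParity, triangle]
  | @cons f p fs ps h1 h2 ih =>
    rw [List.map_cons, iter_cons, bracket_ham_diff _ _ _ _ h1, hQ.inv_eq, schouten_zsmul_left,
      map_zsmul, smul_smul, iter_zsmul, ih (hasParity_schouten hQ h1), smul_smul, List.foldl_cons]
    congr 1
    rw [← sgn_add, ← sgn_add]
    congr 1
    rw [List.length_cons, triangle_succ, weightedParity, List.sum_cons]
    push_cast
    -- The two exponents differ by an even number, and 2 = 0 in `ZMod 2`.
    linear_combination (ZMod.natCast_self 2 : ((2 : ℕ) : ZMod 2) = 0) * (-1 : ZMod 2)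

/-- Multilinearity, symmetry, oddness and the Leibniz rule are inherited from the axioms. The
special values are computed by following `ham P`: through `iter_ham` if there are only
differentials, through one bracket with a function and then `iter_symbol` if one function occurs,
and to zero if there are two. -/
theorem isKoszulBrackets {P : Mult V m} (hP : HasParity 0 P) :
    IsKoszulBrackets P fun l => 𝒮.ev (𝒮.iter (𝒮.ham P) l) := by
  have hodd : 𝒮.inv (𝒮.ham P) = sgn 1 • 𝒮.ham P := by rw [𝒮.inv_ham P hP]; simp
  have hPinv : P.inv = P := by rw [hP.inv_eq]; simp
  refine ⟨?_, ?_, ?_, ?_, ?_, ?_, ?_, ?_⟩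
  · intro l₁ ω ω' l₂
    simp only [iter_append, iter_cons, map_add, iter_add]
  · intro l₁ c ω l₂
    simp only [iter_append, iter_cons, map_smul, iter_smul]
  · intro l ps hl
    refine hasParity_of_inv_eq ?_
    rw [← 𝒮.ev_inv, 𝒮.inv_iter hodd hl, map_zsmul, add_comm]
  · intro l₁ ω ω' l₂ p p' hp hp'
    simp only [iter_append, iter_cons]
    rw [𝒮.bracket_symm _ _ _ p p' hp hp', iter_zsmul, map_zsmul]
  · intro l ps ω p ω' hl hp
    simp only [iter_append, iter_cons]
    -- The axiom needs both factors homogeneous, whereas the condition does not ask this of the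
    -- second one, which is therefore split into its even and odd parts.
    have key : ∀ q, 𝒮.ev (𝒮.bracket (𝒮.iter (𝒮.ham P) l) (ω * ω'.part q))
        = 𝒮.ev (𝒮.bracket (𝒮.iter (𝒮.ham P) l) ω) * ω'.part q + sgn (p * (1 + ps.sum)) •
          (ω * 𝒮.ev (𝒮.bracket (𝒮.iter (𝒮.ham P) l) (ω'.part q))) := fun q =>
      𝒮.bracket_mul _ _ _ p q _ (𝒮.good_iter (𝒮.good_ham P) l) (𝒮.inv_iter hodd hl) hp
        (hasParity_part q ω')
    change 𝒮.ev (𝒮.bracket _ _) = 𝒮.ev (𝒮.bracket _ _) * ω' + _ • (ω * 𝒮.ev (𝒮.bracket _ _))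
    generalize sgn (p * (1 + ps.sum)) = k at key ⊢
    conv_lhs => rw [← part_add_part ω', mul_add, map_add, map_add, key, key]
    conv_rhs => rw [← part_add_part ω', mul_add, map_add, map_add, mul_add, smul_add]
    abel
  · intro f fs ps h
    cases h with
    | @cons _ p _ ps h1 h2 =>
      have h3 := hasParity_schouten hP h1
      change 𝒮.ev (𝒮.iter _ _) = _
      rw [iter_cons, 𝒮.bracket_ham_fun, hPinv, 𝒮.iter_symbol h2 h3, map_zsmul, 𝒮.ev_symbol]
      congr 2
      rw [koszulSign_eq, List.length_cons, triangle_succ, weightedParity]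
      linear_combination (ZMod.natCast_self 2 : ((2 : ℕ) : ZMod 2) = 0) * (-1 : ZMod 2)
  · intro fs ps h
    have h1 := 𝒮.iter_ham h hP
    have h2 := hasParity_restrict (hasParity_foldl_schouten h hP)
    change 𝒮.ev (𝒮.iter _ _) = _
    -- The bracket of the functions has parity equal to the sum of the parities plus the length; the
    -- involution in `ev_ham` thus cancels the additional sign of `iter_ham`.
    rw [h1, map_zsmul, 𝒮.ev_ham, h2.inv_eq, toForm_zsmul, isSuperDer_deRham.map_zsmul, smul_smul,
      ← sgn_add]
    congr 2
    rw [koszulSign_eq]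
    linear_combination (ZMod.natCast_self 2 : ((2 : ℕ) : ZMod 2) = 0)
      * (ps.sum + ps.length - 1 : ZMod 2)
  · intro f g l _
    rw [iter_cons, iter_cons, 𝒮.bracket_ham_fun, 𝒮.bracket_symbol_fun, iter_zero, map_zero]

end DerivedBracketSystem

end HigherKoszul

namespace HigherKoszul

open Grass

/-! Shortcuts for the instances on the algebras of smooth functions. -/

section Instances

variable {ι : Type} [Fintype ι] (V : Opens (ι → ℝ))

instance instCommRingCInf : CommRing (CInf V) := (CInf V).toCommRing

instance instAddCommGroupCInf : AddCommGroup (CInf V) := Ring.toAddCommGroup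

instance instAlgebraCInf : Algebra ℂ (CInf V) := (CInf V).algebra

instance instModuleCInf : Module ℂ (CInf V) := Algebra.toModule

end Instances

/-! ### Operators on Grassmann algebras -/

theorem ring_mul_zero {R : Type*} [Ring R] (a : R) : a * 0 = 0 := mul_zero a

theorem ring_zero_mul {R : Type*} [Ring R] (a : R) : 0 * a = 0 := zero_mul a

namespace Op

variable {ο : Type} [LinearOrder ο] [DecidableEq ο] [Fintype ο] {A : Type u} [CommRing A]
  [Algebra ℂ A]

/-- The parity involution as an operator. -/
def parity (ο : Type) (A : Type u) [LinearOrder ο] [DecidableEq ο] [Fintype ο] [CommRing A] [Algebra ℂ A] : Module.End ℂ (Grass ο A) where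
  toFun := Grass.inv
  map_add' := inv_add
  map_smul' := inv_smul

theorem parity_apply (f : Grass ο A) : parity ο A f = f.inv := rfl

/-- Conjugation of operators with the parity involution, if `r` is odd. -/
def conj (r : ZMod 2) : Module.End ℂ (Grass ο A) →ₗ[ℂ] Module.End ℂ (Grass ο A) :=
  if r = 0 then LinearMap.id
  else LinearMap.mulLeft ℂ (parity ο A) ∘ₗ LinearMap.mulRight ℂ (parity ο A)

variable (S T R : Module.End ℂ (Grass ο A))

@[simp] theorem conj_zero : conj 0 T = T := rfl

theorem conj_one_apply (f : Grass ο A) : conj 1 T f = (T f.inv).inv := rfl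

theorem conj_apply_one_one : conj 1 T 1 = (T 1).inv := by
  rw [conj_one_apply, Grass.inv_one]

theorem conj_mul (r : ZMod 2) : conj r (S * T) = conj r S * conj r T := by
  rcases zmod_two_cases r with rfl | rfl
  · rfl
  · refine LinearMap.ext fun f => ?_
    simp only [conj_one_apply, Module.End.mul_apply, Grass.inv_inv]

theorem conj_map_one (r : ZMod 2) : conj r (1 : Module.End ℂ (Grass ο A)) = 1 := by
  rcases zmod_two_cases r with rfl | rfl
  · rfl
  · exact LinearMap.ext fun f => Grass.inv_inv f

theorem conj_conj (r s : ZMod 2) : conj r (conj s T) = conj (r + s) T := by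
  rcases zmod_two_cases r with rfl | rfl
  · rw [zero_add]; rfl
  · rcases zmod_two_cases s with rfl | rfl
    · rw [add_zero]; rfl
    · rw [show (1 + 1 : ZMod 2) = 0 from rfl]
      refine LinearMap.ext fun f => ?_
      simp only [conj_one_apply, Grass.inv_inv, conj_zero]

/-- `T` is homogeneous of parity `p`. -/
def IsHomogeneous (p : ZMod 2) (T : Module.End ℂ (Grass ο A)) : Prop :=
  ∀ r, conj r T = sgn (r * p) • T

variable {S T R}

theorem isHomogeneous_of_conj_one {p : ZMod 2} (h : conj 1 T = sgn p • T) : IsHomogeneous p T := by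
  intro r
  rcases zmod_two_cases r with rfl | rfl
  · simp
  · rw [h, one_mul]

theorem IsHomogeneous.mul {p q : ZMod 2} (hS : IsHomogeneous p S) (hT : IsHomogeneous q T) :
    IsHomogeneous (p + q) (S * T) := fun r => by
  rw [conj_mul, hS, hT, smul_mul_smul_comm, ← sgn_add, mul_add]

theorem IsHomogeneous.one : IsHomogeneous 0 (1 : Module.End ℂ (Grass ο A)) := fun r => by
  rw [conj_map_one]; simp

theorem IsHomogeneous.pow (hS : IsHomogeneous 0 S) (k : ℕ) : IsHomogeneous 0 (S ^ k) := by
  induction k with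
  | zero => exact IsHomogeneous.one
  | succ k ih => simpa [pow_succ] using ih.mul hS

variable (A) in
/-- The supercommutator `S T - (-1)^{S̃ p} T S` for `T` of parity `p`. -/
def bracket (p : ZMod 2) : Module.End ℂ (Grass ο A) →ₗ[ℂ] Module.End ℂ (Grass ο A) →ₗ[ℂ]
    Module.End ℂ (Grass ο A) :=
  LinearMap.mk₂ ℂ (fun S T => S * T - T * conj p S)
    (fun S S' T => by rw [map_add, add_mul, mul_add]; abel)
    (fun c S T => by rw [map_smul, smul_mul_assoc, mul_smul_comm, smul_sub])
    (fun S T T' => by rw [mul_add, add_mul]; abel)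
    (fun c S T => by rw [mul_smul_comm, smul_mul_assoc, smul_sub])

theorem bracket_apply (p : ZMod 2) (S T : Module.End ℂ (Grass ο A)) :
    bracket A p S T = S * T - T * conj p S := rfl

theorem bracket_zero_left (p : ZMod 2) (T : Module.End ℂ (Grass ο A)) : bracket A p 0 T = 0 := by
  rw [map_zero, LinearMap.zero_apply]

theorem bracket_mul_left (p : ZMod 2) (S S' T : Module.End ℂ (Grass ο A)) :
    bracket A p (S * S') T = S * bracket A p S' T + bracket A p S T * conj p S' := by
  simp only [bracket_apply, conj_mul]; noncomm_ring

theorem bracket_mul_right (p q : ZMod 2) (S T T' : Module.End ℂ (Grass ο A)) :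
    bracket A (p + q) S (T * T') = bracket A p S T * T' + T * bracket A q (conj p S) T' := by
  simp only [bracket_apply, conj_conj, add_comm q p]; noncomm_ring

theorem conj_bracket (r p : ZMod 2) (S T : Module.End ℂ (Grass ο A)) :
    conj r (bracket A p S T) = bracket A p (conj r S) (conj r T) := by
  simp only [bracket_apply, map_sub, conj_mul, conj_conj, add_comm r p]

/-- The Jacobi identity, with the sign depending on S absorbed by conjugation so that S may be
inhomogeneous. It yields the symmetry of iterated commutators, the behaviour of orders under
commutation with a derivation, and the commutators of [d, Q̂] with forms. -/
theorem bracket_bracket {p q : ZMod 2} (S : Module.End ℂ (Grass ο A)) (hT : IsHomogeneous p T)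
    (hR : IsHomogeneous q R) : bracket A q (bracket A p S T) R
      = bracket A (p + q) S (bracket A q T R)
        + sgn (p * q) • bracket A p (bracket A q S R) T := by
  have h1 := hT q
  have h2 := hR p
  rw [mul_comm] at h1
  rw [bracket_apply q (bracket A p S T), bracket_apply p (bracket A q S R), conj_bracket,
    conj_bracket, h1, h2]
  simp only [bracket_apply, conj_conj, add_comm q p, h1]
  have : sgn (p * q) = 1 ∨ sgn (p * q) = -1 := by
    generalize p * q = r; revert r; decide
  rcases this with e | e <;> rw [e] <;> noncomm_ring

/-- Left multiplication. -/
abbrev mulLeft (f : Grass ο A) : Module.End ℂ (Grass ο A) := LinearMap.mulLeft ℂ f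

theorem mulLeft_add (f g : Grass ο A) : mulLeft (f + g) = mulLeft f + mulLeft g :=
  LinearMap.ext fun h => add_mul f g h

theorem mulLeft_smul (c : ℂ) (f : Grass ο A) : mulLeft (c • f) = c • mulLeft f :=
  LinearMap.ext fun h => smul_mul_assoc c f h

theorem mulLeft_mul (f g : Grass ο A) : mulLeft (f * g) = mulLeft f * mulLeft g :=
  LinearMap.ext fun h => mul_assoc f g h

theorem mulLeft_one : mulLeft (1 : Grass ο A) = 1 :=
  LinearMap.ext fun h => one_mul h

/-- Left multiplication as a linear map. -/
def mulLeftHom (ο : Type) (A : Type u) [LinearOrder ο] [DecidableEq ο] [Fintype ο] [CommRing A]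
    [Algebra ℂ A] : Grass ο A →ₗ[ℂ] Module.End ℂ (Grass ο A) where
  toFun := mulLeft
  map_add' := mulLeft_add
  map_smul' := mulLeft_smul

theorem mulLeftHom_apply (f : Grass ο A) : mulLeftHom ο A f = mulLeft f := rfl

theorem conj_one_mulLeft (f : Grass ο A) : conj 1 (mulLeft f) = mulLeft f.inv :=
  LinearMap.ext fun g => by
    rw [conj_one_apply, LinearMap.mulLeft_apply, LinearMap.mulLeft_apply, inv_mul, Grass.inv_inv]

theorem mulLeft_zero : mulLeft (0 : Grass ο A) = 0 := map_zero (mulLeftHom ο A)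

theorem mulLeft_zsmul (k : ℤ) (f : Grass ο A) : mulLeft (k • f) = k • mulLeft f :=
  map_zsmul (mulLeftHom ο A) k f

theorem conj_mulLeft (r : ZMod 2) (f : Grass ο A) :
    conj r (mulLeft f) = mulLeft (f.twist r) := by
  rcases zmod_two_cases r with rfl | rfl
  · rw [twist_zero]; rfl
  · rw [twist_one, conj_one_mulLeft]

theorem isHomogeneous_mulLeft {p : ZMod 2} {f : Grass ο A} (hf : HasParity p f) :
    IsHomogeneous p (mulLeft f) :=
  isHomogeneous_of_conj_one (by rw [conj_one_mulLeft, hf.inv_eq, mulLeft_zsmul])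

theorem mulLeft_mul_comm {p : ZMod 2} {f : Grass ο A} (hf : HasParity p f) (g : Grass ο A) :
    mulLeft f * mulLeft g = mulLeft (g.twist p) * mulLeft f := by
  rw [← mulLeft_mul, hf.mul_comm, mulLeft_mul]

theorem bracket_mulLeft_mulLeft {p : ZMod 2} {f : Grass ο A} (hf : HasParity p f)
    (g : Grass ο A) : bracket A p (mulLeft g) (mulLeft f) = 0 := by
  have h : p + p = 0 := CharTwo.add_self_eq_zero p
  rw [bracket_apply, conj_mulLeft, mulLeft_mul_comm hf, ← twist_add_parity, h, twist_zero, sub_self]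

/-- The supercommutator with the operator of multiplication by a form. -/
def comm : Module.End ℂ (Grass ο A) →ₗ[ℂ] Grass ο A →ₗ[ℂ] Module.End ℂ (Grass ο A) :=
  LinearMap.mk₂ ℂ (fun S f => bracket A 0 S (mulLeft (f.part 0)) + bracket A 1 S (mulLeft (f.part 1)))
    (fun S S' f => by simp only [map_add, LinearMap.add_apply]; abel)
    (fun c S f => by simp only [map_smul, LinearMap.smul_apply, smul_add])
    (fun S f g => by
      have h : ∀ p, (f + g).part p = f.part p + g.part p := fun p => by
        ext U; simp only [part, Grass.add_apply]; split_ifs <;> simp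
      simp only [h, mulLeft_add, map_add]; abel)
    (fun c S f => by
      have h : ∀ p, (c • f).part p = c • f.part p := fun p => by
        ext U; simp only [part, Grass.smul_apply]; split_ifs <;> simp
      simp only [h, mulLeft_smul, map_smul, smul_add])

theorem comm_apply (S : Module.End ℂ (Grass ο A)) (f : Grass ο A) :
    comm S f = bracket A 0 S (mulLeft (f.part 0)) + bracket A 1 S (mulLeft (f.part 1)) := rfl

theorem comm_of_hasParity {p : ZMod 2} (S : Module.End ℂ (Grass ο A)) {f : Grass ο A}
    (hf : HasParity p f) : comm S f = bracket A p S (mulLeft f) := by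
  rw [comm_apply, hf.part_eq, hf.part_eq]
  rcases zmod_two_cases p with rfl | rfl <;> simp

theorem isHomogeneous_of_isSuperDer {q : ZMod 2} {D : Module.End ℂ (Grass ο A)}
    (hD : IsSuperDer q D) : IsHomogeneous q D :=
  isHomogeneous_of_conj_one (LinearMap.ext fun g => by
    rw [conj_one_apply, hD.map_inv, Grass.inv_zsmul, Grass.inv_inv]; rfl)

theorem superDer_mul_mulLeft {p : ZMod 2} {D : Module.End ℂ (Grass ο A)} (hD : IsSuperDer p D)
    {f : Grass ο A} (h : D f = 0) : D * mulLeft f = mulLeft (f.twist p) * D :=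
  LinearMap.ext fun g => by
    simp only [Module.End.mul_apply, LinearMap.mulLeft_apply, hD.map_mul, h, zero_mul, zero_add]

theorem bracket_one_left (p : ZMod 2) (T : Module.End ℂ (Grass ο A)) : bracket A p 1 T = 0 := by
  rw [bracket_apply, conj_map_one, one_mul, mul_one, sub_self]

theorem bracket_superDer {p q : ZMod 2} {D : Module.End ℂ (Grass ο A)} (hD : IsSuperDer q D)
    {f : Grass ο A} (hf : HasParity p f) : bracket A p D (mulLeft f) = mulLeft (D f) := by
  refine LinearMap.ext fun g => ?_
  rw [bracket_apply, isHomogeneous_of_isSuperDer hD]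
  simp only [LinearMap.sub_apply, Module.End.mul_apply, LinearMap.mulLeft_apply,
    LinearMap.smul_apply, hD.map_mul, hf.twist_eq, smul_mul_assoc, mul_smul_comm]
  abel

/-- Operators of order less than `k`. -/
def ord (ο : Type) (A : Type u) [LinearOrder ο] [DecidableEq ο] [Fintype ο] [CommRing A]
    [Algebra ℂ A] : ℕ → Submodule ℂ (Module.End ℂ (Grass ο A))
  | 0 => ⊥
  | k + 1 => ⨅ f, (ord ο A k).comap (comm.flip f)

theorem mem_ord_zero : S ∈ ord ο A 0 ↔ S = 0 := Submodule.mem_bot ℂ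

theorem comm_mem_ord {k : ℕ} (h : S ∈ ord ο A (k + 1)) (f : Grass ο A) : comm S f ∈ ord ο A k := by
  rw [ord, Submodule.mem_iInf] at h
  exact h f

theorem bracket_mem_ord {k : ℕ} (h : S ∈ ord ο A (k + 1)) {p : ZMod 2} {f : Grass ο A}
    (hf : HasParity p f) : bracket A p S (mulLeft f) ∈ ord ο A k := by
  rw [← comm_of_hasParity S hf]; exact comm_mem_ord h f

theorem mem_ord_succ {k : ℕ}
    (h : ∀ p f, HasParity p f → bracket A p S (mulLeft f) ∈ ord ο A k) : S ∈ ord ο A (k + 1) := by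
  rw [ord, Submodule.mem_iInf]
  exact fun f => add_mem (h 0 _ (hasParity_part 0 f)) (h 1 _ (hasParity_part 1 f))

theorem conj_mem_ord {k : ℕ} (r : ZMod 2) (h : S ∈ ord ο A k) : conj r S ∈ ord ο A k := by
  induction k generalizing S with
  | zero => rw [mem_ord_zero] at h ⊢; rw [h, map_zero]
  | succ k ih =>
    refine mem_ord_succ fun p f hf => ?_
    -- Writing the multiplication as the conjugate of a signed copy of itself allows the conjugation
    -- to be pulled out of the bracket.
    have h1 : mulLeft f = conj r (sgn (r * p) • mulLeft f) := by
      rw [map_zsmul, isHomogeneous_mulLeft hf, smul_smul, sgn_mul_self, one_smul]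
    rw [h1, ← conj_bracket, map_zsmul, map_zsmul]
    exact zsmul_mem (ih (bracket_mem_ord h hf)) _

/-- Orders add: with "order less than a" as the convention, the bound for a product is a + b - 1.
The bracket with a multiplication obeys the Leibniz rule in S * T, which permits induction on a + b;
if a or b is 0 that factor vanishes, so the truncated subtraction does no harm. -/
theorem mul_mem_ord {a b : ℕ} (hS : S ∈ ord ο A a) (hT : T ∈ ord ο A b) :
    S * T ∈ ord ο A (a + b - 1) := by
  induction h : a + b generalizing a b S T with
  | zero =>
    obtain rfl : a = 0 := by omega
    rw [mem_ord_zero] at hS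
    rw [hS, zero_mul]; exact zero_mem _
  | succ k ih =>
    obtain - | a := a
    · rw [mem_ord_zero] at hS
      rw [hS, zero_mul]; exact zero_mem _
    obtain - | b := b
    · rw [mem_ord_zero] at hT
      rw [hT, mul_zero]; exact zero_mem _
    obtain rfl : k = a + b + 1 := by omega
    refine mem_ord_succ fun p f hf => ?_
    rw [bracket_mul_left]
    exact add_mem (ih hS (bracket_mem_ord hT hf) (by omega))
      (ih (bracket_mem_ord hS hf) (conj_mem_ord p hT) (by omega))

theorem mulLeft_mem_ord (f : Grass ο A) : mulLeft f ∈ ord ο A 1 :=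
  mem_ord_succ fun p g hg => by
    rw [bracket_mulLeft_mulLeft hg]; exact zero_mem _

theorem superDer_mem_ord {q : ZMod 2} {D : Module.End ℂ (Grass ο A)} (hD : IsSuperDer q D) :
    D ∈ ord ο A 2 :=
  mem_ord_succ fun p f hf => by
    rw [bracket_superDer hD hf]; exact mulLeft_mem_ord _

/-- Each of the two products may have order one higher, but the commutator does not: by the Jacobi
identity, bracketing it with f gives the bracket of S with D f and the bracket of [S, f] with D,
both of smaller order. This keeps [d, Q̂] within the bound valid for Q̂. -/
theorem bracket_superDer_mem_ord {k : ℕ} {q : ZMod 2} {D : Module.End ℂ (Grass ο A)}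
    (hD : IsSuperDer q D) (hS : S ∈ ord ο A k) : bracket A q S D ∈ ord ο A k := by
  induction k generalizing S with
  | zero => rw [mem_ord_zero] at hS ⊢; rw [hS, bracket_zero_left]
  | succ k ih =>
    refine mem_ord_succ fun p f hf => ?_
    rw [bracket_bracket S (isHomogeneous_of_isSuperDer hD) (isHomogeneous_mulLeft hf), bracket_superDer hD hf]
    exact add_mem (bracket_mem_ord hS (hD.hasParity hf)) (zsmul_mem (ih (bracket_mem_ord hS hf)) _)

theorem eq_of_mem_ord_one (h : S ∈ ord ο A 1) {p : ZMod 2} {f : Grass ο A} (hf : HasParity p f) :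
    S * mulLeft f = mulLeft f * conj p S := by
  have := bracket_mem_ord h hf
  rwa [mem_ord_zero, bracket_apply, sub_eq_zero] at this

end Op

end HigherKoszul

namespace HigherKoszul

open Grass

/-! ### Coefficients with respect to a second group of variables -/

theorem neg_one_pow_mul_eq {R : Type*} [Ring R] (k : ℕ) (x : R) :
    (-1) ^ k * x = sgn (k : ZMod 2) • x := by
  rw [sgn_natCast, zsmul_eq_mul]; push_cast; rfl

section LexCoeff

variable {ο ο' : Type} [LinearOrder ο] [LinearOrder ο'] [Fintype ο] [Fintype ο'] {σ : Type}
  {A : Type} [CommRing A]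

theorem mem_lexUnion_inl {S : Finset ο} {T : Finset ο'} {o : ο} :
    toLex (Sum.inl o) ∈ lexUnion S T ↔ o ∈ S := by
  simp [lexUnion]

theorem mem_lexUnion_inr {S : Finset ο} {T : Finset ο'} {o : ο'} :
    toLex (Sum.inr o) ∈ lexUnion S T ↔ o ∈ T := by
  simp [lexUnion]

theorem card_filter_lexUnion_lt_inl (S : Finset ο) (T : Finset ο') (o : ο) :
    ((lexUnion S T).filter fun s => s < toLex (Sum.inl o)).card
      = (S.filter fun s => s < o).card := by
  have : (lexUnion S T).filter (fun s => s < toLex (Sum.inl o))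
      = lexUnion (S.filter fun s => s < o) ∅ := by
    ext x
    rcases lex_cases x with ⟨a, rfl⟩ | ⟨b, rfl⟩ <;>
      simp [mem_lexUnion_inl, mem_lexUnion_inr]
  rw [this, card_lexUnion, Finset.card_empty, add_zero]

theorem card_filter_lexUnion_lt_inr (S : Finset ο) (T : Finset ο') (o : ο') :
    ((lexUnion S T).filter fun s => s < toLex (Sum.inr o)).card
      = S.card + (T.filter fun s => s < o).card := by
  have : (lexUnion S T).filter (fun s => s < toLex (Sum.inr o))
      = lexUnion S (T.filter fun s => s < o) := by
    ext x
    rcases lex_cases x with ⟨a, rfl⟩ | ⟨b, rfl⟩ <;>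
      simp [mem_lexUnion_inl, mem_lexUnion_inr]
  rw [this, card_lexUnion]

theorem insert_inl_lexUnion [DecidableEq (ο ⊕ₗ ο')] (o : ο) (S : Finset ο) (T : Finset ο') :
    insert (toLex (Sum.inl o)) (lexUnion S T) = lexUnion (insert o S) T := by
  ext x
  rcases lex_cases x with ⟨a, rfl⟩ | ⟨b, rfl⟩ <;>
    simp [mem_lexUnion_inl, mem_lexUnion_inr]

theorem insert_inr_lexUnion [DecidableEq (ο ⊕ₗ ο')] (o : ο') (S : Finset ο) (T : Finset ο') :
    insert (toLex (Sum.inr o)) (lexUnion S T) = lexUnion S (insert o T) := by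
  ext x
  rcases lex_cases x with ⟨a, rfl⟩ | ⟨b, rfl⟩ <;>
    simp [mem_lexUnion_inl, mem_lexUnion_inr]

theorem lexUnion_sdiff_inl [DecidableEq (ο ⊕ₗ ο')] (o : ο) (S : Finset ο) (T : Finset ο') :
    lexUnion S T \ {toLex (Sum.inl o)} = lexUnion (S \ {o}) T := by
  ext x
  rcases lex_cases x with ⟨a, rfl⟩ | ⟨b, rfl⟩ <;>
    simp [mem_lexUnion_inl, mem_lexUnion_inr]

/-- The coefficient of the monomial given by `α` and `T` in the variables of the power series and in
the odd variables of the second group. -/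
def lexCoeff (α : σ →₀ ℕ) (T : Finset ο') (F : Grass (ο ⊕ₗ ο') (MvPowerSeries σ A)) : Grass ο A :=
  fun S => MvPowerSeries.coeff α (F (lexUnion S T))

variable (α : σ →₀ ℕ) (T : Finset ο') (F G : Grass (ο ⊕ₗ ο') (MvPowerSeries σ A))

theorem lexCoeff_apply (S : Finset ο) :
    lexCoeff α T F S = MvPowerSeries.coeff α (F (lexUnion S T)) := rfl

theorem lexCoeff_add : lexCoeff α T (F + G) = lexCoeff α T F + lexCoeff α T G :=
  Grass.ext fun _ => map_add _ _ _

/-- The coefficient, as an additive map. -/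
def lexCoeffHom (ο : Type) [LinearOrder ο] [Fintype ο] (A : Type) [CommRing A] (α : σ →₀ ℕ) (T : Finset ο') :
    Grass (ο ⊕ₗ ο') (MvPowerSeries σ A) →+ Grass ο A :=
  AddMonoidHom.mk' (lexCoeff α T) (lexCoeff_add α T)

variable {F G} in
theorem ext_lexCoeff (h : ∀ α T, lexCoeff α T F = lexCoeff α T G) : F = G := by
  refine Grass.ext fun U => MvPowerSeries.ext fun α => ?_
  rw [← lexUnion_left_right U]
  exact congrFun (h α (lexRight U)) (lexLeft U)

theorem lexCoeff_inv : lexCoeff α T F.inv = sgn (T.card : ZMod 2) • (lexCoeff α T F).inv := by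
  refine Grass.ext fun S => ?_
  rw [Grass.zsmul_apply, inv_apply, smul_smul, ← sgn_add, lexCoeff_apply, inv_apply, map_zsmul,
    card_lexUnion, Nat.cast_add, add_comm]
  rfl

theorem lexCoeff_mapSeries (φ : A → A) :
    lexCoeff α T (F.mapCoeff (mapSeries φ)) = (lexCoeff α T F).mapCoeff φ := rfl

/-- A left derivative along the second group has to pass the variables of the first group, which
produces the parity involution of the coefficient; the remaining sign is the position within the
second group. -/
theorem lexCoeff_oddDeriv_inl (o : ο) :
    lexCoeff α T (F.oddDeriv (toLex (Sum.inl o))) = (lexCoeff α T F).oddDeriv o := by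
  refine Grass.ext fun S => ?_
  rw [lexCoeff_apply, oddDeriv_apply, oddDeriv_apply, card_filter_lexUnion_lt_inl,
    insert_inl_lexUnion]
  simp only [mem_lexUnion_inl]
  split_ifs
  · exact map_zero _
  · rw [neg_one_pow_mul_eq, neg_one_pow_mul_eq, map_zsmul]; rfl

theorem lexCoeff_oddDeriv_inr (o : ο') :
    lexCoeff α T (F.oddDeriv (toLex (Sum.inr o))) = if o ∈ T then 0 else
      sgn ((T.filter fun s => s < o).card : ZMod 2) • (lexCoeff α (insert o T) F).inv := by
  refine Grass.ext fun S => ?_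
  rw [lexCoeff_apply, oddDeriv_apply, card_filter_lexUnion_lt_inr, insert_inr_lexUnion]
  simp only [mem_lexUnion_inr]
  split_ifs
  · exact map_zero _
  · rw [Grass.zsmul_apply, inv_apply, smul_smul, ← sgn_add, ← Nat.cast_add, add_comm S.card, neg_one_pow_mul_eq,
      map_zsmul]
    rfl

theorem lexCoeff_pderiv (i : σ) : lexCoeff α T (F.mapCoeff (MvPowerSeries.pderiv A i))
    = (α i + 1) • lexCoeff (α + Finsupp.single i 1) T F := by
  refine Grass.ext fun S => ?_
  rw [show ((α i + 1) • lexCoeff (α + Finsupp.single i 1) T F) S = (α i + 1) •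
    lexCoeff (α + Finsupp.single i 1) T F S from map_nsmul (coeffHom S) _ _, nsmul_eq_mul,
    mul_comm]
  push_cast
  exact MvPowerSeries.coeff_pderiv _ _

/-- The variables of the second group stand to the right of those of the first, so multiplication on
the left by a function of the first group meets none of them and produces no sign. -/
theorem lexCoeff_embed_mul (f : Grass ο A) :
    lexCoeff α T (embed (lexInl ο ο') (MvPowerSeries.C (σ := σ) (R := A)) f * F)
      = f * lexCoeff α T F := by
  have e : ∀ f, embed (lexInl ο ο') (MvPowerSeries.C (σ := σ) (R := A)) f
      = embedHom (lexInl ο ο') (MvPowerSeries.C (σ := σ) (R := A)) f := fun _ => rfl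
  induction f using generator_induction generalizing F with
  | add f g hf hg => rw [e, map_add, add_mul, lexCoeff_add, ← e, ← e, hf, hg, add_mul]
  | const a =>
    have h := embed_const (lexInl ο ο').toEmbedding (MvPowerSeries.C (σ := σ) (R := A)) a
    change embed (lexInl ο ο') _ _ = _ at h
    rw [h]
    refine Grass.ext fun S => ?_
    rw [lexCoeff_apply, const_mul_apply, const_mul_apply, MvPowerSeries.coeff_C_mul]
    rfl
  | gen_mul o f hf =>
    have h := embed_gen (lexInl ο ο').toEmbedding (MvPowerSeries.C (σ := σ) (R := A)) o
    change embed (lexInl ο ο') _ _ = _ at h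
    have key : ∀ F : Grass (ο ⊕ₗ ο') (MvPowerSeries σ A),
        lexCoeff α T (gen (toLex (Sum.inl o)) * F) = gen o * lexCoeff α T F := fun F => by
      refine Grass.ext fun S => ?_
      rw [lexCoeff_apply, gen_eq_mono, gen_eq_mono, mono_mul_apply, mono_mul_apply,
        inversions_singleton_left, inversions_singleton_left, one_mul, one_mul,
        lexUnion_sdiff_inl, card_filter_lexUnion_lt_inl]
      simp only [Finset.singleton_subset_iff, mem_lexUnion_inl]
      split_ifs
      · rw [neg_one_pow_mul_eq, neg_one_pow_mul_eq, map_zsmul]; rfl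
      · exact map_zero _
    rw [e, map_mul, ← e, ← e, h, mul_assoc, mul_assoc, ← hf]
    exact key _

theorem hasParity_embed {A B : Type} [CommRing A] [CommRing B]
    (e : ο ↪ ο') (φ : A →+* B) {p : ZMod 2} {f : Grass ο A} (hf : HasParity p f) :
    HasParity p (embed e φ f) := by
  intro U hU
  by_cases h : (U : Set ο') ⊆ Set.range e
  · obtain ⟨S, rfl⟩ := exists_map_eq e h
    rw [Finset.card_map] at hU
    rw [embed_apply_map, hf S hU, map_zero]
  · exact embed_apply_of_not_subset _ _ _ h

/-- A factor on the right has to pass the |T| odd variables of the second group. Supercommutativity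
reduces this to multiplication on the left. -/
theorem lexCoeff_mul_embed (f : Grass ο A) :
    lexCoeff α T (F * embed (lexInl ο ο') (MvPowerSeries.C (σ := σ) (R := A)) f)
      = lexCoeff α T F * f.twist (T.card : ZMod 2) := by
  have e : ∀ f, embed (lexInl ο ο') (MvPowerSeries.C (σ := σ) (R := A)) f
      = embedHom (lexInl ο ο') (MvPowerSeries.C (σ := σ) (R := A)) f := fun _ => rfl
  have key : ∀ p (f : Grass ο A), HasParity p f →
      lexCoeff α T (F * embed (lexInl ο ο') (MvPowerSeries.C (σ := σ) (R := A)) f)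
        = lexCoeff α T F * f.twist (T.card : ZMod 2) := by
    intro p f hf
    have hp : HasParity p (embed (lexInl ο ο') (MvPowerSeries.C (σ := σ) (R := A)) f) :=
      hasParity_embed (lexInl ο ο').toEmbedding _ hf
    have h2 : p + p = 0 := CharTwo.add_self_eq_zero p
    have h3 : F = (F.twist p).twist p := by rw [← twist_add_parity, h2, twist_zero]
    rw [h3, ← hp.mul_comm, lexCoeff_embed_mul, hf.mul_comm, ← h3, hf.twist_eq]
    rcases zmod_two_cases p with rfl | rfl
    · simp
    · rw [twist_one, twist_one, lexCoeff_inv, inv_zsmul, Grass.inv_inv, one_mul, smul_mul_assoc,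
        mul_smul_comm]
  rw [← part_add_part f, e, map_add, mul_add, lexCoeff_add, ← e, ← e, key 0 _ (hasParity_part 0 f),
    key 1 _ (hasParity_part 1 f), twist_add, mul_add]

end LexCoeff

end HigherKoszul

namespace HigherKoszul

open Grass

namespace Op

/-! ### Products of derivations -/

section Products

variable {ο κ : Type} [LinearOrder ο] [DecidableEq ο] [Fintype ο] {A : Type u} [CommRing A]
  [Algebra ℂ A] [LinearOrder κ] (D : κ → Module.End ℂ (Grass ο A))

/-- The product of the operators `D a`, `a ∈ S`, in increasing order. -/
def oddProd (S : Finset κ) : Module.End ℂ (Grass ο A) := ((S.sort (· ≤ ·)).map D).prod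

/-- The product of the powers of the operators `D μ` for `μ` in a list. -/
def evenProd (l : List κ) (α : κ →₀ ℕ) : Module.End ℂ (Grass ο A) :=
  (l.map fun μ => D μ ^ α μ).prod

theorem oddProd_insert {a : κ} {S : Finset κ} (h : ∀ b ∈ S, a < b) :
    oddProd D (insert a S) = D a * oddProd D S := by
  rw [oddProd, Finset.sort_insert _ (fun b hb => (h b hb).le) fun ha => lt_irrefl _ (h a ha)]
  rfl

theorem oddProd_empty : oddProd D ∅ = 1 := by simp [oddProd]

theorem evenProd_nil (α : κ →₀ ℕ) : evenProd D [] α = 1 := rfl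

theorem evenProd_cons (μ : κ) (l : List κ) (α : κ →₀ ℕ) :
    evenProd D (μ :: l) α = D μ ^ α μ * evenProd D l α := rfl

theorem evenProd_congr {l : List κ} {α β : κ →₀ ℕ} (h : ∀ μ ∈ l, α μ = β μ) :
    evenProd D l α = evenProd D l β :=
  congrArg List.prod (List.map_congr_left fun μ hμ => by rw [h μ hμ])

variable {D}

theorem isHomogeneous_oddProd (hD : ∀ a, IsSuperDer 1 (D a)) (S : Finset κ) :
    IsHomogeneous (S.card : ZMod 2) (oddProd D S) := by
  induction S using Finset.induction_on_min with
  | empty => rw [oddProd_empty]; simpa using IsHomogeneous.one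
  | insert a S h ih =>
    rw [oddProd_insert _ h, Finset.card_insert_of_notMem fun ha => lt_irrefl _ (h a ha),
      Nat.cast_succ, add_comm]
    exact (isHomogeneous_of_isSuperDer (hD a)).mul ih

theorem isHomogeneous_evenProd (hD : ∀ a, IsSuperDer 0 (D a)) (l : List κ) (α : κ →₀ ℕ) :
    IsHomogeneous 0 (evenProd D l α) := by
  induction l with
  | nil => exact IsHomogeneous.one
  | cons μ l ih =>
    rw [evenProd_cons]
    simpa using ((isHomogeneous_of_isSuperDer (hD μ)).pow (α μ)).mul ih

theorem oddProd_mul_mulLeft (hD : ∀ a, IsSuperDer 1 (D a)) {f : Grass ο A}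
    (hf : ∀ a, D a f = 0) (S : Finset κ) :
    oddProd D S * mulLeft f = mulLeft (f.twist (S.card : ZMod 2)) * oddProd D S := by
  have h0 : ∀ a (q : ZMod 2), D a (f.twist q) = 0 := fun a q => by
    rcases zmod_two_cases q with rfl | rfl
    · exact hf a
    · rw [twist_one, (hD a).map_inv, hf, Grass.inv_zero, smul_zero]
  induction S using Finset.induction_on_min with
  | empty => rw [oddProd_empty]; simp
  | insert a S h ih =>
    rw [oddProd_insert _ h, Finset.card_insert_of_notMem fun ha => lt_irrefl _ (h a ha),
      Nat.cast_succ, mul_assoc, ih, ← mul_assoc, superDer_mul_mulLeft (hD a) (h0 a _), mul_assoc,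
      add_comm, twist_add_parity]

theorem evenProd_mul_mulLeft (hD : ∀ a, IsSuperDer 0 (D a)) {f : Grass ο A}
    (hf : ∀ a, D a f = 0) (l : List κ) (α : κ →₀ ℕ) :
    evenProd D l α * mulLeft f = mulLeft f * evenProd D l α := by
  induction l with
  | nil => rfl
  | cons μ l ih =>
    have h : Commute (D μ ^ α μ) (mulLeft f) :=
      Commute.pow_left (superDer_mul_mulLeft (hD μ) (hf μ)) _
    rw [evenProd_cons, mul_assoc, ih, ← mul_assoc, h.eq, mul_assoc]

/-- Only the factor D a fails to supercommute with f, and it is replaced by 1. The sign counts the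
odd factors standing after it, which the odd f has to pass. -/
theorem bracket_oddProd_self (hD : ∀ a, IsSuperDer 1 (D a)) {f : Grass ο A} (hf : HasParity 1 f)
    {a : κ} (hDf : ∀ b, D b f = if b = a then 1 else 0) (S : Finset κ) :
    bracket A 1 (oddProd D S) (mulLeft f)
      = if a ∈ S then sgn ((S.filter fun s => a < s).card : ZMod 2) • oddProd D (S.erase a)
        else 0 := by
  induction S using Finset.induction_on_min with
  | empty => rw [oddProd_empty, bracket_one_left]; simp
  | insert b S h ih =>
    have hb : b ∉ S := fun ha => lt_irrefl _ (h b ha)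
    rw [oddProd_insert _ h, bracket_mul_left, ih, bracket_superDer (hD b) hf,
      hDf, isHomogeneous_oddProd hD]
    by_cases hab : b = a
    · subst hab
      have h1 : (insert b S).filter (fun s => b < s) = S := by
        ext x; simp only [Finset.mem_filter, Finset.mem_insert]
        exact ⟨fun hx => hx.1.resolve_left hx.2.ne', fun hx => ⟨Or.inr hx, h x hx⟩⟩
      rw [if_neg hb, if_pos rfl, if_pos (Finset.mem_insert_self _ _), h1,
        Finset.erase_insert hb, mulLeft_one, one_mul, one_mul, mul_zero, zero_add]
    · rw [if_neg hab, mulLeft_zero, zero_mul, add_zero]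
      simp only [Finset.mem_insert, or_iff_right (Ne.symm hab)]
      split_ifs with ha
      · have h1 : (insert b S).filter (fun s => a < s) = S.filter fun s => a < s := by
          rw [Finset.filter_insert, if_neg (h a ha).not_gt]
        rw [h1, mul_smul_comm, Finset.erase_insert_of_ne hab, oddProd_insert]
        exact fun x hx => h x (Finset.mem_of_mem_erase hx)
      · rw [mul_zero]

theorem bracket_oddProd_eq_zero (hD : ∀ a, IsSuperDer 1 (D a)) {p : ZMod 2} {f : Grass ο A}
    (hf : HasParity p f) (hDf : ∀ b, D b f = 0) (S : Finset κ) :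
    bracket A p (oddProd D S) (mulLeft f) = 0 := by
  induction S using Finset.induction_on_min with
  | empty => rw [oddProd_empty, bracket_one_left]
  | insert b S h ih =>
    rw [oddProd_insert _ h, bracket_mul_left, ih, bracket_superDer (hD b) hf, hDf, mulLeft_zero,
      zero_mul, mul_zero, add_zero]

/-- The commutator acts as the derivative of a power. For k = 0 the truncated exponent is harmless,
since its coefficient is zero. -/
theorem bracket_pow_self {E : Module.End ℂ (Grass ο A)} (hE : IsSuperDer 0 E) {f : Grass ο A}
    (hf : HasParity 0 f) (h1 : E f = 1) (k : ℕ) :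
    bracket A 0 (E ^ k) (mulLeft f) = k • E ^ (k - 1) := by
  induction k with
  | zero => rw [pow_zero, bracket_one_left]; simp
  | succ k ih =>
    rw [pow_succ', bracket_mul_left, ih, bracket_superDer hE hf, h1, conj_zero, mulLeft_one,
      one_mul, Nat.add_sub_cancel, succ_nsmul, mul_smul_comm]
    obtain - | k := k
    · simp
    · rw [Nat.add_sub_cancel, ← pow_succ']

theorem bracket_pow_eq_zero {E : Module.End ℂ (Grass ο A)} (hE : IsSuperDer 0 E) {p : ZMod 2}
    {f : Grass ο A} (hf : HasParity p f) (h1 : E f = 0) (k : ℕ) :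
    bracket A p (E ^ k) (mulLeft f) = 0 := by
  induction k with
  | zero => rw [pow_zero, bracket_one_left]
  | succ k ih =>
    rw [pow_succ', bracket_mul_left, ih, bracket_superDer hE hf, h1, mulLeft_zero, zero_mul,
      mul_zero, add_zero]

theorem bracket_evenProd_self (hD : ∀ a, IsSuperDer 0 (D a)) {f : Grass ο A} (hf : HasParity 0 f)
    {μ : κ} (hDf : ∀ b, D b f = if b = μ then 1 else 0) {l : List κ} (hl : l.Nodup) (α : κ →₀ ℕ) :
    bracket A 0 (evenProd D l α) (mulLeft f)
      = if μ ∈ l then α μ • evenProd D l (α - Finsupp.single μ 1) else 0 := by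
  induction l with
  | nil => rw [evenProd_nil, bracket_one_left]; simp
  | cons ν l ih =>
    rw [List.nodup_cons] at hl
    rw [evenProd_cons, bracket_mul_left, ih hl.2, conj_zero, evenProd_cons]
    by_cases h : ν = μ
    · subst h
      rw [if_neg hl.1, bracket_pow_self (hD ν) hf (by rw [hDf, if_pos rfl]),
        if_pos List.mem_cons_self, mul_zero, zero_add, smul_mul_assoc]
      congr 2
      · simp
      · refine evenProd_congr _ fun κ hκ => ?_
        rw [Finsupp.tsub_apply, Finsupp.single_eq_of_ne, Nat.sub_zero]
        rintro rfl; exact hl.1 hκ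
    · rw [bracket_pow_eq_zero (hD ν) hf (by rw [hDf, if_neg h]), zero_mul, add_zero]
      simp only [List.mem_cons, or_iff_right (Ne.symm h)]
      split_ifs
      · rw [mul_smul_comm, Finsupp.tsub_apply, Finsupp.single_eq_of_ne h, Nat.sub_zero]
      · rw [mul_zero]

theorem bracket_evenProd_eq_zero (hD : ∀ a, IsSuperDer 0 (D a)) {p : ZMod 2} {f : Grass ο A}
    (hf : HasParity p f) (hDf : ∀ b, D b f = 0) (l : List κ) (α : κ →₀ ℕ) :
    bracket A p (evenProd D l α) (mulLeft f) = 0 := by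
  induction l with
  | nil => rw [evenProd_nil, bracket_one_left]
  | cons μ l ih =>
    rw [evenProd_cons, bracket_mul_left, ih, bracket_pow_eq_zero (hD μ) hf (hDf μ), mul_zero,
      zero_mul, add_zero]

theorem bracket_mul_of_left {p : ZMod 2} {S T : Module.End ℂ (Grass ο A)}
    (h : bracket A p S T = 0) (S' : Module.End ℂ (Grass ο A)) :
    bracket A p (S * S') T = S * bracket A p S' T := by
  rw [bracket_mul_left, h, zero_mul, add_zero]

theorem bracket_mul_of_right {p : ZMod 2} {S' T : Module.End ℂ (Grass ο A)}
    (h : bracket A p S' T = 0) (S : Module.End ℂ (Grass ο A)) :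
    bracket A p (S * S') T = bracket A p S T * conj p S' := by
  rw [bracket_mul_left, h, mul_zero, zero_add]

theorem mul_ite_zsmul (c : Prop) [Decidable c] (k : ℤ) (S T : Module.End ℂ (Grass ο A)) :
    (S * if c then k • T else 0) = if c then k • (S * T) else 0 := by
  split_ifs
  · rw [mul_smul_comm]
  · rw [mul_zero]

theorem one_mem_ord : (1 : Module.End ℂ (Grass ο A)) ∈ ord ο A 1 := by
  rw [← mulLeft_one]; exact mulLeft_mem_ord _

theorem oddProd_mem_ord (hD : ∀ a, IsSuperDer 1 (D a)) (S : Finset κ) :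
    oddProd D S ∈ ord ο A (S.card + 1) := by
  induction S using Finset.induction_on_min with
  | empty => rw [oddProd_empty]; exact one_mem_ord
  | insert a S h ih =>
    rw [oddProd_insert _ h, Finset.card_insert_of_notMem fun ha => lt_irrefl _ (h a ha)]
    have := mul_mem_ord (superDer_mem_ord (hD a)) ih
    rwa [show 2 + (S.card + 1) - 1 = S.card + 1 + 1 by omega] at this

theorem pow_mem_ord {E : Module.End ℂ (Grass ο A)} (hE : IsSuperDer 0 E) (k : ℕ) :
    E ^ k ∈ ord ο A (k + 1) := by
  induction k with
  | zero => rw [pow_zero]; exact one_mem_ord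
  | succ k ih => exact mul_mem_ord ih (superDer_mem_ord hE)

theorem evenProd_mem_ord (hD : ∀ a, IsSuperDer 0 (D a)) (l : List κ) (α : κ →₀ ℕ) :
    evenProd D l α ∈ ord ο A ((l.map α).sum + 1) := by
  induction l with
  | nil => exact one_mem_ord
  | cons μ l ih =>
    have := mul_mem_ord (pow_mem_ord (hD μ) (α μ)) ih
    rwa [show α μ + 1 + ((l.map α).sum + 1) - 1 = ((μ :: l).map α).sum + 1 by
      rw [List.map_cons, List.sum_cons]; omega] at this

end Products

end Op

/-! ### Constant-coefficient operators along the fibres -/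

section Fibre

variable {n m : ℕ} {V : Opens (Fin n → ℝ)}

open Op

/-- The operator `∂/∂dx^a`. -/
def dxOp (V : Opens (Fin n → ℝ)) (m : ℕ) (a : Fin n) : Module.End ℂ (Form V m) where
  toFun := Grass.oddDeriv (toLex (Sum.inr a))
  map_add' := oddDeriv_add _
  map_smul' := oddDeriv_smul _

/-- The operator `∂/∂dξ^μ`. -/
def dxiOp (V : Opens (Fin n → ℝ)) (m : ℕ) (μ : Fin m) : Module.End ℂ (Form V m) where
  toFun := Grass.mapCoeff (CInf.partialDeriv (Sum.inr μ))
  map_add' f g := (isSuperDer_mapCoeff (CInf.isDer_partialDeriv _)).map_add f g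
  map_smul' _ _ := Grass.ext fun _ => CInf.partialDeriv_smul _ _ _

theorem isSuperDer_dxOp (V : Opens (Fin n → ℝ)) (m : ℕ) (a : Fin n) : IsSuperDer 1 (dxOp V m a) := isSuperDer_oddDeriv _

theorem isSuperDer_dxiOp (V : Opens (Fin n → ℝ)) (m : ℕ) (μ : Fin m) : IsSuperDer 0 (dxiOp V m μ) :=
  isSuperDer_mapCoeff (CInf.isDer_partialDeriv _)

/-- The de Rham differential as an operator. -/
def deRhamOp (V : Opens (Fin n → ℝ)) (m : ℕ) : Module.End ℂ (Form V m) where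
  toFun := deRham
  map_add' := isSuperDer_deRham.map_add
  map_smul' := deRham_smul

theorem isSuperDer_deRhamOp (V : Opens (Fin n → ℝ)) (m : ℕ) : IsSuperDer 1 (deRhamOp V m) := isSuperDer_deRham

/-- The operator `(∂/∂dξ)^α (∂/∂dx)^S`. -/
def fibreOp (V : Opens (Fin n → ℝ)) (m : ℕ) (α : Fin m →₀ ℕ) (S : Finset (Fin n)) :
    Module.End ℂ (Form V m) :=
  evenProd (dxiOp V m) (List.finRange m) α * oddProd (dxOp V m) S

theorem fibreDeriv_eq (α : Fin m →₀ ℕ) (S : Finset (Fin n)) (ω : Form V m) :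
    ω.fibreDeriv α S = fibreOp V m α S ω := by
  have h1 : ∀ l : List (Fin n), l.foldr (fun a η => Grass.oddDeriv (toLex (Sum.inr a)) η) ω
      = (l.map (dxOp V m)).prod ω := fun l => by
    induction l with
    | nil => rfl
    | cons a l ih => rw [List.foldr_cons, ih]; rfl
  have h2 : ∀ (l : List (Fin m)) (η : Form V m), l.foldr
      (fun μ η => (Grass.mapCoeff (CInf.partialDeriv (Sum.inr μ)))^[α μ] η) η
        = evenProd (dxiOp V m) l α η := fun l η => by
    induction l with
    | nil => rfl
    | cons μ l ih =>
      rw [List.foldr_cons, ih, evenProd_cons, Module.End.mul_apply, Module.End.pow_apply]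
      rfl
  rw [Form.fibreDeriv, h1, h2]
  rfl

theorem isHomogeneous_fibreOp (α : Fin m →₀ ℕ) (S : Finset (Fin n)) :
    IsHomogeneous (S.card : ZMod 2) (fibreOp V m α S) := by
  rw [fibreOp]
  simpa using (isHomogeneous_evenProd (isSuperDer_dxiOp V m) (List.finRange m) α).mul
    (isHomogeneous_oddProd (isSuperDer_dxOp V m) S)

theorem twist_toForm (q : ZMod 2) (f : SFun V m) :
    f.toForm.twist q = SFun.toForm (f.twist q) := by
  rcases zmod_two_cases q with rfl | rfl
  · rfl
  · rw [twist_one, twist_one, toForm_inv]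

/-- Functions on M do not depend on dx and dξ, so the derivatives along the fibres pass them, up to
the sign from the |S| odd derivatives. -/
theorem fibreOp_mul_toForm (α : Fin m →₀ ℕ) (S : Finset (Fin n)) (f : SFun V m) :
    fibreOp V m α S * mulLeft f.toForm
      = mulLeft (SFun.toForm (f.twist (S.card : ZMod 2))) * fibreOp V m α S := by
  rw [fibreOp, mul_assoc, oddProd_mul_mulLeft (isSuperDer_dxOp V m) (oddDeriv_inr_toForm · f),
    ← mul_assoc, twist_toForm,
    evenProd_mul_mulLeft (isSuperDer_dxiOp V m) (mapCoeff_inr_toForm · _), mul_assoc]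

theorem dxOp_dx (V : Opens (Fin n → ℝ)) (m : ℕ) (a b : Fin n) : dxOp V m a (Form.dx V m b) = if a = b then 1 else 0 := by
  change oddDeriv _ (gen _ : Form V m) = _
  rw [oddDeriv_gen]
  simp

theorem dxiOp_dxi (V : Opens (Fin n → ℝ)) (m : ℕ) (μ ν : Fin m) : dxiOp V m μ (Form.dxi V m ν) = if μ = ν then 1 else 0 := by
  change mapCoeff (CInf.partialDeriv (Sum.inr μ)) (const _ : Form V m) = _
  rw [mapCoeff_const (CInf.isDer_partialDeriv _).map_zero, CInf.partialDeriv_coord]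
  simp only [Sum.inr.injEq]
  split_ifs <;> simp [const_one, const_zero]

theorem dxOp_dxi (V : Opens (Fin n → ℝ)) (m : ℕ) (a : Fin n) (μ : Fin m) : dxOp V m a (Form.dxi V m μ) = 0 := oddDeriv_const _ _

theorem dxiOp_dx (V : Opens (Fin n → ℝ)) (m : ℕ) (μ : Fin m) (a : Fin n) : dxiOp V m μ (Form.dx V m a) = 0 :=
  mapCoeff_gen (CInf.isDer_partialDeriv _) _

theorem hasParity_dx (V : Opens (Fin n → ℝ)) (m : ℕ) (a : Fin n) : HasParity 1 (Form.dx V m a) := hasParity_gen _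

theorem hasParity_dxi (V : Opens (Fin n → ℝ)) (m : ℕ) (μ : Fin m) : HasParity 0 (Form.dxi V m μ) := hasParity_const _

theorem bracket_fibreOp_dx (α : Fin m →₀ ℕ) (S : Finset (Fin n)) (a : Fin n) :
    bracket _ 1 (fibreOp V m α S) (mulLeft (Form.dx V m a))
      = if a ∈ S then sgn ((S.filter fun s => a < s).card : ZMod 2) • fibreOp V m α (S.erase a)
        else 0 :=
  (bracket_mul_of_left (bracket_evenProd_eq_zero (isSuperDer_dxiOp V m) (hasParity_dx V m a)
      (fun μ => dxiOp_dx V m μ a) (List.finRange m) α) (oddProd (dxOp V m) S)).trans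
    ((congrArg _ (bracket_oddProd_self (isSuperDer_dxOp V m) (hasParity_dx V m a)
      (fun b => dxOp_dx V m b a) S)).trans (mul_ite_zsmul _ _ _ _))

theorem bracket_fibreOp_dxi (α : Fin m →₀ ℕ) (S : Finset (Fin n)) (μ : Fin m) :
    bracket _ 0 (fibreOp V m α S) (mulLeft (Form.dxi V m μ))
      = α μ • fibreOp V m (α - Finsupp.single μ 1) S := by
  have h1 := bracket_oddProd_eq_zero (isSuperDer_dxOp V m) (hasParity_dxi V m μ)
    (fun a => dxOp_dxi V m a μ) S
  have h2 := bracket_evenProd_self (isSuperDer_dxiOp V m) (hasParity_dxi V m μ)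
    (fun ν => dxiOp_dxi V m ν μ) (List.nodup_finRange m) α
  rw [if_pos (List.mem_finRange μ)] at h2
  refine (bracket_mul_of_right h1 _).trans ?_
  rw [h2, smul_mul_assoc, conj_zero, fibreOp]

theorem fibreOp_mem_ord (α : Fin m →₀ ℕ) (S : Finset (Fin n)) :
    fibreOp V m α S ∈ ord _ _ (S.card + α.degree + 1) := by
  have := mul_mem_ord (evenProd_mem_ord (isSuperDer_dxiOp V m) (List.finRange m) α)
    (oddProd_mem_ord (isSuperDer_dxOp V m) S)
  have h : ((List.finRange m).map α).sum = α.degree := by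
    rw [Finsupp.degree_eq_sum, ← List.sum_ofFn, List.ofFn_eq_map]
  rwa [h, show α.degree + 1 + (S.card + 1) - 1 = S.card + α.degree + 1 by omega] at this

end Fibre

end HigherKoszul

namespace HigherKoszul

open Grass Op

/-! ### The operators `P̂` and the higher Koszul brackets -/

section Generic

variable {ο : Type} [LinearOrder ο] [DecidableEq ο] [Fintype ο] {A : Type u} [CommRing A]
  [Algebra ℂ A] {ι : Type*}

theorem smul_sum_mul (c : ℂ) (s : Finset ι) (f : ι → Grass ο A)
    (D : ι → Module.End ℂ (Grass ο A)) (T : Module.End ℂ (Grass ο A)) :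
    (c • ∑ x ∈ s, mulLeft (f x) * D x) * T = c • ∑ x ∈ s, mulLeft (f x) * (D x * T) := by
  simp only [smul_mul_assoc, Finset.sum_mul, mul_assoc]

theorem mulLeft_zsmul_mul (k : ℤ) (f : Grass ο A) (D : Module.End ℂ (Grass ο A)) :
    mulLeft (k • f) * D = k • (mulLeft f * D) := by
  rw [mulLeft_zsmul, smul_mul_assoc]

theorem mulLeft_nsmul_mul (k : ℕ) (f : Grass ο A) (D : Module.End ℂ (Grass ο A)) :
    mulLeft (k • f) * D = k • (mulLeft f * D) := by
  rw [show mulLeft (k • f) = k • mulLeft f from map_nsmul (mulLeftHom ο A) k f, smul_mul_assoc]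

theorem mulLeft_mul_zsmul (k : ℤ) (f : Grass ο A) (D : Module.End ℂ (Grass ο A)) :
    mulLeft f * (k • D) = k • (mulLeft f * D) := mul_smul_comm _ _ _

theorem mulLeft_mul_nsmul (k : ℕ) (f : Grass ο A) (D : Module.End ℂ (Grass ο A)) :
    mulLeft f * (k • D) = k • (mulLeft f * D) := mul_smul_comm _ _ _

theorem mulLeft_zero_mul (D : Module.End ℂ (Grass ο A)) : mulLeft (0 : Grass ο A) * D = 0 := by
  rw [mulLeft_zero, zero_mul]

theorem bracket_sum_smul (p : ZMod 2) (c : ℂ) (s : Finset ι)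
    (f : ι → Grass ο A) (D : ι → Module.End ℂ (Grass ο A)) {g : Grass ο A} (hg : HasParity p g) :
    bracket A p (c • ∑ x ∈ s, mulLeft (f x) * D x) (mulLeft g)
      = c • ∑ x ∈ s, mulLeft (f x) * bracket A p (D x) (mulLeft g) := by
  rw [map_smul, LinearMap.smul_apply, map_sum, LinearMap.sum_apply]
  congr 1
  exact Finset.sum_congr rfl fun x _ => bracket_mul_of_left (bracket_mulLeft_mulLeft hg _) _

theorem sum_mem_ord {c : ℂ} {k : ℕ} {s : Finset ι} {f : ι → Grass ο A}
    {D : ι → Module.End ℂ (Grass ο A)} (h : ∀ x ∈ s, D x ∈ ord ο A (k + 1)) :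
    c • ∑ x ∈ s, mulLeft (f x) * D x ∈ ord ο A (k + 1) :=
  Submodule.smul_mem _ _ (Submodule.sum_mem _ fun x hx => by
    have := mul_mem_ord (mulLeft_mem_ord (f x)) (h x hx)
    rwa [show 1 + (k + 1) - 1 = k + 1 by omega] at this)

end Generic

section Quantization

variable {n m : ℕ} {V : Opens (Fin n → ℝ)}

/-- The indices of the fibrewise derivatives of order `j`. -/
def fibreIdx (n m j : ℕ) : Finset (Finset (Fin n) × (Fin m →₀ ℕ)) :=
  (Finset.HasAntidiagonal.antidiagonal j).biUnion fun q =>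
    Finset.powersetCard q.1 (Finset.univ : Finset (Fin n)) ×ˢ
      Finset.finsuppAntidiag (Finset.univ : Finset (Fin m)) q.2

theorem mem_fibreIdx {j : ℕ} {x : Finset (Fin n) × (Fin m →₀ ℕ)} :
    x ∈ fibreIdx n m j ↔ x.1.card + x.2.degree = j := by
  simp only [fibreIdx, Finset.mem_biUnion, Finset.HasAntidiagonal.mem_antidiagonal, Finset.mem_product,
    Finset.mem_powersetCard_univ, Finset.mem_finsuppAntidiag, Finset.subset_univ, and_true,
    Finsupp.degree_eq_sum]
  constructor
  · rintro ⟨q, h, h1, h2⟩; rw [h1, h2, h]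
  · intro h; exact ⟨(_, _), h, rfl, rfl⟩

theorem sum_fibreIdx {M : Type*} [AddCommMonoid M] (j : ℕ)
    (F : Finset (Fin n) → (Fin m →₀ ℕ) → M) : ∑ x ∈ fibreIdx n m j, F x.1 x.2
      = ∑ q ∈ Finset.HasAntidiagonal.antidiagonal j,
        ∑ S ∈ Finset.powersetCard q.1 (Finset.univ : Finset (Fin n)),
          ∑ α ∈ Finset.finsuppAntidiag (Finset.univ : Finset (Fin m)) q.2, F S α := by
  rw [fibreIdx, Finset.sum_biUnion]
  · exact Finset.sum_congr rfl fun q _ => Finset.sum_product _ _ _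
  · rintro q hq q' hq' hne
    refine Finset.disjoint_left.2 fun x hx hx' => hne ?_
    rw [Finset.mem_product, Finset.mem_powersetCard_univ, Finset.mem_finsuppAntidiag] at hx hx'
    exact Prod.ext (hx.1.symm.trans hx'.1) (hx.2.1.symm.trans hx'.2.1)

/-- The term of order `j` in `ħ` of the operator `Q̂`. -/
def quantOp (Q : Mult V m) (j : ℕ) : Module.End ℂ (Form V m) :=
  (-Complex.I) ^ j • ∑ x ∈ fibreIdx n m j,
    mulLeft (Q.coeff x.2 x.1).toForm * fibreOp V m x.2 x.1

theorem quantOp_apply (Q : Mult V m) (j : ℕ) (ω : Form V m) :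
    quantOp Q j ω = quantizeCoeff Q j ω := by
  rw [quantOp, quantizeCoeff, LinearMap.smul_apply, LinearMap.sum_apply,
    ← sum_fibreIdx j fun S α => (Q.coeff α S).toForm * ω.fibreDeriv α S]
  congr 1
  refine Finset.sum_congr rfl fun x _ => ?_
  rw [fibreDeriv_eq]; rfl

theorem quantOp_add (Q R : Mult V m) (j : ℕ) : quantOp (Q + R) j = quantOp Q j + quantOp R j := by
  rw [quantOp, quantOp, quantOp, ← smul_add, ← Finset.sum_add_distrib]
  congr 1
  refine Finset.sum_congr rfl fun x _ => ?_
  rw [← add_mul, ← mulLeft_add, ← toForm_add]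
  rfl

/-- `Q ↦ Q̂` as an additive map. -/
def quantOpHom (V : Opens (Fin n → ℝ)) (m j : ℕ) : Mult V m →+ Module.End ℂ (Form V m) :=
  AddMonoidHom.mk' (fun Q => quantOp Q j) fun Q R => quantOp_add Q R j

theorem quantOpHom_apply (Q : Mult V m) (j : ℕ) : quantOpHom V m j Q = quantOp Q j := rfl

theorem multCoeff_inv (Q : Mult V m) (α : Fin m →₀ ℕ) (S : Finset (Fin n)) :
    Mult.coeff Q.inv α S = sgn (S.card : ZMod 2) • Grass.inv (Q.coeff α S) :=
  lexCoeff_inv α S Q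

theorem multCoeff_mul_toMult (Q : Mult V m) (f : SFun V m) (α : Fin m →₀ ℕ)
    (S : Finset (Fin n)) :
    Mult.coeff (Q * f.toMult) α S = Q.coeff α S * f.twist (S.card : ZMod 2) :=
  lexCoeff_mul_embed α S Q f

theorem multCoeff_oddDeriv (Q : Mult V m) (a : Fin n) (α : Fin m →₀ ℕ)
    (S : Finset (Fin n)) :
    Mult.coeff (Q.oddDeriv (toLex (Sum.inr a))) α S = if a ∈ S then 0 else
      sgn ((S.filter fun s => s < a).card : ZMod 2) • Grass.inv (Q.coeff α (insert a S)) :=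
  lexCoeff_oddDeriv_inr α S Q a

theorem multCoeff_pderiv (Q : Mult V m) (μ : Fin m) (α : Fin m →₀ ℕ) (S : Finset (Fin n)) :
    Mult.coeff (Q.mapCoeff (MvPowerSeries.pderiv _ μ)) α S
      = (α μ + 1) • Q.coeff (α + Finsupp.single μ 1) S :=
  lexCoeff_pderiv α S Q μ

theorem conj_quantOp (Q : Mult V m) (j : ℕ) : conj 1 (quantOp Q j) = quantOp Q.inv j := by
  rw [quantOp, quantOp, map_smul, map_sum]
  congr 1
  refine Finset.sum_congr rfl fun x _ => ?_
  rw [Op.conj_mul, conj_one_mulLeft, isHomogeneous_fibreOp, multCoeff_inv, toForm_zsmul, toForm_inv,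
    mulLeft_zsmul, one_mul, smul_mul_assoc, mul_smul_comm]

theorem mulLeft_multCoeff_mul (Q : Mult V m) (f : SFun V m)
    (x : Finset (Fin n) × (Fin m →₀ ℕ)) :
    mulLeft (SFun.toForm (Mult.coeff (Q * f.toMult) x.2 x.1)) * fibreOp V m x.2 x.1
      = mulLeft (SFun.toForm (Q.coeff x.2 x.1)) * (fibreOp V m x.2 x.1 * mulLeft f.toForm) := by
  rw [fibreOp_mul_toForm, multCoeff_mul_toMult, toForm_mul, mulLeft_mul, mul_assoc]

/-- The coefficients stand to the left of the fibre derivatives, which pass functions on M; hence a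
function factor can be taken out exactly, without terms of other orders in ħ. -/
theorem quantOp_mul_toMult (Q : Mult V m) (f : SFun V m) (j : ℕ) :
    quantOp (Q * f.toMult) j = quantOp Q j * mulLeft f.toForm := by
  refine Eq.trans ?_ (smul_sum_mul _ _ _ _ _).symm
  rw [quantOp, Finset.sum_congr rfl fun x _ => mulLeft_multCoeff_mul Q f x]

theorem bracket_fibreOp_toForm (α : Fin m →₀ ℕ) (S : Finset (Fin n)) {p : ZMod 2} {f : SFun V m}
    (hf : HasParity p f) :
    bracket _ p (fibreOp V m α S) (mulLeft f.toForm) = 0 := by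
  rw [bracket_apply, fibreOp_mul_toForm, isHomogeneous_fibreOp, hf.twist_eq, toForm_zsmul,
    mulLeft_zsmul, smul_mul_assoc, mul_smul_comm, sub_self]

theorem bracket_quantOp_toForm (Q : Mult V m) (j : ℕ) {p : ZMod 2} {f : SFun V m}
    (hf : HasParity p f) : bracket _ p (quantOp Q j) (mulLeft f.toForm) = 0 := by
  rw [quantOp, bracket_sum_smul p _ _ _ _ (HasParity_toForm hf), Finset.sum_eq_zero, smul_zero]
  intro x _
  rw [bracket_fibreOp_toForm x.2 x.1 hf]
  exact ring_mul_zero _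

/-- Erasing a matches the indices of order j + 1 that contain a with those of order j that do not.
This is the shift of order when a symbol is differentiated along an odd antimomentum. -/
theorem sum_fibreIdx_erase {M : Type*} [AddCommMonoid M] (j : ℕ) (a : Fin n)
    (F : Finset (Fin n) → (Fin m →₀ ℕ) → M) :
    ∑ x ∈ fibreIdx n m (j + 1), (if a ∈ x.1 then F (x.1.erase a) x.2 else 0)
      = ∑ x ∈ fibreIdx n m j, if a ∈ x.1 then 0 else F x.1 x.2 := by
  have h : ∀ x : Finset (Fin n) × (Fin m →₀ ℕ), (if a ∈ x.1 then 0 else F x.1 x.2)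
      = if a ∉ x.1 then F x.1 x.2 else 0 := fun x => by rw [ite_not]
  rw [Finset.sum_congr rfl fun x _ => h x, ← Finset.sum_filter, ← Finset.sum_filter]
  refine Finset.sum_nbij' (fun x => (x.1.erase a, x.2)) (fun x => (insert a x.1, x.2)) ?_ ?_ ?_ ?_ ?_
  · intro x hx
    rw [Finset.mem_filter, mem_fibreIdx] at hx ⊢
    have := Finset.card_erase_add_one hx.2
    exact ⟨by change (x.1.erase a).card + x.2.degree = j; omega, Finset.notMem_erase _ _⟩
  · intro x hx
    rw [Finset.mem_filter, mem_fibreIdx] at hx ⊢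
    have := Finset.card_insert_of_notMem hx.2
    exact ⟨by change (insert a x.1).card + x.2.degree = j + 1; omega, Finset.mem_insert_self _ _⟩
  · intro x hx
    exact Prod.ext (Finset.insert_erase (Finset.mem_filter.1 hx).2) rfl
  · intro x hx
    exact Prod.ext (Finset.erase_insert (Finset.mem_filter.1 hx).2) rfl
  · intro x hx; rfl

/-- The even analogue of `sum_fibreIdx_erase`; terms with zero exponent are excluded because there
the truncated subtraction would not lower the order. -/
theorem sum_fibreIdx_sub_single {M : Type*} [AddCommMonoid M] (j : ℕ) (μ : Fin m)
    (F : Finset (Fin n) → (Fin m →₀ ℕ) → M) :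
    ∑ x ∈ fibreIdx n m (j + 1), (if x.2 μ = 0 then 0 else F x.1 (x.2 - Finsupp.single μ 1))
      = ∑ x ∈ fibreIdx n m j, F x.1 x.2 := by
  simp_rw [← ite_not (_ = 0) _ (0 : M)]
  rw [← Finset.sum_filter]
  refine Finset.sum_nbij' (fun x => (x.1, x.2 - Finsupp.single μ 1))
    (fun x => (x.1, x.2 + Finsupp.single μ 1)) ?_ ?_ ?_ ?_ ?_
  · intro x hx
    rw [Finset.mem_filter, mem_fibreIdx] at hx
    rw [mem_fibreIdx]
    have h1 : x.2 - Finsupp.single μ 1 + Finsupp.single μ 1 = x.2 :=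
      tsub_add_cancel_of_le (Finsupp.single_le_iff.2 (Nat.one_le_iff_ne_zero.2 hx.2))
    have h2 := congrArg Finsupp.degree h1
    rw [map_add, Finsupp.degree_single] at h2
    change x.1.card + Finsupp.degree (x.2 - Finsupp.single μ 1) = j
    omega
  · intro x hx
    rw [mem_fibreIdx] at hx
    rw [Finset.mem_filter, mem_fibreIdx]
    refine ⟨?_, by simp⟩
    change x.1.card + Finsupp.degree (x.2 + Finsupp.single μ 1) = j + 1
    rw [map_add, Finsupp.degree_single]
    omega
  · intro x hx
    refine Prod.ext rfl (tsub_add_cancel_of_le (Finsupp.single_le_iff.2 ?_))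
    exact Nat.one_le_iff_ne_zero.2 (Finset.mem_filter.1 hx).2
  · intro x hx
    exact Prod.ext rfl (add_tsub_cancel_right _ _)
  · intro x hx; rfl

theorem sgn_card_filter {S : Finset (Fin n)} {a : Fin n} (h : a ∉ S) :
    sgn ((S.filter fun s => a < s).card : ZMod 2)
      = sgn (S.card : ZMod 2) * sgn ((S.filter fun s => s < a).card : ZMod 2) := by
  have h1 : (S.filter fun s => a < s).card + (S.filter fun s => s < a).card = S.card := by
    rw [← Finset.card_filter_add_card_filter_not (s := S) (fun s => a < s)]
    congr 2
    ext s
    simp only [Finset.mem_filter, not_lt]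
    refine and_congr_right fun hs => ⟨le_of_lt, fun h' => lt_of_le_of_ne h' ?_⟩
    rintro rfl; exact h hs
  rw [← h1, Nat.cast_add, sgn_add, mul_assoc, sgn_mul_self, mul_one]

-- Commuting with dx^a removes one factor ∂/∂dx^a, that is, differentiates the symbol along x*_a and
-- lowers the power of ħ by one. The additional factor -i and the sign between the derivative and
-- the involution combine to i.
set_option maxHeartbeats 1000000 in
theorem bracket_quantOp_dx (Q : Mult V m) (j : ℕ) (a : Fin n) :
    bracket _ 1 (quantOp Q (j + 1)) (mulLeft (Form.dx V m a))
      = Complex.I • quantOp (Grass.oddDeriv (toLex (Sum.inr a)) Q.inv) j := by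
  let G : Finset (Fin n) → (Fin m →₀ ℕ) → Module.End ℂ (Form V m) := fun S α =>
    sgn ((S.filter fun s => a < s).card : ZMod 2) •
      (mulLeft (Q.coeff α (insert a S)).toForm * fibreOp V m α S)
  have h1 : ∀ x : Finset (Fin n) × (Fin m →₀ ℕ), mulLeft (Q.coeff x.2 x.1).toForm *
      bracket _ 1 (fibreOp V m x.2 x.1) (mulLeft (Form.dx V m a))
        = if a ∈ x.1 then G (x.1.erase a) x.2 else 0 := fun x => by
    rw [bracket_fibreOp_dx]
    split_ifs with h
    · rw [mulLeft_mul_zsmul]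
      simp only [G, Finset.insert_erase h]
      rw [Finset.filter_erase, Finset.erase_eq_of_notMem fun h' =>
        lt_irrefl a (Finset.mem_filter.1 h').2]
    · exact ring_mul_zero _
  have h2 : ∀ x : Finset (Fin n) × (Fin m →₀ ℕ),
      mulLeft (Mult.coeff (Grass.oddDeriv (toLex (Sum.inr a)) Q.inv) x.2 x.1).toForm *
        fibreOp V m x.2 x.1 = (-1 : ℂ) • if a ∈ x.1 then 0 else G x.1 x.2 := fun x => by
    rw [multCoeff_oddDeriv]
    split_ifs with h
    · rw [toForm_zero, mulLeft_zero_mul, smul_zero]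
    · rw [multCoeff_inv, Grass.inv_zsmul, Grass.inv_inv, smul_smul,
        Finset.card_insert_of_notMem h, Nat.cast_succ, sgn_add, toForm_zsmul, mulLeft_zsmul_mul,
        neg_one_smul]
      simp only [G]
      rw [← neg_smul, sgn_card_filter h]
      congr 1
      rw [sgn_one]; ring
  rw [quantOp, bracket_sum_smul 1 _ _ _ _ (hasParity_dx V m a), quantOp,
    Finset.sum_congr rfl fun x _ => h1 x, Finset.sum_congr rfl fun x _ => h2 x,
    sum_fibreIdx_erase, ← Finset.smul_sum, smul_smul, smul_smul]
  congr 1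
  ring

/-- Here the removed derivative ∂/∂dξ^μ is even, so only the factor -i of the lost power of ħ/i
remains. -/
theorem bracket_quantOp_dxi (Q : Mult V m) (j : ℕ) (μ : Fin m) :
    bracket _ 0 (quantOp Q (j + 1)) (mulLeft (Form.dxi V m μ))
      = (-Complex.I) • quantOp (Q.mapCoeff (MvPowerSeries.pderiv _ μ)) j := by
  let G : Finset (Fin n) → (Fin m →₀ ℕ) → Module.End ℂ (Form V m) := fun S α =>
    (α μ + 1) • (mulLeft (Q.coeff (α + Finsupp.single μ 1) S).toForm * fibreOp V m α S)
  have h1 : ∀ x : Finset (Fin n) × (Fin m →₀ ℕ), mulLeft (Q.coeff x.2 x.1).toForm *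
      bracket _ 0 (fibreOp V m x.2 x.1) (mulLeft (Form.dxi V m μ))
        = if x.2 μ = 0 then 0 else G x.1 (x.2 - Finsupp.single μ 1) := fun x => by
    rw [bracket_fibreOp_dxi, mulLeft_mul_nsmul]
    split_ifs with h
    · rw [h, zero_nsmul]
    · have h3 : x.2 - Finsupp.single μ 1 + Finsupp.single μ 1 = x.2 :=
        tsub_add_cancel_of_le (Finsupp.single_le_iff.2 (Nat.one_le_iff_ne_zero.2 h))
      simp only [G, h3]
      congr 1
      rw [Finsupp.tsub_apply, Finsupp.single_eq_same]
      omega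
  have h2 : ∀ x : Finset (Fin n) × (Fin m →₀ ℕ),
      mulLeft (Mult.coeff (Q.mapCoeff (MvPowerSeries.pderiv _ μ)) x.2 x.1).toForm *
        fibreOp V m x.2 x.1 = G x.1 x.2 := fun x => by
    rw [multCoeff_pderiv, show SFun.toForm ((x.2 μ + 1) • Q.coeff (x.2 + Finsupp.single μ 1) x.1)
      = (x.2 μ + 1) • SFun.toForm (Q.coeff (x.2 + Finsupp.single μ 1) x.1) from
      map_nsmul (toFormHom V m) _ _, mulLeft_nsmul_mul]
  rw [quantOp, bracket_sum_smul 0 _ _ _ _ (hasParity_dxi V m μ), quantOp,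
    Finset.sum_congr rfl fun x _ => h1 x, Finset.sum_congr rfl fun x _ => h2 x,
    sum_fibreIdx_sub_single, smul_smul]
  congr 1
  ring

/-- Each power of ħ comes with one derivative along the fibres, so the coefficient of ħ^j has order
at most j. The divisibility by ħ^k and the Leibniz rule in the limit both rest on this. -/
theorem quantOp_mem_ord (Q : Mult V m) (j : ℕ) : quantOp Q j ∈ ord _ _ (j + 1) :=
  sum_mem_ord fun x hx => by
    have := fibreOp_mem_ord (V := V) x.2 x.1
    rwa [mem_fibreIdx.1 hx] at this

end Quantization

end HigherKoszul

/-! ### Commutators of Q̂ and of [d, Q̂] with functions and with differentials of functions. -/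

namespace HigherKoszul

open Grass Op

section Generic

variable {ο : Type} [LinearOrder ο] [DecidableEq ο] [Fintype ο] {A : Type u} [CommRing A]
  [Algebra ℂ A] (S : Module.End ℂ (Grass ο A)) {D : Module.End ℂ (Grass ο A)}

theorem bracket_mulLeft_mul (p q : ZMod 2) (f g : Grass ο A)
    (h : bracket A q (conj p S) (mulLeft g) = 0) :
    bracket A (p + q) S (mulLeft (f * g)) = bracket A p S (mulLeft f) * mulLeft g := by
  rw [mulLeft_mul, bracket_mul_right, h, mul_zero, add_zero]

theorem bracket_mulLeft_sum {ι κ : Type} [Fintype ι] [Fintype κ] (p : ZMod 2) (f : ι → Grass ο A)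
    (g : κ → Grass ο A) :
    bracket A p S (mulLeft (∑ i, f i + ∑ k, g k))
      = ∑ i, bracket A p S (mulLeft (f i)) + ∑ k, bracket A p S (mulLeft (g k)) := by
  rw [← mulLeftHom_apply, map_add, map_sum, map_sum, map_add, map_sum, map_sum]
  rfl

theorem sum_smul_add_sum_neg_smul {E : Type*} [AddCommGroup E] [Module ℂ E] {ι κ : Type}
    [Fintype ι] [Fintype κ] (c : ℂ) (f : ι → E) (g : κ → E) :
    ∑ i, c • f i + ∑ k, (-c) • g k = c • (∑ i, f i - ∑ k, g k) := by
  rw [← Finset.smul_sum, ← Finset.smul_sum, neg_smul, smul_sub, sub_eq_add_neg]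

variable {S} in
theorem bracket_mulLeft_sum_eq {M : Type*} [AddCommGroup M] {ι κ : Type} [Fintype ι] [Fintype κ]
    {p : ZMod 2} {f : ι → Grass ο A} {g : κ → Grass ο A} {c : ℂ}
    (T : M →+ Module.End ℂ (Grass ο A)) {x : ι → M} {y : κ → M}
    (h1 : ∀ i, bracket A p S (mulLeft (f i)) = c • T (x i))
    (h2 : ∀ k, bracket A p S (mulLeft (g k)) = (-c) • T (y k)) :
    bracket A p S (mulLeft (∑ i, f i + ∑ k, g k)) = c • T (∑ i, x i - ∑ k, y k) := by
  rw [bracket_mulLeft_sum, map_sub, map_sum, map_sum, ← sum_smul_add_sum_neg_smul]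
  exact congrArg₂ (· + ·) (Finset.sum_congr rfl fun i _ => h1 i) (Finset.sum_congr rfl fun k _ => h2 k)

theorem bracket_smul_left (p : ZMod 2) (c : ℂ) (T : Module.End ℂ (Grass ο A)) :
    bracket A p (c • S) T = c • bracket A p S T := by
  rw [map_smul, LinearMap.smul_apply]

theorem bracket_add_left (p : ZMod 2) (S' T : Module.End ℂ (Grass ο A)) :
    bracket A p (S + S') T = bracket A p S T + bracket A p S' T := by
  rw [map_add, LinearMap.add_apply]

/-- The Jacobi identity splits the commutator of [d, S] with f into the commutator of S with df and
the commutator of d with [S, f]. In the two applications below one of the terms vanishes: [S, f] = 0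
for functions, and d(df) = 0 for differentials. -/
theorem bracket_neg_bracket (hD : IsSuperDer 1 D) {p : ZMod 2} {f : Grass ο A}
    (hf : HasParity p f) : bracket A p (-bracket A 1 S D) (mulLeft f)
      = -(bracket A (1 + p) S (mulLeft (D f)) +
        sgn p • bracket A 1 (bracket A p S (mulLeft f)) D) := by
  rw [map_neg, LinearMap.neg_apply, bracket_bracket _ (isHomogeneous_of_isSuperDer hD)
    (isHomogeneous_mulLeft hf), bracket_superDer hD hf, one_mul]

variable {S}

theorem bracket_neg_bracket_of_left (hD : IsSuperDer 1 D) {p : ZMod 2} {f : Grass ο A}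
    (hf : HasParity p f) (h : bracket A p S (mulLeft f) = 0) :
    bracket A p (-bracket A 1 S D) (mulLeft f) = -bracket A (1 + p) S (mulLeft (D f)) := by
  rw [bracket_neg_bracket S hD hf, h, bracket_zero_left, smul_zero, add_zero]

theorem bracket_neg_bracket_of_right (hD : IsSuperDer 1 D) {p : ZMod 2} {f : Grass ο A}
    (hf : HasParity p f) (h : D f = 0) {c : ℂ} {T : Module.End ℂ (Grass ο A)}
    (hT : bracket A p S (mulLeft f) = c • T) :
    bracket A p (-bracket A 1 S D) (mulLeft f) = (-c) • sgn (1 + p) • -bracket A 1 T D := by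
  rw [bracket_neg_bracket S hD hf, h, mulLeft_zero, map_zero, zero_add, hT, bracket_smul_left,
    sgn_add, sgn_one, neg_one_mul, neg_smul, neg_smul, smul_neg, neg_neg, smul_comm, smul_neg, smul_neg]

end Generic

section OperatorSystem

variable {n m : ℕ} {V : Opens (Fin n → ℝ)}

theorem hasParity_deRham_toForm {p : ZMod 2} {f : SFun V m} (hf : HasParity p f) :
    HasParity (1 + p) (deRham f.toForm) := isSuperDer_deRham.hasParity (HasParity_toForm hf)

theorem bracket_quantOp_dx_mul (Q : Mult V m) (j : ℕ) (a : Fin n) {p : ZMod 2} {g : SFun V m}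
    (hg : HasParity p g) :
    bracket _ (1 + p) (quantOp Q (j + 1)) (mulLeft (Form.dx V m a * g.toForm))
      = Complex.I • quantOp (Grass.oddDeriv (toLex (Sum.inr a)) Q.inv * g.toMult) j := by
  rw [bracket_mulLeft_mul, bracket_quantOp_dx, quantOp_mul_toMult]
  · exact smul_mul_assoc _ _ _
  · rw [conj_quantOp]; exact bracket_quantOp_toForm _ _ hg

theorem bracket_quantOp_dxi_mul (Q : Mult V m) (j : ℕ) (μ : Fin m) {p : ZMod 2} {g : SFun V m}
    (hg : HasParity p g) :
    bracket _ p (quantOp Q (j + 1)) (mulLeft (Form.dxi V m μ * g.toForm))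
      = (-Complex.I) • quantOp (Q.mapCoeff (MvPowerSeries.pderiv _ μ) * g.toMult) j := by
  have := bracket_mulLeft_mul (quantOp Q (j + 1)) 0 p (Form.dxi V m μ) g.toForm
    (bracket_quantOp_toForm Q (j + 1) hg)
  rw [zero_add] at this
  rw [this, bracket_quantOp_dxi, quantOp_mul_toMult]
  exact smul_mul_assoc _ _ _

/-- In df = dx^a ∂f/∂x^a + dξ^μ ∂f/∂ξ^μ the commutator acts only on dx^a and dξ^μ, since Q̂
supercommutes with functions. The fibre derivatives of the symbol, multiplied by the derivatives of
f, are the terms of the Schouten bracket. -/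
theorem bracket_quantOp_deRham (Q : Mult V m) (j : ℕ) {p : ZMod 2} {f : SFun V m}
    (hf : HasParity p f) :
    bracket _ (1 + p) (quantOp Q (j + 1)) (mulLeft (deRham f.toForm))
      = Complex.I • quantOp (schouten Q.inv f.toMult) j := by
  have h1 : ∀ a, HasParity p (f.mapCoeff (CInf.partialDeriv a)) := fun a => by
    simpa using (isSuperDer_mapCoeff (CInf.isDer_partialDeriv a)).hasParity hf
  have h2 : ∀ μ, HasParity (1 + p) (f.oddDeriv μ) := fun μ => (isSuperDer_oddDeriv μ).hasParity hf
  rw [schouten_toMult, Grass.inv_inv, deRham_toForm]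
  exact bracket_mulLeft_sum_eq (quantOpHom V m j)
    (fun a => bracket_quantOp_dx_mul Q j a (h1 a)) (fun μ => bracket_quantOp_dxi_mul Q j μ (h2 μ))

theorem schouten_add_right (Q : Mult V m) (f g : SFun V m) :
    schouten Q (SFun.toMult (f + g)) = schouten Q f.toMult + schouten Q g.toMult := by
  have h : ∀ f g : SFun V m, SFun.toMult (f + g) = f.toMult + g.toMult :=
    map_add (toMultHom V m)
  have h1 : ∀ a, (f + g).mapCoeff (CInf.partialDeriv a)
      = f.mapCoeff (CInf.partialDeriv a) + g.mapCoeff (CInf.partialDeriv a) := fun a =>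
    (isSuperDer_mapCoeff (CInf.isDer_partialDeriv a)).map_add f g
  rw [schouten_toMult, schouten_toMult, schouten_toMult]
  simp only [oddDeriv_add, h1, h, mul_add, Finset.sum_add_distrib]
  abel

/-- The coefficients in `ħ` of the operator `[d, Q̂]`. -/
def deltaOp (Q : Mult V m) (j : ℕ) : Module.End ℂ (Form V m) :=
  -bracket _ 1 (quantOp Q j) (deRhamOp V m)

theorem deltaOp_apply (Q : Mult V m) (j : ℕ) (ω : Form V m) :
    deltaOp Q j ω = deRham (quantOp Q.inv j ω) - quantOp Q j (deRham ω) := by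
  rw [deltaOp, bracket_apply, neg_sub, conj_quantOp]; rfl

theorem deltaOp_add (Q R : Mult V m) (j : ℕ) : deltaOp (Q + R) j = deltaOp Q j + deltaOp R j := by
  rw [deltaOp, deltaOp, deltaOp, quantOp_add, bracket_add_left, neg_add]

theorem deltaOp_mem_ord (Q : Mult V m) (j : ℕ) : deltaOp Q j ∈ ord _ _ (j + 1) :=
  neg_mem (bracket_superDer_mem_ord (isSuperDer_deRhamOp V m) (quantOp_mem_ord Q j))

theorem bracket_deltaOp_toForm (Q : Mult V m) (j : ℕ) {p : ZMod 2} {f : SFun V m}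
    (hf : HasParity p f) : bracket _ p (deltaOp Q (j + 1)) (mulLeft f.toForm)
      = (-Complex.I) • quantOp (schouten Q.inv f.toMult) j :=
  (bracket_neg_bracket_of_left (isSuperDer_deRhamOp V m) (HasParity_toForm hf)
    (bracket_quantOp_toForm Q (j + 1) hf)).trans (by
      rw [neg_smul]
      exact congrArg _ (bracket_quantOp_deRham Q j hf))

theorem bracket_deltaOp_deRham (Q : Mult V m) (j : ℕ) {p : ZMod 2} {f : SFun V m}
    (hf : HasParity p f) : bracket _ (1 + p) (deltaOp Q (j + 1)) (mulLeft (deRham f.toForm))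
      = (-Complex.I) • sgn p • deltaOp (schouten Q.inv f.toMult) j := by
  have h : deRhamOp V m (deRham f.toForm) = 0 := deRham_deRham _
  refine (bracket_neg_bracket_of_right (isSuperDer_deRhamOp V m) (hasParity_deRham_toForm hf) h
    (bracket_quantOp_deRham Q j hf)).trans ?_
  rw [← add_assoc, show (1 + 1 : ZMod 2) = 0 from rfl, zero_add]
  rfl

end OperatorSystem

end HigherKoszul

/-! ### The model of the brackets by operators depending on ħ, and the classical limit. -/

namespace HigherKoszul

open Grass Op

section Generic

variable {ο : Type} [LinearOrder ο] [DecidableEq ο] [Fintype ο] {A : Type u} [CommRing A]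
  [Algebra ℂ A] {S : Module.End ℂ (Grass ο A)}

theorem comm_comm (S : Module.End ℂ (Grass ο A)) {p q : ZMod 2} {f g : Grass ο A}
    (hf : HasParity p f) (hg : HasParity q g) :
    comm (comm S f) g = sgn (p * q) • comm (comm S g) f := by
  rw [comm_of_hasParity S hf, comm_of_hasParity S hg, comm_of_hasParity _ hf,
    comm_of_hasParity _ hg, bracket_bracket S (isHomogeneous_mulLeft hf)
    (isHomogeneous_mulLeft hg), bracket_mulLeft_mulLeft hg, map_zero, zero_add]

theorem conj_comm (S : Module.End ℂ (Grass ο A)) {r p : ZMod 2} {f : Grass ο A}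
    (hS : conj 1 S = sgn r • S) (hf : HasParity p f) :
    conj 1 (comm S f) = sgn (r + p) • comm S f := by
  rw [comm_of_hasParity S hf, conj_bracket, conj_one_mulLeft, hf.inv_eq, mulLeft_zsmul, map_zsmul,
    hS, map_zsmul, LinearMap.smul_apply, smul_smul, ← sgn_add, add_comm p r]

theorem hasParity_apply_one {r : ZMod 2} (hS : conj 1 S = sgn r • S) : HasParity r (S 1) :=
  hasParity_of_inv_eq (by rw [← conj_apply_one_one, hS, LinearMap.smul_apply])

/-- For an operator of order at most one, [S, f] has order zero and so supercommutes with
multiplication by g. Hence g can be taken out of the value at 1, and the derivation property of the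
commutator becomes the Leibniz rule. -/
theorem comm_mul_apply_one {r p q : ZMod 2} {f g : Grass ο A} (hS : conj 1 S = sgn r • S)
    (hS2 : S ∈ ord ο A 2) (hf : HasParity p f) (hg : HasParity q g) :
    comm S (f * g) 1 = comm S f 1 * g + sgn (p * r) • (f * comm S g 1) := by
  have h1 := comm_mem_ord hS2 f
  have h2 := eq_of_mem_ord_one h1 hg
  have h3 := isHomogeneous_of_conj_one (conj_comm S hS hf)
  have h4 := isHomogeneous_of_conj_one hS
  have h5 := hasParity_apply_one (conj_comm S hS hf)
  rw [comm_of_hasParity S (hf.mul hg), mulLeft_mul, bracket_mul_right, h4, map_zsmul,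
    LinearMap.smul_apply, mul_smul_comm, ← comm_of_hasParity S hf, ← comm_of_hasParity S hg, h2,
    h3, mul_smul_comm, LinearMap.add_apply, LinearMap.smul_apply, LinearMap.smul_apply,
    Module.End.mul_apply, Module.End.mul_apply, LinearMap.mulLeft_apply, LinearMap.mulLeft_apply,
    h5.mul_comm, hg.twist_eq, smul_mul_assoc, mul_comm q]

/-- The bracket of a power series of operators with the operator of multiplication by a
superfunction, divided by `ħ/i`. -/
def shiftComm (ο : Type) (A : Type u) [LinearOrder ο] [DecidableEq ο] [Fintype ο] [CommRing A]
    [Algebra ℂ A] : (ℕ → Module.End ℂ (Grass ο A)) →ₗ[ℂ] Grass ο A →ₗ[ℂ]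
      (ℕ → Module.End ℂ (Grass ο A)) :=
  LinearMap.mk₂ ℂ (fun x f j => Complex.I • comm (x (j + 1)) f)
    (fun x y f => funext fun j => by
      rw [Pi.add_apply, map_add, LinearMap.add_apply, smul_add]; rfl)
    (fun c x f => funext fun j => by
      rw [Pi.smul_apply, map_smul, LinearMap.smul_apply, smul_comm]; rfl)
    (fun x f g => funext fun j => by rw [map_add, smul_add]; rfl)
    (fun c x f => funext fun j => by rw [map_smul, smul_comm]; rfl)

theorem shiftComm_apply (x : ℕ → Module.End ℂ (Grass ο A)) (f : Grass ο A) (j : ℕ) :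
    shiftComm ο A x f j = Complex.I • comm (x (j + 1)) f := rfl

theorem shiftComm_symm (x : ℕ → Module.End ℂ (Grass ο A)) {p q : ZMod 2} {f g : Grass ο A}
    (hf : HasParity p f) (hg : HasParity q g) :
    shiftComm ο A (shiftComm ο A x f) g = sgn (p * q) • shiftComm ο A (shiftComm ο A x g) f :=
  funext fun j => by
    rw [Pi.smul_apply]
    simp only [shiftComm_apply, map_smul, LinearMap.smul_apply]
    rw [comm_comm _ hf hg, smul_comm (sgn (p * q)), smul_comm (sgn (p * q))]

theorem conj_shiftComm {x : ℕ → Module.End ℂ (Grass ο A)} {r p : ZMod 2} {f : Grass ο A}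
    (hx : (fun j => conj 1 (x j)) = sgn r • x) (hf : HasParity p f) :
    (fun j => conj 1 (shiftComm ο A x f j)) = sgn (r + p) • shiftComm ο A x f :=
  funext fun j => by
    rw [Pi.smul_apply, shiftComm_apply, map_smul, conj_comm _ (congrFun hx (j + 1)) hf, smul_comm]

/-- The shift lowers the index by one and the commutator lowers the order by one, so the relation
between index and order persists under iteration. -/
theorem shiftComm_mem_ord {x : ℕ → Module.End ℂ (Grass ο A)} (hx : ∀ j, x j ∈ ord ο A (j + 1))
    (f : Grass ο A) (j : ℕ) : shiftComm ο A x f j ∈ ord ο A (j + 1) :=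
  Submodule.smul_mem _ _ (comm_mem_ord (hx (j + 1)) f)

theorem shiftComm_add {x a b : ℕ → Module.End ℂ (Grass ο A)} {f g : Grass ο A}
    (hf : shiftComm ο A x f = a) (hg : shiftComm ο A x g = b) :
    shiftComm ο A x (f + g) = a + b := by rw [map_add, hf, hg]

theorem shiftComm_apply_eq_zero {x : ℕ → Module.End ℂ (Grass ο A)} {p : ZMod 2} {f : Grass ο A}
    {j : ℕ} (hf : HasParity p f) (h : bracket A p (x (j + 1)) (mulLeft f) = 0) :
    shiftComm ο A x f j = 0 := by
  rw [shiftComm_apply, comm_of_hasParity _ hf, h, smul_zero]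

theorem shiftComm_apply_eq_smul {x : ℕ → Module.End ℂ (Grass ο A)} {p : ZMod 2} {f : Grass ο A}
    {j : ℕ} {c : ℂ} {T : Module.End ℂ (Grass ο A)} (hf : HasParity p f)
    (h : bracket A p (x (j + 1)) (mulLeft f) = c • T) :
    shiftComm ο A x f j = (Complex.I * c) • T := by
  rw [shiftComm_apply, comm_of_hasParity _ hf, h, smul_smul]

/-- The value of the leading coefficient on the function `1`. -/
def evalOne (ο : Type) (A : Type u) [LinearOrder ο] [DecidableEq ο] [Fintype ο] [CommRing A]
    [Algebra ℂ A] : (ℕ → Module.End ℂ (Grass ο A)) →ₗ[ℂ] Grass ο A where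
  toFun x := x 0 1
  map_add' _ _ := rfl
  map_smul' _ _ := rfl

/-- The leading coefficient after a bracket is a commutator of x 1, an operator of order at most
one, for which the Leibniz rule holds. -/
theorem evalOne_shiftComm_mul {x : ℕ → Module.End ℂ (Grass ο A)} {r p q : ZMod 2}
    {f g : Grass ο A} (hx : ∀ j, x j ∈ ord ο A (j + 1))
    (hr : (fun j => conj 1 (x j)) = sgn r • x) (hf : HasParity p f) (hg : HasParity q g) :
    evalOne ο A (shiftComm ο A x (f * g)) = evalOne ο A (shiftComm ο A x f) * g
      + sgn (p * r) • (f * evalOne ο A (shiftComm ο A x g)) := by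
  change Complex.I • comm (x 1) (f * g) 1 = (Complex.I • comm (x 1) f 1) * g
    + sgn (p * r) • (f * (Complex.I • comm (x 1) g 1))
  rw [comm_mul_apply_one (congrFun hr 1) (hx 1) hf hg, smul_add, smul_mul_assoc, mul_smul_comm,
    smul_comm Complex.I]

/-- The shifts discard the lowest coefficients of x. Under the bound on orders nothing is lost,
because their iterated commutators vanish by `foldl_comm_eq_zero`. -/
theorem foldl_shiftComm (x : ℕ → Module.End ℂ (Grass ο A)) (l : List (Grass ο A)) (j : ℕ) :
    l.foldl (fun x f => shiftComm ο A x f) x j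
      = Complex.I ^ l.length • l.foldl (fun S f => comm S f) (x (j + l.length)) := by
  have h : ∀ (l : List (Grass ο A)) (c : ℂ) (S : Module.End ℂ (Grass ο A)),
      l.foldl (fun S f => comm S f) (c • S) = c • l.foldl (fun S f => comm S f) S := by
    intro l
    induction l with
    | nil => exact fun _ _ => rfl
    | cons f l ih =>
      intro c S
      rw [List.foldl_cons, List.foldl_cons, map_smul, LinearMap.smul_apply, ih]
  induction l generalizing x with
  | nil => rw [List.length_nil, pow_zero, one_smul]; rfl
  | cons f l ih =>
    rw [List.foldl_cons, ih, List.foldl_cons, shiftComm_apply, h, smul_smul, List.length_cons,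
      pow_succ, add_assoc]

theorem foldl_comm_mem_ord {k : ℕ} (hS : S ∈ ord ο A k) (l : List (Grass ο A))
    (h : l.length ≤ k) : l.foldl (fun S f => comm S f) S ∈ ord ο A (k - l.length) := by
  induction l generalizing S k with
  | nil => exact hS
  | cons f l ih =>
    obtain - | k := k
    · simp at h
    · rw [List.foldl_cons, List.length_cons, Nat.add_sub_add_right]
      exact ih (comm_mem_ord hS f) (by simpa using h)

/-- Every commutator lowers the order, so k of them annihilate an operator of order less than k, and
further ones leave zero. -/
theorem foldl_comm_eq_zero {k : ℕ} (hS : S ∈ ord ο A k) (l : List (Grass ο A))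
    (h : k ≤ l.length) : l.foldl (fun S f => comm S f) S = 0 := by
  have h0 : ∀ l : List (Grass ο A),
      l.foldl (fun S f => comm S f) (0 : Module.End ℂ (Grass ο A)) = 0 := by
    intro l
    induction l with
    | nil => rfl
    | cons f l ih => rwa [List.foldl_cons, map_zero, LinearMap.zero_apply]
  have := foldl_comm_mem_ord hS (l.take k) (by simp)
  rw [List.length_take, min_eq_left h, Nat.sub_self, mem_ord_zero] at this
  rw [← List.take_append_drop k l, List.foldl_append, this, h0]

/-- The action of a power series of operators on power series. -/
def opSeries (x : ℕ → Module.End ℂ (Grass ο A)) (F : ℕ → Grass ο A) : ℕ → Grass ο A := fun j =>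
  ∑ q ∈ Finset.HasAntidiagonal.antidiagonal j, x q.1 (F q.2)

theorem comm_apply_eq (S : Module.End ℂ (Grass ο A)) (f g : Grass ο A) :
    comm S f g = S (f * g) - f.part 0 * S g - f.part 1 * (S g.inv).inv := by
  rw [comm_apply, LinearMap.add_apply, bracket_apply, bracket_apply, conj_zero]
  change S (f.part 0 * g) - f.part 0 * S g + (S (f.part 1 * g) - f.part 1 * (S g.inv).inv) = _
  conv_rhs => rw [← part_add_part f, add_mul, map_add, part_add_part f]
  abel

theorem opSeries_comm (x : ℕ → Module.End ℂ (Grass ο A)) (f : Grass ο A) (F : ℕ → Grass ο A) :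
    opSeries x (fun j => f * F j) - (fun j => f.part 0 * opSeries x F j)
      - (fun j => f.part 1 * (opSeries x (fun i => (F i).inv) j).inv)
      = opSeries (fun j => comm (x j) f) F := funext fun j => by
  change ∑ q ∈ Finset.HasAntidiagonal.antidiagonal j, x q.1 (f * F q.2)
    - f.part 0 * ∑ q ∈ Finset.HasAntidiagonal.antidiagonal j, x q.1 (F q.2)
    - f.part 1 * invHom (∑ q ∈ Finset.HasAntidiagonal.antidiagonal j, x q.1 (F q.2).inv)
    = ∑ q ∈ Finset.HasAntidiagonal.antidiagonal j, comm (x q.1) f (F q.2)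
  rw [map_sum, Finset.mul_sum, Finset.mul_sum, ← Finset.sum_sub_distrib, ← Finset.sum_sub_distrib]
  exact Finset.sum_congr rfl fun q _ => (comm_apply_eq _ _ _).symm

theorem opSeries_single (x : ℕ → Module.End ℂ (Grass ο A)) (f : Grass ο A) (j : ℕ) :
    opSeries x (Pi.single 0 f) j = x j f := by
  rw [opSeries, Finset.sum_eq_single (j, 0)]
  · rw [Pi.single_eq_same]
  · intro q hq hne
    rw [Pi.single_eq_of_ne, map_zero]
    rintro h
    rw [Finset.HasAntidiagonal.mem_antidiagonal] at hq
    exact hne (Prod.ext (by omega) h)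
  · simp

end Generic

section OperatorSystem

variable {n m : ℕ} {V : Opens (Fin n → ℝ)}

theorem superComm_opSeries (x : ℕ → Module.End ℂ (Form V m)) (ω : Form V m) :
    superComm (opSeries x) ω = opSeries fun j => comm (x j) ω :=
  funext fun F => opSeries_comm x ω F

theorem foldl_superComm (x : ℕ → Module.End ℂ (Form V m)) (l : List (Form V m)) :
    l.foldl superComm (opSeries x)
      = opSeries fun j => l.foldl (fun S ω => comm S ω) (x j) := by
  induction l generalizing x with
  | nil => rfl
  | cons ω l ih => rw [List.foldl_cons, superComm_opSeries, ih]; rfl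

theorem iteratedComm_opSeries (x : ℕ → Module.End ℂ (Form V m)) (l : List (Form V m)) (j : ℕ) :
    iteratedComm (opSeries x) l j = l.foldl (fun S ω => comm S ω) (x j) 1 := by
  rw [iteratedComm, foldl_superComm]
  exact opSeries_single _ _ _

theorem Delta_eq_opSeries {P : Mult V m} (hP : HasParity 0 P) :
    Delta P = opSeries (deltaOp P) := funext fun F => funext fun j => by
  have h : P.inv = P := by rw [hP.inv_eq, sgn_zero, one_smul]
  change deRhamOp V m (∑ q ∈ Finset.HasAntidiagonal.antidiagonal j, quantizeCoeff P q.1 (F q.2))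
    - ∑ q ∈ Finset.HasAntidiagonal.antidiagonal j, quantizeCoeff P q.1 (deRham (F q.2))
    = ∑ q ∈ Finset.HasAntidiagonal.antidiagonal j, deltaOp P q.1 (F q.2)
  rw [map_sum, ← Finset.sum_sub_distrib]
  refine Finset.sum_congr rfl fun q _ => ?_
  rw [deltaOp_apply, h, ← quantOp_apply, ← quantOp_apply]
  rfl

theorem quantOp_zero_one (Q : Mult V m) : quantOp Q 0 1 = SFun.toForm Q.restrict := by
  have h : fibreIdx n m 0 = {(∅, 0)} := by
    ext x
    rw [mem_fibreIdx, Finset.mem_singleton, Nat.add_eq_zero_iff, Finset.card_eq_zero,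
      Finsupp.degree_eq_zero_iff, Prod.ext_iff]
  have h1 : fibreOp V m 0 ∅ (1 : Form V m) = 1 := by
    rw [← fibreDeriv_eq]
    simp [Form.fibreDeriv]
  rw [quantOp, h, Finset.sum_singleton, pow_zero, one_smul, Module.End.mul_apply, h1]
  exact mul_one _

theorem conj_deltaOp (Q : Mult V m) (j : ℕ) : conj 1 (deltaOp Q j) = -deltaOp Q.inv j := by
  have h : conj 1 (deRhamOp V m) = -deRhamOp V m := by
    rw [isHomogeneous_of_isSuperDer (isSuperDer_deRhamOp V m), one_mul, sgn_one, neg_one_smul]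
  rw [deltaOp, deltaOp, map_neg, conj_bracket, conj_quantOp, h, map_neg, neg_neg]

/-- The coefficients of `[d, Q̂]`, as an additive map. -/
def deltaOpHom (V : Opens (Fin n → ℝ)) (m : ℕ) : Mult V m →+ (ℕ → Module.End ℂ (Form V m)) :=
  AddMonoidHom.mk' deltaOp fun Q R => funext fun j => deltaOp_add Q R j

/-- The coefficients of `Q̂`, as an additive map. -/
def quantSeriesHom (V : Opens (Fin n → ℝ)) (m : ℕ) :
    Mult V m →+ (ℕ → Module.End ℂ (Form V m)) :=
  AddMonoidHom.mk' quantOp fun Q R => funext fun j => quantOp_add Q R j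

@[elab_as_elim]
theorem fun_induction_parity {C : SFun V m → Prop} (f : SFun V m)
    (hadd : ∀ f g, C f → C g → C (f + g)) (h : ∀ p f, HasParity p f → C f) : C f := by
  rw [← part_add_part f]
  exact hadd _ _ (h 0 _ (hasParity_part _ _)) (h 1 _ (hasParity_part _ _))

theorem shiftComm_quantOp_toForm (Q : Mult V m) (f : SFun V m) :
    shiftComm _ _ (quantSeriesHom V m Q) f.toForm = 0 := by
  refine fun_induction_parity f (fun f g hf hg => ?_) fun p f hf => funext fun j => ?_
  · rw [toForm_add, shiftComm_add hf hg, add_zero]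
  · exact shiftComm_apply_eq_zero (HasParity_toForm hf) (bracket_quantOp_toForm Q (j + 1) hf)

theorem shiftComm_quantOp_deRham (Q : Mult V m) (f : SFun V m) :
    shiftComm _ _ (quantSeriesHom V m Q) (deRham f.toForm)
      = -quantSeriesHom V m (schouten Q.inv f.toMult) := by
  refine fun_induction_parity f (fun f g hf hg => ?_) fun p f hf => funext fun j => ?_
  · rw [toForm_add, isSuperDer_deRham.map_add, shiftComm_add hf hg, schouten_add_right, map_add,
      neg_add]
  · refine (shiftComm_apply_eq_smul (hasParity_deRham_toForm hf)
      (bracket_quantOp_deRham Q j hf)).trans ?_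
    rw [Complex.I_mul_I, neg_one_smul]
    rfl

theorem shiftComm_deltaOp_toForm (Q : Mult V m) (f : SFun V m) :
    shiftComm _ _ (deltaOpHom V m Q) f.toForm
      = quantSeriesHom V m (schouten Q.inv f.toMult) := by
  refine fun_induction_parity f (fun f g hf hg => ?_) fun p f hf => funext fun j => ?_
  · rw [toForm_add, shiftComm_add hf hg, schouten_add_right, map_add]
  · refine (shiftComm_apply_eq_smul (HasParity_toForm hf) (bracket_deltaOp_toForm Q j hf)).trans ?_
    rw [mul_neg, Complex.I_mul_I, neg_neg, one_smul]
    rfl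

theorem shiftComm_deltaOp_deRham (Q : Mult V m) (f : SFun V m) (p : ZMod 2) (hf : HasParity p f) :
    shiftComm _ _ (deltaOpHom V m Q) (deRham f.toForm)
      = sgn p • deltaOpHom V m (schouten Q.inv f.toMult) := funext fun j => by
  refine (shiftComm_apply_eq_smul (hasParity_deRham_toForm hf)
    (bracket_deltaOp_deRham Q j hf)).trans ?_
  rw [mul_neg, Complex.I_mul_I, neg_neg, one_smul]
  rfl

theorem multRestrict_inv (Q : Mult V m) : Mult.restrict Q.inv = Grass.inv Q.restrict := by
  have := multCoeff_inv Q 0 ∅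
  rw [Finset.card_empty, Nat.cast_zero, sgn_zero, one_smul] at this
  exact this

theorem deltaOp_zero_one (Q : Mult V m) :
    deltaOp Q 0 1 = deRham (SFun.toForm (Grass.inv Q.restrict)) := by
  have h1 : deRham (1 : Form V m) = 0 := isSuperDer_deRham.map_one
  rw [deltaOp_apply, quantOp_zero_one, h1, LinearMap.map_zero, sub_zero, multRestrict_inv]

/-- The system of operators on forms depending on `ħ`. -/
def operatorSystem (V : Opens (Fin n → ℝ)) (m : ℕ) :
    DerivedBracketSystem (m := m) V (ℕ → Module.End ℂ (Form V m)) where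
  bracket := shiftComm _ _
  ev := evalOne _ _
  inv x j := conj 1 (x j)
  good x := ∀ j, x j ∈ ord _ _ (j + 1)
  symbol := quantSeriesHom V m
  ham := deltaOpHom V m
  good_bracket x ω hx := shiftComm_mem_ord hx ω
  bracket_symm x ω ω' p q h h' := shiftComm_symm x h h'
  bracket_mul x ω ω' p q r hx hr h h' := evalOne_shiftComm_mul hx hr h h'
  inv_bracket x ω r p hx h := conj_shiftComm hx h
  ev_inv x := conj_apply_one_one (x 0)
  bracket_symbol_fun := shiftComm_quantOp_toForm
  bracket_symbol_diff := shiftComm_quantOp_deRham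
  bracket_ham_fun := shiftComm_deltaOp_toForm
  bracket_ham_diff := shiftComm_deltaOp_deRham
  ev_symbol := quantOp_zero_one
  ev_ham := deltaOp_zero_one
  good_ham Q := deltaOp_mem_ord Q
  inv_ham Q hQ := funext fun j => by
    have h : Q.inv = Q := by rw [hQ.inv_eq, sgn_zero, one_smul]
    exact (conj_deltaOp Q j).trans (by rw [h]; rfl)

/-- The higher Koszul brackets on a superdomain. -/
def koszul (P : Mult V m) (l : List (Form V m)) : Form V m :=
  (operatorSystem V m).ev ((operatorSystem V m).iter ((operatorSystem V m).ham P) l)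

theorem isKoszulBrackets_koszul {P : Mult V m} (hP : HasParity 0 P) :
    IsKoszulBrackets P (koszul P) := (operatorSystem V m).isKoszulBrackets hP

theorem koszul_eq (P : Mult V m) (l : List (Form V m)) : koszul P l
    = Complex.I ^ l.length • l.foldl (fun S ω => comm S ω) (deltaOp P l.length) 1 :=
  (congrArg (fun S : Module.End ℂ (Form V m) => S 1) (foldl_shiftComm (deltaOp P) l 0)).trans (by
    rw [zero_add]; rfl)

/-- The coefficient of ħ^j in Δ has order at most j, so k commutators kill it for j < k; the
coefficient of ħ^k is the bracket by construction of `koszul`. -/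
theorem hasClassicalLimit_koszul {P : Mult V m} (hP : HasParity 0 P) (l : List (Form V m)) :
    HasClassicalLimit l.length (iteratedComm (Delta P) l) (koszul P l) := by
  rw [Delta_eq_opSeries hP]
  refine ⟨fun j hj => ?_, ?_⟩
  · rw [iteratedComm_opSeries, foldl_comm_eq_zero (deltaOp_mem_ord P j) l hj]
    rfl
  · rw [iteratedComm_opSeries, koszul_eq]

end OperatorSystem

end HigherKoszul

/-! ### Poisson brackets with functions on the base, for functions formal in the momenta. -/

namespace HigherKoszul

open Grass

section MomentumCalculus

variable {ε ο : Type} [Fintype ε] [DecidableEq ε] [Fintype ο] [LinearOrder ο] {A : Type}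
  [CommRing A] [Algebra ℂ A]

theorem seriesCoeff_smul (α : ε →₀ ℕ) (c : ℂ) (F : MvPowerSeries ε A) :
    MvPowerSeries.coeff α (c • F) = c • MvPowerSeries.coeff α F := rfl

/-- A superfunction on the base, as a superfunction on the cotangent bundle. -/
def baseHom (ε ο A : Type) [Fintype ο] [LinearOrder ο] [CommRing A] :
    Grass ο A →+* Grass (ο ⊕ₗ ο) (MvPowerSeries ε A) :=
  embedHom (lexInl ο ο) (MvPowerSeries.C (σ := ε) (R := A))

theorem hasParity_baseHom {p : ZMod 2} {f : Grass ο A} (hf : HasParity p f) :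
    HasParity p (baseHom ε ο A f) :=
  hasParity_embed (lexInl ο ο).toEmbedding (MvPowerSeries.C (σ := ε) (R := A)) hf

theorem baseHom_smul (c : ℂ) (f : Grass ο A) :
    baseHom ε ο A (c • f) = c • baseHom ε ο A f :=
  embed_smul (lexInl ο ο).toEmbedding (MvPowerSeries.C (σ := ε) (R := A))
    (fun c a => by
      ext α
      rw [seriesCoeff_smul, MvPowerSeries.coeff_C, MvPowerSeries.coeff_C]
      split_ifs <;> simp) c f

theorem baseHom_inv (f : Grass ο A) : baseHom ε ο A f.inv = (baseHom ε ο A f).inv :=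
  embed_inv (lexInl ο ο).toEmbedding (MvPowerSeries.C (σ := ε) (R := A)) f

/-- The parity of a coordinate. -/
def coordParity : ε ⊕ ο → ZMod 2 := Sum.elim (fun _ => 0) fun _ => 1

/-- The derivative with respect to the momentum of a coordinate, followed by the parity involution
for an odd coordinate. -/
def momDeriv : ε ⊕ ο → Grass (ο ⊕ₗ ο) (MvPowerSeries ε A) → Grass (ο ⊕ₗ ο) (MvPowerSeries ε A)
  | Sum.inl a, F => F.mapCoeff (MvPowerSeries.pderiv A a)
  | Sum.inr o, F => (F.oddDeriv (toLex (Sum.inr o))).inv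

theorem isSuperDer_pderiv (a : ε) : IsSuperDer 0 (Grass.mapCoeff (MvPowerSeries.pderiv A a) :
    Grass (ο ⊕ₗ ο) (MvPowerSeries ε A) → Grass (ο ⊕ₗ ο) (MvPowerSeries ε A)) :=
  isSuperDer_mapCoeff (isDer_pderiv a)

theorem pderiv_baseHom (a : ε) (f : Grass ο A) :
    (baseHom ε ο A f).mapCoeff (MvPowerSeries.pderiv A a) = 0 :=
  mapCoeff_embed_eq_zero (lexInl ο ο).toEmbedding (MvPowerSeries.C (σ := ε) (R := A)) _
    (map_zero _) (fun _ => MvPowerSeries.pderiv_C) f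

theorem oddDeriv_inr_baseHom (o : ο) (f : Grass ο A) :
    (baseHom ε ο A f).oddDeriv (toLex (Sum.inr o)) = 0 :=
  oddDeriv_embed_of_notMem _ _ (by rintro ⟨x, hx⟩; cases hx) f

theorem momDeriv_add (k : ε ⊕ ο) (F G : Grass (ο ⊕ₗ ο) (MvPowerSeries ε A)) :
    momDeriv k (F + G) = momDeriv k F + momDeriv k G := by
  rcases k with a | o
  · exact (isSuperDer_pderiv a).map_add F G
  · rw [momDeriv, momDeriv, momDeriv, oddDeriv_add, inv_add]

theorem momDeriv_smul (k : ε ⊕ ο) (c : ℂ) (F : Grass (ο ⊕ₗ ο) (MvPowerSeries ε A)) :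
    momDeriv k (c • F) = c • momDeriv k F := by
  rcases k with a | o
  · refine Grass.ext fun U => ?_
    change MvPowerSeries.pderiv A a (c • F U) = c • MvPowerSeries.pderiv A a (F U)
    ext α
    refine (MvPowerSeries.coeff_pderiv _ _).trans ?_
    refine Eq.trans ?_ (congrArg (c • ·) (MvPowerSeries.coeff_pderiv (i := a) (F U) α).symm)
    exact smul_mul_assoc _ _ _
  · rw [momDeriv, momDeriv, oddDeriv_smul, inv_smul]

/-- `momDeriv` as an additive map. -/
def momDerivHom (k : ε ⊕ ο) :
    Grass (ο ⊕ₗ ο) (MvPowerSeries ε A) →+ Grass (ο ⊕ₗ ο) (MvPowerSeries ε A) :=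
  AddMonoidHom.mk' (momDeriv k) (momDeriv_add k)

theorem momDeriv_zsmul (k : ε ⊕ ο) (c : ℤ) (F : Grass (ο ⊕ₗ ο) (MvPowerSeries ε A)) :
    momDeriv k (c • F) = c • momDeriv k F := map_zsmul (momDerivHom k) c F

theorem momDeriv_sum (k : ε ⊕ ο) {ι : Type*} (s : Finset ι)
    (F : ι → Grass (ο ⊕ₗ ο) (MvPowerSeries ε A)) :
    momDeriv k (∑ i ∈ s, F i) = ∑ i ∈ s, momDeriv k (F i) := map_sum (momDerivHom k) F s

theorem momDeriv_mul_baseHom (k : ε ⊕ ο) (F : Grass (ο ⊕ₗ ο) (MvPowerSeries ε A))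
    (g : Grass ο A) : momDeriv k (F * baseHom ε ο A g)
      = momDeriv k F * baseHom ε ο A (g.twist (coordParity k)) := by
  rcases k with a | o
  · refine ((isSuperDer_pderiv a).map_mul F _).trans ?_
    rw [pderiv_baseHom, ring_mul_zero, add_zero]
    rfl
  · change Grass.inv (Grass.oddDeriv _ _) = Grass.inv _ * baseHom ε ο A g.inv
    rw [oddDeriv_mul, oddDeriv_inr_baseHom, ring_mul_zero, add_zero, inv_mul, baseHom_inv]

theorem momDeriv_inv (k : ε ⊕ ο) (F : Grass (ο ⊕ₗ ο) (MvPowerSeries ε A)) :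
    momDeriv k F.inv = sgn (coordParity k) • (momDeriv k F).inv := by
  rcases k with a | o
  · exact (isSuperDer_pderiv a).map_inv F
  · change Grass.inv (Grass.oddDeriv _ F.inv) = (-1 : ℤ) • _
    rw [oddDeriv_inv, Grass.inv_neg, neg_one_zsmul]
    rfl

theorem momDeriv_comm (k l : ε ⊕ ο) (F : Grass (ο ⊕ₗ ο) (MvPowerSeries ε A)) :
    momDeriv k (momDeriv l F) = sgn (coordParity k * coordParity l) • momDeriv l (momDeriv k F) := by
  have h : ∀ (a : ε) (o : ο), Grass.mapCoeff (MvPowerSeries.pderiv A a)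
      (F.oddDeriv (toLex (Sum.inr o))).inv
      = ((F.mapCoeff (MvPowerSeries.pderiv A a)).oddDeriv (toLex (Sum.inr o))).inv := fun a o => by
    rw [(isSuperDer_pderiv a).map_inv, sgn_zero, one_smul, mapCoeff_oddDeriv (isDer_pderiv a)]
  rcases k with a | o <;> rcases l with b | o'
  · refine Eq.trans ?_ (one_smul ℤ _).symm
    refine mapCoeff_comm (D := MvPowerSeries.pderiv A a) (D' := MvPowerSeries.pderiv A b)
      (fun c => ?_) F
    ext α
    simp only [MvPowerSeries.coeff_pderiv, add_right_comm α (Finsupp.single a 1)]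
    by_cases h : a = b
    · rw [h]
    · simp [Finsupp.single_eq_of_ne h, Finsupp.single_eq_of_ne (Ne.symm h)]; ring
  · exact (h a o').trans (one_smul ℤ _).symm
  · exact (h b o).symm.trans (one_smul ℤ _).symm
  · change Grass.inv (Grass.oddDeriv _ (Grass.inv _))
      = (-1 : ℤ) • Grass.inv (Grass.oddDeriv _ (Grass.inv _))
    rw [oddDeriv_inv, oddDeriv_inv, oddDeriv_oddDeriv, neg_one_zsmul]
    simp only [Grass.inv_neg, Grass.inv_inv, neg_neg]

/-- Restriction to the zero section. -/
def restrictHom (ε ο A : Type) [Fintype ο] [LinearOrder ο] [CommRing A] [Algebra ℂ A] :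
    Grass (ο ⊕ₗ ο) (MvPowerSeries ε A) →ₗ[ℂ] Grass ο A where
  toFun F := lexCoeff 0 ∅ F
  map_add' F G := lexCoeff_add 0 ∅ F G
  map_smul' _ _ := rfl

theorem restrictHom_mul_baseHom (F : Grass (ο ⊕ₗ ο) (MvPowerSeries ε A)) (f : Grass ο A) :
    restrictHom ε ο A (F * baseHom ε ο A f) = restrictHom ε ο A F * f := by
  refine (lexCoeff_mul_embed 0 ∅ F f).trans ?_
  rw [Finset.card_empty, Nat.cast_zero, twist_zero]
  rfl

theorem restrictHom_baseHom_mul (F : Grass (ο ⊕ₗ ο) (MvPowerSeries ε A)) (f : Grass ο A) :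
    restrictHom ε ο A (baseHom ε ο A f * F) = f * restrictHom ε ο A F :=
  lexCoeff_embed_mul 0 ∅ F f

theorem restrictHom_inv (F : Grass (ο ⊕ₗ ο) (MvPowerSeries ε A)) :
    restrictHom ε ο A F.inv = (restrictHom ε ο A F).inv := by
  refine (lexCoeff_inv 0 ∅ F).trans ?_
  rw [Finset.card_empty, Nat.cast_zero, sgn_zero, one_smul]
  rfl

variable {δ : ε → A → A}

/-- The derivative of a superfunction with respect to a coordinate, given the derivatives of its
coefficients with respect to the even coordinates. -/
def coordDeriv (δ : ε → A → A) : ε ⊕ ο → Grass ο A → Grass ο A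
  | Sum.inl a, f => f.mapCoeff (δ a)
  | Sum.inr o, f => f.oddDeriv o

theorem isSuperDer_coordDeriv (hδ : ∀ a, IsDer (δ a)) (k : ε ⊕ ο) :
    IsSuperDer (coordParity k) (coordDeriv δ k) := by
  rcases k with a | o
  · exact isSuperDer_mapCoeff (hδ a)
  · exact isSuperDer_oddDeriv o

theorem zmod_two_mul_add (p a r : ZMod 2) : p * a + p * (a + r) = p * r := by
  revert a p r; decide

theorem zmod_two_add_add (p a r : ZMod 2) : a + r + (a + p) = r + p := by
  revert a p r; decide

theorem zmod_two_symm (p q a b : ZMod 2) :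
    a * b + ((b + p) * a + (a + q) * (b + p)) = p * q + (a + q) * b := by
  revert a b p q; decide

/-- The Poisson bracket with a superfunction on the base. -/
def baseBracket (δ : ε → A → A) (hδ : ∀ a, IsDer (δ a)) (hs : ∀ a (c : ℂ) x, δ a (c • x) = c • δ a x) :
    Grass (ο ⊕ₗ ο) (MvPowerSeries ε A) →ₗ[ℂ] Grass ο A →ₗ[ℂ]
      Grass (ο ⊕ₗ ο) (MvPowerSeries ε A) :=
  LinearMap.mk₂ ℂ (fun F f => ∑ k, momDeriv k F * baseHom ε ο A (coordDeriv δ k f))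
    (fun F G f => by
      simp only [momDeriv_add, add_mul, Finset.sum_add_distrib])
    (fun c F f => by
      simp only [momDeriv_smul, smul_mul_assoc, Finset.smul_sum])
    (fun F f g => by
      simp only [(isSuperDer_coordDeriv hδ _).map_add, map_add, mul_add, Finset.sum_add_distrib])
    (fun c F f => by
      have : ∀ k, coordDeriv δ k (c • f) = c • coordDeriv δ k f := by
        rintro (a | o)
        · exact Grass.ext fun S => hs a c (f S)
        · exact oddDeriv_smul o c f
      simp only [this, baseHom_smul, mul_smul_comm, Finset.smul_sum])

variable {hδ : ∀ a, IsDer (δ a)} {hs : ∀ a (c : ℂ) x, δ a (c • x) = c • δ a x}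
  (F : Grass (ο ⊕ₗ ο) (MvPowerSeries ε A))

theorem baseBracket_apply (f : Grass ο A) : baseBracket δ hδ hs F f
    = ∑ k, momDeriv k F * baseHom ε ο A (coordDeriv δ k f) := rfl

theorem baseBracket_baseBracket (f g : Grass ο A) :
    baseBracket δ hδ hs (baseBracket δ hδ hs F f) g
      = ∑ k, ∑ l, momDeriv k (momDeriv l F)
        * baseHom ε ο A ((coordDeriv δ l f).twist (coordParity k) * coordDeriv δ k g) := by
  rw [baseBracket_apply]
  refine Finset.sum_congr rfl fun k _ => ?_
  rw [baseBracket_apply, momDeriv_sum, Finset.sum_mul]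
  refine Finset.sum_congr rfl fun l _ => ?_
  rw [momDeriv_mul_baseHom, map_mul, mul_assoc]

/-- A bracket with a function on the base differentiates only along the momenta. Two of them
contract a second momentum derivative of F with the derivatives of f and g, and momentum derivatives
supercommute. -/
theorem baseBracket_symm {p q : ZMod 2} {f g : Grass ο A} (hf : HasParity p f)
    (hg : HasParity q g) :
    baseBracket δ hδ hs (baseBracket δ hδ hs F f) g
      = sgn (p * q) • baseBracket δ hδ hs (baseBracket δ hδ hs F g) f := by
  rw [baseBracket_baseBracket, baseBracket_baseBracket, Finset.sum_comm, Finset.smul_sum]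
  refine Finset.sum_congr rfl fun l _ => ?_
  rw [Finset.smul_sum]
  refine Finset.sum_congr rfl fun k _ => ?_
  have h1 := (isSuperDer_coordDeriv hδ l).hasParity hf
  have h2 := (isSuperDer_coordDeriv hδ k).hasParity hg
  rw [momDeriv_comm k l, h1.twist_eq, smul_mul_assoc (sgn _) (coordDeriv δ l f),
    h1.mul_comm (coordDeriv δ k g), h2.twist_eq, h2.twist_eq]
  simp only [smul_mul_assoc, map_zsmul, mul_smul_comm, smul_smul]
  congr 1
  rw [← sgn_add, ← sgn_add, ← sgn_add]
  congr 1
  exact (add_comm _ _).trans (zmod_two_symm p q (coordParity k) (coordParity l))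

/-- The bracket is linear in the first derivatives of its second argument, so the Leibniz rule holds
without any condition on F; on the zero section the momentum derivative of F is a function on the
base and can be moved past f with the sign rule. -/
theorem restrictHom_baseBracket_mul {p r : ZMod 2} {f g : Grass ο A}
    (hF : F.inv = sgn r • F) (hf : HasParity p f) :
    restrictHom ε ο A (baseBracket δ hδ hs F (f * g))
      = restrictHom ε ο A (baseBracket δ hδ hs F f) * g
        + sgn (p * r) • (f * restrictHom ε ο A (baseBracket δ hδ hs F g)) := by
  simp only [baseBracket_apply, map_sum, Finset.sum_mul, Finset.mul_sum, Finset.smul_sum,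
    restrictHom_mul_baseHom]
  rw [← Finset.sum_add_distrib]
  refine Finset.sum_congr rfl fun k _ => ?_
  have h1 : HasParity (coordParity k + r) (restrictHom ε ο A (momDeriv k F)) := by
    refine hasParity_of_inv_eq ?_
    rw [← restrictHom_inv]
    have := momDeriv_inv k F
    rw [hF, momDeriv_zsmul] at this
    have h2 : (momDeriv k F).inv = sgn (coordParity k + r) • momDeriv k F := by
      rw [sgn_add, mul_smul, this, smul_smul, sgn_mul_self, one_smul]
    rw [h2, map_zsmul]
  rw [(isSuperDer_coordDeriv hδ k).map_mul, mul_add, mul_assoc, hf.twist_eq, smul_mul_assoc,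
    mul_smul_comm, ← mul_assoc _ f, h1.mul_comm f, hf.twist_eq, smul_mul_assoc, smul_mul_assoc,
    smul_smul, mul_assoc f]
  congr 2
  rw [← sgn_add]
  congr 1
  exact zmod_two_mul_add p (coordParity k) r

theorem inv_baseBracket {p r : ZMod 2} {f : Grass ο A} (hF : F.inv = sgn r • F)
    (hf : HasParity p f) :
    (baseBracket δ hδ hs F f).inv = sgn (r + p) • baseBracket δ hδ hs F f := by
  rw [baseBracket_apply, inv_sum, Finset.smul_sum]
  refine Finset.sum_congr rfl fun k _ => ?_
  have h1 := hasParity_baseHom (ε := ε) ((isSuperDer_coordDeriv hδ k).hasParity hf)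
  have := momDeriv_inv k F
  rw [hF, momDeriv_zsmul] at this
  have h2 : (momDeriv k F).inv = sgn (coordParity k + r) • momDeriv k F := by
    rw [sgn_add, mul_smul, this, smul_smul, sgn_mul_self, one_smul]
  rw [inv_mul, h2, h1.inv_eq, smul_mul_assoc, mul_smul_comm, smul_smul, ← sgn_add]
  rw [zmod_two_add_add]

end MomentumCalculus

end HigherKoszul

/-! ### The Hamiltonian vector field of the de Rham differential on T*(ΠTM). -/

namespace HigherKoszul

open Grass

section VectorField

variable {ε ο : Type} [Fintype ε] [DecidableEq ε] [Fintype ο] [LinearOrder ο] {R : Type}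
  [CommRing R] [Algebra ℂ R] {d : ε → R → R}

theorem coordDeriv_comm (hd : ∀ a, IsDer (d a)) (hc : ∀ a b x, d a (d b x) = d b (d a x))
    (k l : ε ⊕ ο) (F : Grass ο R) : coordDeriv d k (coordDeriv d l F)
      = sgn (coordParity k * coordParity l) • coordDeriv d l (coordDeriv d k F) := by
  rcases k with a | o <;> rcases l with b | o'
  · exact (mapCoeff_comm (D := d a) (D' := d b) (hc a b) F).trans (one_smul ℤ _).symm
  · exact (mapCoeff_oddDeriv (hd a) o' F).trans (one_smul ℤ _).symm
  · exact (mapCoeff_oddDeriv (hd b) o F).symm.trans (one_smul ℤ _).symm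
  · exact (oddDeriv_oddDeriv o o' F).trans (neg_one_zsmul _).symm

/-- The vector field with components `c i` along the coordinates `k i`. -/
def vectorField {ι : Type} [Fintype ι] (d : ε → R → R) (c : ι → Grass ο R) (k : ι → ε ⊕ ο)
    (F : Grass ο R) : Grass ο R := ∑ i, c i * coordDeriv d (k i) F

variable {ι : Type} [Fintype ι] {c : ι → Grass ο R} {k : ι → ε ⊕ ο}

theorem isSuperDer_vectorField (hd : ∀ a, IsDer (d a))
    (hp : ∀ i, HasParity (1 + coordParity (k i)) (c i)) : IsSuperDer 1 (vectorField d c k) :=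
  IsSuperDer.sum _ fun i => by
    have := (isSuperDer_coordDeriv hd (k i)).left_mul (hp i)
    have h : ∀ a : ZMod 2, 1 + a + a = 1 := by decide
    rwa [h] at this

/-- Coordinate derivatives supercommute, so the commutator of one of them with a vector field is the
vector field with differentiated components. All commutation rules of D and of d below are
instances. -/
theorem coordDeriv_vectorField (hd : ∀ a, IsDer (d a)) (hc : ∀ a b x, d a (d b x) = d b (d a x))
    (hp : ∀ i, HasParity (1 + coordParity (k i)) (c i)) (l : ε ⊕ ο) (F : Grass ο R) :
    coordDeriv d l (vectorField d c k F) = ∑ i, coordDeriv d l (c i) * coordDeriv d (k i) F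
      + sgn (coordParity l) • vectorField d c k (coordDeriv d l F) := by
  rw [vectorField, vectorField, (isSuperDer_coordDeriv hd l).map_sum, Finset.smul_sum,
    ← Finset.sum_add_distrib]
  refine Finset.sum_congr rfl fun i _ => ?_
  rw [(isSuperDer_coordDeriv hd l).map_mul, (hp i).twist_eq, coordDeriv_comm hd hc,
    smul_mul_assoc, mul_smul_comm, smul_smul, ← sgn_add]
  congr 3
  generalize coordParity (k i) = a
  generalize coordParity l = b
  revert a b
  decide

end VectorField

section TotalDerivation

variable {n m : ℕ} {A : Type} [CommRing A] [Algebra ℂ A]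

/-- The derivatives with respect to the even coordinates and their momenta. -/
def evenDeriv {ε : Type} [DecidableEq ε] (δ : ε → A → A) :
    ε ⊕ ε → MvPowerSeries ε A → MvPowerSeries ε A :=
  Sum.elim (fun a => mapSeries (δ a)) fun a => MvPowerSeries.pderiv A a

variable {δ : Fin n ⊕ Fin m → A → A}

theorem isDer_evenDeriv {ε : Type} [DecidableEq ε] {δ : ε → A → A} (hδ : ∀ a, IsDer (δ a))
    (a : ε ⊕ ε) : IsDer (evenDeriv δ a) := by
  rcases a with a | a
  · exact isDer_mapSeries (hδ a)
  · exact isDer_pderiv a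

theorem mapSeries_pderiv {ε : Type} [DecidableEq ε] {D : A → A} (hD : IsDer D) (a : ε)
    (x : MvPowerSeries ε A) :
    mapSeries D (MvPowerSeries.pderiv A a x) = MvPowerSeries.pderiv A a (mapSeries D x) := by
  ext α
  have h : ∀ (k : ℕ) (c : A), D (c * (k + 1)) = D c * (k + 1) := fun k c => by
    have h0 : D ((k : A) + 1) = 0 := by
      induction k with
      | zero => rw [Nat.cast_zero, zero_add, hD.map_one]
      | succ k ih => rw [Nat.cast_succ, hD.map_add, ih, hD.map_one, add_zero]
    rw [hD.map_mul, h0, mul_zero, add_zero]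
  rw [MvPowerSeries.coeff_pderiv, coeff_mapSeries, coeff_mapSeries, MvPowerSeries.coeff_pderiv, h]

theorem pderiv_comm {ε : Type} [DecidableEq ε] (a b : ε) (x : MvPowerSeries ε A) :
    MvPowerSeries.pderiv A a (MvPowerSeries.pderiv A b x)
      = MvPowerSeries.pderiv A b (MvPowerSeries.pderiv A a x) := by
  ext α
  simp only [MvPowerSeries.coeff_pderiv, add_right_comm α (Finsupp.single a 1)]
  by_cases h : a = b
  · rw [h]
  · simp [Finsupp.single_eq_of_ne h, Finsupp.single_eq_of_ne (Ne.symm h)]; ring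

theorem evenDeriv_comm {ε : Type} [DecidableEq ε] {δ : ε → A → A} (hδ : ∀ a, IsDer (δ a))
    (hc : ∀ a b x, δ a (δ b x) = δ b (δ a x)) (a b : ε ⊕ ε) (x : MvPowerSeries ε A) :
    evenDeriv δ a (evenDeriv δ b x) = evenDeriv δ b (evenDeriv δ a x) := by
  rcases a with a | a <;> rcases b with b | b
  · ext α; exact hc a b _
  · exact mapSeries_pderiv (hδ a) b x
  · exact (mapSeries_pderiv (hδ b) a x).symm
  · exact pderiv_comm a b x

theorem mapSeries_X {ε : Type} [DecidableEq ε] {D : A → A} (hD : IsDer D) (a : ε) :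
    mapSeries D (MvPowerSeries.X a : MvPowerSeries ε A) = 0 := by
  ext α
  rw [coeff_mapSeries, MvPowerSeries.coeff_X]
  split_ifs
  · exact hD.map_one
  · exact hD.map_zero

/-- Superfunctions on the cotangent bundle of the antitangent bundle. -/
abbrev TotalGrass (n m : ℕ) (A : Type) : Type :=
  Grass ((Fin m ⊕ₗ Fin n) ⊕ₗ (Fin m ⊕ₗ Fin n)) (MvPowerSeries (Fin n ⊕ Fin m) A)

/-- The components of the Hamiltonian vector field of the de Rham differential; the even functions
`y μ` represent the differentials of the odd coordinates. -/
def totalCoeff (y : Fin m → A) :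
    (Fin n ⊕ Fin m) ⊕ (Fin n ⊕ Fin m) → TotalGrass n m A
  | Sum.inl (Sum.inl a) => gen (toLex (Sum.inl (toLex (Sum.inr a))))
  | Sum.inl (Sum.inr μ) => const (MvPowerSeries.C (y μ))
  | Sum.inr (Sum.inl a) => const (MvPowerSeries.X (Sum.inl a))
  | Sum.inr (Sum.inr μ) => -gen (toLex (Sum.inr (toLex (Sum.inl μ))))

/-- The coordinates along which the Hamiltonian vector field of the de Rham differential has
components. -/
def totalIndex (n m : ℕ) : (Fin n ⊕ Fin m) ⊕ (Fin n ⊕ Fin m) →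
    ((Fin n ⊕ Fin m) ⊕ (Fin n ⊕ Fin m)) ⊕ ((Fin m ⊕ₗ Fin n) ⊕ₗ (Fin m ⊕ₗ Fin n))
  | Sum.inl (Sum.inl a) => Sum.inl (Sum.inl (Sum.inl a))
  | Sum.inl (Sum.inr μ) => Sum.inr (toLex (Sum.inl (toLex (Sum.inl μ))))
  | Sum.inr (Sum.inl a) => Sum.inr (toLex (Sum.inr (toLex (Sum.inr a))))
  | Sum.inr (Sum.inr μ) => Sum.inl (Sum.inr (Sum.inr μ))

theorem hasParity_totalCoeff (y : Fin m → A) (i : (Fin n ⊕ Fin m) ⊕ (Fin n ⊕ Fin m)) :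
    HasParity (1 + coordParity (totalIndex n m i)) (totalCoeff y i) := by
  rcases i with (a | μ) | (a | μ)
  · exact hasParity_gen _
  · exact hasParity_const _
  · exact hasParity_const _
  · exact (hasParity_gen _).neg

/-- The Hamiltonian vector field of the de Rham differential. -/
def totalDer (δ : Fin n ⊕ Fin m → A → A) (y : Fin m → A) : TotalGrass n m A → TotalGrass n m A :=
  vectorField (evenDeriv δ) (totalCoeff y) (totalIndex n m)

variable (y : Fin m → A) (F : TotalGrass n m A)

theorem totalDer_eq : totalDer δ y F
    = ∑ a, gen (toLex (Sum.inl (toLex (Sum.inr a)))) * F.mapCoeff (mapSeries (δ (Sum.inl a)))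
      + ∑ μ, const (MvPowerSeries.C (y μ)) * F.oddDeriv (toLex (Sum.inl (toLex (Sum.inl μ))))
      + (∑ a, const (MvPowerSeries.X (Sum.inl a)) * F.oddDeriv (toLex (Sum.inr (toLex (Sum.inr a))))
      + ∑ μ, (-gen (toLex (Sum.inr (toLex (Sum.inl μ)))))
          * F.mapCoeff (MvPowerSeries.pderiv A (Sum.inr μ))) := by
  rw [totalDer, vectorField, Fintype.sum_sum_type, Fintype.sum_sum_type, Fintype.sum_sum_type]
  rfl

theorem isSuperDer_totalDer (hδ : ∀ a, IsDer (δ a)) : IsSuperDer 1 (totalDer δ y) :=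
  isSuperDer_vectorField (isDer_evenDeriv hδ) (hasParity_totalCoeff y)

theorem sum_coordDeriv_inl (hδ : ∀ a, IsDer (δ a)) (e : (Fin n ⊕ Fin m) ⊕ (Fin n ⊕ Fin m)) :
    ∑ i, coordDeriv (evenDeriv δ) (Sum.inl e) (totalCoeff y i)
        * coordDeriv (evenDeriv δ) (totalIndex n m i) F
      = ∑ μ, const (evenDeriv δ e (MvPowerSeries.C (y μ)))
          * F.oddDeriv (toLex (Sum.inl (toLex (Sum.inl μ))))
        + ∑ a, const (evenDeriv δ e (MvPowerSeries.X (Sum.inl a)))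
          * F.oddDeriv (toLex (Sum.inr (toLex (Sum.inr a)))) := by
  have h0 := (isDer_evenDeriv hδ e).map_zero
  have h1 : ∀ o, Grass.mapCoeff (evenDeriv δ e) (gen o : TotalGrass n m A) = 0 :=
    mapCoeff_gen (isDer_evenDeriv hδ e)
  have h2 : ∀ μ, Grass.mapCoeff (evenDeriv δ e)
      (-gen (toLex (Sum.inr (toLex (Sum.inl μ)))) : TotalGrass n m A) = 0 := fun μ => by
    rw [(isSuperDer_mapCoeff (isDer_evenDeriv hδ e)).map_neg, h1, neg_zero]
  rw [Fintype.sum_sum_type, Fintype.sum_sum_type, Fintype.sum_sum_type]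
  simp only [coordDeriv, totalCoeff, totalIndex, h1, h2, ring_zero_mul, Finset.sum_const_zero,
    zero_add, add_zero, mapCoeff_const h0]

theorem sum_coordDeriv_inr (o : (Fin m ⊕ₗ Fin n) ⊕ₗ (Fin m ⊕ₗ Fin n)) :
    ∑ i, coordDeriv (evenDeriv δ) (Sum.inr o) (totalCoeff y i)
        * coordDeriv (evenDeriv δ) (totalIndex n m i) F
      = ∑ a, (if o = toLex (Sum.inl (toLex (Sum.inr a))) then
          F.mapCoeff (mapSeries (δ (Sum.inl a))) else 0)
        - ∑ μ, (if o = toLex (Sum.inr (toLex (Sum.inl μ))) then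
          F.mapCoeff (MvPowerSeries.pderiv A (Sum.inr μ)) else 0) := by
  rw [Fintype.sum_sum_type, Fintype.sum_sum_type, Fintype.sum_sum_type]
  simp only [coordDeriv, totalCoeff, totalIndex, oddDeriv_const, ring_zero_mul,
    Finset.sum_const_zero, zero_add, add_zero, (isSuperDer_oddDeriv o).map_neg, oddDeriv_gen,
    ring_neg_mul, Finset.sum_neg_distrib, ite_mul, one_mul]
  rw [sub_eq_add_neg]
  rfl

/-- Commuting derivations `δ` along the even coordinates of the antitangent bundle, the even functions
`y μ` being the differentials of the odd coordinates. -/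
structure IsTangentCalculus (δ : Fin n ⊕ Fin m → A → A) (y : Fin m → A) : Prop where
  isDer : ∀ a, IsDer (δ a)
  comm : ∀ a b x, δ a (δ b x) = δ b (δ a x)
  inl : ∀ a μ, δ (Sum.inl a) (y μ) = 0
  inr : ∀ ν μ, δ (Sum.inr ν) (y μ) = if ν = μ then 1 else 0

variable {y}

/-- The momentum of x^b occurs in a single component of the field, the one along the momentum of
dx^b. -/
theorem pderiv_inl_totalDer (h : IsTangentCalculus δ y) (b : Fin n) :
    (totalDer δ y F).mapCoeff (MvPowerSeries.pderiv A (Sum.inl b))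
      = totalDer δ y (F.mapCoeff (MvPowerSeries.pderiv A (Sum.inl b)))
        + F.oddDeriv (toLex (Sum.inr (toLex (Sum.inr b)))) := by
  refine (coordDeriv_vectorField (isDer_evenDeriv h.isDer) (evenDeriv_comm h.isDer h.comm)
    (hasParity_totalCoeff y) (Sum.inl (Sum.inr (Sum.inl b))) F).trans ?_
  rw [sum_coordDeriv_inl y F h.isDer, add_comm]
  refine congrArg₂ (· + ·) (one_smul ℤ _) ?_
  simp only [evenDeriv, Sum.elim_inr, MvPowerSeries.pderiv_C, MvPowerSeries.pderiv_X, const_zero,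
    ring_zero_mul, Finset.sum_const_zero, zero_add]
  rw [Finset.sum_eq_single b]
  · rw [Pi.single_eq_same, const_one, one_mul]
  · intro a _ hne
    rw [Pi.single_eq_of_ne (by simpa using hne), const_zero, ring_zero_mul]
  · simp

theorem pderiv_inr_totalDer (h : IsTangentCalculus δ y) (ν : Fin m) :
    (totalDer δ y F).mapCoeff (MvPowerSeries.pderiv A (Sum.inr ν))
      = totalDer δ y (F.mapCoeff (MvPowerSeries.pderiv A (Sum.inr ν))) := by
  refine (coordDeriv_vectorField (isDer_evenDeriv h.isDer) (evenDeriv_comm h.isDer h.comm)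
    (hasParity_totalCoeff y) (Sum.inl (Sum.inr (Sum.inr ν))) F).trans ?_
  rw [sum_coordDeriv_inl y F h.isDer, add_comm]
  refine (congrArg₂ (· + ·) (one_smul ℤ _) ?_).trans (add_zero _)
  simp [evenDeriv, MvPowerSeries.pderiv_C, const_zero]

theorem mapSeries_inl_totalDer (h : IsTangentCalculus δ y) (b : Fin n) :
    (totalDer δ y F).mapCoeff (mapSeries (δ (Sum.inl b)))
      = totalDer δ y (F.mapCoeff (mapSeries (δ (Sum.inl b)))) := by
  refine (coordDeriv_vectorField (isDer_evenDeriv h.isDer) (evenDeriv_comm h.isDer h.comm)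
    (hasParity_totalCoeff y) (Sum.inl (Sum.inl (Sum.inl b))) F).trans ?_
  rw [sum_coordDeriv_inl y F h.isDer, add_comm]
  refine (congrArg₂ (· + ·) (one_smul ℤ _) ?_).trans (add_zero _)
  simp [evenDeriv, mapSeries_C (h.isDer _).map_zero, mapSeries_X (h.isDer _), h.inl, const_zero]

/-- The variable dξ^ν occurs in a single component of the field, the one along ξ^ν. -/
theorem mapSeries_inr_totalDer (h : IsTangentCalculus δ y) (ν : Fin m) : (totalDer δ y F).mapCoeff (mapSeries (δ (Sum.inr ν)))
      = totalDer δ y (F.mapCoeff (mapSeries (δ (Sum.inr ν))))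
        + F.oddDeriv (toLex (Sum.inl (toLex (Sum.inl ν)))) := by
  refine (coordDeriv_vectorField (isDer_evenDeriv h.isDer) (evenDeriv_comm h.isDer h.comm)
    (hasParity_totalCoeff y) (Sum.inl (Sum.inl (Sum.inr ν))) F).trans ?_
  rw [sum_coordDeriv_inl y F h.isDer, add_comm]
  refine congrArg₂ (· + ·) (one_smul ℤ _) ?_
  simp only [evenDeriv, Sum.elim_inl, mapSeries_C (h.isDer _).map_zero, mapSeries_X (h.isDer _), const_zero,
    ring_zero_mul, Finset.sum_const_zero, add_zero, h.inr]
  rw [Finset.sum_eq_single ν]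
  · rw [if_pos rfl, map_one, const_one, one_mul]
  · intro a _ hne
    rw [if_neg hne.symm, map_zero, const_zero, ring_zero_mul]
  · simp

theorem oddDeriv_totalDer (h : IsTangentCalculus δ y) (o : (Fin m ⊕ₗ Fin n) ⊕ₗ (Fin m ⊕ₗ Fin n)) :
    (totalDer δ y F).oddDeriv o = ∑ a, (if o = toLex (Sum.inl (toLex (Sum.inr a))) then
          F.mapCoeff (mapSeries (δ (Sum.inl a))) else 0)
        - ∑ μ, (if o = toLex (Sum.inr (toLex (Sum.inl μ))) then
          F.mapCoeff (MvPowerSeries.pderiv A (Sum.inr μ)) else 0)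
      - totalDer δ y (F.oddDeriv o) := by
  refine (coordDeriv_vectorField (isDer_evenDeriv h.isDer) (evenDeriv_comm h.isDer h.comm)
    (hasParity_totalCoeff y) (Sum.inr o) F).trans ?_
  rw [sum_coordDeriv_inr y F, sub_eq_add_neg _ (totalDer δ y _)]
  exact congrArg₂ (· + ·) rfl (neg_one_zsmul _)

theorem oddDeriv_inl_inl_totalDer (h : IsTangentCalculus δ y) (μ : Fin m) :
    (totalDer δ y F).oddDeriv (toLex (Sum.inl (toLex (Sum.inl μ))))
      = -totalDer δ y (F.oddDeriv (toLex (Sum.inl (toLex (Sum.inl μ))))) := by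
  rw [oddDeriv_totalDer F h]
  simp

theorem oddDeriv_inl_inr_totalDer (h : IsTangentCalculus δ y) (a : Fin n) :
    (totalDer δ y F).oddDeriv (toLex (Sum.inl (toLex (Sum.inr a))))
      = F.mapCoeff (mapSeries (δ (Sum.inl a)))
        - totalDer δ y (F.oddDeriv (toLex (Sum.inl (toLex (Sum.inr a))))) := by
  rw [oddDeriv_totalDer F h]
  simp

theorem oddDeriv_inr_inl_totalDer (h : IsTangentCalculus δ y) (μ : Fin m) :
    (totalDer δ y F).oddDeriv (toLex (Sum.inr (toLex (Sum.inl μ))))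
      = -F.mapCoeff (MvPowerSeries.pderiv A (Sum.inr μ))
        - totalDer δ y (F.oddDeriv (toLex (Sum.inr (toLex (Sum.inl μ))))) := by
  rw [oddDeriv_totalDer F h]
  simp

theorem oddDeriv_inr_inr_totalDer (h : IsTangentCalculus δ y) (a : Fin n) :
    (totalDer δ y F).oddDeriv (toLex (Sum.inr (toLex (Sum.inr a))))
      = -totalDer δ y (F.oddDeriv (toLex (Sum.inr (toLex (Sum.inr a))))) := by
  rw [oddDeriv_totalDer F h]
  simp

end TotalDerivation

end HigherKoszul

/-! ### Multivector fields as functions on T*(ΠTM): antimomenta become momenta of differentials. -/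

namespace HigherKoszul

open Grass

section SeriesEmbedding

variable {σ τ A B : Type} [CommRing A] [CommRing B] (ψ : B →+* A)

/-- Formal power series in a part of the variables, with a change of the coefficients. -/
def seriesEmb (σ : Type) {τ A B : Type} [CommRing A] [CommRing B] (ψ : B →+* A) :
    MvPowerSeries τ B →+* MvPowerSeries (σ ⊕ τ) A :=
  ((MvPowerSeries.rename (R := A) (Function.Embedding.inr : τ ↪ σ ⊕ τ)).toRingHom).comp
    (MvPowerSeries.map ψ)

theorem coeff_seriesEmb (F : MvPowerSeries τ B) (α : τ →₀ ℕ) :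
    MvPowerSeries.coeff (α.embDomain Function.Embedding.inr) (seriesEmb σ ψ F)
      = ψ (MvPowerSeries.coeff α F) :=
  (MvPowerSeries.coeff_embDomain_rename _ _ _).trans (MvPowerSeries.coeff_map _ _ _)

theorem exists_embDomain_eq {x : σ ⊕ τ →₀ ℕ} (h : ∀ a, x (Sum.inl a) = 0) :
    ∃ α : τ →₀ ℕ, α.embDomain Function.Embedding.inr = x := by
  refine ⟨x.comapDomain Sum.inr Sum.inr_injective.injOn, ?_⟩
  ext (a | b)
  · rw [h, Finsupp.embDomain_of_notMem_range _ _ _ (by simp)]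
  · exact Finsupp.embDomain_apply_self Function.Embedding.inr _ b

theorem coeff_seriesEmb_eq_zero (F : MvPowerSeries τ B) {x : σ ⊕ τ →₀ ℕ} {a : σ}
    (h : x (Sum.inl a) ≠ 0) : MvPowerSeries.coeff x (seriesEmb σ ψ F) = 0 := by
  refine MvPowerSeries.coeff_rename_eq_zero _ _ ?_
  rintro ⟨α, rfl⟩
  refine h ?_
  rw [← Finsupp.embDomain_eq_mapDomain, Finsupp.embDomain_of_notMem_range _ _ _ (by simp)]

/-- A power series in the image of `seriesEmb` is determined by its coefficients. -/
theorem seriesEmb_eq {F : MvPowerSeries τ B} {G : MvPowerSeries (σ ⊕ τ) A}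
    (h0 : ∀ x a, x (Sum.inl a) ≠ 0 → MvPowerSeries.coeff x G = 0)
    (h : ∀ α : τ →₀ ℕ, MvPowerSeries.coeff (α.embDomain Function.Embedding.inr) G
      = ψ (MvPowerSeries.coeff α F)) : G = seriesEmb σ ψ F := by
  ext x
  by_cases hx : ∀ a, x (Sum.inl a) = 0
  · obtain ⟨α, rfl⟩ := exists_embDomain_eq hx
    rw [h, coeff_seriesEmb]
  · obtain ⟨a, ha⟩ := not_forall.1 hx
    rw [h0 x a ha, coeff_seriesEmb_eq_zero ψ F ha]

theorem pderiv_inl_seriesEmb [DecidableEq σ] [DecidableEq τ] (a : σ) (F : MvPowerSeries τ B) :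
    MvPowerSeries.pderiv A (Sum.inl a) (seriesEmb σ ψ F) = 0 := by
  ext x
  rw [MvPowerSeries.coeff_pderiv, coeff_seriesEmb_eq_zero ψ F (a := a) (by simp), zero_mul, map_zero]

theorem pderiv_inr_seriesEmb [DecidableEq σ] [DecidableEq τ] (b : τ) (F : MvPowerSeries τ B) :
    MvPowerSeries.pderiv A (Sum.inr b) (seriesEmb σ ψ F)
      = seriesEmb σ ψ (MvPowerSeries.pderiv B b F) := by
  refine seriesEmb_eq ψ (fun x a hx => ?_) fun α => ?_
  · rw [MvPowerSeries.coeff_pderiv, coeff_seriesEmb_eq_zero ψ F (a := a), zero_mul]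
    rw [Finsupp.add_apply, Finsupp.single_eq_of_ne (by simp), add_zero]
    exact hx
  · have h : α.embDomain Function.Embedding.inr + Finsupp.single (Sum.inr b : σ ⊕ τ) 1
        = (α + Finsupp.single b 1).embDomain Function.Embedding.inr := by
      rw [Finsupp.embDomain_add, Finsupp.embDomain_single]; rfl
    have h' : α.embDomain Function.Embedding.inr (Sum.inr b : σ ⊕ τ) = α b :=
      Finsupp.embDomain_apply_self Function.Embedding.inr _ b
    rw [MvPowerSeries.coeff_pderiv, h, coeff_seriesEmb, MvPowerSeries.coeff_pderiv, h', map_mul]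
    simp

theorem mapSeries_seriesEmb {D : A → A} {D' : B → B} (h0 : D 0 = 0) (h : ∀ b, D (ψ b) = ψ (D' b))
    (F : MvPowerSeries τ B) :
    mapSeries D (seriesEmb σ ψ F) = seriesEmb σ ψ (mapSeries D' F) := by
  refine seriesEmb_eq ψ (fun x a hx => ?_) fun α => ?_
  · rw [coeff_mapSeries, coeff_seriesEmb_eq_zero ψ F hx, h0]
  · rw [coeff_mapSeries, coeff_seriesEmb, h, coeff_mapSeries]

theorem mapSeries_seriesEmb_eq_zero {D : A → A} (h0 : D 0 = 0) (h : ∀ b, D (ψ b) = 0)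
    (F : MvPowerSeries τ B) : mapSeries D (seriesEmb σ ψ F) = 0 := by
  rw [mapSeries_seriesEmb ψ (D' := fun _ => 0) h0 (fun b => by rw [h, map_zero])]
  exact map_zero (seriesEmb σ ψ)

theorem seriesEmb_C (c : B) : seriesEmb σ ψ (MvPowerSeries.C c : MvPowerSeries τ B)
    = MvPowerSeries.C (ψ c) := by
  rw [seriesEmb, RingHom.comp_apply, MvPowerSeries.map_C]
  exact MvPowerSeries.rename_C _ _

end SeriesEmbedding

/-- The antimomenta `x*_a`, as momenta of the variables `dx^a`. -/
def multEmb (n m : ℕ) : Fin m ⊕ₗ Fin n ↪o (Fin m ⊕ₗ Fin n) ⊕ₗ (Fin m ⊕ₗ Fin n) :=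
  OrderEmbedding.ofStrictMono
    (fun o => Sum.elim (fun μ => toLex (Sum.inl (toLex (Sum.inl μ))))
      (fun a => toLex (Sum.inr (toLex (Sum.inr a)))) (ofLex o)) fun x y h => by
    rcases lex_cases x with ⟨a, rfl⟩ | ⟨a, rfl⟩ <;> rcases lex_cases y with ⟨b, rfl⟩ | ⟨b, rfl⟩
    · simpa using h
    · exact Sum.Lex.inl_lt_inr _ _
    · exact absurd h (Sum.Lex.not_inr_lt_inl)
    · simpa using h

theorem inl_inr_notMem_multEmb {n m : ℕ} (a : Fin n) :
    toLex (Sum.inl (toLex (Sum.inr a))) ∉ Set.range (multEmb n m) := by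
  rintro ⟨x, hx⟩
  rcases lex_cases x with ⟨b, rfl⟩ | ⟨b, rfl⟩ <;> cases hx

theorem inr_inl_notMem_multEmb {n m : ℕ} (μ : Fin m) :
    toLex (Sum.inr (toLex (Sum.inl μ))) ∉ Set.range (multEmb n m) := by
  rintro ⟨x, hx⟩
  rcases lex_cases x with ⟨b, rfl⟩ | ⟨b, rfl⟩ <;> cases hx

section MultEmbedding

variable {n m : ℕ} {A B : Type} [CommRing A] [Algebra ℂ A] [CommRing B] [Algebra ℂ B]

/-- Multivector fields as functions on the cotangent bundle of the antitangent bundle: the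
antimomentum of a coordinate is the momentum of its differential. -/
def multHamHom (n m : ℕ) (ψ : B →+* A) :
    Grass (Fin m ⊕ₗ Fin n) (MvPowerSeries (Fin m) B) →+* TotalGrass n m A :=
  embedHom (multEmb n m) (seriesEmb (Fin n) ψ)

variable (ψ : B →+* A) (Q : Grass (Fin m ⊕ₗ Fin n) (MvPowerSeries (Fin m) B))

theorem multHamHom_inv : multHamHom n m ψ Q.inv = (multHamHom n m ψ Q).inv :=
  embed_inv (multEmb n m).toEmbedding (seriesEmb (Fin n) ψ) Q

theorem hasParity_multHamHom {p : ZMod 2} (hQ : HasParity p Q) :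
    HasParity p (multHamHom n m ψ Q) :=
  hasParity_embed (multEmb n m).toEmbedding (seriesEmb (Fin n) ψ) hQ

theorem pderiv_inl_multHamHom (a : Fin n) :
    (multHamHom n m ψ Q).mapCoeff (MvPowerSeries.pderiv A (Sum.inl a)) = 0 :=
  mapCoeff_embed_eq_zero (multEmb n m).toEmbedding (seriesEmb (Fin n) ψ) _ (map_zero _)
    (pderiv_inl_seriesEmb ψ a) Q

theorem pderiv_inr_multHamHom (μ : Fin m) :
    (multHamHom n m ψ Q).mapCoeff (MvPowerSeries.pderiv A (Sum.inr μ))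
      = multHamHom n m ψ (Q.mapCoeff (MvPowerSeries.pderiv B μ)) :=
  mapCoeff_embed (multEmb n m).toEmbedding (seriesEmb (Fin n) ψ) (seriesEmb (Fin n) ψ) _ _
    (map_zero _) (pderiv_inr_seriesEmb ψ μ) Q

theorem mapSeries_multHamHom {D : A → A} {D' : B → B} (h0 : D 0 = 0) (h : ∀ b, D (ψ b) = ψ (D' b)) :
    (multHamHom n m ψ Q).mapCoeff (mapSeries D) = multHamHom n m ψ (Q.mapCoeff (mapSeries D')) :=
  mapCoeff_embed (multEmb n m).toEmbedding (seriesEmb (Fin n) ψ) (seriesEmb (Fin n) ψ) _ _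
    (MvPowerSeries.ext fun _ => h0) (mapSeries_seriesEmb ψ h0 h) Q

theorem mapSeries_multHamHom_eq_zero {D : A → A} (h0 : D 0 = 0) (h : ∀ b, D (ψ b) = 0) :
    (multHamHom n m ψ Q).mapCoeff (mapSeries D) = 0 :=
  mapCoeff_embed_eq_zero (multEmb n m).toEmbedding (seriesEmb (Fin n) ψ) _
    (MvPowerSeries.ext fun _ => h0) (mapSeries_seriesEmb_eq_zero ψ h0 h) Q

theorem oddDeriv_inl_inl_multHamHom (μ : Fin m) :
    (multHamHom n m ψ Q).oddDeriv (toLex (Sum.inl (toLex (Sum.inl μ))))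
      = multHamHom n m ψ (Q.oddDeriv (toLex (Sum.inl μ))) :=
  (embed_oddDeriv (multEmb n m) (seriesEmb (Fin n) ψ) (toLex (Sum.inl μ)) Q).symm

theorem oddDeriv_inr_inr_multHamHom (a : Fin n) :
    (multHamHom n m ψ Q).oddDeriv (toLex (Sum.inr (toLex (Sum.inr a))))
      = multHamHom n m ψ (Q.oddDeriv (toLex (Sum.inr a))) :=
  (embed_oddDeriv (multEmb n m) (seriesEmb (Fin n) ψ) (toLex (Sum.inr a)) Q).symm

theorem oddDeriv_inl_inr_multHamHom (a : Fin n) :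
    (multHamHom n m ψ Q).oddDeriv (toLex (Sum.inl (toLex (Sum.inr a)))) = 0 :=
  oddDeriv_embed_of_notMem _ _ (inl_inr_notMem_multEmb a) Q

theorem oddDeriv_inr_inl_multHamHom (μ : Fin m) :
    (multHamHom n m ψ Q).oddDeriv (toLex (Sum.inr (toLex (Sum.inl μ)))) = 0 :=
  oddDeriv_embed_of_notMem _ _ (inr_inl_notMem_multEmb μ) Q

theorem embed_embed {ο₁ ο₂ ο₃ : Type} [Fintype ο₁] [Fintype ο₂] [Fintype ο₃] [LinearOrder ο₁]
    [LinearOrder ο₂] [LinearOrder ο₃] {A₁ A₂ A₃ : Type u} [CommRing A₁] [CommRing A₂] [CommRing A₃]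
    (e : ο₁ ↪ ο₂) (φ : A₁ →+* A₂) (e' : ο₂ ↪ ο₃) (φ' : A₂ →+* A₃) (f : Grass ο₁ A₁) :
    embed e' φ' (embed e φ f) = embed (e.trans e') (φ'.comp φ) f := by
  induction f using Grass.induction with
  | add f g hf hg => rw [embed_add, embed_add, embed_add, hf, hg]
  | mono S a => rw [embed_mono, embed_mono, embed_mono, Finset.map_map]; rfl

theorem multHamHom_embed (f : Grass (Fin m) B) :
    multHamHom n m ψ (embed (lexInl (Fin m) (Fin n)) (MvPowerSeries.C (σ := Fin m) (R := B)) f)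
      = baseHom (Fin n ⊕ Fin m) _ A (embed (lexInl (Fin m) (Fin n)) ψ f) := by
  refine (embed_embed (lexInl (Fin m) (Fin n)).toEmbedding (MvPowerSeries.C (σ := Fin m) (R := B))
    (multEmb n m).toEmbedding (seriesEmb (Fin n) ψ) f).trans (Eq.trans ?_
    (embed_embed (lexInl (Fin m) (Fin n)).toEmbedding ψ (lexInl _ _).toEmbedding
      (MvPowerSeries.C (σ := Fin n ⊕ Fin m) (R := A)) f).symm)
  congr 1
  exact funext fun c => seriesEmb_C ψ c

/-- The coefficients of the image of a multivector field. -/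
theorem lexCoeff_multHamHom (α : Fin m →₀ ℕ) (S : Finset (Fin n)) :
    lexCoeff (α.embDomain Function.Embedding.inr)
        (S.map (lexInr (Fin m) (Fin n)).toEmbedding) (multHamHom n m ψ Q)
      = embed (lexInl (Fin m) (Fin n)) ψ (lexCoeff α S Q) := by
  have h : ∀ R : Finset (Fin m), lexUnion (R.map (lexInl (Fin m) (Fin n)).toEmbedding)
      (S.map (lexInr (Fin m) (Fin n)).toEmbedding)
      = (lexUnion R S).map (multEmb n m).toEmbedding := fun R => by
    rw [lexUnion_eq, lexUnion_eq, Finset.map_union, Finset.map_map, Finset.map_map,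
      Finset.map_map, Finset.map_map]
    rfl
  refine ext_range (lexInl (Fin m) (Fin n)).toEmbedding (fun R => ?_) fun R hR => ?_
  · refine Eq.trans ?_
      (embed_apply_map (lexInl (Fin m) (Fin n)).toEmbedding ψ (lexCoeff α S Q) R).symm
    rw [lexCoeff_apply, h]
    refine (congrArg _ (embed_apply_map (multEmb n m).toEmbedding (seriesEmb (Fin n) ψ) Q _)).trans ?_
    exact coeff_seriesEmb ψ _ α
  · refine Eq.trans ?_ (embed_apply_of_not_subset _ ψ (lexCoeff α S Q) hR).symm
    rw [lexCoeff_apply]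
    refine (congrArg _ (embed_apply_of_not_subset (multEmb n m) (seriesEmb (Fin n) ψ) Q ?_)).trans
      (map_zero _)
    intro hsub
    refine hR fun x hx => ?_
    obtain ⟨y, hy⟩ := hsub (mem_lexUnion_inl.2 hx)
    rcases lex_cases y with ⟨b, rfl⟩ | ⟨b, rfl⟩
    · cases hy; exact ⟨b, rfl⟩
    · cases hy

theorem lexCoeff_multHamHom_eq_zero {x : Fin n ⊕ Fin m →₀ ℕ} {T : Finset (Fin m ⊕ₗ Fin n)}
    (h : (∃ a, x (Sum.inl a) ≠ 0) ∨ ∃ μ, toLex (Sum.inl μ) ∈ T) :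
    lexCoeff x T (multHamHom n m ψ Q) = 0 := by
  refine Grass.ext fun R => ?_
  rw [lexCoeff_apply]
  by_cases hs : ((lexUnion R T : Finset _) : Set _) ⊆ Set.range (multEmb n m)
  · rcases h with ⟨a, ha⟩ | ⟨μ, hμ⟩
    · obtain ⟨W, hW⟩ := exists_map_eq (multEmb n m).toEmbedding hs
      rw [← hW]
      refine (congrArg _ (embed_apply_map (multEmb n m).toEmbedding (seriesEmb (Fin n) ψ) Q
        W)).trans ?_
      exact coeff_seriesEmb_eq_zero ψ _ ha
    · exact absurd (hs (mem_lexUnion_inr.2 hμ)) (inr_inl_notMem_multEmb μ)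
  · exact (congrArg _ (embed_apply_of_not_subset _ _ Q hs)).trans (map_zero _)

end MultEmbedding

end HigherKoszul

/-! ### The field D on forms and on the zero section, and its brackets with forms. -/

namespace HigherKoszul

open Grass

section BaseCalculus

variable {n m : ℕ} {A : Type} [CommRing A] [Algebra ℂ A]

section General

variable {ε ο : Type} [Fintype ε] [DecidableEq ε] [Fintype ο] [LinearOrder ο]

theorem mapSeries_baseHom {D : A → A} (h0 : D 0 = 0) (f : Grass ο A) :
    (baseHom ε ο A f).mapCoeff (mapSeries D) = baseHom ε ο A (f.mapCoeff D) :=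
  mapCoeff_embed (lexInl ο ο).toEmbedding (MvPowerSeries.C (σ := ε) (R := A))
    (MvPowerSeries.C (σ := ε) (R := A)) _ _ (MvPowerSeries.ext fun _ => h0)
    (fun c => mapSeries_C h0 c) f

theorem oddDeriv_inl_baseHom (o : ο) (f : Grass ο A) :
    (baseHom ε ο A f).oddDeriv (toLex (Sum.inl o)) = baseHom ε ο A (f.oddDeriv o) :=
  (embed_oddDeriv (lexInl ο ο) (MvPowerSeries.C (σ := ε) (R := A)) o f).symm

theorem baseHom_gen (o : ο) : baseHom ε ο A (gen o) = gen (toLex (Sum.inl o)) :=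
  embed_gen (lexInl ο ο).toEmbedding (MvPowerSeries.C (σ := ε) (R := A)) o

theorem baseHom_const (c : A) : baseHom ε ο A (const c) = const (MvPowerSeries.C c) :=
  embed_const (lexInl ο ο).toEmbedding (MvPowerSeries.C (σ := ε) (R := A)) c

theorem restrictHom_const_X_mul (a : ε) (F : Grass (ο ⊕ₗ ο) (MvPowerSeries ε A)) :
    restrictHom ε ο A (const (MvPowerSeries.X a) * F) = 0 := Grass.ext fun S => by
  change MvPowerSeries.coeff 0 ((const (MvPowerSeries.X a) * F : Grass (ο ⊕ₗ ο) (MvPowerSeries ε A))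
    (lexUnion S ∅)) = 0
  rw [const_mul_apply, MvPowerSeries.coeff_zero_eq_constantCoeff_apply, map_mul,
    MvPowerSeries.constantCoeff_X, zero_mul]

theorem restrictHom_gen_mul (o : ο) (F : Grass (ο ⊕ₗ ο) (MvPowerSeries ε A)) :
    restrictHom ε ο A (gen (toLex (Sum.inr o)) * F) = 0 := Grass.ext fun S => by
  change MvPowerSeries.coeff 0 ((gen (toLex (Sum.inr o)) * F : Grass (ο ⊕ₗ ο) (MvPowerSeries ε A))
    (lexUnion S ∅)) = 0
  rw [gen_eq_mono, mono_mul_apply, if_neg, map_zero]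
  rw [Finset.singleton_subset_iff, mem_lexUnion_inr]
  exact Finset.notMem_empty o

end General

variable {δ : Fin n ⊕ Fin m → A → A} {y : Fin m → A}

/-- The de Rham differential, given the derivatives `δ` and the differentials `y` of the odd
coordinates. -/
def baseDer (δ : Fin n ⊕ Fin m → A → A) (y : Fin m → A) (f : Grass (Fin m ⊕ₗ Fin n) A) :
    Grass (Fin m ⊕ₗ Fin n) A :=
  ∑ a, gen (toLex (Sum.inr a)) * f.mapCoeff (δ (Sum.inl a))
    + ∑ μ, const (y μ) * f.oddDeriv (toLex (Sum.inl μ))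

theorem baseHom_gen_lex (o : Fin m ⊕ₗ Fin n) :
    baseHom (Fin n ⊕ Fin m) (Fin m ⊕ₗ Fin n) A (gen o) = gen (toLex (Sum.inl o)) :=
  baseHom_gen o

theorem baseHom_const_lex (c : A) :
    baseHom (Fin n ⊕ Fin m) (Fin m ⊕ₗ Fin n) A (const c) = const (MvPowerSeries.C c) :=
  baseHom_const c

theorem restrictHom_const_X_mul_lex (a : Fin n ⊕ Fin m) (F : TotalGrass n m A) :
    restrictHom _ _ A (const (MvPowerSeries.X a) * F) = 0 := restrictHom_const_X_mul a F

theorem restrictHom_gen_mul_lex (o : Fin m ⊕ₗ Fin n) (F : TotalGrass n m A) :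
    restrictHom _ _ A (gen (toLex (Sum.inr o)) * F) = 0 := restrictHom_gen_mul o F

theorem totalDer_baseHom (h : IsTangentCalculus δ y) (f : Grass (Fin m ⊕ₗ Fin n) A) :
    totalDer δ y (baseHom (Fin n ⊕ Fin m) (Fin m ⊕ₗ Fin n) A f)
      = baseHom (Fin n ⊕ Fin m) (Fin m ⊕ₗ Fin n) A (baseDer δ y f) := by
  simp only [totalDer_eq, oddDeriv_inr_baseHom, pderiv_baseHom, ring_mul_zero,
    Finset.sum_const_zero, add_zero, mapSeries_baseHom (h.isDer _).map_zero, oddDeriv_inl_baseHom,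
    baseDer, map_add, map_sum, map_mul, baseHom_gen_lex, baseHom_const_lex]

/-- The components of D along the momenta are linear in the momenta, so they vanish on the zero
section and only the de Rham differential remains. -/
theorem restrictHom_totalDer (F : TotalGrass n m A) :
    restrictHom _ _ A (totalDer δ y F) = baseDer δ y (restrictHom _ _ A F) := by
  simp only [totalDer_eq, map_add, map_sum, restrictHom_const_X_mul_lex, ring_neg_mul, map_neg,
    restrictHom_gen_mul_lex, neg_zero, Finset.sum_const_zero, add_zero, ← baseHom_gen_lex,
    ← baseHom_const_lex, restrictHom_baseHom_mul]
  rw [baseDer]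
  refine congrArg _ (Finset.sum_congr rfl fun μ _ => ?_)
  exact congrArg _ (lexCoeff_oddDeriv_inl 0 ∅ F (toLex (Sum.inl μ)))

variable {hδ : ∀ a, IsDer (δ a)} {hs : ∀ a (c : ℂ) x, δ a (c • x) = c • δ a x}

theorem baseBracket_eq (F : TotalGrass n m A) (f : Grass (Fin m ⊕ₗ Fin n) A) :
    baseBracket δ hδ hs F f
      = ∑ a, F.mapCoeff (MvPowerSeries.pderiv A (Sum.inl a))
          * baseHom _ _ A (f.mapCoeff (δ (Sum.inl a)))
        + ∑ μ, F.mapCoeff (MvPowerSeries.pderiv A (Sum.inr μ))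
          * baseHom _ _ A (f.mapCoeff (δ (Sum.inr μ)))
        + (∑ μ, (F.oddDeriv (toLex (Sum.inr (toLex (Sum.inl μ))))).inv
          * baseHom _ _ A (f.oddDeriv (toLex (Sum.inl μ)))
        + ∑ a, (F.oddDeriv (toLex (Sum.inr (toLex (Sum.inr a))))).inv
          * baseHom _ _ A (f.oddDeriv (toLex (Sum.inr a)))) := by
  rw [baseBracket_apply, Fintype.sum_sum_type, Fintype.sum_sum_type, sum_lex]
  rfl

variable {B : Type} [CommRing B] [Algebra ℂ B] {ψ : B →+* A}
  (Q : Grass (Fin m ⊕ₗ Fin n) (MvPowerSeries (Fin m) B))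

theorem baseBracket_multHamHom (f : Grass (Fin m ⊕ₗ Fin n) A) :
    baseBracket δ hδ hs (multHamHom n m ψ Q) f
      = ∑ μ, multHamHom n m ψ (Q.mapCoeff (MvPowerSeries.pderiv B μ))
          * baseHom _ _ A (f.mapCoeff (δ (Sum.inr μ)))
        + ∑ a, (multHamHom n m ψ (Q.oddDeriv (toLex (Sum.inr a)))).inv
          * baseHom _ _ A (f.oddDeriv (toLex (Sum.inr a))) := by
  have h : (0 : TotalGrass n m A).inv = 0 := map_zero invHom
  rw [baseBracket_eq]
  simp only [pderiv_inl_multHamHom, pderiv_inr_multHamHom, oddDeriv_inr_inl_multHamHom,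
    oddDeriv_inr_inr_multHamHom, h, ring_zero_mul, Finset.sum_const_zero, zero_add]

theorem baseBracket_totalDer_multHamHom (h : IsTangentCalculus δ y)
    (f : Grass (Fin m ⊕ₗ Fin n) A) :
    baseBracket δ hδ hs (totalDer δ y (multHamHom n m ψ Q)) f
      = ∑ a, multHamHom n m ψ (Q.oddDeriv (toLex (Sum.inr a)))
          * baseHom _ _ A (f.mapCoeff (δ (Sum.inl a)))
        + ∑ μ, totalDer δ y (multHamHom n m ψ (Q.mapCoeff (MvPowerSeries.pderiv B μ)))
          * baseHom _ _ A (f.mapCoeff (δ (Sum.inr μ)))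
        + (-∑ μ, (multHamHom n m ψ (Q.mapCoeff (MvPowerSeries.pderiv B μ))).inv
          * baseHom _ _ A (f.oddDeriv (toLex (Sum.inl μ)))
        + ∑ a, totalDer δ y (multHamHom n m ψ (Q.oddDeriv (toLex (Sum.inr a)))).inv
          * baseHom _ _ A (f.oddDeriv (toLex (Sum.inr a)))) := by
  have hD := isSuperDer_totalDer y h.isDer
  have h1 : ∀ F : TotalGrass n m A, (-totalDer δ y F).inv = totalDer δ y F.inv := fun F => by
    rw [hD.map_inv, sgn_one, neg_one_smul, Grass.inv_neg]
  rw [baseBracket_eq]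
  simp only [pderiv_inl_totalDer _ h, pderiv_inr_totalDer _ h, oddDeriv_inr_inl_totalDer _ h,
    oddDeriv_inr_inr_totalDer _ h, pderiv_inl_multHamHom, pderiv_inr_multHamHom,
    oddDeriv_inr_inl_multHamHom, oddDeriv_inr_inr_multHamHom, hD.map_zero, zero_add, sub_zero, h1,
    Grass.inv_neg, ring_neg_mul, Finset.sum_neg_distrib]

end BaseCalculus

section HamiltonianSystem

variable {n m : ℕ} {V : Opens (Fin n → ℝ)}

theorem isTangentCalculus_partialDeriv (V : Opens (Fin n → ℝ)) (m : ℕ) :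
    IsTangentCalculus (CInf.partialDeriv (V := tangentDomain V m))
      fun μ => CInf.coord _ (Sum.inr μ) where
  isDer := CInf.isDer_partialDeriv
  comm := CInf.partialDeriv_comm
  inl a μ := by rw [CInf.partialDeriv_coord, if_neg (by simp)]
  inr ν μ := by rw [CInf.partialDeriv_coord]; simp

theorem baseDer_eq_deRham (ω : Form V m) :
    baseDer CInf.partialDeriv (fun μ => CInf.coord _ (Sum.inr μ)) ω = deRham ω := rfl

theorem deRham_eq_vectorField : (deRham : Form V m → Form V m)
    = vectorField CInf.partialDeriv (Sum.elim (Form.dx V m) (Form.dxi V m))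
      (Sum.elim (fun a => Sum.inl (Sum.inl a)) fun μ => Sum.inr (toLex (Sum.inl μ))) :=
  funext fun ω => by
    rw [vectorField, Fintype.sum_sum_type]
    rfl

theorem coordDeriv_deRham (l : (Fin n ⊕ Fin m) ⊕ (Fin m ⊕ₗ Fin n)) (ω : Form V m) :
    coordDeriv CInf.partialDeriv l (deRham ω)
      = ∑ a, coordDeriv CInf.partialDeriv l (Form.dx V m a) * ω.dX a
        + ∑ μ, coordDeriv CInf.partialDeriv l (Form.dxi V m μ) * ω.dXi μ
        + sgn (coordParity l) • deRham (coordDeriv CInf.partialDeriv l ω) := by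
  have hp : ∀ i : Fin n ⊕ Fin m, HasParity (1 + coordParity ((Sum.elim
      (fun a => Sum.inl (Sum.inl a)) fun μ => Sum.inr (toLex (Sum.inl μ)) :
        Fin n ⊕ Fin m → (Fin n ⊕ Fin m) ⊕ (Fin m ⊕ₗ Fin n)) i))
      ((Sum.elim (Form.dx V m) (Form.dxi V m) : Fin n ⊕ Fin m → Form V m) i) := by
    rintro (a | μ)
    · exact hasParity_gen _
    · exact hasParity_const _
  rw [deRham_eq_vectorField]
  refine (coordDeriv_vectorField CInf.isDer_partialDeriv CInf.partialDeriv_comm hp l ω).trans ?_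
  rw [Fintype.sum_sum_type]
  rfl

theorem dX_deRham (a : Fin n) (ω : Form V m) : (deRham ω).dX a = deRham (ω.dX a) := by
  refine (coordDeriv_deRham (Sum.inl (Sum.inl a)) ω).trans ?_
  have h1 : ∀ b, coordDeriv (CInf.partialDeriv (V := tangentDomain V m)) (Sum.inl (Sum.inl a))
      (Form.dx V m b) = 0 := dX_dx a
  have h2 : ∀ μ, coordDeriv (CInf.partialDeriv (V := tangentDomain V m)) (Sum.inl (Sum.inl a))
      (Form.dxi V m μ) = 0 := dX_dxi a
  simp only [h1, h2, ring_zero_mul, Finset.sum_const_zero, zero_add]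
  exact one_smul ℤ _

theorem dXi_deRham (μ : Fin m) (ω : Form V m) : (deRham ω).dXi μ = -deRham (ω.dXi μ) := by
  refine (coordDeriv_deRham (Sum.inr (toLex (Sum.inl μ))) ω).trans ?_
  have h1 : ∀ b, coordDeriv (CInf.partialDeriv (V := tangentDomain V m))
      (Sum.inr (toLex (Sum.inl μ))) (Form.dx V m b) = 0 := dXi_dx μ
  have h2 : ∀ ν, coordDeriv (CInf.partialDeriv (V := tangentDomain V m))
      (Sum.inr (toLex (Sum.inl μ))) (Form.dxi V m ν) = 0 := dXi_dxi μ
  simp only [h1, h2, ring_zero_mul, Finset.sum_const_zero, zero_add]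
  exact neg_one_zsmul _

theorem partialDeriv_inr_deRham_toForm (μ : Fin m) (f : SFun V m) :
    (deRham f.toForm).mapCoeff (CInf.partialDeriv (Sum.inr μ))
      = SFun.toForm (f.oddDeriv μ) := by
  refine (coordDeriv_deRham (Sum.inl (Sum.inr μ)) f.toForm).trans ?_
  have h1 : ∀ b, coordDeriv (CInf.partialDeriv (V := tangentDomain V m)) (Sum.inl (Sum.inr μ))
      (Form.dx V m b) = 0 := fun b => mapCoeff_gen (CInf.isDer_partialDeriv _) _
  have h2 : ∀ ν, coordDeriv (CInf.partialDeriv (V := tangentDomain V m)) (Sum.inl (Sum.inr μ))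
      (Form.dxi V m ν) = if μ = ν then 1 else 0 := fun ν => by
    refine (mapCoeff_const (CInf.isDer_partialDeriv _).map_zero _).trans ?_
    rw [CInf.partialDeriv_coord]
    by_cases h : μ = ν
    · rw [if_pos h, if_pos (congrArg _ h)]; rfl
    · rw [if_neg h, if_neg (by simpa using h), const_zero]
  have h3 : coordDeriv (CInf.partialDeriv (V := tangentDomain V m)) (Sum.inl (Sum.inr μ))
      f.toForm = 0 := mapCoeff_inr_toForm μ f
  simp only [h1, h2, h3, ring_zero_mul, Finset.sum_const_zero, zero_add, isSuperDer_deRham.map_zero,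
    smul_zero, add_zero, ite_mul, one_mul, Finset.sum_ite_eq, Finset.mem_univ, if_true, dXi_toForm]

theorem oddDeriv_inr_deRham_toForm (a : Fin n) (f : SFun V m) :
    (deRham f.toForm).oddDeriv (toLex (Sum.inr a))
      = SFun.toForm (f.mapCoeff (CInf.partialDeriv a)) := by
  refine (coordDeriv_deRham (Sum.inr (toLex (Sum.inr a))) f.toForm).trans ?_
  have h1 : ∀ b, coordDeriv (CInf.partialDeriv (V := tangentDomain V m))
      (Sum.inr (toLex (Sum.inr a))) (Form.dx V m b) = if a = b then 1 else 0 := fun b => by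
    refine (oddDeriv_gen _ _).trans ?_
    simp
  have h2 : ∀ ν, coordDeriv (CInf.partialDeriv (V := tangentDomain V m))
      (Sum.inr (toLex (Sum.inr a))) (Form.dxi V m ν) = 0 := fun ν => oddDeriv_const _ _
  have h3 : coordDeriv (CInf.partialDeriv (V := tangentDomain V m))
      (Sum.inr (toLex (Sum.inr a))) f.toForm = 0 := oddDeriv_inr_toForm a f
  simp only [h1, h2, h3, ring_zero_mul, Finset.sum_const_zero, add_zero, isSuperDer_deRham.map_zero,
    smul_zero, ite_mul, one_mul, Finset.sum_ite_eq, Finset.mem_univ, if_true, dX_toForm]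

end HamiltonianSystem

end HigherKoszul

/-! ### The model of the brackets by Hamiltonians on T*(ΠTM). -/

namespace HigherKoszul

open Grass

section HamiltonianSystem

variable {n m : ℕ} {V : Opens (Fin n → ℝ)}

/-- Functions on the cotangent bundle of the antitangent bundle of a superdomain. -/
abbrev TotalHam (V : Opens (Fin n → ℝ)) (m : ℕ) : Type :=
  Ham (tangentDomain V m) (Fin m ⊕ₗ Fin n)

/-- Forms as functions on the cotangent bundle. -/
abbrev formHam (V : Opens (Fin n → ℝ)) (m : ℕ) : Form V m →+* TotalHam V m :=
  baseHom (Fin n ⊕ Fin m) (Fin m ⊕ₗ Fin n) (CInf (tangentDomain V m))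

/-- Multivector fields as functions on the cotangent bundle. -/
abbrev multHam (V : Opens (Fin n → ℝ)) (m : ℕ) : Mult V m →+* TotalHam V m :=
  multHamHom n m (pullbackHom V m)

/-- The Hamiltonian vector field of the de Rham differential. -/
abbrev deRhamHam (V : Opens (Fin n → ℝ)) (m : ℕ) : TotalHam V m → TotalHam V m :=
  totalDer (CInf.partialDeriv (V := tangentDomain V m)) fun μ => CInf.coord _ (Sum.inr μ)

/-- The Poisson bracket with a form. -/
abbrev formBracket (V : Opens (Fin n → ℝ)) (m : ℕ) :
    TotalHam V m →ₗ[ℂ] Form V m →ₗ[ℂ] TotalHam V m :=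
  baseBracket (CInf.partialDeriv (V := tangentDomain V m)) CInf.isDer_partialDeriv
    CInf.partialDeriv_smul

theorem isSuperDer_deRhamHam (V : Opens (Fin n → ℝ)) (m : ℕ) : IsSuperDer 1 (deRhamHam V m) :=
  isSuperDer_totalDer _ CInf.isDer_partialDeriv

theorem multHam_toMult (f : SFun V m) : multHam V m f.toMult = formHam V m f.toForm :=
  multHamHom_embed (pullbackHom V m) f

theorem deRhamHam_formHam (ω : Form V m) :
    deRhamHam V m (formHam V m ω) = formHam V m (deRham ω) :=
  totalDer_baseHom (isTangentCalculus_partialDeriv V m) ω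

theorem multHam_schouten (Q : Mult V m) (f : SFun V m) : multHam V m (schouten Q f.toMult)
    = ∑ a, multHam V m (Q.oddDeriv (toLex (Sum.inr a)))
        * formHam V m (SFun.toForm (f.mapCoeff (CInf.partialDeriv a)))
      - ∑ μ, multHam V m (Q.inv.mapCoeff (MvPowerSeries.pderiv _ μ))
        * formHam V m (SFun.toForm (f.oddDeriv μ)) := by
  rw [schouten_toMult, map_sub, map_sum, map_sum]
  simp only [map_mul, multHam_toMult]

theorem formBracket_multHam_toForm (Q : Mult V m) (f : SFun V m) :
    formBracket V m (multHam V m Q) f.toForm = 0 := by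
  refine (baseBracket_multHamHom Q f.toForm).trans ?_
  simp only [mapCoeff_inr_toForm, oddDeriv_inr_toForm, map_zero, ring_mul_zero,
    Finset.sum_const_zero, add_zero]

/-- The image of Q contains only the momenta of dx^a and dξ^μ. They are paired with the derivatives
of df along dx^a and dξ^μ, which are the derivatives of f, and the result is the Schouten bracket.
-/
theorem formBracket_multHam_deRham (Q : Mult V m) (f : SFun V m) :
    formBracket V m (multHam V m Q) (deRham f.toForm)
      = -multHam V m (schouten Q.inv f.toMult) := by
  refine (baseBracket_multHamHom Q (deRham f.toForm)).trans ?_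
  rw [multHam_schouten, neg_sub, sub_eq_add_neg, ← Finset.sum_neg_distrib]
  refine congrArg₂ (· + ·) (Finset.sum_congr rfl fun μ _ => ?_)
    (Finset.sum_congr rfl fun a _ => ?_)
  · rw [partialDeriv_inr_deRham_toForm, Grass.inv_inv]
    rfl
  · rw [oddDeriv_inr_deRham_toForm, oddDeriv_inv, map_neg, ring_neg_mul, neg_neg,
      multHamHom_inv]
    rfl

/-- A function depends on x and ξ only, so the momenta of x and ξ are needed; D introduces them by
turning the momentum of dx^a into that of x^a, and similarly for ξ up to sign. The coefficients are
the derivatives of Q along its antimomenta. -/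
theorem formBracket_deRhamHam_toForm (Q : Mult V m) (f : SFun V m) :
    formBracket V m (deRhamHam V m (multHam V m Q)) f.toForm
      = multHam V m (schouten Q f.toMult) := by
  refine (baseBracket_totalDer_multHamHom Q (isTangentCalculus_partialDeriv V m)
    f.toForm).trans ?_
  rw [multHam_schouten]
  have h1 : ∀ a, f.toForm.mapCoeff (CInf.partialDeriv (Sum.inl a))
    = SFun.toForm (f.mapCoeff (CInf.partialDeriv a)) := fun a => dX_toForm a f
  have h2 : ∀ μ, f.toForm.oddDeriv (toLex (Sum.inl μ)) = SFun.toForm (f.oddDeriv μ) :=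
    fun μ => dXi_toForm μ f
  have h3 : ∀ μ, Grass.mapCoeff (MvPowerSeries.pderiv _ μ) Q.inv
      = (Q.mapCoeff (MvPowerSeries.pderiv _ μ)).inv := fun μ => by
    rw [(isSuperDer_multPderiv μ).map_inv, sgn_zero, one_smul]
  simp only [mapCoeff_inr_toForm, oddDeriv_inr_toForm, map_zero, ring_mul_zero,
    Finset.sum_const_zero, add_zero, h1, h2, h3, multHamHom_inv]
  exact (sub_eq_add_neg _ _).symm

/-- D is a derivation of the Poisson bracket and restricts to d on forms, so it can be taken out of
the bracket because d(df) = 0. The verification is by components. -/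
theorem formBracket_deRhamHam_deRham (Q : Mult V m) (f : SFun V m) :
    formBracket V m (deRhamHam V m (multHam V m Q)) (deRham f.toForm)
      = deRhamHam V m (formBracket V m (multHam V m Q) (deRham f.toForm)) := by
  have hD := isSuperDer_deRhamHam V m
  have h1 : ∀ a, (deRham f.toForm).mapCoeff (CInf.partialDeriv (Sum.inl a))
    = deRham (SFun.toForm (f.mapCoeff (CInf.partialDeriv a))) := fun a =>
      (dX_deRham a f.toForm).trans (congrArg _ (dX_toForm a f))
  have h2 : ∀ μ, (deRham f.toForm).oddDeriv (toLex (Sum.inl μ))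
    = -deRham (SFun.toForm (f.oddDeriv μ)) := fun μ =>
      (dXi_deRham μ f.toForm).trans (congrArg _ (congrArg _ (dXi_toForm μ f)))
  have h3 : ∀ ω : Form V m,
      deRhamHam V m (baseHom (Fin n ⊕ Fin m) (Fin m ⊕ₗ Fin n) (CInf (tangentDomain V m)) ω)
        = baseHom (Fin n ⊕ Fin m) (Fin m ⊕ₗ Fin n) (CInf (tangentDomain V m)) (deRham ω) :=
    deRhamHam_formHam
  refine (baseBracket_totalDer_multHamHom Q (isTangentCalculus_partialDeriv V m) _).trans
    (Eq.trans ?_ (congrArg _ (baseBracket_multHamHom Q (deRham f.toForm)).symm))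
  simp only [hD.map_add, hD.map_sum, hD.map_mul, twist_one, Grass.inv_inv, h1, h2, h3,
    partialDeriv_inr_deRham_toForm, oddDeriv_inr_deRham_toForm, map_neg, ring_mul_neg,
    Finset.sum_neg_distrib, Finset.sum_add_distrib, neg_neg]
  abel

theorem inv_schouten (Q : Mult V m) {p : ZMod 2} {f : SFun V m} (hf : HasParity p f) :
    (schouten Q.inv f.toMult).inv = -(sgn p • schouten Q f.toMult) := by
  have h1 : ∀ a, HasParity p (SFun.toMult (f.mapCoeff (CInf.partialDeriv a))) := fun a =>
    hasParity_toMult (by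
      simpa using! (isSuperDer_mapCoeff (CInf.isDer_partialDeriv a)).hasParity hf)
  have h2 : ∀ μ, HasParity (1 + p) (SFun.toMult (f.oddDeriv μ)) := fun μ =>
    hasParity_toMult ((isSuperDer_oddDeriv μ).hasParity hf)
  have h3 : ∀ μ, Grass.mapCoeff (MvPowerSeries.pderiv _ μ) Q.inv
      = (Q.mapCoeff (MvPowerSeries.pderiv _ μ)).inv := fun μ => by
    rw [(isSuperDer_multPderiv μ).map_inv, sgn_zero, one_smul]
  rw [schouten_toMult, schouten_toMult, inv_sub, inv_sum, inv_sum, smul_sub, neg_sub',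
    Finset.smul_sum, Finset.smul_sum, ← Finset.sum_neg_distrib, ← Finset.sum_neg_distrib,
    ]
  refine congrArg₂ (· - ·) (Finset.sum_congr rfl fun a _ => ?_)
    (Finset.sum_congr rfl fun μ _ => ?_)
  · rw [inv_mul, (h1 a).inv_eq, oddDeriv_inv, Grass.inv_neg, Grass.inv_inv, ring_neg_mul,
      mul_smul_comm]
  · rw [inv_mul, (h2 μ).inv_eq, Grass.inv_inv, h3, sgn_add, sgn_one, neg_one_mul, mul_smul_comm,
      neg_smul]

theorem restrictHom_multHam (Q : Mult V m) :
    restrictHom _ _ _ (multHam V m Q) = SFun.toForm Q.restrict := by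
  have := lexCoeff_multHamHom (pullbackHom V m) Q 0 ∅
  rw [Finsupp.embDomain_zero, Finset.map_empty] at this
  exact this

/-- The system of functions on the cotangent bundle of the antitangent bundle. -/
def hamiltonianSystem (V : Opens (Fin n → ℝ)) (m : ℕ) :
    DerivedBracketSystem (m := m) V (TotalHam V m) where
  bracket := formBracket V m
  ev := restrictHom _ _ _
  inv := Grass.inv
  good _ := True
  symbol := (multHam V m).toAddMonoidHom
  -- The involution is the sign in the supercommutator of the odd operator d with a symbol of
  -- arbitrary parity, as in `deltaOp_apply`; for the even P it has no effect.
  ham := AddMonoidHom.mk' (fun Q : Mult V m => deRhamHam V m (multHam V m Q.inv)) fun Q R => by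
    rw [inv_add, map_add, (isSuperDer_deRhamHam V m).map_add]
  good_bracket _ _ _ := trivial
  bracket_symm x _ _ _ _ h h' := baseBracket_symm x h h'
  bracket_mul x _ _ _ _ _ _ hx h _ := restrictHom_baseBracket_mul x hx h
  inv_bracket x _ _ _ hx h := inv_baseBracket x hx h
  ev_inv := restrictHom_inv
  bracket_symbol_fun := formBracket_multHam_toForm
  bracket_symbol_diff := formBracket_multHam_deRham
  bracket_ham_fun Q f := formBracket_deRhamHam_toForm Q.inv f
  bracket_ham_diff Q f p hf := by
    refine (formBracket_deRhamHam_deRham Q.inv f).trans ?_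
    rw [formBracket_multHam_deRham, Grass.inv_inv]
    change _ = sgn p • deRhamHam V m (multHam V m (Grass.inv (schouten Q.inv f.toMult)))
    rw [inv_schouten Q hf, map_neg, map_zsmul, (isSuperDer_deRhamHam V m).map_neg,
      (isSuperDer_deRhamHam V m).map_neg, (isSuperDer_deRhamHam V m).map_zsmul, smul_neg, smul_smul,
      sgn_mul_self, one_smul]
  ev_symbol := restrictHom_multHam
  ev_ham Q := by
    refine (restrictHom_totalDer (multHam V m Q.inv)).trans ?_
    rw [restrictHom_multHam, multRestrict_inv]
    exact baseDer_eq_deRham _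
  good_ham _ := trivial
  inv_ham Q hQ := by
    have h : Q.inv = Q := by rw [hQ.inv_eq, sgn_zero, one_smul]
    change Grass.inv (deRhamHam V m (multHam V m Q.inv)) = -deRhamHam V m (multHam V m Q.inv)
    rw [h]
    have := ((isSuperDer_deRhamHam V m).hasParity
      (hasParity_multHamHom (pullbackHom V m) Q hQ)).inv_eq
    rwa [add_zero, sgn_one, neg_one_smul] at this

/-- The master Hamiltonian of the higher Koszul brackets. -/
def masterHam (P : Mult V m) : TotalHam V m := deRhamHam V m (multHam V m P)

theorem poisson_baseToHam (G : TotalHam V m) (ω : Form V m) :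
    poisson G (baseToHam ω) = formBracket V m G ω := by
  have h0 : baseToHam ω = formHam V m ω := rfl
  have h1 : ∀ a, (formHam V m ω).mapCoeff (mapSeries (CInf.partialDeriv a))
      = formHam V m (ω.mapCoeff (CInf.partialDeriv a)) := fun a =>
    mapSeries_baseHom (CInf.isDer_partialDeriv a).map_zero ω
  have h2 : ∀ a, (formHam V m ω).mapCoeff (MvPowerSeries.pderiv _ a) = 0 := fun a =>
    pderiv_baseHom a ω
  have h3 : ∀ o, (formHam V m ω).oddDeriv (toLex (Sum.inl o)) = formHam V m (ω.oddDeriv o) :=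
    fun o => oddDeriv_inl_baseHom o ω
  have h4 : ∀ o, (formHam V m ω).oddDeriv (toLex (Sum.inr o)) = 0 := fun o =>
    oddDeriv_inr_baseHom o ω
  refine Eq.trans ?_ (Fintype.sum_sum_type fun k =>
    momDeriv k G * formHam V m (coordDeriv CInf.partialDeriv k ω)).symm
  rw [poisson, h0]
  refine congrArg₂ (· + ·) (Finset.sum_congr rfl fun a _ => ?_) (Finset.sum_congr rfl fun o _ => ?_)
  · rw [h1, h2, ring_mul_zero, sub_zero]
    rfl
  · rw [h3, h4, ring_mul_zero, sub_zero, oddDeriv_inv, ring_neg_mul, neg_neg]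
    rfl

theorem derivedBracket_masterHam {P : Mult V m} (hP : HasParity 0 P) (l : List (Form V m)) :
    derivedBracket (masterHam P) l
      = (hamiltonianSystem V m).ev
        ((hamiltonianSystem V m).iter ((hamiltonianSystem V m).ham P) l) := by
  have h : P.inv = P := by rw [hP.inv_eq, sgn_zero, one_smul]
  have h1 : (hamiltonianSystem V m).ham P = masterHam P :=
    congrArg (fun Q => deRhamHam V m (multHam V m Q)) h
  rw [h1]
  refine congrArg (restrictHom _ _ _) ?_
  generalize masterHam P = G
  induction l generalizing G with
  | nil => rfl
  | cons ω l ih =>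
    rw [List.foldl_cons, poisson_baseToHam]
    exact ih _

end HamiltonianSystem

end HigherKoszul

/-! ### The master equation. -/

namespace HigherKoszul

open Grass

section MasterEquation

theorem even_mul_comm {ο : Type} [LinearOrder ο] [Fintype ο] {A : Type} [CommRing A]
    {f : Grass ο A} (hf : HasParity 0 f) (g : Grass ο A) : f * g = g * f := by
  rw [hf.mul_comm, twist_zero]

theorem odd_mul_comm {ο : Type} [LinearOrder ο] [Fintype ο] {A : Type} [CommRing A]
    {f g : Grass ο A} (hf : HasParity 1 f) (hg : HasParity 1 g) : f * g = -(g * f) := by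
  rw [hf.mul_comm, twist_one, hg.inv_eq, sgn_one, neg_one_smul, neg_mul]

variable {n m : ℕ} {V : Opens (Fin n → ℝ)}

theorem schouten_self {P : Mult V m} (hP : HasParity 0 P) :
    schouten P P
      = (2 : ℤ) • (∑ a, P.oddDeriv (toLex (Sum.inr a)) * P.mapCoeff (mapSeries (CInf.partialDeriv a))
        - ∑ μ, P.mapCoeff (MvPowerSeries.pderiv _ μ) * P.oddDeriv (toLex (Sum.inl μ))) := by
  have h : P.inv = P := by rw [hP.inv_eq, sgn_zero, one_smul]
  have h1 : ∀ a, HasParity 0 (P.mapCoeff (mapSeries (CInf.partialDeriv a))) := fun a => by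
    simpa using! (isSuperDer_multX a).hasParity hP
  have h2 : ∀ μ, HasParity 0 (P.mapCoeff (MvPowerSeries.pderiv _ μ)) := fun μ => by
    simpa using! (isSuperDer_multPderiv μ).hasParity hP
  rw [schouten, h, smul_sub, Finset.smul_sum, Finset.smul_sum, sub_eq_add_neg,
    ← Finset.sum_neg_distrib]
  refine congrArg₂ (· + ·) (Finset.sum_congr rfl fun a _ => ?_) (Finset.sum_congr rfl fun μ _ => ?_)
  · rw [even_mul_comm (h1 a), two_zsmul]
  · rw [even_mul_comm (h2 μ), two_zsmul]
    abel

/-- Let F be the image of P. It Poisson commutes with itself, since no momentum in it is conjugate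
to a coordinate in it, while the bracket of F with D F reproduces the Schouten bracket of P with
itself. As D is a derivation of the bracket with square zero, (D F, D F) is D of this bracket up to
sign. The proof is the corresponding computation in components. -/
theorem poisson_masterHam {P : Mult V m} (hP : HasParity 0 P) :
    poisson (masterHam P) (masterHam P) = -deRhamHam V m (multHam V m (schouten P P)) := by
  have hT := isTangentCalculus_partialDeriv V m
  have hD := isSuperDer_deRhamHam V m
  let F := multHam V m P
  have hF : HasParity 0 F := hasParity_multHamHom (pullbackHom V m) P hP
  have hH : HasParity 1 (masterHam P) := by simpa using! hD.hasParity hF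
  have hinv : (masterHam P).inv = -masterHam P := by rw [hH.inv_eq, sgn_one, neg_one_smul]
  -- Because F depends only on x, ξ and the momenta of their differentials, every first derivative
  -- of H is, up to sign, a derivative of F or D applied to one. The following eight identities list
  -- them.
  have e1 : ∀ a, (masterHam P).mapCoeff (MvPowerSeries.pderiv _ (Sum.inl a))
      = F.oddDeriv (toLex (Sum.inr (toLex (Sum.inr a)))) := fun a => by
    refine (pderiv_inl_totalDer F hT a).trans ?_
    rw [show F.mapCoeff (MvPowerSeries.pderiv _ (Sum.inl a)) = 0 from
      pderiv_inl_multHamHom (pullbackHom V m) P a]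
    exact (congrArg (· + _) hD.map_zero).trans (zero_add _)
  have e2 : ∀ a, (masterHam P).mapCoeff (mapSeries (CInf.partialDeriv (Sum.inl a)))
      = deRhamHam V m (F.mapCoeff (mapSeries (CInf.partialDeriv (Sum.inl a)))) := fun a =>
    mapSeries_inl_totalDer F hT a
  have e3 : ∀ μ, (masterHam P).mapCoeff (MvPowerSeries.pderiv _ (Sum.inr μ))
      = deRhamHam V m (F.mapCoeff (MvPowerSeries.pderiv _ (Sum.inr μ))) := fun μ =>
    pderiv_inr_totalDer F hT μ
  have e4 : ∀ μ, (masterHam P).mapCoeff (mapSeries (CInf.partialDeriv (Sum.inr μ)))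
      = F.oddDeriv (toLex (Sum.inl (toLex (Sum.inl μ)))) := fun μ => by
    refine (mapSeries_inr_totalDer F hT μ).trans ?_
    rw [show F.mapCoeff (mapSeries (CInf.partialDeriv (Sum.inr μ))) = 0 from
      mapSeries_multHamHom_eq_zero (pullbackHom V m) P (CInf.isDer_partialDeriv _).map_zero
        (partialDeriv_inr_pullback μ)]
    exact (congrArg (· + _) hD.map_zero).trans (zero_add _)
  have e5 : ∀ μ, (masterHam P).oddDeriv (toLex (Sum.inr (toLex (Sum.inl μ))))
      = -F.mapCoeff (MvPowerSeries.pderiv _ (Sum.inr μ)) := fun μ => by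
    refine (oddDeriv_inr_inl_totalDer F hT μ).trans ?_
    rw [show F.oddDeriv (toLex (Sum.inr (toLex (Sum.inl μ)))) = 0 from
      oddDeriv_inr_inl_multHamHom (pullbackHom V m) P μ]
    exact (congrArg (_ - ·) hD.map_zero).trans (sub_zero _)
  have e6 : ∀ μ, (masterHam P).oddDeriv (toLex (Sum.inl (toLex (Sum.inl μ))))
      = -deRhamHam V m (F.oddDeriv (toLex (Sum.inl (toLex (Sum.inl μ))))) := fun μ =>
    oddDeriv_inl_inl_totalDer F hT μ
  have e7 : ∀ a, (masterHam P).oddDeriv (toLex (Sum.inr (toLex (Sum.inr a))))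
      = -deRhamHam V m (F.oddDeriv (toLex (Sum.inr (toLex (Sum.inr a))))) := fun a =>
    oddDeriv_inr_inr_totalDer F hT a
  have e8 : ∀ a, (masterHam P).oddDeriv (toLex (Sum.inl (toLex (Sum.inr a))))
      = F.mapCoeff (mapSeries (CInf.partialDeriv (Sum.inl a))) := fun a => by
    refine (oddDeriv_inl_inr_totalDer F hT a).trans ?_
    rw [show F.oddDeriv (toLex (Sum.inl (toLex (Sum.inr a)))) = 0 from
      oddDeriv_inl_inr_multHamHom (pullbackHom V m) P a]
    exact (congrArg (_ - ·) hD.map_zero).trans (sub_zero _)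
  have p1 : ∀ a, HasParity 1 (F.oddDeriv (toLex (Sum.inr (toLex (Sum.inr a))))) := fun a => by
    simpa using! (isSuperDer_oddDeriv _).hasParity hF
  have p2 : ∀ a, HasParity 0 (F.mapCoeff (mapSeries (CInf.partialDeriv (Sum.inl a)))) := fun a => by
    simpa using! (isSuperDer_mapCoeff (isDer_mapSeries (CInf.isDer_partialDeriv _))).hasParity hF
  have p3 : ∀ μ, HasParity 0 (F.mapCoeff (MvPowerSeries.pderiv _ (Sum.inr μ))) := fun μ => by
    simpa using! (isSuperDer_pderiv _).hasParity hF
  have p4 : ∀ μ, HasParity 1 (F.oddDeriv (toLex (Sum.inl (toLex (Sum.inl μ))))) := fun μ => by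
    simpa using! (isSuperDer_oddDeriv _).hasParity hF
  have p5 : ∀ {G : TotalHam V m}, HasParity 0 G → HasParity 1 (deRhamHam V m G) := fun h => by
    simpa using! hD.hasParity h
  have i1 : ∀ a, (F.oddDeriv (toLex (Sum.inr (toLex (Sum.inr a))))).inv
      = -F.oddDeriv (toLex (Sum.inr (toLex (Sum.inr a)))) := fun a => by
    rw [(p1 a).inv_eq, sgn_one, neg_one_smul]
  have i3 : ∀ μ, (F.mapCoeff (MvPowerSeries.pderiv _ (Sum.inr μ))).inv
      = F.mapCoeff (MvPowerSeries.pderiv _ (Sum.inr μ)) := fun μ => by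
    rw [(p3 μ).inv_eq, sgn_zero, one_smul]
  have hS : multHam V m (schouten P P) = (2 : ℤ) •
      (∑ a, F.oddDeriv (toLex (Sum.inr (toLex (Sum.inr a))))
          * F.mapCoeff (mapSeries (CInf.partialDeriv (Sum.inl a)))
        - ∑ μ, F.mapCoeff (MvPowerSeries.pderiv _ (Sum.inr μ))
          * F.oddDeriv (toLex (Sum.inl (toLex (Sum.inl μ))))) := by
    rw [schouten_self hP, map_zsmul, map_sub, map_sum, map_sum]
    refine congrArg _ (congrArg₂ (· - ·) (Finset.sum_congr rfl fun a _ => ?_)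
      (Finset.sum_congr rfl fun μ _ => ?_))
    · rw [map_mul]
      exact (congrArg₂ (· * ·) (oddDeriv_inr_inr_multHamHom (pullbackHom V m) P a)
        (mapSeries_multHamHom (pullbackHom V m) P (CInf.isDer_partialDeriv _).map_zero
          (partialDeriv_inl_pullback a))).symm
    · rw [map_mul]
      exact (congrArg₂ (· * ·) (pderiv_inr_multHamHom (pullbackHom V m) P μ)
        (oddDeriv_inl_inl_multHamHom (pullbackHom V m) P μ)).symm
  rw [hS, hD.map_zsmul, hD.map_sub, hD.map_sum, hD.map_sum, poisson, Fintype.sum_sum_type, sum_lex,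
    hinv]
  simp only [e1, e2, e3, e4, e5, e6, e7, e8, (isSuperDer_oddDeriv _).map_neg, hD.map_mul, twist_one,
    i1, i3, ring_neg_mul, ring_mul_neg, neg_neg]
  -- It remains to bring the two halves of the bracket to the same order of factors; exchanging two
  -- odd factors costs a sign, exchanging with an even one does not.
  have q1 : ∀ a, deRhamHam V m (F.mapCoeff (mapSeries (CInf.partialDeriv (Sum.inl a))))
      * F.oddDeriv (toLex (Sum.inr (toLex (Sum.inr a))))
      = -(F.oddDeriv (toLex (Sum.inr (toLex (Sum.inr a))))
        * deRhamHam V m (F.mapCoeff (mapSeries (CInf.partialDeriv (Sum.inl a))))) := fun a =>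
    odd_mul_comm (p5 (p2 a)) (p1 a)
  have q2 : ∀ μ, F.oddDeriv (toLex (Sum.inl (toLex (Sum.inl μ))))
      * deRhamHam V m (F.mapCoeff (MvPowerSeries.pderiv _ (Sum.inr μ)))
      = -(deRhamHam V m (F.mapCoeff (MvPowerSeries.pderiv _ (Sum.inr μ)))
        * F.oddDeriv (toLex (Sum.inl (toLex (Sum.inl μ))))) := fun μ =>
    odd_mul_comm (p4 μ) (p5 (p3 μ))
  have q3 : ∀ μ, deRhamHam V m (F.oddDeriv (toLex (Sum.inl (toLex (Sum.inl μ)))))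
      * F.mapCoeff (MvPowerSeries.pderiv _ (Sum.inr μ))
      = F.mapCoeff (MvPowerSeries.pderiv _ (Sum.inr μ))
        * deRhamHam V m (F.oddDeriv (toLex (Sum.inl (toLex (Sum.inl μ))))) := fun μ =>
    (even_mul_comm (p3 μ) _).symm
  have q4 : ∀ a, F.mapCoeff (mapSeries (CInf.partialDeriv (Sum.inl a)))
      * deRhamHam V m (F.oddDeriv (toLex (Sum.inr (toLex (Sum.inr a)))))
      = deRhamHam V m (F.oddDeriv (toLex (Sum.inr (toLex (Sum.inr a)))))
        * F.mapCoeff (mapSeries (CInf.partialDeriv (Sum.inl a))) := fun a =>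
    even_mul_comm (p2 a) _
  simp only [q1, q2, q3, q4, Finset.sum_add_distrib, Finset.sum_sub_distrib,
    Finset.sum_neg_distrib]
  abel

theorem masterHam_master {P : Mult V m} (hP : HasParity 0 P) (h : schouten P P = 0) :
    poisson (masterHam P) (masterHam P) = 0 := by
  rw [poisson_masterHam hP, h, map_zero, (isSuperDer_deRhamHam V m).map_zero, neg_zero]

theorem hasParity_masterHam {P : Mult V m} (hP : HasParity 0 P) : HasParity 1 (masterHam P) := by
  simpa using! (isSuperDer_deRhamHam V m).hasParity
    (hasParity_multHamHom (pullbackHom V m) P hP)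

theorem isMasterHamiltonian_masterHam {P : Mult V m} (hP : HasParity 0 P)
    (h : schouten P P = 0) {b : List (Form V m) → Form V m} (hb : IsKoszulBrackets P b) :
    IsMasterHamiltonian (masterHam P) b where
  odd := hasParity_masterHam hP
  master := masterHam_master hP h
  generates l := by
    rw [hb.unique ((hamiltonianSystem V m).isKoszulBrackets hP), derivedBracket_masterHam hP]

end MasterEquation

end HigherKoszul

namespace HigherKoszul

open Grass

theorem sum_ite_zero_eq {ι M : Type*} [AddCommMonoid M] (p : Prop) [Decidable p]
    (s : Finset ι) (f : ι → M) : ∑ i ∈ s, (if p then f i else 0) = if p then ∑ i ∈ s, f i else 0 := by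
  split_ifs
  · rfl
  · exact Finset.sum_const_zero

theorem sum_antidiagonal_ite_mul_ite {A : Type*} [CommRing A] (k d e : ℕ) (x y : A) :
    ∑ q ∈ Finset.HasAntidiagonal.antidiagonal k,
      (if d = q.1 then x else 0) * (if e = q.2 then y else 0) = if d + e = k then x * y else 0 := by
  split_ifs with h
  · rw [Finset.sum_eq_single (d, e)]
    · simp
    · rintro ⟨i, j⟩ _ hne
      by_cases h1 : d = i
      · have h2 : e ≠ j := fun h2 => hne (by rw [h1, h2])
        simp [h2]
      · simp [h1]
    · exact fun hn => absurd (Finset.HasAntidiagonal.mem_antidiagonal.2 h) hn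
  · refine Finset.sum_eq_zero fun q hq => ?_
    by_cases h1 : d = q.1
    · have h2 : e ≠ q.2 := fun h2 => h (by rw [h1, h2]; exact Finset.HasAntidiagonal.mem_antidiagonal.1 hq)
      simp [h2]
    · simp [h1]

section MomentumDegree

variable {ε ο : Type} [Fintype ε] [DecidableEq ε] [Fintype ο] [LinearOrder ο] {A : Type}
  [CommRing A] [Algebra ℂ A]

/-! ### The grading by the degree in the momenta -/

theorem momentumDegree_lexUnion (α : ε →₀ ℕ) (S T : Finset ο) :
    momentumDegree α (lexUnion S T) = α.degree + T.card := by
  rw [momentumDegree, lexRight_lexUnion]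

/-- The component of degree `k` in the momenta. -/
def momentumPart (k : ℕ) : Grass (ο ⊕ₗ ο) (MvPowerSeries ε A) →ₗ[ℂ]
    Grass (ο ⊕ₗ ο) (MvPowerSeries ε A) where
  toFun F := fun U α => if momentumDegree α U = k then MvPowerSeries.coeff α (F U) else 0
  map_add' F G := Grass.ext fun U => MvPowerSeries.ext fun α => by
    change (if _ then MvPowerSeries.coeff α (F U + G U) else 0)
      = (if _ then MvPowerSeries.coeff α (F U) else 0) + if _ then MvPowerSeries.coeff α (G U) else 0
    split_ifs
    · exact map_add _ _ _
    · exact (add_zero _).symm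
  map_smul' c F := Grass.ext fun U => MvPowerSeries.ext fun α => by
    change (if _ then MvPowerSeries.coeff α (c • F U) else 0)
      = c • (if _ then MvPowerSeries.coeff α (F U) else 0)
    split_ifs
    · rfl
    · exact (smul_zero _).symm

variable (F G : Grass (ο ⊕ₗ ο) (MvPowerSeries ε A)) (k : ℕ)

theorem coeff_momentumPart (U : Finset (ο ⊕ₗ ο)) (α : ε →₀ ℕ) :
    MvPowerSeries.coeff α (momentumPart k F U)
      = if momentumDegree α U = k then MvPowerSeries.coeff α (F U) else 0 := rfl

variable {F G} in
theorem ext_momentumPart (h : ∀ k, momentumPart k F = momentumPart k G) : F = G :=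
  Grass.ext fun U => MvPowerSeries.ext fun α => by
    have := congrArg (MvPowerSeries.coeff α) (congrFun (h (momentumDegree α U)) U)
    rwa [coeff_momentumPart, coeff_momentumPart, if_pos rfl, if_pos rfl] at this

theorem momentumPart_of_ne {j : ℕ} (h : j ≠ k) : momentumPart j (momentumPart k F) = 0 :=
  Grass.ext fun U => MvPowerSeries.ext fun α => by
    simp only [coeff_momentumPart]
    split_ifs with h1 h2
    · exact absurd (h1.symm.trans h2) h
    · rfl
    · rfl

theorem momentumPart_inv : momentumPart k F.inv = (momentumPart k F).inv :=
  Grass.ext fun U => MvPowerSeries.ext fun α => by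
    rw [coeff_momentumPart, inv_apply, inv_apply, map_zsmul, map_zsmul, coeff_momentumPart,
      smul_ite, smul_zero]

theorem coeff_grass_mul (U : Finset (ο ⊕ₗ ο)) (α : ε →₀ ℕ) :
    MvPowerSeries.coeff α ((F * G) U) = ∑ T ∈ U.powerset, sgn (inversions T (U \ T) : ZMod 2) •
      ∑ p ∈ Finset.HasAntidiagonal.antidiagonal α, MvPowerSeries.coeff p.1 (F T)
        * MvPowerSeries.coeff p.2 (G (U \ T)) := by
  rw [mul_apply, map_sum]
  refine Finset.sum_congr rfl fun T _ => ?_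
  rw [neg_one_pow_mul_eq, map_zsmul, MvPowerSeries.coeff_mul]

theorem momentumDegree_add {α : ε →₀ ℕ} {U T : Finset (ο ⊕ₗ ο)} (hT : T ⊆ U)
    {p : (ε →₀ ℕ) × (ε →₀ ℕ)} (hp : p.1 + p.2 = α) :
    momentumDegree p.1 T + momentumDegree p.2 (U \ T) = momentumDegree α U := by
  have h : (lexRight U).card = (lexRight T).card + (lexRight (U \ T)).card := by
    have h1 : lexRight U = lexRight T ∪ lexRight (U \ T) := by
      ext o
      simp only [lexRight, Finset.mem_union, Finset.mem_toRight, Finset.mem_map_equiv,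
        Finset.mem_sdiff]
      exact ⟨fun h => (em _).imp_right fun h' => ⟨h, h'⟩, fun h => h.elim (fun h => hT h) And.left⟩
    rw [h1, Finset.card_union_of_disjoint]
    rw [Finset.disjoint_left]
    intro o
    simp only [lexRight, Finset.mem_toRight, Finset.mem_map_equiv, Finset.mem_sdiff]
    exact fun h h' => h'.2 h
  rw [momentumDegree, momentumDegree, momentumDegree, h, ← hp, map_add]
  ring

/-- Every way of splitting a monomial between the two factors also splits its momentum degree, by
`momentumDegree_add`. -/
theorem momentumPart_mul : momentumPart k (F * G)
    = ∑ q ∈ Finset.HasAntidiagonal.antidiagonal k, momentumPart q.1 F * momentumPart q.2 G := by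
  refine Grass.ext fun U => MvPowerSeries.ext fun α => ?_
  rw [Grass.sum_apply, map_sum]
  simp only [coeff_grass_mul, coeff_momentumPart]
  rw [Finset.sum_comm, ← sum_ite_zero_eq]
  refine Finset.sum_congr rfl fun T hT => ?_
  rw [← Finset.smul_sum, Finset.sum_comm, ← smul_zero (sgn _), ← smul_ite, ← sum_ite_zero_eq]
  refine congrArg _ (Finset.sum_congr rfl fun p hp => ?_)
  simp only [smul_zero]
  rw [sum_antidiagonal_ite_mul_ite, momentumDegree_add (Finset.mem_powerset.1 hT)
    (Finset.HasAntidiagonal.mem_antidiagonal.1 hp)]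

theorem lexCoeff_momentumPart (α : ε →₀ ℕ) (T : Finset ο) : lexCoeff α T (momentumPart k F)
    = if α.degree + T.card = k then lexCoeff α T F else 0 := Grass.ext fun S => by
  rw [lexCoeff_apply, coeff_momentumPart, momentumDegree_lexUnion]
  split_ifs <;> rfl

/-- `F` is homogeneous of degree `k` in the momenta. -/
def IsMomentumHomogeneous (k : ℕ) (F : Grass (ο ⊕ₗ ο) (MvPowerSeries ε A)) : Prop :=
  momentumPart k F = F

variable {F G k}

theorem IsMomentumHomogeneous.momentumPart_of_ne (h : IsMomentumHomogeneous k F) {j : ℕ}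
    (hj : j ≠ k) : momentumPart j F = 0 := by
  rw [← h, HigherKoszul.momentumPart_of_ne _ _ hj]

theorem IsMomentumHomogeneous.momentumPart_mul (h : IsMomentumHomogeneous 1 F)
    (G : Grass (ο ⊕ₗ ο) (MvPowerSeries ε A)) (k : ℕ) :
    momentumPart (k + 1) (F * G) = F * momentumPart k G := by
  rw [HigherKoszul.momentumPart_mul, Finset.sum_eq_single (1, k)]
  · exact congrArg (· * _) h
  · rintro ⟨i, j⟩ hij hne
    rw [h.momentumPart_of_ne, ring_zero_mul]
    rintro rfl
    exact hne (Prod.ext rfl (Nat.add_left_cancel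
      ((Finset.HasAntidiagonal.mem_antidiagonal.1 hij).trans (add_comm k 1))))
  · exact fun hn => absurd (Finset.HasAntidiagonal.mem_antidiagonal.2 (add_comm 1 k)) hn

theorem IsMomentumHomogeneous.momentumPart_zero_mul (h : IsMomentumHomogeneous 1 F)
    (G : Grass (ο ⊕ₗ ο) (MvPowerSeries ε A)) : momentumPart 0 (F * G) = 0 := by
  rw [HigherKoszul.momentumPart_mul, Finset.Nat.antidiagonal_zero, Finset.sum_singleton,
    h.momentumPart_of_ne (by decide), ring_zero_mul]

theorem IsMomentumHomogeneous.mul (h : IsMomentumHomogeneous 1 F)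
    (hG : IsMomentumHomogeneous k G) : IsMomentumHomogeneous (k + 1) (F * G) :=
  (h.momentumPart_mul G k).trans (congrArg (F * ·) hG)

theorem isMomentumHomogeneous_sum {ι : Type*} {s : Finset ι}
    {F : ι → Grass (ο ⊕ₗ ο) (MvPowerSeries ε A)} (h : ∀ i ∈ s, IsMomentumHomogeneous k (F i)) :
    IsMomentumHomogeneous k (∑ i ∈ s, F i) :=
  (map_sum _ _ _).trans (Finset.sum_congr rfl h)

theorem isMomentumHomogeneous_one :
    IsMomentumHomogeneous 0 (1 : Grass (ο ⊕ₗ ο) (MvPowerSeries ε A)) := by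
  refine Grass.ext fun U => MvPowerSeries.ext fun α => ?_
  rw [coeff_momentumPart, one_eq_mono, mono_apply]
  split_ifs with h1 h2 h2
  · rfl
  · rfl
  · subst h2
    rw [MvPowerSeries.coeff_one, if_neg]
    rintro rfl
    exact h1 (by simp [momentumDegree, show lexRight (∅ : Finset (ο ⊕ₗ ο)) = ∅ from rfl])
  · rfl

theorem isMomentumHomogeneous_const_X_mul (a : ε) {f : Grass (ο ⊕ₗ ο) (MvPowerSeries ε A)}
    (hf : IsMomentumHomogeneous k f) :
    IsMomentumHomogeneous (k + 1) (const (MvPowerSeries.X a) * f) := by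
  refine Grass.ext fun U => MvPowerSeries.ext fun α => ?_
  rw [coeff_momentumPart, const_mul_apply, MvPowerSeries.X_def, MvPowerSeries.coeff_monomial_mul]
  split_ifs with h1 h2 h2
  · rfl
  · rfl
  · rw [← hf, coeff_momentumPart, if_neg, mul_zero]
    rintro rfl
    refine h1 ?_
    nth_rewrite 1 [← add_tsub_cancel_of_le h2]
    rw [momentumDegree, map_add, Finsupp.degree_single, momentumDegree]
    ring
  · rfl

theorem isMomentumHomogeneous_gen (o : ο) : IsMomentumHomogeneous 1
    (gen (toLex (Sum.inr o)) : Grass (ο ⊕ₗ ο) (MvPowerSeries ε A)) := by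
  refine Grass.ext fun U => MvPowerSeries.ext fun α => ?_
  rw [coeff_momentumPart, gen_eq_mono, mono_apply]
  split_ifs with h1 h2 h2
  · rfl
  · rfl
  · subst h2
    rw [MvPowerSeries.coeff_one, if_neg]
    rintro rfl
    refine h1 ?_
    have : lexRight {toLex (Sum.inr o : ο ⊕ ο)} = {o} := by
      ext; simp [lexRight]
    rw [momentumDegree, this]
    simp
  · rfl

theorem momentumPart_baseHom_mul (f : Grass ο A) (G : Grass (ο ⊕ₗ ο) (MvPowerSeries ε A)) (k : ℕ) :
    momentumPart k (baseHom ε ο A f * G) = baseHom ε ο A f * momentumPart k G :=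
  ext_lexCoeff fun α T => by
    rw [lexCoeff_momentumPart]
    refine Eq.trans ?_ (lexCoeff_embed_mul α T _ f).symm
    rw [lexCoeff_momentumPart, mul_ite, ring_mul_zero]
    exact if_congr Iff.rfl (lexCoeff_embed_mul α T _ f) rfl

end MomentumDegree
end HigherKoszul

namespace HigherKoszul

open Grass

section LiftOp

variable {ε ο : Type} [Fintype ε] [DecidableEq ε] [Fintype ο] [LinearOrder ο] {A : Type}
  [CommRing A] [Algebra ℂ A]

/-! ### The action of operators on functions of the momenta -/

/-- The action of an operator on superfunctions on the cotangent bundle, the momenta being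
considered as parameters written on the right. -/
def liftOp (S : Module.End ℂ (Grass ο A)) (F : Grass (ο ⊕ₗ ο) (MvPowerSeries ε A)) :
    Grass (ο ⊕ₗ ο) (MvPowerSeries ε A) :=
  fun U α => S (lexCoeff α (lexRight U) F) (lexLeft U)

variable (S T : Module.End ℂ (Grass ο A)) (F G : Grass (ο ⊕ₗ ο) (MvPowerSeries ε A))

theorem lexCoeff_liftOp (α : ε →₀ ℕ) (R : Finset ο) :
    lexCoeff α R (liftOp S F) = S (lexCoeff α R F) := Grass.ext fun U => by
  change S (lexCoeff α (lexRight (lexUnion U R)) F) (lexLeft (lexUnion U R)) = _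
  rw [lexRight_lexUnion, lexLeft_lexUnion]

theorem liftOp_mul : liftOp (S * T) F = liftOp S (liftOp T F) := ext_lexCoeff fun α R => by
  rw [lexCoeff_liftOp, lexCoeff_liftOp, lexCoeff_liftOp, Module.End.mul_apply]

theorem liftOp_one : liftOp 1 F = F := ext_lexCoeff fun α R => by
  rw [lexCoeff_liftOp, Module.End.one_apply]

theorem lexCoeff_smul (α : ε →₀ ℕ) (R : Finset ο) (c : ℂ) :
    lexCoeff α R (c • F) = c • lexCoeff α R F := rfl

theorem lexCoeff_zero (α : ε →₀ ℕ) (R : Finset ο) :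
    lexCoeff α R (0 : Grass (ο ⊕ₗ ο) (MvPowerSeries ε A)) = 0 := rfl

theorem liftOp_add : liftOp (S + T) F = liftOp S F + liftOp T F := ext_lexCoeff fun α R => by
  rw [lexCoeff_add, lexCoeff_liftOp, lexCoeff_liftOp, lexCoeff_liftOp, LinearMap.add_apply]

theorem liftOp_zero : liftOp (0 : Module.End ℂ (Grass ο A)) F = 0 := ext_lexCoeff fun α R => by
  rw [lexCoeff_liftOp, lexCoeff_zero, LinearMap.zero_apply]

theorem liftOp_smul (c : ℂ) : liftOp (c • S) F = c • liftOp S F := ext_lexCoeff fun α R => by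
  rw [lexCoeff_smul, lexCoeff_liftOp, lexCoeff_liftOp, LinearMap.smul_apply]

theorem liftOp_sub : liftOp (S - T) F = liftOp S F - liftOp T F := by
  rw [sub_eq_add_neg, liftOp_add, ← neg_one_smul ℂ T, liftOp_smul, neg_one_smul, ← sub_eq_add_neg]

theorem liftOp_sum {ι : Type*} (s : Finset ι) (S : ι → Module.End ℂ (Grass ο A)) :
    liftOp (∑ i ∈ s, S i) F = ∑ i ∈ s, liftOp (S i) F := by
  classical
  induction s using Finset.induction_on with
  | empty => rw [Finset.sum_empty, Finset.sum_empty, liftOp_zero]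
  | insert i s hi ih => rw [Finset.sum_insert hi, Finset.sum_insert hi, liftOp_add, ih]

theorem liftOp_add_right : liftOp S (F + G) = liftOp S F + liftOp S G :=
  ext_lexCoeff fun α R => by
    rw [lexCoeff_add, lexCoeff_liftOp, lexCoeff_liftOp, lexCoeff_liftOp, lexCoeff_add, map_add]

theorem liftOp_smul_right (c : ℂ) : liftOp S (c • F) = c • liftOp S F :=
  ext_lexCoeff fun α R => by
    rw [lexCoeff_smul, lexCoeff_liftOp, lexCoeff_liftOp, lexCoeff_smul, map_smul]

/-- `liftOp S` as a linear map. -/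
def liftLin : Grass (ο ⊕ₗ ο) (MvPowerSeries ε A) →ₗ[ℂ] Grass (ο ⊕ₗ ο) (MvPowerSeries ε A) where
  toFun := liftOp S
  map_add' := liftOp_add_right S
  map_smul' c F := liftOp_smul_right S F c

theorem liftOp_sum_right {ι : Type*} (s : Finset ι)
    (F : ι → Grass (ο ⊕ₗ ο) (MvPowerSeries ε A)) :
    liftOp S (∑ i ∈ s, F i) = ∑ i ∈ s, liftOp S (F i) := map_sum (liftLin S) F s

theorem liftOp_momentumPart (k : ℕ) : liftOp S (momentumPart k F) = momentumPart k (liftOp S F) :=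
  ext_lexCoeff fun α R => by
    rw [lexCoeff_liftOp, lexCoeff_momentumPart, lexCoeff_momentumPart, lexCoeff_liftOp]
    split_ifs
    · rfl
    · exact map_zero S

variable {S}

theorem liftOp_eq_baseHom_mul {f : Grass ο A} (h : ∀ g, S g = f * g) :
    liftOp S F = baseHom ε ο A f * F := ext_lexCoeff fun α R => by
  rw [lexCoeff_liftOp, h]
  exact (lexCoeff_embed_mul α R F f).symm

theorem liftOp_eq_mapSeries {D : A → A} (h : ∀ g, S g = g.mapCoeff D) :
    liftOp S F = F.mapCoeff (mapSeries D) := ext_lexCoeff fun α R => by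
  rw [lexCoeff_liftOp, h, lexCoeff_mapSeries]

theorem liftOp_eq_oddDeriv {o : ο} (h : ∀ g, S g = g.oddDeriv o) :
    liftOp S F = F.oddDeriv (toLex (Sum.inl o)) := ext_lexCoeff fun α R => by
  rw [lexCoeff_liftOp, h, lexCoeff_oddDeriv_inl]

variable (S)

theorem lexCoeff_const_X_mul (a : ε) (α : ε →₀ ℕ) (R : Finset ο) :
    lexCoeff α R (const (MvPowerSeries.X a) * F)
      = if Finsupp.single a 1 ≤ α then lexCoeff (α - Finsupp.single a 1) R F else 0 :=
  Grass.ext fun U => by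
    rw [lexCoeff_apply, const_mul_apply, MvPowerSeries.X_def, MvPowerSeries.coeff_monomial_mul]
    split_ifs
    · exact one_mul _
    · rfl

theorem liftOp_const_X_mul (a : ε) : liftOp S (const (MvPowerSeries.X a) * F)
    = const (MvPowerSeries.X a) * liftOp S F := ext_lexCoeff fun α R => by
  rw [lexCoeff_liftOp, lexCoeff_const_X_mul, lexCoeff_const_X_mul, lexCoeff_liftOp]
  split_ifs
  · rfl
  · exact map_zero S

theorem lexCoeff_mul_gen (o : ο) (α : ε →₀ ℕ) (R : Finset ο) :
    lexCoeff α R (F * gen (toLex (Sum.inr o)))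
      = if o ∈ R then sgn ((((R \ {o}).filter fun s => s < o).card + (R \ {o}).card : ℕ) : ZMod 2) •
          lexCoeff α (R \ {o}) F
        else 0 := by
  have h : F * gen (toLex (Sum.inr o)) = gen (toLex (Sum.inr o)) * F.inv := by
    rw [(hasParity_gen _).mul_comm, twist_one, Grass.inv_inv]
  rw [h]
  refine Grass.ext fun U => ?_
  have e : lexUnion U R \ {toLex (Sum.inr o)} = lexUnion U (R \ {o}) := by
    ext x
    rcases lex_cases x with ⟨a, rfl⟩ | ⟨b, rfl⟩ <;>
      simp [mem_lexUnion_inl, mem_lexUnion_inr]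
  rw [lexCoeff_apply, gen_eq_mono, mono_mul_apply]
  have hs : {toLex (Sum.inr o)} ⊆ lexUnion U R ↔ o ∈ R := by
    rw [Finset.singleton_subset_iff, mem_lexUnion_inr]
  by_cases ho : o ∈ R
  · rw [if_pos (hs.2 ho), if_pos ho]
    rw [e, inversions_singleton_left, card_filter_lexUnion_lt_inr, one_mul, inv_apply,
      card_lexUnion, neg_one_pow_mul_eq, smul_smul, ← sgn_add, map_zsmul, Grass.zsmul_apply,
      lexCoeff_apply]
    refine congrArg (fun p => sgn p • _) ?_
    push_cast
    have h2 : (2 : ZMod 2) = 0 := rfl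
    -- The variables in U contribute once through the position of the momentum and once through the
    -- involution, so their effect cancels. Only a sign depending on R and o is left.
    linear_combination (U.card : ZMod 2) * h2
  · rw [if_neg fun h => ho (hs.1 h), if_neg ho]
    rfl

/-- A momentum written on the right is never passed by S, so it comes out without a sign whatever
the parity of S. -/
theorem liftOp_mul_gen (o : ο) : liftOp S (F * gen (toLex (Sum.inr o)))
    = liftOp S F * gen (toLex (Sum.inr o)) := ext_lexCoeff fun α R => by
  rw [lexCoeff_liftOp, lexCoeff_mul_gen, lexCoeff_mul_gen, lexCoeff_liftOp]
  split_ifs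
  · exact map_zsmul S _ _
  · exact map_zero S

end LiftOp

/-! ### The exponential of the phase -/

section Exponential

variable {ε ο : Type} [Fintype ε] [DecidableEq ε] [Fintype ο] [LinearOrder ο] {A : Type}
  [CommRing A] [Algebra ℂ A]

/-- The exponential of `c • φ` for an element `φ` homogeneous of degree one in the momenta. -/
def momentumExp (φ : Grass (ο ⊕ₗ ο) (MvPowerSeries ε A)) (c : ℂ) :
    Grass (ο ⊕ₗ ο) (MvPowerSeries ε A) := fun U α =>
  (c ^ momentumDegree α U / (Nat.factorial (momentumDegree α U) : ℂ)) •
    MvPowerSeries.coeff α (((fun G => φ * G)^[momentumDegree α U] 1) U)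

variable {φ : Grass (ο ⊕ₗ ο) (MvPowerSeries ε A)}

theorem iterate_mul_one (φ : Grass (ο ⊕ₗ ο) (MvPowerSeries ε A)) (k : ℕ) :
    (fun G => φ * G)^[k] 1 = φ ^ k := by
  induction k with
  | zero => exact (pow_zero φ).symm
  | succ k ih => rw [Function.iterate_succ_apply', ih, pow_succ']

theorem isMomentumHomogeneous_pow (hφ : IsMomentumHomogeneous 1 φ) (k : ℕ) :
    IsMomentumHomogeneous k (φ ^ k) := by
  induction k with
  | zero => rw [pow_zero]; exact isMomentumHomogeneous_one
  | succ k ih => rw [pow_succ']; exact hφ.mul ih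

theorem momentumPart_momentumExp (hφ : IsMomentumHomogeneous 1 φ) (c : ℂ) (k : ℕ) :
    momentumPart k (momentumExp φ c) = (c ^ k / (Nat.factorial k : ℂ)) • φ ^ k := by
  refine Eq.trans ?_ (congrArg (_ • ·) (isMomentumHomogeneous_pow hφ k))
  refine Grass.ext fun U => MvPowerSeries.ext fun α => ?_
  change (if momentumDegree α U = k then (_ / _ : ℂ) • MvPowerSeries.coeff α
      (((fun G => φ * G)^[momentumDegree α U] 1) U) else 0)
    = (_ / _ : ℂ) • (if momentumDegree α U = k then MvPowerSeries.coeff α ((φ ^ k) U) else 0)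
  split_ifs with h
  · rw [h, iterate_mul_one]
  · exact (smul_zero _).symm

/-- In degree k both sides are multiples of φ^k, and the comparison of the numerical factors is the
identity e^X e^{-X} = 1 for power series in one variable. -/
theorem momentumExp_neg_mul (hφ : IsMomentumHomogeneous 1 φ) :
    momentumExp φ (-1) * momentumExp φ 1 = 1 := by
  refine ext_momentumPart fun k => ?_
  have h1 : momentumPart k (1 : Grass (ο ⊕ₗ ο) (MvPowerSeries ε A)) = if k = 0 then 1 else 0 := by
    split_ifs with h
    · subst h; exact isMomentumHomogeneous_one
    · exact isMomentumHomogeneous_one.momentumPart_of_ne h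
  have h2 : ∑ q ∈ Finset.HasAntidiagonal.antidiagonal k, ((-1) ^ q.1 / (Nat.factorial q.1 : ℂ))
      * (1 ^ q.2 / (Nat.factorial q.2 : ℂ)) = if k = 0 then 1 else 0 := by
    have := congrArg (PowerSeries.coeff k) (PowerSeries.exp_mul_exp_neg_eq_one (A := ℂ))
    rw [mul_comm, PowerSeries.coeff_mul, PowerSeries.coeff_one] at this
    rw [← this]
    refine Finset.sum_congr rfl fun q _ => ?_
    simp [PowerSeries.evalNegHom, PowerSeries.coeff_exp, div_eq_mul_inv]
  rw [h1, momentumPart_mul]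
  calc _ = ∑ q ∈ Finset.HasAntidiagonal.antidiagonal k, (((-1) ^ q.1 / (Nat.factorial q.1 : ℂ))
      * (1 ^ q.2 / (Nat.factorial q.2 : ℂ))) • φ ^ k := by
        refine Finset.sum_congr rfl fun q hq => ?_
        rw [momentumPart_momentumExp hφ, momentumPart_momentumExp hφ, smul_mul_smul_comm, ← pow_add,
          Finset.HasAntidiagonal.mem_antidiagonal.1 hq]
    _ = _ := by
        rw [← Finset.sum_smul, h2]
        split_ifs with h
        · rw [h, pow_zero, one_smul]
        · exact zero_smul ℂ _

theorem inv_momentumExp (hφ : IsMomentumHomogeneous 1 φ) (he : HasParity 0 φ) (c : ℂ) :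
    (momentumExp φ c).inv = momentumExp φ c := by
  have h : ∀ k, (φ ^ k).inv = φ ^ k := fun k => by
    induction k with
    | zero => rw [pow_zero, Grass.inv_one]
    | succ k ih => rw [pow_succ, Grass.inv_mul, ih, he.inv_eq, sgn_zero, one_smul]
  refine ext_momentumPart fun k => ?_
  rw [momentumPart_inv, momentumPart_momentumExp hφ, Grass.inv_smul, h]

theorem hasParity_momentumExp (hφ : IsMomentumHomogeneous 1 φ) (he : HasParity 0 φ) (c : ℂ) :
    HasParity 0 (momentumExp φ c) :=
  hasParity_iff.2 ((inv_momentumExp hφ he c).trans (one_smul ℤ _).symm)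

theorem superDer_pow {p : ZMod 2} {S : Grass (ο ⊕ₗ ο) (MvPowerSeries ε A) →
    Grass (ο ⊕ₗ ο) (MvPowerSeries ε A)} (hS : IsSuperDer p S) (he : HasParity 0 φ) (k : ℕ) :
    S (φ ^ (k + 1)) = ((k + 1 : ℕ) : ℂ) • (S φ * φ ^ k) := by
  induction k with
  | zero => rw [pow_zero, mul_one, pow_one, zero_add, Nat.cast_one, one_smul]
  | succ k ih =>
    have ht : φ.twist p = φ := by rw [he.twist_eq, zero_mul, sgn_zero, one_smul]
    rw [pow_succ' φ (k + 1), hS.map_mul, ih, ht, mul_smul_comm, ← mul_assoc, even_mul_comm he (S φ),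
      mul_assoc, ← pow_succ', Nat.cast_succ (k + 1), add_smul, one_smul, add_comm]

/-- A base derivation that commutes with the grading acts on the exponential of the phase `φ` by
multiplication with the derivative of `φ`. -/
theorem superDer_momentumExp {p : ZMod 2} {S : Grass (ο ⊕ₗ ο) (MvPowerSeries ε A) →
    Grass (ο ⊕ₗ ο) (MvPowerSeries ε A)} (hS : IsSuperDer p S)
    (hs : ∀ (c : ℂ) F, S (c • F) = c • S F)
    (hm : ∀ k F, S (momentumPart k F) = momentumPart k (S F)) (hφ : IsMomentumHomogeneous 1 φ)
    (he : HasParity 0 φ) : S (momentumExp φ 1) = S φ * momentumExp φ 1 := by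
  have h1 : IsMomentumHomogeneous 1 (S φ) := (hm 1 φ).symm.trans (congrArg S hφ)
  refine ext_momentumPart fun k => ?_
  rw [← hm, momentumPart_momentumExp hφ, hs]
  rcases k with _ | k
  · rw [h1.momentumPart_zero_mul, pow_zero φ, show S 1 = 0 from ?_, smul_zero]
    have := hS.map_mul 1 1
    rw [mul_one, mul_one, show (1 : Grass (ο ⊕ₗ ο) (MvPowerSeries ε A)).twist p = 1 from ?_,
      one_mul] at this
    · exact left_eq_add.1 this
    · rw [hasParity_one.twist_eq, zero_mul, sgn_zero, one_smul]
  · rw [superDer_pow hS he, h1.momentumPart_mul, momentumPart_momentumExp hφ, smul_smul,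
      mul_smul_comm]
    refine congrArg (· • _) ?_
    rw [one_pow, one_pow, Nat.factorial_succ, Nat.cast_mul]
    field_simp

end Exponential
end HigherKoszul

namespace HigherKoszul

open Grass Op

theorem gen_mul_eq_inv_mul {ο A : Type} [LinearOrder ο] [DecidableEq ο] [Fintype ο]
    [CommRing A] (o : ο)
    (f : Grass ο A) : gen o * f = f.inv * gen o := (hasParity_gen o).mul_comm f

/-! ### The phase function z^A p_A and derivatives of its exponential. -/

section PhaseFunction

variable {ε ο : Type} [Fintype ε] [DecidableEq ε] [Fintype ο] [LinearOrder ο] {A : Type}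
  [CommRing A] [Algebra ℂ A]

/-- The phase function, given the even coordinates. -/
def phaseOf (ο : Type) [Fintype ο] [LinearOrder ο] (x : ε → A) :
    Grass (ο ⊕ₗ ο) (MvPowerSeries ε A) :=
  ∑ a : ε, const (MvPowerSeries.C (x a) * MvPowerSeries.X a)
    + ∑ o : ο, gen (toLex (Sum.inl o)) * gen (toLex (Sum.inr o))

variable (x : ε → A)

theorem isMomentumHomogeneous_baseHom (f : Grass ο A) :
    IsMomentumHomogeneous 0 (baseHom ε ο A f) := by
  have := momentumPart_baseHom_mul f (1 : Grass (ο ⊕ₗ ο) (MvPowerSeries ε A)) 0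
  rw [mul_one, isMomentumHomogeneous_one, mul_one] at this
  exact this

theorem isMomentumHomogeneous_phaseOf : IsMomentumHomogeneous 1 (phaseOf ο x) := by
  have h1 : IsMomentumHomogeneous 1 (∑ a : ε, const (MvPowerSeries.C (x a) * MvPowerSeries.X a) :
      Grass (ο ⊕ₗ ο) (MvPowerSeries ε A)) := isMomentumHomogeneous_sum fun a _ => by
    rw [mul_comm, const_eq_mono, ← const_mul_mono, ← const_eq_mono, ← baseHom_const]
    exact isMomentumHomogeneous_const_X_mul a (isMomentumHomogeneous_baseHom _)
  have h2 : IsMomentumHomogeneous 1 (∑ o : ο, gen (toLex (Sum.inl o)) * gen (toLex (Sum.inr o)) :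
      Grass (ο ⊕ₗ ο) (MvPowerSeries ε A)) := isMomentumHomogeneous_sum fun o _ => by
    rw [← baseHom_gen]
    exact (momentumPart_baseHom_mul _ _ _).trans (congrArg _ (isMomentumHomogeneous_gen o))
  exact (map_add _ _ _).trans (congrArg₂ _ h1 h2)

theorem hasParity_phaseOf : HasParity 0 (phaseOf ο x) :=
  (hasParity_sum _ _ fun _ _ => hasParity_const _).add
    (hasParity_sum _ _ fun _ _ => (hasParity_gen _).mul (hasParity_gen _))

theorem mapSeries_phaseOf {δ : A → A} (hδ : IsDer δ) {a : ε}
    (h : ∀ b, δ (x b) = if a = b then 1 else 0) :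
    (phaseOf ο x).mapCoeff (mapSeries δ) = const (MvPowerSeries.X a) := by
  have hD := isSuperDer_mapCoeff (ο := ο ⊕ₗ ο) (isDer_mapSeries (σ := ε) hδ)
  let L : Grass (ο ⊕ₗ ο) (MvPowerSeries ε A) →+ Grass (ο ⊕ₗ ο) (MvPowerSeries ε A) :=
    AddMonoidHom.mk' _ hD.map_add
  change L (phaseOf ο x) = _
  have h1 : ∀ b, L (const (MvPowerSeries.C (x b) * MvPowerSeries.X b))
      = if a = b then const (MvPowerSeries.X b) else 0 := fun b => by
    refine (mapCoeff_const (isDer_mapSeries hδ).map_zero _).trans ?_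
    rw [(isDer_mapSeries hδ).map_mul, mapSeries_X hδ, mul_zero, add_zero, mapSeries_C hδ.map_zero, h]
    split_ifs
    · rw [map_one, one_mul]
    · rw [map_zero, zero_mul, const_zero]
  have h2 : ∀ o, L (gen (toLex (Sum.inl o)) * gen (toLex (Sum.inr o))) = 0 := fun o => by
    refine (hD.map_mul _ _).trans ?_
    rw [mapCoeff_gen (isDer_mapSeries hδ), mapCoeff_gen (isDer_mapSeries hδ), ring_zero_mul,
      ring_mul_zero, add_zero]
  rw [phaseOf, map_add, map_sum, map_sum, Finset.sum_congr rfl fun o _ => h2 o,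
    Finset.sum_const_zero, add_zero, Finset.sum_congr rfl fun b _ => h1 b, Finset.sum_ite_eq,
    if_pos (Finset.mem_univ _)]

theorem oddDeriv_phaseOf (o : ο) :
    (phaseOf ο x).oddDeriv (toLex (Sum.inl o)) = gen (toLex (Sum.inr o)) := by
  let L : Grass (ο ⊕ₗ ο) (MvPowerSeries ε A) →+ Grass (ο ⊕ₗ ο) (MvPowerSeries ε A) :=
    AddMonoidHom.mk' _ (isSuperDer_oddDeriv (toLex (Sum.inl o))).map_add
  change L (phaseOf ο x) = _
  have h1 : ∀ b, L (const (MvPowerSeries.C (x b) * MvPowerSeries.X b)) = 0 := fun b =>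
    oddDeriv_const _ _
  have h2 : ∀ o', L (gen (toLex (Sum.inl o')) * gen (toLex (Sum.inr o')))
      = if o = o' then gen (toLex (Sum.inr o')) else 0 := fun o' => by
    refine (oddDeriv_mul _ _ _).trans ?_
    rw [oddDeriv_gen, oddDeriv_gen]
    by_cases h : o = o'
    · subst h; simp
    · simp [h]
  rw [phaseOf, map_add, map_sum, map_sum, Finset.sum_congr rfl fun o _ => h1 o,
    Finset.sum_const_zero, zero_add, Finset.sum_congr rfl fun b _ => h2 b, Finset.sum_ite_eq,
    if_pos (Finset.mem_univ _)]

/-- The function `e^{z^A p_A}`. -/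
def phaseExp (ο : Type) [Fintype ο] [LinearOrder ο] (x : ε → A) (c : ℂ) :
    Grass (ο ⊕ₗ ο) (MvPowerSeries ε A) := momentumExp (phaseOf ο x) c

theorem hasParity_phaseExp (c : ℂ) : HasParity 0 (phaseExp ο x c) :=
  hasParity_momentumExp (isMomentumHomogeneous_phaseOf x) (hasParity_phaseOf x) c

theorem phaseExp_neg_mul : phaseExp ο x (-1) * phaseExp ο x 1 = 1 :=
  momentumExp_neg_mul (isMomentumHomogeneous_phaseOf x)

theorem mapSeries_phaseExp {δ : A → A} (hδ : IsDer δ) (hs : ∀ (c : ℂ) f, δ (c • f) = c • δ f)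
    {a : ε} (h : ∀ b, δ (x b) = if a = b then 1 else 0) :
    (phaseExp ο x 1).mapCoeff (mapSeries δ) = const (MvPowerSeries.X a) * phaseExp ο x 1 := by
  refine (superDer_momentumExp (isSuperDer_mapCoeff (isDer_mapSeries hδ)) (fun c F => ?_)
    (fun k F => ?_) (isMomentumHomogeneous_phaseOf x) (hasParity_phaseOf x)).trans
    (congrArg (· * _) (mapSeries_phaseOf x hδ h))
  · exact Grass.ext fun U => MvPowerSeries.ext fun α => hs c _
  · refine ext_lexCoeff fun α T => ?_
    rw [lexCoeff_mapSeries, lexCoeff_momentumPart, lexCoeff_momentumPart, lexCoeff_mapSeries]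
    split_ifs
    · rfl
    · exact (isSuperDer_mapCoeff hδ).map_zero

theorem oddDeriv_phaseExp (o : ο) : (phaseExp ο x 1).oddDeriv (toLex (Sum.inl o))
    = gen (toLex (Sum.inr o)) * phaseExp ο x 1 := by
  have hs : ∀ (c : ℂ) (F : Grass (ο ⊕ₗ ο) (MvPowerSeries ε A)),
      (c • F).oddDeriv (toLex (Sum.inl o)) = c • F.oddDeriv (toLex (Sum.inl o)) := fun c F => by
    rw [oddDeriv_smul]
  refine (superDer_momentumExp (isSuperDer_oddDeriv (toLex (Sum.inl o))) hs
    (fun k F => ?_) (isMomentumHomogeneous_phaseOf x) (hasParity_phaseOf x)).trans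
    (congrArg (· * _) (oddDeriv_phaseOf x o))
  refine ext_lexCoeff fun α T => ?_
  rw [lexCoeff_oddDeriv_inl, lexCoeff_momentumPart, lexCoeff_momentumPart, lexCoeff_oddDeriv_inl]
  split_ifs
  · rfl
  · exact (isSuperDer_oddDeriv _).map_zero

/-! ### Products of derivatives of the exponential of the phase -/

variable {κ : Type} [LinearOrder κ] {D : κ → Module.End ℂ (Grass ο A)} {x}

/-- Each odd derivative multiplies the exponential by the conjugate momentum. The derivatives are
applied starting with the largest index, so every new momentum is placed in front of later ones and
no sign arises. -/
theorem liftOp_oddProd (e : κ ↪o ο) (hD : ∀ a f, D a f = f.oddDeriv (e a)) (S : Finset κ) :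
    liftOp (oddProd D S) (phaseExp ο x 1)
      = mono ((S.map e.toEmbedding).map (lexInr ο ο).toEmbedding) 1 * phaseExp ο x 1 := by
  induction S using Finset.induction_on_min with
  | empty =>
    rw [oddProd_empty, liftOp_one, Finset.map_empty, Finset.map_empty, ← one_eq_mono, one_mul]
  | insert a S h ih =>
    have hn : toLex (Sum.inl (e a)) ∉ (S.map e.toEmbedding).map (lexInr ο ο).toEmbedding := by
      simp [lexInr_apply]
    have hn' : toLex (Sum.inr (e a)) ∉ (S.map e.toEmbedding).map (lexInr ο ο).toEmbedding := by
      simpa [lexInr_apply] using fun h' => lt_irrefl a (h a h')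
    rw [oddProd_insert _ h, liftOp_mul, ih, liftOp_eq_oddDeriv _ (hD a), oddDeriv_mul,
      oddDeriv_mono_of_notMem hn, ring_zero_mul, zero_add, oddDeriv_phaseExp, ← mul_assoc,
      ← gen_mul_eq_inv_mul, gen_mul_mono hn']
    congr 1
    rw [Finset.map_insert, Finset.map_insert, Finset.filter_eq_empty_iff.2, Finset.card_empty,
      pow_zero, one_mul]
    · rfl
    · intro s hs
      obtain ⟨b, hb, rfl⟩ := Finset.mem_map.1 hs
      obtain ⟨c, hc, rfl⟩ := Finset.mem_map.1 hb
      refine not_lt.2 (Sum.Lex.inr_le_inr_iff.2 (e.monotone (h c hc).le))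

/-- Each derivative along an even coordinate multiplies the exponential by the conjugate momentum.
The monomial factor is carried along so that the result can be iterated over several coordinates. -/
theorem liftOp_pow {E : Module.End ℂ (Grass ο A)} {δ : A → A} (hδ : IsDer δ)
    (hs : ∀ (c : ℂ) f, δ (c • f) = c • δ f) {a : ε} (h : ∀ b, δ (x b) = if a = b then 1 else 0)
    (hE : ∀ f, E f = f.mapCoeff δ) (R : Finset (ο ⊕ₗ ο)) (β : ε →₀ ℕ) (k : ℕ) :
    liftOp (E ^ k) (mono R (MvPowerSeries.monomial β 1) * phaseExp ο x 1)
      = mono R (MvPowerSeries.monomial (β + Finsupp.single a k) 1) * phaseExp ο x 1 := by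
  induction k with
  | zero => rw [pow_zero, liftOp_one, Finsupp.single_zero, add_zero]
  | succ k ih =>
    have h0 : ∀ γ : ε →₀ ℕ, (mono R (MvPowerSeries.monomial γ (1 : A))).mapCoeff (mapSeries δ) = 0 :=
      fun γ => Grass.ext fun U => MvPowerSeries.ext fun α => by
        change δ (MvPowerSeries.coeff α (mono R (MvPowerSeries.monomial γ (1 : A)) U)) = 0
        rw [mono_apply]
        split_ifs
        · rw [MvPowerSeries.coeff_monomial]
          split_ifs
          · exact hδ.map_one
          · exact hδ.map_zero
        · exact hδ.map_zero
    rw [pow_succ', liftOp_mul, ih, liftOp_eq_mapSeries _ hE,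
      (isSuperDer_mapCoeff (isDer_mapSeries hδ)).map_mul, h0, ring_zero_mul, zero_add, twist_zero,
      mapSeries_phaseExp x hδ hs h, ← mul_assoc, ← even_mul_comm (hasParity_const _),
      const_mul_mono, MvPowerSeries.X_def, MvPowerSeries.monomial_mul_monomial, one_mul,
      add_comm (Finsupp.single a 1), add_assoc, ← Finsupp.single_add]

theorem liftOp_evenProd (e : κ → ε) {δ : κ → A → A} (hδ : ∀ μ, IsDer (δ μ))
    (hs : ∀ μ (c : ℂ) f, δ μ (c • f) = c • δ μ f)
    (h : ∀ μ b, δ μ (x b) = if e μ = b then 1 else 0)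
    (hD : ∀ μ f, D μ f = f.mapCoeff (δ μ)) (R : Finset (ο ⊕ₗ ο)) (l : List κ) (α : κ →₀ ℕ) :
    liftOp (evenProd D l α) (mono R 1 * phaseExp ο x 1)
      = mono R (MvPowerSeries.monomial (l.map fun μ => Finsupp.single (e μ) (α μ)).sum 1)
        * phaseExp ο x 1 := by
  induction l with
  | nil => rw [evenProd_nil, liftOp_one]; rfl
  | cons μ l ih =>
    rw [evenProd_cons, liftOp_mul, ih, liftOp_pow (hδ μ) (hs μ) (h μ) (hD μ), List.map_cons,
      List.sum_cons, add_comm]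

theorem lexCoeff_mono (α β : ε →₀ ℕ) (R T : Finset ο) :
    lexCoeff α T (mono (R.map (lexInr ο ο).toEmbedding) (MvPowerSeries.monomial β (1 : A)))
      = if T = R ∧ α = β then 1 else 0 := Grass.ext fun S => by
  have h : lexUnion S T = R.map (lexInr ο ο).toEmbedding ↔ S = ∅ ∧ T = R := by
    constructor
    · intro h
      have h1 := congrArg lexLeft h
      have h2 := congrArg lexRight h
      have h3 : R.map (lexInr ο ο).toEmbedding = lexUnion (∅ : Finset ο) R := by
        rw [lexUnion_eq, Finset.map_empty, Finset.empty_union]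
      rw [h3, lexLeft_lexUnion, lexLeft_lexUnion] at h1
      rw [h3, lexRight_lexUnion, lexRight_lexUnion] at h2
      exact ⟨h1, h2⟩
    · rintro ⟨rfl, rfl⟩
      rw [lexUnion_eq, Finset.map_empty, Finset.empty_union]
  rw [lexCoeff_apply, mono_apply]
  by_cases h1 : S = ∅ ∧ T = R
  · rw [if_pos (h.2 h1), MvPowerSeries.coeff_monomial]
    by_cases h2 : α = β
    · rw [if_pos h2, if_pos ⟨h1.2, h2⟩, one_eq_mono, mono_apply, if_pos h1.1]
    · rw [if_neg h2, if_neg fun h => h2 h.2]; rfl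
  · rw [if_neg fun h' => h1 (h.1 h')]
    split_ifs with h2
    · rw [one_eq_mono, mono_apply, if_neg fun h' => h1 ⟨h', h2.1⟩]; rfl
    · rfl

end PhaseFunction
end HigherKoszul

/-! ### The full symbol of Q̂. -/

namespace HigherKoszul

open Grass Op

theorem sum_map_single_finRange {σ : Type} {m : ℕ} (e : Fin m ↪ σ) (α : Fin m →₀ ℕ) :
    ((List.finRange m).map fun μ => Finsupp.single (e μ) (α μ)).sum = α.embDomain e := by
  conv_rhs => rw [← Finsupp.univ_sum_single α, ← Finsupp.embDomain.addMonoidHom_apply, map_sum]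
  rw [← List.ofFn_eq_map, List.sum_ofFn]
  exact Finset.sum_congr rfl fun μ _ => (Finsupp.embDomain_single e μ (α μ)).symm

section MultSum

variable {n m : ℕ} {A B : Type} [CommRing A] [Algebra ℂ A] [CommRing B] [Algebra ℂ B]

/-- The monomial in the momenta of the differentials. -/
def fibreMono (n m : ℕ) (A : Type) [CommRing A] (α : Fin m →₀ ℕ) (S : Finset (Fin n)) :
    TotalGrass n m A :=
  mono ((S.map (lexInr (Fin m) (Fin n)).toEmbedding).map
    (lexInr (Fin m ⊕ₗ Fin n) (Fin m ⊕ₗ Fin n)).toEmbedding)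
    (MvPowerSeries.monomial (α.embDomain Function.Embedding.inr) 1)

variable (ψ : B →+* A) (Q : Grass (Fin m ⊕ₗ Fin n) (MvPowerSeries (Fin m) B))

theorem lexCoeff_baseHom_mul_fibreMono (f : Grass (Fin m ⊕ₗ Fin n) A) (α : Fin m →₀ ℕ)
    (S : Finset (Fin n)) (β : Fin n ⊕ Fin m →₀ ℕ) (T : Finset (Fin m ⊕ₗ Fin n)) :
    lexCoeff β T (baseHom (Fin n ⊕ Fin m) (Fin m ⊕ₗ Fin n) A f * fibreMono n m A α S)
      = if T = S.map (lexInr (Fin m) (Fin n)).toEmbedding ∧ β = α.embDomain Function.Embedding.inr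
        then f else 0 := by
  refine (lexCoeff_embed_mul β T _ f).trans ?_
  refine (congrArg (f * ·) (lexCoeff_mono β _ _ T)).trans ?_
  rw [mul_ite, ring_mul_zero]
  exact if_congr Iff.rfl (mul_one f) rfl

/-- Both sides are compared coefficient by coefficient. Monomials containing momenta of x or ξ occur
on neither side; every other monomial occurs in exactly one term of the sum, precisely when its
degree is j. -/
theorem sum_fibreMono (j : ℕ) : ∑ x ∈ fibreIdx n m j,
      baseHom (Fin n ⊕ Fin m) (Fin m ⊕ₗ Fin n) A (embed (lexInl (Fin m) (Fin n)) ψ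
        (lexCoeff x.2 x.1 Q)) * fibreMono n m A x.2 x.1
    = momentumPart j (multHamHom n m ψ Q) := ext_lexCoeff fun β T => by
  have h : ∀ (s : Finset (Finset (Fin n) × (Fin m →₀ ℕ))) (F : _ → TotalGrass n m A),
      lexCoeff β T (∑ x ∈ s, F x) = ∑ x ∈ s, lexCoeff β T (F x) := fun s F =>
    map_sum (lexCoeffHom (Fin m ⊕ₗ Fin n) A β T) F s
  rw [h, Finset.sum_congr rfl fun x _ => lexCoeff_baseHom_mul_fibreMono _ _ _ β T,
    lexCoeff_momentumPart]
  by_cases h1 : (∃ a, β (Sum.inl a) ≠ 0) ∨ ∃ μ, toLex (Sum.inl μ) ∈ T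
  · rw [lexCoeff_multHamHom_eq_zero ψ Q h1, ite_self]
    refine Finset.sum_eq_zero fun x _ => if_neg ?_
    rintro ⟨rfl, rfl⟩
    rcases h1 with ⟨a, ha⟩ | ⟨μ, hμ⟩
    · exact ha (Finsupp.embDomain_of_notMem_range _ _ _ (by simp))
    · simp [lexInr_apply] at hμ
  · push Not at h1
    obtain ⟨α, rfl⟩ := exists_embDomain_eq h1.1
    obtain ⟨S, rfl⟩ : ∃ S : Finset (Fin n), S.map (lexInr (Fin m) (Fin n)).toEmbedding = T := by
      refine exists_map_eq (lexInr (Fin m) (Fin n)).toEmbedding fun t ht => ?_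
      rcases lex_cases t with ⟨a, rfl⟩ | ⟨b, rfl⟩
      · exact absurd ht (h1.2 a)
      · exact ⟨b, rfl⟩
    have hd : (α.embDomain (Function.Embedding.inr (α := Fin n))).degree = α.degree := by
      rw [← sum_map_single_finRange, map_list_sum, List.map_map, Finsupp.degree_eq_sum,
        ← List.sum_ofFn, List.ofFn_eq_map]
      exact congrArg List.sum (List.map_congr_left fun μ _ => Finsupp.degree_single _ _)
    rw [lexCoeff_multHamHom, Finset.card_map, hd]
    have h2 : ∀ x : Finset (Fin n) × (Fin m →₀ ℕ),
        (S.map (lexInr (Fin m) (Fin n)).toEmbedding = x.1.map (lexInr (Fin m) (Fin n)).toEmbedding ∧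
          α.embDomain (Function.Embedding.inr (α := Fin n)) = x.2.embDomain Function.Embedding.inr)
        ↔ (S, α) = x := fun x => by
      rw [Finset.map_inj, (Finsupp.embDomain_injective _).eq_iff, Prod.ext_iff]
    simp only [h2]
    rw [Finset.sum_ite_eq]
    simp only [mem_fibreIdx, add_comm S.card]

end MultSum

section Symbol

variable {n m : ℕ} {V : Opens (Fin n → ℝ)}

/-- The function `e^{z^A p_A}` on the cotangent bundle of the antitangent bundle. -/
def formExp (V : Opens (Fin n → ℝ)) (m : ℕ) (c : ℂ) : TotalHam V m :=
  phaseExp (Fin m ⊕ₗ Fin n) (CInf.coord (tangentDomain V m)) c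

theorem liftOp_fibreOp (α : Fin m →₀ ℕ) (S : Finset (Fin n)) :
    liftOp (fibreOp V m α S) (formExp V m 1)
      = fibreMono n m (CInf (tangentDomain V m)) α S * formExp V m 1 := by
  refine (liftOp_mul _ _ _).trans ((congrArg _ (liftOp_oddProd (lexInr (Fin m) (Fin n))
    (D := dxOp V m) (fun a f => rfl) S)).trans ((liftOp_evenProd (Sum.inr : Fin m → Fin n ⊕ Fin m)
    (δ := fun μ => CInf.partialDeriv (Sum.inr μ)) (D := dxiOp V m)
    (fun μ => CInf.isDer_partialDeriv _) (fun μ => CInf.partialDeriv_smul _)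
    (fun μ b => CInf.partialDeriv_coord _ _) (fun μ f => rfl) _ _ α).trans ?_))
  have := sum_map_single_finRange (Function.Embedding.inr : Fin m ↪ Fin n ⊕ Fin m) α
  exact congrArg (fun β => mono _ (MvPowerSeries.monomial β 1) * formExp V m 1) this

theorem liftOp_mulLeft (f : Form V m) (F : TotalHam V m) :
    liftOp (mulLeft f) F = formHam V m f * F := liftOp_eq_baseHom_mul F fun _ => rfl

/-- On the exponential the fibre derivatives become momenta, and the coefficients already stand on
the left. So the term of order j in ħ multiplies by the component of degree j exactly. -/
theorem liftOp_quantOp (Q : Mult V m) (j : ℕ) : liftOp (quantOp Q j) (formExp V m 1)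
    = (-Complex.I) ^ j • (momentumPart j (multHam V m Q) * formExp V m 1) := by
  rw [quantOp, liftOp_smul, liftOp_sum]
  refine congrArg _ ?_
  rw [← sum_fibreMono (pullbackHom V m) Q j, Finset.sum_mul]
  refine Finset.sum_congr rfl fun x _ => ?_
  rw [liftOp_mul, liftOp_fibreOp, liftOp_mulLeft, ← mul_assoc]
  rfl

end Symbol
end HigherKoszul

/-! ### Commutators with d acting on the exponential: horizontal and vertical parts of D. -/

namespace HigherKoszul

open Grass Op

section General

variable {ε ο : Type} [Fintype ε] [DecidableEq ε] [Fintype ο] [LinearOrder ο] {A : Type}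
  [CommRing A] [Algebra ℂ A]

theorem isMomentumHomogeneous_const_X (a : ε) :
    IsMomentumHomogeneous 1 (const (MvPowerSeries.X a) : Grass (ο ⊕ₗ ο) (MvPowerSeries ε A)) := by
  have := isMomentumHomogeneous_const_X_mul (A := A) (ο := ο) a isMomentumHomogeneous_one
  rwa [mul_one] at this

theorem momentumPart_neg (k : ℕ) (F : Grass (ο ⊕ₗ ο) (MvPowerSeries ε A)) :
    momentumPart k (-F) = -momentumPart k F := by
  rw [← neg_one_smul ℂ F, map_smul, neg_one_smul]

theorem momentumPart_sum {ι : Type} (k : ℕ) (s : Finset ι)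
    (F : ι → Grass (ο ⊕ₗ ο) (MvPowerSeries ε A)) :
    momentumPart k (∑ i ∈ s, F i) = ∑ i ∈ s, momentumPart k (F i) := map_sum (momentumPart k) F s

end General

section Horizontal

variable {n m : ℕ} {A : Type} [CommRing A] [Algebra ℂ A] (δ : Fin n ⊕ Fin m → A → A)
  (y : Fin m → A)

/-- The de Rham differential of the coefficients of a function of the momenta. -/
def horizontalDer : TotalGrass n m A → TotalGrass n m A :=
  vectorField (evenDeriv δ) (totalCoeff y ∘ Sum.inl) (totalIndex n m ∘ Sum.inl)

/-- The part of the Hamiltonian vector field of the de Rham differential that differentiates along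
the momenta. -/
def verticalDer (F : TotalGrass n m A) : TotalGrass n m A :=
  ∑ a, const (MvPowerSeries.X (Sum.inl a)) * F.oddDeriv (toLex (Sum.inr (toLex (Sum.inr a))))
    + ∑ μ, (-gen (toLex (Sum.inr (toLex (Sum.inl μ)))))
      * F.mapCoeff (MvPowerSeries.pderiv A (Sum.inr μ))

variable (F : TotalGrass n m A)

theorem horizontalDer_eq : horizontalDer δ y F
    = ∑ a, gen (toLex (Sum.inl (toLex (Sum.inr a)))) * F.mapCoeff (mapSeries (δ (Sum.inl a)))
      + ∑ μ, const (MvPowerSeries.C (y μ)) * F.oddDeriv (toLex (Sum.inl (toLex (Sum.inl μ)))) := by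
  rw [horizontalDer, vectorField, Fintype.sum_sum_type]
  rfl

theorem totalDer_eq_add : totalDer δ y F = horizontalDer δ y F + verticalDer F := by
  rw [totalDer_eq, horizontalDer_eq, verticalDer]

variable {δ y}

theorem isSuperDer_horizontalDer (hδ : ∀ a, IsDer (δ a)) : IsSuperDer 1 (horizontalDer δ y) :=
  isSuperDer_vectorField (isDer_evenDeriv hδ) fun i => hasParity_totalCoeff y (Sum.inl i)

theorem lexCoeff_baseHom_mul (f : Grass (Fin m ⊕ₗ Fin n) A) (α : Fin n ⊕ Fin m →₀ ℕ)
    (T : Finset (Fin m ⊕ₗ Fin n)) :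
    lexCoeff α T (baseHom (Fin n ⊕ Fin m) (Fin m ⊕ₗ Fin n) A f * F) = f * lexCoeff α T F :=
  lexCoeff_embed_mul α T F f

theorem liftOp_deRham {D : Module.End ℂ (Grass (Fin m ⊕ₗ Fin n) A)}
    (hD : ∀ f, D f = baseDer δ y f) : liftOp D F = horizontalDer δ y F :=
  ext_lexCoeff fun α T => by
    have h : ∀ {ι : Type} (s : Finset ι) (F : ι → TotalGrass n m A),
        lexCoeff α T (∑ x ∈ s, F x) = ∑ x ∈ s, lexCoeff α T (F x) := fun s F =>
      map_sum (lexCoeffHom (Fin m ⊕ₗ Fin n) A α T) F s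
    rw [lexCoeff_liftOp, hD, horizontalDer_eq, lexCoeff_add, h, h, baseDer]
    simp only [← baseHom_gen_lex, ← baseHom_const_lex, lexCoeff_baseHom_mul, lexCoeff_mapSeries,
      lexCoeff_oddDeriv_inl]

variable {E G : TotalGrass n m A} {c : ℂ} {D K : Module.End ℂ (Grass (Fin m ⊕ₗ Fin n) A)}
  {L : Fin n → Module.End ℂ (Grass (Fin m ⊕ₗ Fin n) A)}
  {R : Fin m → Module.End ℂ (Grass (Fin m ⊕ₗ Fin n) A)}

theorem horizontalDer_exp (hE : HasParity 0 E)
    (h1 : ∀ a, E.mapCoeff (mapSeries (δ (Sum.inl a))) = const (MvPowerSeries.X (Sum.inl a)) * E)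
    (h2 : ∀ μ, E.oddDeriv (toLex (Sum.inl (toLex (Sum.inl μ))))
      = gen (toLex (Sum.inr (toLex (Sum.inl μ)))) * E) :
    horizontalDer δ y E
      = ∑ a, const (MvPowerSeries.X (Sum.inl a)) *
          (baseHom (Fin n ⊕ Fin m) (Fin m ⊕ₗ Fin n) A (gen (toLex (Sum.inr a))) * E)
        + ∑ μ, baseHom (Fin n ⊕ Fin m) (Fin m ⊕ₗ Fin n) A (const (y μ)) * E *
          gen (toLex (Sum.inr (toLex (Sum.inl μ)))) := by
  rw [horizontalDer_eq]
  refine congrArg₂ (· + ·) (Finset.sum_congr rfl fun a _ => ?_) (Finset.sum_congr rfl fun μ _ => ?_)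
  · rw [h1, baseHom_gen_lex, ← mul_assoc, ← mul_assoc, ← even_mul_comm (hasParity_const _)]
  · rw [h2, baseHom_const_lex, mul_assoc, even_mul_comm hE]

theorem liftOp_baseHom_mul {S : Module.End ℂ (Grass (Fin m ⊕ₗ Fin n) A)}
    (f : Grass (Fin m ⊕ₗ Fin n) A) : liftOp S (baseHom (Fin n ⊕ Fin m) (Fin m ⊕ₗ Fin n) A f * E)
      = liftOp (S * mulLeft f) E := by
  rw [liftOp_mul, liftOp_eq_baseHom_mul (S := mulLeft f) E fun _ => rfl]

/-- The action of a commutator with the de Rham differential on an exponential. -/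
theorem liftOp_commutator (hδ : ∀ a, IsDer (δ a)) (hD : ∀ f, D f = baseDer δ y f)
    (hE : HasParity 0 E) (hG : HasParity 0 G)
    (h1 : ∀ a, E.mapCoeff (mapSeries (δ (Sum.inl a))) = const (MvPowerSeries.X (Sum.inl a)) * E)
    (h2 : ∀ μ, E.oddDeriv (toLex (Sum.inl (toLex (Sum.inl μ))))
      = gen (toLex (Sum.inr (toLex (Sum.inl μ)))) * E)
    (hK : liftOp K E = c • (G * E))
    (hL : ∀ a, K * mulLeft (gen (toLex (Sum.inr a)))
      = mulLeft (gen (toLex (Sum.inr a))) * K + L a)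
    (hR : ∀ μ, K * mulLeft (const (y μ)) = mulLeft (const (y μ)) * K + R μ) :
    liftOp (D * K - K * D) E = c • (horizontalDer δ y G * E)
      - (∑ a, const (MvPowerSeries.X (Sum.inl a)) * liftOp (L a) E
        + ∑ μ, liftOp (R μ) E * gen (toLex (Sum.inr (toLex (Sum.inl μ))))) := by
  have hs : ∀ f : TotalGrass n m A, liftOp D (c • f) = c • horizontalDer δ y f := fun f => by
    rw [liftOp_smul_right, liftOp_deRham f hD]
  have hder : horizontalDer δ y (G * E)
      = horizontalDer δ y G * E + G * horizontalDer δ y E := by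
    rw [(isSuperDer_horizontalDer hδ).map_mul, twist_one, hG.inv_eq, sgn_zero, one_smul]
  have hl : ∀ (f : Grass (Fin m ⊕ₗ Fin n) A) (S), K * mulLeft f = mulLeft f * K + S →
      liftOp K (baseHom (Fin n ⊕ Fin m) (Fin m ⊕ₗ Fin n) A f * E)
        = c • (G * (baseHom (Fin n ⊕ Fin m) (Fin m ⊕ₗ Fin n) A f * E)) + liftOp S E :=
    fun f S h => by
      rw [liftOp_baseHom_mul, h, liftOp_add, liftOp_mul, hK,
        liftOp_eq_baseHom_mul (S := mulLeft f) _ fun _ => rfl, mul_smul_comm, ← mul_assoc,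
        ← even_mul_comm hG, mul_assoc]
  -- Applied to the exponential, d produces p_a dx^a and terms with dξ^μ, and K acts after this
  -- multiplication. Moving K past dx^a and y μ creates the commutators L a and R μ; the momenta are
  -- parameters and pass K freely.
  have hKE : liftOp K (horizontalDer δ y E) = c • (G * horizontalDer δ y E)
      + (∑ a, const (MvPowerSeries.X (Sum.inl a)) * liftOp (L a) E
        + ∑ μ, liftOp (R μ) E * gen (toLex (Sum.inr (toLex (Sum.inl μ))))) := by
    have e1 : ∀ a, liftOp K (const (MvPowerSeries.X (Sum.inl a)) *
        (baseHom (Fin n ⊕ Fin m) (Fin m ⊕ₗ Fin n) A (gen (toLex (Sum.inr a))) * E))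
        = c • (G * (const (MvPowerSeries.X (Sum.inl a)) *
          (baseHom (Fin n ⊕ Fin m) (Fin m ⊕ₗ Fin n) A (gen (toLex (Sum.inr a))) * E)))
          + const (MvPowerSeries.X (Sum.inl a)) * liftOp (L a) E := fun a => by
      refine (liftOp_const_X_mul K _ (Sum.inl a)).trans ?_
      rw [hl _ _ (hL a), mul_add, mul_smul_comm, ← mul_assoc, ← mul_assoc G, even_mul_comm hG]
      rfl
    have e2 : ∀ μ, liftOp K (baseHom (Fin n ⊕ Fin m) (Fin m ⊕ₗ Fin n) A (const (y μ)) * E *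
          gen (toLex (Sum.inr (toLex (Sum.inl μ)))))
        = c • (G * (baseHom (Fin n ⊕ Fin m) (Fin m ⊕ₗ Fin n) A (const (y μ)) * E *
          gen (toLex (Sum.inr (toLex (Sum.inl μ))))))
          + liftOp (R μ) E * gen (toLex (Sum.inr (toLex (Sum.inl μ)))) := fun μ => by
      refine (liftOp_mul_gen K _ (toLex (Sum.inl μ))).trans ?_
      rw [hl _ _ (hR μ), add_mul, smul_mul_assoc, mul_assoc G]
      rfl
    rw [horizontalDer_exp hE h1 h2, liftOp_add_right, liftOp_sum_right, liftOp_sum_right,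
      Finset.sum_congr rfl fun a _ => e1 a, Finset.sum_congr rfl fun μ _ => e2 μ,
      Finset.sum_add_distrib, Finset.sum_add_distrib, ← Finset.smul_sum, ← Finset.smul_sum,
      ← Finset.mul_sum, ← Finset.mul_sum, mul_add, smul_add]
    abel
  rw [liftOp_sub, liftOp_mul, liftOp_mul, hK, hs, hder, liftOp_deRham E hD, hKE, smul_add]
  abel

/-- The commutator with dx^a lowered the degree by one and multiplication by the momentum of x^a
restores it. The factors combine by i (-i)^j = -(-i)^(j+1). -/
theorem const_X_mul_smul (a : Fin n) (j : ℕ) (H : TotalGrass n m A) :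
    const (MvPowerSeries.X (Sum.inl a)) * (Complex.I • (-Complex.I) ^ j • (momentumPart j H * E))
      = -((-Complex.I) ^ (j + 1) •
        (momentumPart (j + 1) (const (MvPowerSeries.X (Sum.inl a)) * H) * E)) := by
  have h : IsMomentumHomogeneous 1 (const (MvPowerSeries.X (Sum.inl a)) : TotalGrass n m A) :=
    isMomentumHomogeneous_const_X (Sum.inl a)
  rw [h.momentumPart_mul, mul_smul_comm, mul_smul_comm, ← mul_assoc, smul_smul, ← neg_smul]
  refine congrArg (· • _) ?_
  ring

theorem smul_mul_gen (hE : HasParity 0 E) (μ : Fin m) (j : ℕ) {H : TotalGrass n m A}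
    (hH : HasParity 0 H) :
    ((-Complex.I) • (-Complex.I) ^ j • (momentumPart j H * E))
        * gen (toLex (Sum.inr (toLex (Sum.inl μ))))
      = -((-Complex.I) ^ (j + 1) •
        (momentumPart (j + 1) ((-gen (toLex (Sum.inr (toLex (Sum.inl μ))))) * H) * E)) := by
  have h : IsMomentumHomogeneous 1
      (gen (toLex (Sum.inr (toLex (Sum.inl μ)))) : TotalGrass n m A) :=
    isMomentumHomogeneous_gen (toLex (Sum.inl μ))
  have hp : HasParity 0 (momentumPart j H) := by
    refine hasParity_iff.2 ?_
    rw [← momentumPart_inv, hH.inv_eq, sgn_zero, one_smul, one_smul]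
  rw [ring_neg_mul, momentumPart_neg, h.momentumPart_mul, ring_neg_mul, smul_neg, neg_neg, smul_smul,
    ← pow_succ', smul_mul_assoc, even_mul_comm (f := momentumPart j H * E) (hp.mul hE), mul_assoc]

theorem momentumPart_totalDer (hD : ∀ f, D f = baseDer δ y f) (j : ℕ) :
    momentumPart j (totalDer δ y F)
      = horizontalDer δ y (momentumPart j F) + momentumPart j (verticalDer F) := by
  rw [totalDer_eq_add, map_add, ← liftOp_deRham F hD, ← liftOp_deRham _ hD, liftOp_momentumPart]

theorem momentumPart_verticalDer_mul (j : ℕ) : momentumPart j (verticalDer F) * E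
    = ∑ a, momentumPart j (const (MvPowerSeries.X (Sum.inl a)) *
        F.oddDeriv (toLex (Sum.inr (toLex (Sum.inr a))))) * E
      + ∑ μ, momentumPart j ((-gen (toLex (Sum.inr (toLex (Sum.inl μ))))) *
        F.mapCoeff (MvPowerSeries.pderiv _ (Sum.inr μ))) * E := by
  rw [verticalDer, map_add, momentumPart_sum, momentumPart_sum, add_mul, Finset.sum_mul,
    Finset.sum_mul]

/-- The derivative of the coefficients of H is the horizontal part of D, and the commutators of K
with dx^a and with the y μ supply the vertical part. The last two hypotheses say just this. -/
theorem liftOp_commutator_eq {H : TotalGrass n m A} {j : ℕ} (hδ : ∀ a, IsDer (δ a))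
    (hD : ∀ f, D f = baseDer δ y f) (hE : HasParity 0 E) (hG : HasParity 0 (momentumPart j H))
    (h1 : ∀ a, E.mapCoeff (mapSeries (δ (Sum.inl a))) = const (MvPowerSeries.X (Sum.inl a)) * E)
    (h2 : ∀ μ, E.oddDeriv (toLex (Sum.inl (toLex (Sum.inl μ))))
      = gen (toLex (Sum.inr (toLex (Sum.inl μ)))) * E)
    (hK : liftOp K E = c • (momentumPart j H * E))
    (hL : ∀ a, K * mulLeft (gen (toLex (Sum.inr a)))
      = mulLeft (gen (toLex (Sum.inr a))) * K + L a)
    (hR : ∀ μ, K * mulLeft (const (y μ)) = mulLeft (const (y μ)) * K + R μ)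
    (hL' : ∀ a, const (MvPowerSeries.X (Sum.inl a)) * liftOp (L a) E
      = -(c • (momentumPart j (const (MvPowerSeries.X (Sum.inl a)) *
          H.oddDeriv (toLex (Sum.inr (toLex (Sum.inr a))))) * E)))
    (hR' : ∀ μ, liftOp (R μ) E * gen (toLex (Sum.inr (toLex (Sum.inl μ))))
      = -(c • (momentumPart j ((-gen (toLex (Sum.inr (toLex (Sum.inl μ))))) *
          H.mapCoeff (MvPowerSeries.pderiv _ (Sum.inr μ))) * E))) :
    liftOp (D * K - K * D) E = c • (momentumPart j (totalDer δ y H) * E) := by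
  rw [liftOp_commutator hδ hD hE hG h1 h2 hK hL hR, momentumPart_totalDer H hD, add_mul,
    momentumPart_verticalDer_mul, smul_add, smul_add, Finset.smul_sum, Finset.smul_sum,
    Finset.sum_congr rfl fun a _ => hL' a, Finset.sum_congr rfl fun μ _ => hR' μ,
    Finset.sum_neg_distrib, Finset.sum_neg_distrib, ← neg_add, sub_neg_eq_add]

end Horizontal
end HigherKoszul

/-! ### The principal symbol of Δ. -/

namespace HigherKoszul

open Grass Op

section PrincipalSymbol

variable {n m : ℕ} {V : Opens (Fin n → ℝ)}

theorem hasParity_formExp (c : ℂ) : HasParity 0 (formExp V m c) := hasParity_phaseExp _ c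

theorem bracket_quantOp_zero (Q : Mult V m) {p : ZMod 2} {f : Form V m} (hf : HasParity p f) :
    bracket _ p (quantOp Q 0) (mulLeft f) = 0 :=
  mem_ord_zero.1 (bracket_mem_ord (quantOp_mem_ord Q 0) hf)

variable {P : Mult V m}

theorem liftOp_bracket_dx (hP : HasParity 0 P) (j : ℕ) (a : Fin n) :
    const (MvPowerSeries.X (Sum.inl a)) *
        liftOp (bracket _ 1 (quantOp P j) (mulLeft (Form.dx V m a))) (formExp V m 1)
      = -((-Complex.I) ^ j • (momentumPart j (const (MvPowerSeries.X (Sum.inl a)) *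
          (multHam V m P).oddDeriv (toLex (Sum.inr (toLex (Sum.inr a))))) * formExp V m 1)) := by
  have h : P.inv = P := by rw [hP.inv_eq, sgn_zero, one_smul]
  -- For j = 0 both sides vanish: an operator of order zero supercommutes with dx^a, and a multiple
  -- of a momentum has no component of degree zero.
  rcases j with _ | j
  · have h0 := (isMomentumHomogeneous_const_X (A := CInf (tangentDomain V m))
      (ο := Fin m ⊕ₗ Fin n) (Sum.inl a : Fin n ⊕ Fin m)).momentumPart_zero_mul
      ((multHam V m P).oddDeriv (toLex (Sum.inr (toLex (Sum.inr a)))))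
    refine (congrArg (_ * ·) ((congrArg (liftOp · _) (bracket_quantOp_zero P
      (hasParity_dx V m a))).trans (liftOp_zero _))).trans ?_
    refine Eq.trans (ring_mul_zero _) (Eq.symm ?_)
    refine (congrArg (fun F => -((-Complex.I) ^ 0 • (F * formExp V m 1))) h0).trans ?_
    rw [ring_zero_mul, smul_zero, neg_zero]
  · rw [bracket_quantOp_dx, h, liftOp_smul, liftOp_quantOp]
    refine (const_X_mul_smul a j _).trans ?_
    rw [← oddDeriv_inr_inr_multHamHom]

theorem liftOp_bracket_dxi (hP : HasParity 0 P) (j : ℕ) (μ : Fin m) :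
    liftOp (bracket _ 0 (quantOp P j) (mulLeft (Form.dxi V m μ))) (formExp V m 1)
        * gen (toLex (Sum.inr (toLex (Sum.inl μ))))
      = -((-Complex.I) ^ j • (momentumPart j ((-gen (toLex (Sum.inr (toLex (Sum.inl μ))))) *
          (multHam V m P).mapCoeff (MvPowerSeries.pderiv _ (Sum.inr μ))) * formExp V m 1)) := by
  rcases j with _ | j
  · have h0 := (isMomentumHomogeneous_gen (ε := Fin n ⊕ Fin m) (A := CInf (tangentDomain V m))
      (toLex (Sum.inl μ) : Fin m ⊕ₗ Fin n)).momentumPart_zero_mul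
      (-(multHam V m P).mapCoeff (MvPowerSeries.pderiv _ (Sum.inr μ)))
    refine (congrArg (· * _) ((congrArg (liftOp · _) (bracket_quantOp_zero P
      (hasParity_dxi V m μ))).trans (liftOp_zero _))).trans ?_
    refine Eq.trans (ring_zero_mul _) (Eq.symm ?_)
    rw [ring_mul_neg, ← ring_neg_mul] at h0
    refine (congrArg (fun F => -((-Complex.I) ^ 0 • (F * formExp V m 1))) h0).trans ?_
    rw [ring_zero_mul, smul_zero, neg_zero]
  · have hp : HasParity 0 ((multHam V m P).mapCoeff (MvPowerSeries.pderiv _ (Sum.inr μ))) := by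
      refine hasParity_iff.2 ?_
      have := (isSuperDer_mapCoeff (ο := (Fin m ⊕ₗ Fin n) ⊕ₗ (Fin m ⊕ₗ Fin n)) (isDer_pderiv
        (R := CInf (tangentDomain V m)) (Sum.inr μ : Fin n ⊕ Fin m))).map_inv (multHam V m P)
      rw [(hasParity_multHamHom (pullbackHom V m) P hP).inv_eq, sgn_zero, one_smul, one_smul] at this
      rw [← this, sgn_zero, one_smul]
    rw [bracket_quantOp_dxi, liftOp_smul, liftOp_quantOp]
    refine Eq.trans ?_ (smul_mul_gen (hasParity_formExp 1) μ j hp)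
    rw [← pderiv_inr_multHamHom]

theorem deltaOp_eq (hP : HasParity 0 P) (j : ℕ) :
    deltaOp P j = deRhamOp V m * quantOp P j - quantOp P j * deRhamOp V m :=
  LinearMap.ext fun ω => by
    rw [deltaOp_apply, hP.inv_eq, sgn_zero, one_smul]; rfl

theorem quantOp_mul_mulLeft (hP : HasParity 0 P) (j : ℕ) (p : ZMod 2) (f : Form V m) :
    quantOp P j * mulLeft f = mulLeft f * quantOp P j + bracket _ p (quantOp P j) (mulLeft f) := by
  have h : conj p (quantOp P j) = quantOp P j := by
    rcases zmod_two_cases p with rfl | rfl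
    · rfl
    · rw [conj_quantOp, hP.inv_eq, sgn_zero, one_smul]
  rw [bracket_apply, h, add_sub_cancel]

theorem hasParity_momentumPart {ε ο : Type} [Fintype ε] [DecidableEq ε] [Fintype ο] [LinearOrder ο]
    {A : Type} [CommRing A] [Algebra ℂ A] {F : Grass (ο ⊕ₗ ο) (MvPowerSeries ε A)} {p : ZMod 2}
    (hF : HasParity p F) (k : ℕ) : HasParity p (momentumPart k F) := fun U hU =>
  MvPowerSeries.ext fun α => by
    rw [coeff_momentumPart, hF U hU, map_zero, ite_self]

/-- The identity holds in every order in ħ: commuting P̂ with d replaces the symbol by its image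
under D, homogeneous component by homogeneous component. -/
theorem liftOp_deltaOp (hP : HasParity 0 P) (j : ℕ) : liftOp (deltaOp P j) (formExp V m 1)
    = (-Complex.I) ^ j • (momentumPart j (masterHam P) * formExp V m 1) := by
  rw [deltaOp_eq hP]
  exact liftOp_commutator_eq CInf.isDer_partialDeriv (fun _ => rfl) (hasParity_formExp 1)
    (hasParity_momentumPart (hasParity_multHamHom (pullbackHom V m) P hP) j)
    (fun a => mapSeries_phaseExp _ (CInf.isDer_partialDeriv _) (CInf.partialDeriv_smul _)
      fun b => CInf.partialDeriv_coord _ _) (fun μ => oddDeriv_phaseExp _ _) (liftOp_quantOp P j)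
    (fun a => quantOp_mul_mulLeft hP j 1 (Form.dx V m a))
    (fun μ => quantOp_mul_mulLeft hP j 0 (Form.dxi V m μ)) (liftOp_bracket_dx hP j)
    (liftOp_bracket_dxi hP j)

theorem formExp_neg_mul : formExp V m (-1) * formExp V m 1 = 1 := phaseExp_neg_mul _

/-- In degree k in the momenta only the coefficient of ħ^k is nonzero, and i^k (-i)^k = 1. The
expression under the limit is therefore equal to H, with neither negative nor positive powers of ħ.
-/
theorem isPrincipalSymbol_masterHam (hP : HasParity 0 P) :
    IsPrincipalSymbol (fun ω => Delta P (Form.toH ω)) (masterHam P) := by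
  have h1 : ∀ j, actWithParameters (fun ω => Delta P (Form.toH ω)) (formExp V m 1) j
      = liftOp (deltaOp P j) (formExp V m 1) := fun j => by
    refine Grass.ext fun U => MvPowerSeries.ext fun α => ?_
    change Delta P (Form.toH (lexCoeff α (lexRight U) (formExp V m 1))) j (lexLeft U)
      = deltaOp P j (lexCoeff α (lexRight U) (formExp V m 1)) (lexLeft U)
    rw [Delta_eq_opSeries hP]
    exact congrFun (opSeries_single _ _ _) _
  have h2 : ∀ j, formExp V m (-1) * actWithParameters (fun ω => Delta P (Form.toH ω))
      (formExp V m 1) j = (-Complex.I) ^ j • momentumPart j (masterHam P) := fun j => by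
    rw [h1, liftOp_deltaOp hP, mul_smul_comm, ← mul_assoc,
      even_mul_comm (hasParity_formExp (-1)), mul_assoc, formExp_neg_mul, mul_one]
  intro U α
  have h3 : ∀ j, MvPowerSeries.coeff α ((formExp V m (-1) * actWithParameters
      (fun ω => Delta P (Form.toH ω)) (formExp V m 1) j) U)
      = (-Complex.I) ^ j • if momentumDegree α U = j then MvPowerSeries.coeff α (masterHam P U)
        else 0 := fun j => by
    rw [h2]; rfl
  refine ⟨fun j hj => (h3 j).trans ?_, ?_⟩
  · rw [if_neg hj.ne', smul_zero]
  · refine Eq.trans ?_ (congrArg (_ • ·) (h3 _)).symm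
    rw [if_pos rfl, smul_smul, ← mul_pow, mul_neg, Complex.I_mul_I, neg_neg, one_pow, one_smul]

end PrincipalSymbol
end HigherKoszul

/-! ### Compatibility with restriction to smaller domains. -/

namespace HigherKoszul

open Grass Op

section CoefficientHom

variable {ο : Type} [LinearOrder ο] [DecidableEq ο] [Fintype ο] {A A' : Type} [CommRing A]
  [CommRing A'] (χ : A →+* A')

/-- A homomorphism of coefficient algebras, extended to Grassmann algebras. -/
def coeffMapHom (ο : Type) [LinearOrder ο] [DecidableEq ο] [Fintype ο] (χ : A →+* A') :
    Grass ο A →+* Grass ο A' where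
  toFun := mapCoeff χ
  map_zero' := Grass.ext fun _ => map_zero χ
  map_one' := Grass.ext fun S => by
    change χ (if S = ∅ then 1 else 0) = if S = ∅ then 1 else 0
    split_ifs
    · exact map_one χ
    · exact map_zero χ
  map_add' _ _ := Grass.ext fun _ => map_add χ _ _
  map_mul' f g := Grass.ext fun S => by
    change χ ((f * g) S) = (mapCoeff χ f * mapCoeff χ g) S
    rw [mul_apply, mul_apply, map_sum]
    refine Finset.sum_congr rfl fun T _ => ?_
    rw [map_mul, map_mul, map_pow, map_neg, map_one]
    rfl

theorem coeffMapHom_inv (f : Grass ο A) : coeffMapHom ο χ f.inv = (coeffMapHom ο χ f).inv :=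
  Grass.ext fun _ => map_zsmul χ _ _

theorem coeffMapHom_part (p : ZMod 2) (f : Grass ο A) :
    coeffMapHom ο χ (f.part p) = (coeffMapHom ο χ f).part p := Grass.ext fun S => by
  change χ (if _ then f S else 0) = if _ then χ (f S) else 0
  split_ifs
  · rfl
  · exact map_zero χ

theorem coeffMapHom_oddDeriv (o : ο) (f : Grass ο A) :
    coeffMapHom ο χ (f.oddDeriv o) = (coeffMapHom ο χ f).oddDeriv o := mapCoeff_hom_oddDeriv χ o f

theorem coeffMapHom_const (a : A) : coeffMapHom ο χ (const a) = const (χ a) :=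
  Grass.ext fun S => by
    change χ (if S = ∅ then a else 0) = if S = ∅ then χ a else 0
    split_ifs
    · rfl
    · exact map_zero χ

variable [Algebra ℂ A] [Algebra ℂ A'] {χ}

/-- `χ` intertwines the operators `S` and `S'`. -/
def Intertwines (χ : A →+* A') (S : Module.End ℂ (Grass ο A)) (S' : Module.End ℂ (Grass ο A')) :
    Prop := ∀ f, coeffMapHom ο χ (S f) = S' (coeffMapHom ο χ f)

variable {S T : Module.End ℂ (Grass ο A)} {S' T' : Module.End ℂ (Grass ο A')}

theorem Intertwines.mul (hS : Intertwines χ S S') (hT : Intertwines χ T T') :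
    Intertwines χ (S * T) (S' * T') := fun f => (hS _).trans (congrArg S' (hT f))

theorem Intertwines.one : Intertwines χ (1 : Module.End ℂ (Grass ο A)) 1 := fun _ => rfl

theorem Intertwines.pow (hS : Intertwines χ S S') (k : ℕ) : Intertwines χ (S ^ k) (S' ^ k) := by
  induction k with
  | zero => exact Intertwines.one
  | succ k ih => rw [pow_succ, pow_succ]; exact ih.mul hS

theorem Intertwines.listProd {κ : Type} {D : κ → Module.End ℂ (Grass ο A)}
    {D' : κ → Module.End ℂ (Grass ο A')} (l : List κ) (h : ∀ a ∈ l, Intertwines χ (D a) (D' a)) :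
    Intertwines χ (l.map D).prod (l.map D').prod := by
  induction l with
  | nil => exact Intertwines.one
  | cons a l ih =>
    rw [List.map_cons, List.map_cons, List.prod_cons, List.prod_cons]
    exact (h a List.mem_cons_self).mul (ih fun b hb => h b (List.mem_cons_of_mem _ hb))

theorem Intertwines.mulLeft (f : Grass ο A) :
    Intertwines χ (mulLeft f) (mulLeft (coeffMapHom ο χ f)) := fun g => map_mul _ f g

theorem Intertwines.sub (hS : Intertwines χ S S') (hT : Intertwines χ T T') :
    Intertwines χ (S - T) (S' - T') := fun f =>
  (map_sub _ _ _).trans (congrArg₂ _ (hS f) (hT f))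

theorem Intertwines.sum {ι : Type} {s : Finset ι} {S : ι → Module.End ℂ (Grass ο A)}
    {S' : ι → Module.End ℂ (Grass ο A')} (h : ∀ i ∈ s, Intertwines χ (S i) (S' i)) :
    Intertwines χ (∑ i ∈ s, S i) (∑ i ∈ s, S' i) := fun f => by
  rw [LinearMap.sum_apply, LinearMap.sum_apply, map_sum]
  exact Finset.sum_congr rfl fun i hi => h i hi f

theorem coeffMapHom_smul (hχ : ∀ (c : ℂ) a, χ (c • a) = c • χ a) (c : ℂ) (f : Grass ο A) :
    coeffMapHom ο χ (c • f) = c • coeffMapHom ο χ f := Grass.ext fun _ => hχ c _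

theorem Intertwines.smul (hχ : ∀ (c : ℂ) a, χ (c • a) = c • χ a) (hS : Intertwines χ S S') (c : ℂ) :
    Intertwines χ (c • S) (c • S') := fun f => by
  rw [LinearMap.smul_apply, LinearMap.smul_apply, coeffMapHom_smul hχ, hS f]

theorem Intertwines.comm (hS : Intertwines χ S S') (f : Grass ο A) :
    Intertwines χ (comm S f) (comm S' (coeffMapHom ο χ f)) := fun g => by
  rw [comm_apply_eq, comm_apply_eq, map_sub, map_sub, hS (f * g), map_mul (coeffMapHom ο χ) f g,
    map_mul (coeffMapHom ο χ) (f.part 0), map_mul (coeffMapHom ο χ) (f.part 1), coeffMapHom_part,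
    coeffMapHom_part, coeffMapHom_inv, hS, hS, coeffMapHom_inv]

theorem Intertwines.foldl_comm (l : List (Grass ο A)) (hS : Intertwines χ S S') :
    Intertwines χ (l.foldl (fun S f => Op.comm S f) S)
      ((l.map (coeffMapHom ο χ)).foldl (fun S f => Op.comm S f) S') := by
  induction l generalizing S S' with
  | nil => exact hS
  | cons f l ih => exact ih (hS.comm f)

theorem Intertwines.smul_foldl_comm (hχ : ∀ (c : ℂ) a, χ (c • a) = c • χ a)
    (hS : Intertwines χ S S') (c : ℂ) (l : List (Grass ο A)) :
    coeffMapHom ο χ (c • l.foldl (fun S f => Op.comm S f) S 1)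
      = c • (l.map (coeffMapHom ο χ)).foldl (fun S f => Op.comm S f) S' 1 := by
  rw [coeffMapHom_smul hχ, hS.foldl_comm l, map_one]

theorem Intertwines.smul_sum_mulLeft_mul (hχ : ∀ (c : ℂ) a, χ (c • a) = c • χ a) (c : ℂ) {ι : Type}
    {s : Finset ι} {f : ι → Grass ο A} {f' : ι → Grass ο A'} {D : ι → Module.End ℂ (Grass ο A)}
    {D' : ι → Module.End ℂ (Grass ο A')} (hf : ∀ i, coeffMapHom ο χ (f i) = f' i)
    (hD : ∀ i, Intertwines χ (D i) (D' i)) :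
    Intertwines χ (c • ∑ i ∈ s, Op.mulLeft (f i) * D i) (c • ∑ i ∈ s, Op.mulLeft (f' i) * D' i) :=
  Intertwines.smul hχ (Intertwines.sum fun i _ => by
    have := Intertwines.mulLeft (χ := χ) (f i)
    rw [hf] at this
    exact this.mul (hD i)) c

end CoefficientHom

section Restriction

variable {n m : ℕ} {V V' : Opens (Fin n → ℝ)} (h : V' ≤ V)

/-- Restriction of functions on the antitangent bundle. -/
def tangentResHom (m : ℕ) (h : V' ≤ V) : CInf (tangentDomain V m) →+* CInf (tangentDomain V' m) :=
  CInf.resHom (tangentDomain_mono h)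

theorem tangentResHom_smul (c : ℂ) (a : CInf (tangentDomain V m)) :
    tangentResHom m h (c • a) = c • tangentResHom m h a := rfl

theorem intertwines_dxOp (a : Fin n) :
    Intertwines (tangentResHom m h) (dxOp V m a) (dxOp V' m a) :=
  fun f => coeffMapHom_oddDeriv _ _ f

theorem res_partialDeriv (i : Fin n ⊕ Fin m) (f : Form V m) :
    coeffMapHom (Fin m ⊕ₗ Fin n) (tangentResHom m h) (f.mapCoeff (CInf.partialDeriv i))
      = (coeffMapHom (Fin m ⊕ₗ Fin n) (tangentResHom m h) f).mapCoeff (CInf.partialDeriv i) :=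
  Grass.ext fun _ => (CInf.partialDeriv_res (tangentDomain_mono h) i _).symm

theorem intertwines_dxiOp (μ : Fin m) :
    Intertwines (tangentResHom m h) (dxiOp V m μ) (dxiOp V' m μ) :=
  fun f => res_partialDeriv h _ f

theorem intertwines_fibreOp (α : Fin m →₀ ℕ) (S : Finset (Fin n)) :
    Intertwines (tangentResHom m h) (fibreOp V m α S) (fibreOp V' m α S) :=
  (Intertwines.listProd _ fun μ _ => (intertwines_dxiOp h μ).pow (α μ)).mul
    (Intertwines.listProd _ fun a _ => intertwines_dxOp h a)

theorem res_deRham (ω : Form V m) : Form.res h (deRham ω) = deRham (Form.res h ω) := by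
  change coeffMapHom (Fin m ⊕ₗ Fin n) (tangentResHom m h) (deRham ω) = _
  rw [deRham, map_add, map_sum, map_sum]
  refine congrArg₂ (· + ·) (Finset.sum_congr rfl fun a _ => ?_) (Finset.sum_congr rfl fun μ _ => ?_)
  · refine (map_mul _ _ _).trans (congrArg₂ (· * ·) (mapCoeff_gen_hom (tangentResHom m h) _) ?_)
    exact res_partialDeriv h _ ω
  · refine (map_mul _ _ _).trans (congrArg₂ (· * ·) ?_ (coeffMapHom_oddDeriv _ _ ω))
    exact coeffMapHom_const (tangentResHom m h) _

theorem res_toForm (f : SFun V m) : Form.res h f.toForm = SFun.toForm (f.res h) :=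
  mapCoeff_embed (lexInl (Fin m) (Fin n)).toEmbedding (pullbackHom V m) (pullbackHom V' m) _ _
    (map_zero (tangentResHom m h)) (fun c => res_pullback h c) f

theorem coeffMapHom_toForm (f : SFun V m) :
    coeffMapHom (Fin m ⊕ₗ Fin n) (tangentResHom m h) f.toForm = SFun.toForm (f.res h) :=
  res_toForm h f

theorem intertwines_quantOp (Q : Mult V m) (j : ℕ) :
    Intertwines (tangentResHom m h) (quantOp Q j) (quantOp (Q.res h) j) := by
  have h1 : ∀ x : Finset (Fin n) × (Fin m →₀ ℕ), coeffMapHom (Fin m ⊕ₗ Fin n) (tangentResHom m h)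
      (Q.coeff x.2 x.1).toForm = ((Q.res h).coeff x.2 x.1).toForm := fun x =>
    coeffMapHom_toForm h (Q.coeff x.2 x.1)
  have h2 : ∀ x : Finset (Fin n) × (Fin m →₀ ℕ), Intertwines (tangentResHom m h)
      (fibreOp V m x.2 x.1) (fibreOp V' m x.2 x.1) := fun x => intertwines_fibreOp h x.2 x.1
  have h0 : ∀ (c : ℂ) (a : CInf (tangentDomain V m)), (tangentResHom m h) (c • a)
      = c • tangentResHom m h a := tangentResHom_smul h
  have h3 := @Intertwines.smul_sum_mulLeft_mul (Fin m ⊕ₗ Fin n) _ _ _ _ _ _ _ (tangentResHom m h)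
    _ _ h0 ((-Complex.I) ^ j) _ (fibreIdx n m j) _ _ _ _ h1 h2
  rw [quantOp, quantOp]
  exact h3

theorem hasParity_multRes {p : ZMod 2} {Q : Mult V m} (hQ : HasParity p Q) :
    HasParity p (Q.res h) := fun S hS => by
  refine MvPowerSeries.ext fun α => ?_
  change CInf.resHom h (MvPowerSeries.coeff α (Q S)) = 0
  rw [hQ S hS, map_zero, map_zero]

/-- The operators are built from multiplications and derivatives along coordinates, and restriction
is a homomorphism that commutes with the derivatives. -/
theorem intertwines_deltaOp {Q : Mult V m} (hQ : HasParity 0 Q) (j : ℕ) :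
    Intertwines (tangentResHom m h) (deltaOp Q j) (deltaOp (Q.res h) j) := by
  rw [deltaOp_eq hQ, deltaOp_eq (hasParity_multRes h hQ)]
  have hd : Intertwines (tangentResHom m h) (deRhamOp V m) (deRhamOp V' m) := res_deRham h
  exact (hd.mul (intertwines_quantOp h Q j)).sub ((intertwines_quantOp h Q j).mul hd)

/-- The higher Koszul brackets are compatible with restriction. -/
theorem res_koszul {Q : Mult V m} (hQ : HasParity 0 Q) (l : List (Form V m)) :
    Form.res h (koszul Q l) = koszul (Q.res h) (l.map (Form.res h)) := by
  have h0 : ∀ (c : ℂ) (a : CInf (tangentDomain V m)), (tangentResHom m h) (c • a)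
      = c • tangentResHom m h a := tangentResHom_smul h
  have h1 := @Intertwines.smul_foldl_comm (Fin m ⊕ₗ Fin n) _ _ _ _ _ _ _ (tangentResHom m h)
    _ _ _ _ h0 (intertwines_deltaOp h hQ l.length) (Complex.I ^ l.length) l
  refine (congrArg (Form.res h) (koszul_eq Q l)).trans (h1.trans ?_)
  refine Eq.trans ?_ (koszul_eq (Q.res h) (l.map (Form.res h))).symm
  rw [List.length_map]
  rfl

end Restriction
end HigherKoszul

/-! ### Changes of coordinates, and the brackets on a supermanifold. -/

namespace HigherKoszul

open Grass

section SuperIsomorphism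

variable {ο ο' : Type} [LinearOrder ο] [LinearOrder ο'] [Fintype ο] [Fintype ο'] {A B : Type}
  [CommRing A] [CommRing B] [Module ℂ A] [Module ℂ B] {φ : Grass ο A → Grass ο' B}

theorem IsSuperHom.map_zero (h : IsSuperHom φ) : φ 0 = 0 := by
  have := h.map_add 0 0
  rwa [add_zero, left_eq_add] at this

theorem IsSuperHom.map_zsmul (h : IsSuperHom φ) (k : ℤ) (f : Grass ο A) : φ (k • f) = k • φ f :=
  _root_.map_zsmul (AddMonoidHom.mk' φ h.map_add) k f

theorem HasParity.eq_zero {p : ZMod 2} {f : Grass ο A} (h : HasParity p f)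
    (h' : HasParity (p + 1) f) : f = 0 := Grass.ext fun S => by
  by_cases hS : (S.card : ZMod 2) = p
  · exact h' S (by rw [hS]; exact fun hp => one_ne_zero (left_eq_add.1 hp))
  · exact h S hS

/-- The image of the component of the wrong parity is a difference of two elements of parity p, yet
it has parity p + 1; hence it is zero, and so is the component by injectivity. This allows the
conditions on homogeneous arguments to be pulled back along an isomorphism. -/
theorem IsSuperHom.hasParity_of_map (h : IsSuperHom φ) (hi : Function.Injective φ) {p : ZMod 2}
    {f : Grass ο A} (hf : HasParity p (φ f)) : HasParity p f := by
  have h1 : f = f.part p + f.part (p + 1) := by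
    rcases zmod_two_cases p with rfl | rfl
    · exact (part_add_part f).symm
    · exact (part_add_part f).symm.trans (add_comm _ _)
  have h2 : φ (f.part (p + 1)) = φ f - φ (f.part p) := by
    conv_rhs => rw [h1, h.map_add, ← h1]
    exact (add_sub_cancel_left _ _).symm
  have h3 : f.part (p + 1) = 0 := hi <| by
    rw [h.map_zero]
    refine HasParity.eq_zero (p := p) ?_ (h.map_parity _ _ (hasParity_part _ f))
    rw [h2, sub_eq_add_neg]
    exact hf.add (h.map_parity _ _ (hasParity_part p f)).neg
  rw [h1, h3, add_zero]
  exact hasParity_part p f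

theorem IsSuperHom.hasParities_of_map (h : IsSuperHom φ) (hi : Function.Injective φ)
    {l : List (Grass ο A)} {ps : List (ZMod 2)} (hl : HasParities (l.map φ) ps) :
    HasParities l ps := by
  rw [HasParities, List.forall₂_map_left_iff] at hl
  exact hl.imp fun f p hf => h.hasParity_of_map hi hf

end SuperIsomorphism

section Transport

variable {n m : ℕ} {V V' : Opens (Fin n → ℝ)} {φ : SFun V m → SFun V' m}
  {Ψ : Form V m → Form V' m} {Θ : Mult V m → Mult V' m}

open Supermanifold

theorem map_homotopyPoisson (hΘ : IsMultTransformation φ Θ) (P : Mult V m) (l : List (SFun V m)) :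
    φ (homotopyPoisson P l) = homotopyPoisson (Θ P) (l.map φ) := by
  rw [homotopyPoisson, ← hΘ.comm_restrict, homotopyPoisson]
  congr 1
  induction l generalizing P with
  | nil => rfl
  | cons f l ih =>
    rw [List.foldl_cons, ih, hΘ.comm_schouten, hΘ.extends_fun]
    rfl

theorem map_deRham_toForm (hΨ : IsFormTransformation φ Ψ) (l : List (SFun V m)) :
    (l.map fun g => deRham g.toForm).map Ψ = (l.map φ).map fun g => deRham g.toForm := by
  rw [List.map_map, List.map_map]
  exact List.map_congr_left fun g _ => (hΨ.comm_d _).trans (congrArg deRham (hΨ.extends_fun g))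

/-- Brackets transported along a change of coordinates are the brackets specified by the
transformed multivector field. -/
theorem isKoszulBrackets_transport (hφ : IsSuperHom φ) (hb : Function.Bijective φ)
    (hΨ : IsFormTransformation φ Ψ) (hΘ : IsMultTransformation φ Θ) {P : Mult V m}
    {B : List (Form V m) → Form V m} (hB : IsKoszulBrackets P B)
    {B' : List (Form V' m) → Form V' m} (hB' : ∀ l, B' (l.map Ψ) = Ψ (B l)) :
    IsKoszulBrackets (Θ P) B' := by
  have hsurj : ∀ l : List (Form V' m), ∃ l₀ : List (Form V m), l₀.map Ψ = l := fun l =>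
    (List.map_surjective_iff.2 hΨ.bijective.2) l
  have hsurj' : ∀ l : List (SFun V' m), ∃ l₀ : List (SFun V m), l₀.map φ = l := fun l =>
    (List.map_surjective_iff.2 hb.2) l
  have hinj := hΨ.bijective.1
  have happ : ∀ (l₁ : List (Form V m)) ω l₂, B' (l₁.map Ψ ++ Ψ ω :: l₂.map Ψ)
      = Ψ (B (l₁ ++ ω :: l₂)) := fun l₁ ω l₂ => by
    rw [← hB', List.map_append, List.map_cons]
  have hsnoc : ∀ (l : List (Form V m)) ω, B' (l.map Ψ ++ [Ψ ω]) = Ψ (B (l ++ [ω])) :=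
    fun l ω => happ l ω []
  constructor
  · intro l₁ ω ω' l₂
    obtain ⟨l₁, rfl⟩ := hsurj l₁
    obtain ⟨l₂, rfl⟩ := hsurj l₂
    obtain ⟨ω, rfl⟩ := hΨ.bijective.2 ω
    obtain ⟨ω', rfl⟩ := hΨ.bijective.2 ω'
    rw [← hΨ.hom.map_add, happ, happ, happ, hB.map_add, hΨ.hom.map_add]
  · intro l₁ c ω l₂
    obtain ⟨l₁, rfl⟩ := hsurj l₁
    obtain ⟨l₂, rfl⟩ := hsurj l₂
    obtain ⟨ω, rfl⟩ := hΨ.bijective.2 ω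
    rw [← hΨ.hom.map_smul, happ, happ, hB.map_smul, hΨ.hom.map_smul]
  · intro l ps hl
    obtain ⟨l, rfl⟩ := hsurj l
    rw [hB']
    exact hΨ.hom.map_parity _ _ (hB.odd l ps (hΨ.hom.hasParities_of_map hinj hl))
  · intro l₁ ω ω' l₂ p p' hp hp'
    obtain ⟨l₁, rfl⟩ := hsurj l₁
    obtain ⟨l₂, rfl⟩ := hsurj l₂
    obtain ⟨ω, rfl⟩ := hΨ.bijective.2 ω
    obtain ⟨ω', rfl⟩ := hΨ.bijective.2 ω'
    have h2 : ∀ ω ω', B' (l₁.map Ψ ++ Ψ ω :: Ψ ω' :: l₂.map Ψ)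
        = Ψ (B (l₁ ++ ω :: ω' :: l₂)) := fun ω ω' => happ l₁ ω (ω' :: l₂)
    rw [h2, h2, hB.symm l₁ ω ω' l₂ p p'
      (hΨ.hom.hasParity_of_map hinj hp) (hΨ.hom.hasParity_of_map hinj hp'), hΨ.hom.map_zsmul]
  · intro l ps ω p ω' hl hp
    obtain ⟨l, rfl⟩ := hsurj l
    obtain ⟨ω, rfl⟩ := hΨ.bijective.2 ω
    obtain ⟨ω', rfl⟩ := hΨ.bijective.2 ω'
    rw [← hΨ.hom.map_mul, hsnoc, hsnoc, hsnoc, hB.leibniz l ps ω p ω'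
      (hΨ.hom.hasParities_of_map hinj hl) (hΨ.hom.hasParity_of_map hinj hp), hΨ.hom.map_add,
      hΨ.hom.map_mul, hΨ.hom.map_zsmul, hΨ.hom.map_mul]
  · intro f fs ps hl
    obtain ⟨fs, rfl⟩ := hsurj' fs
    obtain ⟨f, rfl⟩ := hb.2 f
    rw [← map_deRham_toForm hΨ, ← hΨ.extends_fun, ← List.map_cons, ← List.map_cons (f := φ), hB',
      hB.fun_diff f fs ps (hφ.hasParities_of_map hb.1 hl), hΨ.hom.map_zsmul, hΨ.extends_fun,
      map_homotopyPoisson hΘ]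
  · intro fs ps hl
    obtain ⟨fs, rfl⟩ := hsurj' fs
    rw [← map_deRham_toForm hΨ, hB', hB.diff_diff fs ps (hφ.hasParities_of_map hb.1 hl),
      hΨ.hom.map_zsmul, hΨ.comm_d, hΨ.extends_fun, map_homotopyPoisson hΘ]
  · intro f g l hl
    obtain ⟨l, rfl⟩ := hsurj l
    obtain ⟨f, rfl⟩ := hb.2 f
    obtain ⟨g, rfl⟩ := hb.2 g
    rw [← hΨ.extends_fun, ← hΨ.extends_fun, ← List.map_cons, ← List.map_cons, hB', hB.fun_fun,
      hΨ.hom.map_zero]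
    intro ω hω
    obtain ⟨h, hh⟩ := hl (Ψ ω) (List.mem_map_of_mem hω)
    obtain ⟨h, rfl⟩ := hb.2 h
    rw [← hΨ.extends_fun, ← hΨ.comm_d] at hh
    exact ⟨h, hh.imp (hinj ·) (hinj ·)⟩

/-- The operators P̂ of two coordinate systems are never compared. The transported brackets satisfy
the conditions that characterise the brackets of the transformed multivector field, and uniqueness
identifies them. -/
theorem map_koszul (hφ : IsSuperHom φ) (hb : Function.Bijective φ)
    (hΨ : IsFormTransformation φ Ψ) (hΘ : IsMultTransformation φ Θ) {P : Mult V m}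
    (hP : HasParity 0 P) (l : List (Form V m)) :
    Ψ (koszul P l) = koszul (Θ P) (l.map Ψ) := by
  let e := Equiv.ofBijective Ψ hΨ.bijective
  let B' : List (Form V' m) → Form V' m := fun l => Ψ (koszul P (l.map e.symm))
  have hB' : ∀ l, B' (l.map Ψ) = Ψ (koszul P l) := fun l => by
    have : (l.map Ψ).map e.symm = l := by
      rw [List.map_map]
      exact (List.map_congr_left fun ω _ => e.symm_apply_apply ω).trans (List.map_id l)
    simp only [B', this]
  rw [← hB']
  exact congrFun ((isKoszulBrackets_transport hφ hb hΨ hΘ (isKoszulBrackets_koszul hP) hB').unique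
    (isKoszulBrackets_koszul (hΘ.hom.map_parity _ _ hP))) _

end Transport

namespace Supermanifold

variable {n m : ℕ} (M : Supermanifold.{u} n m) (P : M.HomotopyPoisson)

theorem trans_bijective (i j : M.Idx) (W : Opens M.body) (hi : (W : Set M.body) ⊆ (M.chart i).source)
    (hj : (W : Set M.body) ⊆ (M.chart j).source) : Function.Bijective (M.trans i j W hi hj) := by
  refine Function.bijective_iff_has_inverse.2 ⟨M.trans j i W hj hi, fun f => ?_, fun f => ?_⟩
  · rw [M.trans_trans, M.trans_self]
  · rw [M.trans_trans, M.trans_self]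

/-- The higher Koszul brackets of forms on a supermanifold. -/
def koszulBracket (l : List M.DiffForm) : M.DiffForm where
  rep i := koszul (P.rep i) (l.map fun ω => ω.rep i)
  compat i j W hi hj Ψ hΨ := by
    -- On the overlap the bracket in chart j is restricted, carried over by Ψ, and recognised as the
    -- restricted bracket in chart i; the compatibility of P and of each argument identifies the
    -- data.
    obtain ⟨Θ, hΘ, h⟩ := P.compat i j W hi hj
    have hj' := res_koszul (M.img_le_dom j W) (P.even j) (l.map fun ω => ω.rep j)
    have hi' := res_koszul (M.img_le_dom i W) (P.even i) (l.map fun ω => ω.rep i)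
    have hk := map_koszul (M.trans_hom i j W hi hj) (M.trans_bijective i j W hi hj) hΨ hΘ
      (hasParity_multRes (M.img_le_dom j W) (P.even j))
      ((l.map fun ω => ω.rep j).map (Form.res (M.img_le_dom j W)))
    refine (congrArg Ψ hj').trans (hk.trans (Eq.trans ?_ hi'.symm))
    rw [h]
    refine congrArg (koszul _) ?_
    refine (congrArg (List.map Ψ) List.map_map).trans (List.map_map.trans (Eq.trans ?_
      List.map_map.symm))
    exact List.map_congr_left fun ω _ => ω.compat i j W hi hj Ψ hΨ

theorem isHigherKoszul_koszulBracket : M.IsHigherKoszul P (M.koszulBracket P) := fun i =>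
  ⟨koszul (P.rep i), isKoszulBrackets_koszul (P.even i), fun _ => rfl⟩

variable {M P}

/-- The definition only asserts that some local bracket exists in each chart; local uniqueness makes
it the explicit one. Global uniqueness and the limit formula follow from this. -/
theorem IsHigherKoszul.rep_eq {B : List M.DiffForm → M.DiffForm} (hB : M.IsHigherKoszul P B)
    (l : List M.DiffForm) (i : M.Idx) :
    (B l).rep i = koszul (P.rep i) (l.map fun ω => ω.rep i) := by
  obtain ⟨b, hb, h⟩ := hB i
  rw [h, hb.unique (isKoszulBrackets_koszul (P.even i))]

theorem IsHigherKoszul.eq_koszulBracket {B : List M.DiffForm → M.DiffForm}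
    (hB : M.IsHigherKoszul P B) : B = M.koszulBracket P :=
  funext fun l => DiffForm.ext (funext fun i => hB.rep_eq l i)

theorem IsHigherKoszul.hasClassicalLimit {B : List M.DiffForm → M.DiffForm}
    (hB : M.IsHigherKoszul P B) (l : List M.DiffForm) (i : M.Idx) :
    HasClassicalLimit l.length (iteratedComm (Delta (P.rep i)) (l.map fun ω => ω.rep i))
      ((B l).rep i) := by
  rw [hB.rep_eq]
  have := hasClassicalLimit_koszul (P.even i) (l.map fun ω => ω.rep i)
  rwa [List.length_map] at this

end Supermanifold

end HigherKoszul

end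

theorem mainTheorem3 {n m : ℕ} (M : HigherKoszul.Supermanifold.{u} n m)
    (P : M.HomotopyPoisson) :
    (∃! B : List M.DiffForm → M.DiffForm, M.IsHigherKoszul P B) ∧
    (∀ B : List M.DiffForm → M.DiffForm, M.IsHigherKoszul P B →
      ∀ (l : List M.DiffForm) (i : M.Idx),
        HigherKoszul.HasClassicalLimit l.length
          (HigherKoszul.iteratedComm (HigherKoszul.Delta (P.rep i)) (l.map fun ω => ω.rep i))
          ((B l).rep i)) ∧
    (∀ i : M.Idx, ∃ H : HigherKoszul.Ham (HigherKoszul.tangentDomain (M.dom i) m)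
        (Fin m ⊕ₗ Fin n),
      HigherKoszul.IsPrincipalSymbol
        (fun ω => HigherKoszul.Delta (P.rep i) (HigherKoszul.Form.toH ω)) H ∧
      ∀ b : List (HigherKoszul.Form (M.dom i) m) → HigherKoszul.Form (M.dom i) m,
        HigherKoszul.IsKoszulBrackets (P.rep i) b →
          HigherKoszul.IsMasterHamiltonian H b) := by
  refine ⟨⟨M.koszulBracket P, M.isHigherKoszul_koszulBracket P, fun B hB => hB.eq_koszulBracket⟩,
    fun B hB l i => hB.hasClassicalLimit l i, fun i => ⟨HigherKoszul.masterHam (P.rep i),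
      HigherKoszul.isPrincipalSymbol_masterHam (P.even i), fun b hb =>
      HigherKoszul.isMasterHamiltonian_masterHam (P.even i) (P.master i) hb⟩⟩
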